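/- Let $k$ be an algebraically closed field of characteristic zero, $S=\mathbb P^1\times\mathbb P^1$, and let $\omega_n\in k$ be a primitive $n$-th root of unity ($n\ge 1$), $i=\omega_4$. Let $\mathrm C_n$ be the cyclic group of order $n$, $\mathrm D_n$ the dihedral group of order $2n$, $\mathrm S_n$, $\mathrm A_n$ the symmetric and alternating groups, and $T\wr \mathrm C_2=T^2\rtimes \mathrm C_2$ with $\mathrm C_2$ permuting the factors. In $\mathrm{PGL}_2(k)$ put $$R_n=\begin{bmatrix}1&0\\0&\omega_n\end{bmatrix},\ A=\begin{bmatrix}1&0\\0&-1\end{bmatrix},\ B=\begin{bmatrix}0&1\\1&0\end{bmatrix},\ C=\begin{bmatrix}i&-i\\1&1\end{bmatrix},\ D=\begin{bmatrix}1&-i\\i&-1\end{bmatrix},\ E=\begin{bmatrix}\omega_5&0\\0&1\end{bmatrix},\ F=\begin{bmatrix}1&1-\omega_5-\omega_5^{-1}\\1&-1\end{bmatrix},$$ and $I=1$. For $M,N\in \mathrm{PGL}_2(k)$ let $(M,N)$ be the automorphism $(x,y)\mapsto(Mx,Ny)$ of $S$ and $(M,N)_\sigma$ the automorphism $(x,y)\mapsto(My,Nx)$;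 put $\sigma=(I,I)_\sigma$. **Theorem.** (1) Every finite subgroup $G\subset\mathrm{Aut}(S)$ is conjugate in $\mathrm{Aut}(S)$ to a subgroup of one of the following groups: * $\langle(R_n,I),(B,I),(I,A),(I,B),(I,C),(I,D)\rangle\simeq \mathrm D_n\times \mathrm S_4$, of order $48n$, $n\ge1$; * $\langle(R_n,I),(B,I),(I,E),(I,F)\rangle\simeq \mathrm D_n\times \mathrm A_5$, of order $120n$, $n\ge1$; * $\langle(A,I),(B,I),(C,I),(D,I),(I,E),(I,F)\rangle\simeq \mathrm S_4\times \mathrm A_5$, of order $1440$; * $\langle(R_n,I),(B,I),\sigma\rangle\simeq \mathrm D_n\wr \mathrm C_2$, of order $8n^2$, $n\ge3$; * $\langle(A,I),(B,I),(C,I),(D,I),\sigma\rangle\simeq \mathrm S_4\wr \mathrm C_2$, of order $1152$; * $\langle(E,I),(F,I),\sigma\rangle\simeq \mathrm A_5\wr \mathrm C_2$, of order $7200$. Each of these groups has the stated order and isomorphism class. For a finite subgroup $G\subset\mathrm{Aut}(S)$ let $H\subset\mathrm{PGL}_2(k)$ be the image of $G\cap(\mathrm{PGL}_2(k)\times\mathrm{PGL}_2(k))$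 under the first projection. Say that $G$ has rank one if some element of $G$ does not preserve the two rulings of $S$ (equivalently, $\mathrm{Pic}(S)^G\simeq\mathbb Z$). (2) A subgroup $G\subset\mathrm{Aut}(S)$ is finite of rank one with $H\simeq \mathrm A_4$ if and only if it is conjugate in $\mathrm{Aut}(S)$ to one of the following groups, which have the stated orders and isomorphism classes: * $\langle(A,A),(B,B),(C,C),\sigma\rangle\simeq \mathrm A_4\times \mathrm C_2$, order $24$; * $\langle(A,A),(B,B),(C,C),(D,D)_\sigma\rangle\simeq \mathrm S_4$, order $24$; * $\langle(A,I),(B,I),(C,C),\sigma\rangle\simeq \mathrm C_2^4\rtimes \mathrm C_6$, order $96$; * $\langle(A,I),(B,I),(C,C),(I,C)_\sigma\rangle\simeq \mathrm C_2^4\rtimes \mathrm C_6$, order $96$; * $\langle(A,I),(B,I),(C,C),(D,D)_\sigma\rangle\simeq \mathrm C_2^2\rtimes \mathrm S_4$, order $96$; * $\langle(A,I),(B,I),(C,I),\sigma\rangle\simeq \mathrm A_4\wr \mathrm C_2$, order $288$; * $\langle(A,I),(B,I),(C,I),(D,D)_\sigma\rangle\simeq \mathrm A_4\wr \mathrm C_2$,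 order $288$. (3) A subgroup $G\subset\mathrm{Aut}(S)$ is finite of rank one with $H\simeq \mathrm S_4$ if and only if it is conjugate in $\mathrm{Aut}(S)$ to one of the following groups, which have the stated orders and isomorphism classes: * $\langle(A,A),(B,B),(C,C),(D,D),\sigma\rangle\simeq \mathrm S_4\times \mathrm C_2$, order $48$; * $\langle(A,I),(B,I),(C,C),(D,D),\sigma\rangle\simeq \mathrm C_2^4\rtimes \mathrm D_6$, order $192$; * $\langle(A,I),(B,I),(C,I),(D,D),\sigma\rangle\simeq \mathrm A_4^2\rtimes \mathrm C_2^2$, order $576$; * $\langle(A,I),(B,I),(C,I),(D,D),(I,D)_\sigma\rangle\simeq \mathrm A_4^2\rtimes \mathrm C_4$, order $576$; * $\langle(A,I),(B,I),(C,I),(D,I),\sigma\rangle\simeq \mathrm S_4\wr \mathrm C_2$, order $1152$. (4) The group $\langle E,F\rangle\subset\mathrm{PGL}_2(k)$ has an outer automorphism $\xi$ with $\xi^2=\mathrm{id}$. For every such $\xi$, a subgroup $G\subset\mathrm{Aut}(S)$ is finite of rank one with $H\simeq \mathrm A_5$ if and only if it is conjugate in $\mathrm{Aut}(S)$ to one of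 the following groups, which have the stated orders and isomorphism classes: * $\langle(E,E),(F,F),\sigma\rangle\simeq \mathrm A_5\times \mathrm C_2$, order $120$; * $\langle(E,\xi(E)),\sigma\rangle\simeq \mathrm S_5$, order $120$; * $\langle(I,E),(I,F),(E,I),(F,I),\sigma\rangle\simeq \mathrm A_5\wr \mathrm C_2$, order $7200$. In (2)–(4) the groups in a list are not claimed to be pairwise non-conjugate. In this statement, $N\rtimes Q$ stands for a semidirect product with respect to some action of $Q$ on $N$. -/

import Mathlib

open scoped MatrixGroups

namespace QuadricAut

/-! ### Regular maps and the automorphism group of `ℙ¹ × ℙ¹`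

Over an algebraically closed field we use the classical language: a variety is its set of points
with the Zariski topology, and morphisms are the maps which are given by (bi)homogeneous
polynomials locally in the Zariski topology. -/

/-- The projective line over `k` (its set of `k`-points). -/
abbrev Line (k : Type*) [Field k] : Type _ := Projectivization k (Fin 2 → k)

/-- The quadric surface `ℙ¹ × ℙ¹`. -/
abbrev Quadric (k : Type*) [Field k] : Type _ := Line k × Line k

/-- The bidegrees of the variables: the homogeneous coordinates `x₀, x₁` (indexed by `Sum.inl`)
of the first factor have bidegree `(1, 0)`, the coordinates `y₀, y₁` (indexed by `Sum.inr`)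
of the second factor have bidegree `(0, 1)`. -/
def bideg : Fin 2 ⊕ Fin 2 → ℕ × ℕ := Sum.elim (fun _ => (1, 0)) (fun _ => (0, 1))

/-- `F` is a bihomogeneous polynomial in `x₀, x₁; y₀, y₁` of bidegree `d`. -/
def IsBihom {k : Type*} [Field k] (F : MvPolynomial (Fin 2 ⊕ Fin 2) k) (d : ℕ × ℕ) : Prop :=
  MvPolynomial.IsWeightedHomogeneous bideg F d

/-- The value `F(u; v)`. -/
noncomputable def biEval {k : Type*} [Field k] (u v : Fin 2 → k)
    (F : MvPolynomial (Fin 2 ⊕ Fin 2) k) : k :=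
  MvPolynomial.eval (Sum.elim u v) F

/-- A map `ℙ¹ × ℙ¹ → ℙ¹` is regular if around every point `([u₀], [v₀])` there is a basic
Zariski open neighbourhood `{h ≠ 0}`, with `h` bihomogeneous, on which the map has the form
`([u], [v]) ↦ [F₀(u; v) : F₁(u; v)]` where `F₀, F₁` are bihomogeneous polynomials of the same
bidegree without common zero on this neighbourhood. -/
def IsRegular {k : Type*} [Field k] (φ : Quadric k → Line k) : Prop :=
  ∀ u₀ v₀ : Fin 2 → k, u₀ ≠ 0 → v₀ ≠ 0 →
    ∃ (h : MvPolynomial (Fin 2 ⊕ Fin 2) k) (F : Fin 2 → MvPolynomial (Fin 2 ⊕ Fin 2) k)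
      (e d : ℕ × ℕ), IsBihom h e ∧ (∀ j, IsBihom (F j) d) ∧ biEval u₀ v₀ h ≠ 0 ∧
        ∀ (u v : Fin 2 → k) (hu : u ≠ 0) (hv : v ≠ 0), biEval u v h ≠ 0 →
          ∃ hF : (fun j => biEval u v (F j)) ≠ 0,
            φ (Projectivization.mk k u hu, Projectivization.mk k v hv) =
              Projectivization.mk k (fun j => biEval u v (F j)) hF

/-- Morphisms of varieties `ℙ¹ × ℙ¹ → ℙ¹ × ℙ¹`. -/
def IsMorphism {k : Type*} [Field k] (f : Quadric k → Quadric k) : Prop :=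
  IsRegular (fun p => (f p).1) ∧ IsRegular (fun p => (f p).2)

theorem isBihom_X_inl {k : Type*} [Field k] (j : Fin 2) :
    IsBihom (MvPolynomial.X (Sum.inl j) : MvPolynomial (Fin 2 ⊕ Fin 2) k) (1, 0) :=
  MvPolynomial.isWeightedHomogeneous_X k bideg (Sum.inl j)

theorem isBihom_X_inr {k : Type*} [Field k] (j : Fin 2) :
    IsBihom (MvPolynomial.X (Sum.inr j) : MvPolynomial (Fin 2 ⊕ Fin 2) k) (0, 1) :=
  MvPolynomial.isWeightedHomogeneous_X k bideg (Sum.inr j)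

/-- Substituting bihomogeneous polynomials into a bihomogeneous polynomial. -/
theorem IsBihom.bind {k : Type*} [Field k] {R : MvPolynomial (Fin 2 ⊕ Fin 2) k} {c : ℕ × ℕ}
    (hR : IsBihom R c) {P Q : Fin 2 → MvPolynomial (Fin 2 ⊕ Fin 2) k} {a b : ℕ × ℕ}
    (hP : ∀ j, IsBihom (P j) a) (hQ : ∀ j, IsBihom (Q j) b) :
    IsBihom (MvPolynomial.bind₁ (Sum.elim P Q) R) (c.1 • a + c.2 • b) := by
  classical
  rw [MvPolynomial.as_sum R, map_sum]
  refine (MvPolynomial.weightedHomogeneousSubmodule k bideg _).sum_mem fun d hd => ?_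
  have hw : Finsupp.weight bideg d = c := hR (MvPolynomial.mem_support_iff.mp hd)
  rw [MvPolynomial.bind₁_monomial, MvPolynomial.mem_weightedHomogeneousSubmodule]
  refine MvPolynomial.IsWeightedHomogeneous.C_mul ?_ _
  have key : MvPolynomial.IsWeightedHomogeneous bideg
      (∏ i, (Sum.elim P Q i : MvPolynomial (Fin 2 ⊕ Fin 2) k) ^ d i)
      (∑ i, d i • (Sum.elim (fun _ => a) (fun _ => b) i : ℕ × ℕ)) := by
    refine MvPolynomial.IsWeightedHomogeneous.prod _ _ _ fun i _ => ?_
    refine MvPolynomial.IsWeightedHomogeneous.pow ?_ _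
    cases i with
    | inl j => exact hP j
    | inr j => exact hQ j
  have h1 : (∏ i ∈ d.support, (Sum.elim P Q i : MvPolynomial (Fin 2 ⊕ Fin 2) k) ^ d i) =
      ∏ i, (Sum.elim P Q i : MvPolynomial (Fin 2 ⊕ Fin 2) k) ^ d i := by
    refine Finset.prod_subset (Finset.subset_univ _) fun i _ hi => ?_
    rw [Finsupp.notMem_support_iff.mp hi, pow_zero]
  have h2 : c.1 • a + c.2 • b =
      ∑ i, d i • (Sum.elim (fun _ => a) (fun _ => b) i : ℕ × ℕ) := by
    rw [← hw, Finsupp.weight_apply, Finsupp.sum_fintype _ _ (by simp)]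
    simp only [Fintype.sum_sum_type, bideg, Sum.elim_inl, Sum.elim_inr, Fin.sum_univ_two]
    ext <;> simp <;> ring
  rw [h2]
  exact h1 ▸ key

theorem biEval_bind {k : Type*} [Field k] (u v : Fin 2 → k)
    (P Q : Fin 2 → MvPolynomial (Fin 2 ⊕ Fin 2) k) (R : MvPolynomial (Fin 2 ⊕ Fin 2) k) :
    biEval u v (MvPolynomial.bind₁ (Sum.elim P Q) R) =
      biEval (fun j => biEval u v (P j)) (fun j => biEval u v (Q j)) R := by
  unfold biEval
  rw [MvPolynomial.eval, MvPolynomial.eval₂Hom_bind₁]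
  congr 2
  funext i
  cases i <;> rfl

theorem IsRegular.comp {k : Type*} [Field k] {φ : Quadric k → Line k}
    (hφ : IsRegular φ) {f : Quadric k → Quadric k} (hf : IsMorphism f) :
    IsRegular (fun p => φ (f p)) := by
  intro u₀ v₀ hu₀ hv₀
  obtain ⟨h₁, P, e₁, a, hh₁, hP, hn₁, H₁⟩ := hf.1 u₀ v₀ hu₀ hv₀
  obtain ⟨h₂, Q, e₂, b, hh₂, hQ, hn₂, H₂⟩ := hf.2 u₀ v₀ hu₀ hv₀
  obtain ⟨hP₀, -⟩ := H₁ u₀ v₀ hu₀ hv₀ hn₁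
  obtain ⟨hQ₀, -⟩ := H₂ u₀ v₀ hu₀ hv₀ hn₂
  obtain ⟨h₃, R, e₃, c, hh₃, hR, hn₃, H₃⟩ := hφ _ _ hP₀ hQ₀
  refine ⟨h₁ * h₂ * MvPolynomial.bind₁ (Sum.elim P Q) h₃,
    fun j => MvPolynomial.bind₁ (Sum.elim P Q) (R j), _, _,
    (hh₁.mul hh₂).mul (hh₃.bind hP hQ), fun j => (hR j).bind hP hQ, ?_, ?_⟩
  · have h3 := biEval_bind u₀ v₀ P Q h₃
    unfold biEval at *
    rw [map_mul, map_mul, h3]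
    exact mul_ne_zero (mul_ne_zero hn₁ hn₂) hn₃
  · intro u v hu hv hne
    have hne' : biEval u v h₁ * biEval u v h₂ *
        biEval u v (MvPolynomial.bind₁ (Sum.elim P Q) h₃) ≠ 0 := by
      simpa [biEval] using hne
    obtain ⟨h12, h3⟩ := mul_ne_zero_iff.mp hne'
    obtain ⟨h1, h2⟩ := mul_ne_zero_iff.mp h12
    obtain ⟨hPu, e1⟩ := H₁ u v hu hv h1
    obtain ⟨hQu, e2⟩ := H₂ u v hu hv h2
    rw [biEval_bind] at h3
    obtain ⟨hRu, e3⟩ := H₃ _ _ hPu hQu h3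
    simp only [biEval_bind]
    refine ⟨hRu, ?_⟩
    rw [← e3, ← e1, ← e2]

theorem IsMorphism.comp {k : Type*} [Field k] {f g : Quadric k → Quadric k}
    (hg : IsMorphism g) (hf : IsMorphism f) : IsMorphism (fun p => g (f p)) :=
  ⟨hg.1.comp hf, hg.2.comp hf⟩

/-- A map which is globally given by two bihomogeneous polynomials is regular. -/
theorem IsRegular.of_global {k : Type*} [Field k] {φ : Quadric k → Line k}
    (F : Fin 2 → MvPolynomial (Fin 2 ⊕ Fin 2) k) (d : ℕ × ℕ) (hF : ∀ j, IsBihom (F j) d)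
    (H : ∀ (u v : Fin 2 → k) (hu : u ≠ 0) (hv : v ≠ 0),
      ∃ hF : (fun j => biEval u v (F j)) ≠ 0,
        φ (Projectivization.mk k u hu, Projectivization.mk k v hv) =
          Projectivization.mk k (fun j => biEval u v (F j)) hF) : IsRegular φ := by
  intro u₀ v₀ hu₀ hv₀
  refine ⟨1, F, 0, d, MvPolynomial.isWeightedHomogeneous_one k bideg, hF, ?_, ?_⟩
  · simp [biEval]
  · intro u v hu hv _
    exact H u v hu hv

theorem isRegular_fst {k : Type*} [Field k] : IsRegular (fun p : Quadric k => p.1) := by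
  refine IsRegular.of_global (fun j => MvPolynomial.X (Sum.inl j)) _ isBihom_X_inl ?_
  intro u v hu hv
  have h : (fun j => biEval u v (MvPolynomial.X (Sum.inl j))) = u := by
    funext j; simp [biEval]
  simp only [h]
  exact ⟨hu, trivial⟩

theorem isRegular_snd {k : Type*} [Field k] : IsRegular (fun p : Quadric k => p.2) := by
  refine IsRegular.of_global (fun j => MvPolynomial.X (Sum.inr j)) _ isBihom_X_inr ?_
  intro u v hu hv
  have h : (fun j => biEval u v (MvPolynomial.X (Sum.inr j))) = v := by
    funext j; simp [biEval]
  simp only [h]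
  exact ⟨hv, trivial⟩

/-- The group `Aut(ℙ¹ × ℙ¹)`: the bijections which are morphisms in both directions. -/
def autQuadric (k : Type*) [Field k] : Subgroup (Equiv.Perm (Quadric k)) where
  carrier := {f | IsMorphism (f : Quadric k → Quadric k) ∧
    IsMorphism (f.symm : Quadric k → Quadric k)}
  one_mem' := ⟨⟨isRegular_fst, isRegular_snd⟩, ⟨isRegular_fst, isRegular_snd⟩⟩
  mul_mem' := fun hf hg => ⟨hf.1.comp hg.1, hg.2.comp hf.2⟩
  inv_mem' := fun hf => ⟨hf.2, hf.1⟩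

/-! ### The automorphisms `(M, N, id)` and `(M, N, σ)` -/

theorem isRegular_smul_fst {k : Type*} [Field k] (M : PGL(2, k)) :
    IsRegular (fun p : Quadric k => M • p.1) := by
  induction M using Matrix.ProjGenLinGroup.induction_on with | mk g =>
  refine IsRegular.of_global
    (fun j => ∑ l, MvPolynomial.C (g j l) * MvPolynomial.X (Sum.inl l)) (1, 0) ?_ ?_
  · intro j
    exact (MvPolynomial.weightedHomogeneousSubmodule k bideg (1, 0)).sum_mem
      fun l _ => (isBihom_X_inl l).C_mul _
  · intro u v hu hv
    have h : (fun j => biEval u v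
        (∑ l, MvPolynomial.C (g j l) * MvPolynomial.X (Sum.inl l))) = g • u := by
      funext j
      simp [biEval, Units.smul_def, Matrix.smul_eq_mulVec, Matrix.mulVec, dotProduct]
    simp only [h]
    exact ⟨(smul_ne_zero_iff_ne g).mpr hu, rfl⟩

theorem isRegular_smul_snd {k : Type*} [Field k] (N : PGL(2, k)) :
    IsRegular (fun p : Quadric k => N • p.2) := by
  induction N using Matrix.ProjGenLinGroup.induction_on with | mk g =>
  refine IsRegular.of_global
    (fun j => ∑ l, MvPolynomial.C (g j l) * MvPolynomial.X (Sum.inr l)) (0, 1) ?_ ?_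
  · intro j
    exact (MvPolynomial.weightedHomogeneousSubmodule k bideg (0, 1)).sum_mem
      fun l _ => (isBihom_X_inr l).C_mul _
  · intro u v hu hv
    have h : (fun j => biEval u v
        (∑ l, MvPolynomial.C (g j l) * MvPolynomial.X (Sum.inr l))) = g • v := by
      funext j
      simp [biEval, Units.smul_def, Matrix.smul_eq_mulVec, Matrix.mulVec, dotProduct]
    simp only [h]
    exact ⟨(smul_ne_zero_iff_ne g).mpr hv, rfl⟩

/-- The homomorphism `PGL₂(k) × PGL₂(k) → Aut(ℙ¹ × ℙ¹)`; the image of `(M, N)` is the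
automorphism `(x, y) ↦ (M x, N y)`. -/
def act {k : Type*} [Field k] : PGL(2, k) × PGL(2, k) →* autQuadric k where
  toFun g := ⟨Equiv.prodCongr (MulAction.toPerm g.1) (MulAction.toPerm g.2),
    ⟨⟨isRegular_smul_fst g.1, isRegular_smul_snd g.2⟩,
      ⟨isRegular_smul_fst g.1⁻¹, isRegular_smul_snd g.2⁻¹⟩⟩⟩
  map_one' := by
    apply Subtype.ext
    apply Equiv.ext
    intro p
    exact Prod.ext (one_smul PGL(2, k) p.1) (one_smul PGL(2, k) p.2)
  map_mul' g h := by
    apply Subtype.ext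
    apply Equiv.ext
    intro p
    exact Prod.ext (mul_smul g.1 h.1 p.1) (mul_smul g.2 h.2 p.2)

/-- The involution `σ : (x, y) ↦ (y, x)` which permutes the two rulings. -/
def swap (k : Type*) [Field k] : autQuadric k :=
  ⟨Equiv.prodComm (Line k) (Line k),
    ⟨⟨isRegular_snd, isRegular_fst⟩, ⟨isRegular_snd, isRegular_fst⟩⟩⟩

/-- `(M, N, id) : (x, y) ↦ (M x, N y)`. -/
def str {k : Type*} [Field k] (M N : PGL(2, k)) : autQuadric k := act (M, N)

/-- `(M, N, σ) : (x, y) ↦ (M y, N x)`. -/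
def tw {k : Type*} [Field k] (M N : PGL(2, k)) : autQuadric k := act (M, N) * swap k

theorem str_apply {k : Type*} [Field k] (M N : PGL(2, k)) (x y : Line k) :
    (str M N).1 (x, y) = (M • x, N • y) := rfl

theorem tw_apply {k : Type*} [Field k] (M N : PGL(2, k)) (x y : Line k) :
    (tw M N).1 (x, y) = (M • y, N • x) := rfl

/-! ### Subgroups of `Aut(ℙ¹ × ℙ¹)` -/

/-- The automorphism `g` preserves each of the two rulings, i.e. it maps fibres of the first
projection to fibres of the first projection, and the same for the second projection. -/
def PreservesRulings {k : Type*} [Field k] (g : autQuadric k) : Prop :=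
  (∀ p q : Quadric k, p.1 = q.1 → (g.1 p).1 = (g.1 q).1) ∧
    ∀ p q : Quadric k, p.2 = q.2 → (g.1 p).2 = (g.1 q).2

/-- The subgroup `H = p₁(G ∩ (PGL₂(k) × PGL₂(k)))` of `PGL₂(k)`. -/
def firstFactor {k : Type*} [Field k] (G : Subgroup (autQuadric k)) : Subgroup PGL(2, k) :=
  (G.comap act).map (MonoidHom.fst PGL(2, k) PGL(2, k))

/-- `G` is a finite subgroup of `Aut(ℙ¹ × ℙ¹)`, some element of `G` does not preserve the two rulings
(so that `G` maps onto `Aut(ℙ¹ × ℙ¹) / (PGL₂(k) × PGL₂(k)) ≃ C₂`; equivalently, the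
invariant Picard group of `ℙ¹ × ℙ¹` has rank one), and the group `H` in the exact sequence
`1 → H ×_Q H → G → C₂ → 1`, i.e. the projection to `PGL₂(k)` of the kernel, is isomorphic
to `T`. -/
def IsRankOneOfType {k : Type*} [Field k] (G : Subgroup (autQuadric k))
    (T : Type*) [Group T] : Prop :=
  Finite G ∧ (∃ g ∈ G, ¬ PreservesRulings g) ∧ Nonempty (firstFactor G ≃* T)

/-- `G` is conjugate to `L`. -/
def IsConjTo {A : Type*} [Group A] (G L : Subgroup A) : Prop :=
  ∃ α : A, L.map (MulAut.conj α).toMonoidHom = G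

/-- `G` is conjugate to a subgroup of `L`. -/
def IsConjIntoSubgroup {A : Type*} [Group A] (G L : Subgroup A) : Prop :=
  ∃ K : Subgroup A, K ≤ L ∧ IsConjTo G K

/-- `G` is isomorphic to a semidirect product `N ⋊ Q` (for some action of `Q` on `N`). -/
def IsSemidirect (G N Q : Type*) [Group G] [Group N] [Group Q] : Prop :=
  ∃ φ : Q →* MulAut N, Nonempty (G ≃* N ⋊[φ] Q)

/-- The cyclic group of order `n` (for `n ≥ 1`), written multiplicatively. -/
abbrev Cyc (n : ℕ) : Type := Multiplicative (ZMod n)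

/-- The wreath product `D ≀ C₂ = D² ⋊ C₂`, where `C₂` permutes the two factors. -/
abbrev WrC2 (D : Type*) [Group D] : Type _ := RegularWreathProduct D (Cyc 2)

/-! ### The matrices -/

/-- A choice, for every `n ≥ 1`, of a primitive `n`-th root of unity `ω n` in `k`.
Over `ℂ` one may take `ω n = exp (2πi / n)`. -/
structure RootChoice (k : Type*) [Field k] where
  root : ℕ → kˣ
  prim : ∀ n : ℕ, 0 < n → IsPrimitiveRoot (root n) n

theorem RootChoice.nonempty (k : Type*) [Field k] [IsAlgClosed k] [CharZero k] :
    Nonempty (RootChoice k) := by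
  have H : ∀ n : ℕ, ∃ z : kˣ, 0 < n → IsPrimitiveRoot z n := by
    intro n
    rcases Nat.eq_zero_or_pos n with rfl | hn
    · exact ⟨1, fun h => absurd h (lt_irrefl 0)⟩
    · have : NeZero n := ⟨hn.ne'⟩
      have : NeZero (n : k) := ⟨Nat.cast_ne_zero.mpr hn.ne'⟩
      obtain ⟨z, hz⟩ := HasEnoughRootsOfUnity.exists_primitiveRoot k n
      refine ⟨(hz.isUnit hn.ne').unit, fun _ => ?_⟩
      exact (IsPrimitiveRoot.coe_units_iff).mp (by simpa using hz)
  choose f hf using H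
  exact ⟨⟨f, hf⟩⟩

/-- The element `i = ω 4`. -/
def RootChoice.i {k : Type*} [Field k] (ω : RootChoice k) : k := (ω.root 4 : k)

/-- The element `ω 5`. -/
def RootChoice.five {k : Type*} [Field k] (ω : RootChoice k) : k := (ω.root 5 : k)

theorem RootChoice.i_sq {k : Type*} [Field k] (ω : RootChoice k) : ω.i ^ 2 = -1 := by
  have h : IsPrimitiveRoot ω.i 4 := IsPrimitiveRoot.coe_units_iff.mpr (ω.prim 4 (by norm_num))
  have h2 : IsPrimitiveRoot (ω.i ^ 2) 2 := h.pow (by norm_num) (by norm_num)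
  exact h2.eq_neg_one_of_two_right

/-- The class in `PGL₂(k)` of an invertible matrix. -/
noncomputable def pgl {k : Type*} [Field k] (M : Matrix (Fin 2) (Fin 2) k) (h : M.det ≠ 0) :
    PGL(2, k) :=
  Matrix.ProjGenLinGroup.mk (Matrix.GeneralLinearGroup.mkOfDetNeZero M h)

/-- `Rₙ = diag(1, ωₙ)`. -/
noncomputable def mR {k : Type*} [Field k] (ω : RootChoice k) (n : ℕ) : PGL(2, k) :=
  pgl !![1, 0; 0, (ω.root n : k)] (by simp [Matrix.det_fin_two])

noncomputable def mA (k : Type*) [Field k] : PGL(2, k) :=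
  pgl !![1, 0; 0, -1] (by simp [Matrix.det_fin_two])

noncomputable def mB (k : Type*) [Field k] : PGL(2, k) :=
  pgl !![0, 1; 1, 0] (by simp [Matrix.det_fin_two])

noncomputable def mC {k : Type*} [Field k] [CharZero k] (ω : RootChoice k) : PGL(2, k) :=
  pgl !![ω.i, -ω.i; 1, 1] (by
    have h : ω.i ≠ 0 := Units.ne_zero _
    have h2 : ω.i + ω.i = 2 * ω.i := by ring
    simpa [Matrix.det_fin_two, h2] using h)

noncomputable def mD {k : Type*} [Field k] [CharZero k] (ω : RootChoice k) : PGL(2, k) :=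
  pgl !![1, -ω.i; ω.i, -1] (by
    have h2 : (1 : k) * (-1) - -ω.i * ω.i = -2 := by linear_combination ω.i_sq
    rw [Matrix.det_fin_two_of, h2]
    norm_num)

noncomputable def mE {k : Type*} [Field k] (ω : RootChoice k) : PGL(2, k) :=
  pgl !![ω.five, 0; 0, 1] (by
    have h : ω.five ≠ 0 := Units.ne_zero _
    simpa [Matrix.det_fin_two] using h)

noncomputable def mF {k : Type*} [Field k] (ω : RootChoice k) : PGL(2, k) :=
  pgl !![1, 1 - ω.five - ω.five⁻¹; 1, -1] (by
    have h0 : ω.five ≠ 0 := Units.ne_zero _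
    have h : IsPrimitiveRoot ω.five 5 :=
      IsPrimitiveRoot.coe_units_iff.mpr (ω.prim 5 (by norm_num))
    have h1 : ω.five - 1 ≠ 0 := sub_ne_zero.mpr (h.ne_one (by norm_num))
    have h2 : (1 : k) * (-1) - (1 - ω.five - ω.five⁻¹) * 1 = (ω.five - 1) ^ 2 * ω.five⁻¹ := by
      field_simp
      ring
    rw [Matrix.det_fin_two_of, h2]
    exact mul_ne_zero (pow_ne_zero _ h1) (inv_ne_zero h0))

/-! ### The groups of the theorem -/

/-- `Dₙ × S₄`. -/
noncomputable def grpDnS4 {k : Type*} [Field k] [CharZero k] (ω : RootChoice k) (n : ℕ) :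
    Subgroup (autQuadric k) :=
  Subgroup.closure {str (mR ω n) 1, str (mB k) 1,
    str 1 (mA k), str 1 (mB k), str 1 (mC ω), str 1 (mD ω)}

/-- `Dₙ × A₅`. -/
noncomputable def grpDnA5 {k : Type*} [Field k] (ω : RootChoice k) (n : ℕ) :
    Subgroup (autQuadric k) :=
  Subgroup.closure {str (mR ω n) 1, str (mB k) 1, str 1 (mE ω), str 1 (mF ω)}

/-- `S₄ × A₅`. -/
noncomputable def grpS4A5 {k : Type*} [Field k] [CharZero k] (ω : RootChoice k) :
    Subgroup (autQuadric k) :=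
  Subgroup.closure {str (mA k) 1, str (mB k) 1, str (mC ω) 1, str (mD ω) 1,
    str 1 (mE ω), str 1 (mF ω)}

/-- `Dₙ ≀ C₂`. -/
noncomputable def grpDnWr {k : Type*} [Field k] (ω : RootChoice k) (n : ℕ) :
    Subgroup (autQuadric k) :=
  Subgroup.closure {str (mR ω n) 1, str (mB k) 1, tw 1 1}

/-- `S₄ ≀ C₂`. -/
noncomputable def grpS4Wr {k : Type*} [Field k] [CharZero k] (ω : RootChoice k) :
    Subgroup (autQuadric k) :=
  Subgroup.closure {str (mA k) 1, str (mB k) 1, str (mC ω) 1, str (mD ω) 1, tw 1 1}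

/-- `A₅ ≀ C₂`. -/
noncomputable def grpA5Wr {k : Type*} [Field k] (ω : RootChoice k) : Subgroup (autQuadric k) :=
  Subgroup.closure {str (mE ω) 1, str (mF ω) 1, tw 1 1}

/-- The seven groups interchanging the rulings with `H ≃ A₄`. -/
noncomputable def a4List {k : Type*} [Field k] [CharZero k] (ω : RootChoice k) :
    Fin 7 → Subgroup (autQuadric k) := ![
  Subgroup.closure {str (mA k) (mA k), str (mB k) (mB k), str (mC ω) (mC ω), tw 1 1},
  Subgroup.closure {str (mA k) (mA k), str (mB k) (mB k), str (mC ω) (mC ω), tw (mD ω) (mD ω)},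
  Subgroup.closure {str (mA k) 1, str (mB k) 1, str (mC ω) (mC ω), tw 1 1},
  Subgroup.closure {str (mA k) 1, str (mB k) 1, str (mC ω) (mC ω), tw 1 (mC ω)},
  Subgroup.closure {str (mA k) 1, str (mB k) 1, str (mC ω) (mC ω), tw (mD ω) (mD ω)},
  Subgroup.closure {str (mA k) 1, str (mB k) 1, str (mC ω) 1, tw 1 1},
  Subgroup.closure {str (mA k) 1, str (mB k) 1, str (mC ω) 1, tw (mD ω) (mD ω)}]

/-- The five groups interchanging the rulings with `H ≃ S₄`. -/
noncomputable def s4List {k : Type*} [Field k] [CharZero k] (ω : RootChoice k) :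
    Fin 5 → Subgroup (autQuadric k) := ![
  Subgroup.closure {str (mA k) (mA k), str (mB k) (mB k), str (mC ω) (mC ω),
    str (mD ω) (mD ω), tw 1 1},
  Subgroup.closure {str (mA k) 1, str (mB k) 1, str (mC ω) (mC ω), str (mD ω) (mD ω), tw 1 1},
  Subgroup.closure {str (mA k) 1, str (mB k) 1, str (mC ω) 1, str (mD ω) (mD ω), tw 1 1},
  Subgroup.closure {str (mA k) 1, str (mB k) 1, str (mC ω) 1, str (mD ω) (mD ω), tw 1 (mD ω)},
  Subgroup.closure {str (mA k) 1, str (mB k) 1, str (mC ω) 1, str (mD ω) 1, tw 1 1}]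

/-- The icosahedral subgroup `⟨E, F⟩` of `PGL₂(k)`. -/
noncomputable def icosahedral {k : Type*} [Field k] (ω : RootChoice k) : Subgroup PGL(2, k) :=
  Subgroup.closure {mE ω, mF ω}

/-- `E` as an element of `⟨E, F⟩`. -/
noncomputable def icoE {k : Type*} [Field k] (ω : RootChoice k) : icosahedral ω :=
  ⟨mE ω, Subgroup.subset_closure (by simp)⟩

/-- The automorphism `ξ` of `⟨E, F⟩` is outer and an involution. -/
def IsOuterInvolution {k : Type*} [Field k] {ω : RootChoice k}
    (ξ : MulAut (icosahedral ω)) : Prop :=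
  ξ ∉ (MulAut.conj : icosahedral ω →* MulAut (icosahedral ω)).range ∧ ξ ^ 2 = 1

/-- The three groups interchanging the rulings with `H ≃ A₅`; the second one uses an outer
involution `ξ` of `⟨E, F⟩`. -/
noncomputable def a5List {k : Type*} [Field k] (ω : RootChoice k)
    (ξ : MulAut (icosahedral ω)) : Fin 3 → Subgroup (autQuadric k) := ![
  Subgroup.closure {str (mE ω) (mE ω), str (mF ω) (mF ω), tw 1 1},
  Subgroup.closure {str (mE ω) (ξ (icoE ω) : PGL(2, k)), tw 1 1},
  Subgroup.closure {str 1 (mE ω), str 1 (mF ω), str (mE ω) 1, str (mF ω) 1, tw 1 1}]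

end QuadricAut

namespace QuadricAut

/-! ### Factors of weighted homogeneous polynomials -/

/-! Automorphisms. A regular map ℙ¹ × ℙ¹ → ℙ¹ is given globally by one coprime pair of bihomogeneous
polynomials (`IsRegular.exists_isGlobalRep`). The bidegrees of the two components of an automorphism
form a 2 × 2 matrix over ℕ, and the matrix of the inverse automorphism is inverse to it over ℕ. It
is therefore a permutation matrix, each component is linear in one of the two pairs of variables,
and the group is PGL₂ × PGL₂ extended by σ (`eq_str_or_eq_tw`).

Finite subgroups of PGL₂ (`klein_classification`). A nontrivial element of finite order has exactly
two fixed points. Burnside's count on the points with nontrivial stabilizer shows that a finite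
group either preserves a pair of points, and is then conjugate into a dihedral group, or has order
12, 24, 60 with element orders 1, 2, 3, m for m = 3, 4, 5. In the second case trace computations
produce y, x of orders m, 2 with yx of order 3 (`exists_isTriangle`). If y = diag(l, 1), then x is
determined up to conjugation by the torus (`IsTriangle.normal_form`), so the only invariant of such
a triangle is l up to inversion. For m = 3, 4 all triangles are conjugate. For m = 5 they are
conjugate up to replacing E by a power, which an automorphism of A₅ achieves. The octahedral and
icosahedral representations themselves come from bounding the orders of groups with the relations aᵐ
= b² = (ab)³ = 1 by coset enumeration.

Part (1). If G preserves the rulings, it lies in the product of its two projections. Otherwise a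
conjugate of G contains some (1, c)σ; conjugation by it interchanges the two projections, so both
are equal to H and G embeds in H ≀ C₂. Klein's theorem applies to the projections.

Parts (2)–(4). Every faithful representation of T = A₄, S₄, A₅ is, up to conjugation and
automorphisms of T, the restriction of the standard one of Γ = S₄, S₄, A₅. So the problem becomes
one about subgroups L of the finite group Γ ≀ C₂ (`exists_isConjTo_map`). By Goursat's lemma the
intersection of L with the base is a fibre product of two copies of T over an automorphism φ of T/N,
and the element (1, p)σ of L forces φ² to be conjugation by p. If φ is conjugation by some q,
conjugating L by (q, 1) makes the fibre product the set of pairs congruent modulo N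
(`exists_conj_congrPairs`), and it remains to see which coset of it completes L. Going through the
normal subgroups N gives the lists. For T = A₅ and N = 1 the automorphism may be outer, which gives
the group isomorphic to S₅.

Orders follow from the index-two description `IsTwist.mem_iff`. Isomorphism classes follow by
exhibiting injective homomorphisms into the group and comparing orders. -/

/-- The homomorphism `Xᵢ ↦ Xᵢ T ^ wᵢ`, which records the weights as powers of `T`. -/
noncomputable def gradHom {k σ : Type*} [Field k] (w : σ → ℕ) :
    MvPolynomial σ k →ₐ[k] Polynomial (MvPolynomial σ k) :=
  MvPolynomial.aeval fun i => Polynomial.monomial (w i) (MvPolynomial.X i)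

theorem gradHom_monomial {k σ : Type*} [Field k] (w : σ → ℕ) (d : σ →₀ ℕ) (c : k) :
    gradHom w (MvPolynomial.monomial d c) =
      Polynomial.monomial (Finsupp.weight w d) (MvPolynomial.monomial d c) := by
  rw [gradHom, MvPolynomial.aeval_monomial, MvPolynomial.monomial_eq, Finsupp.weight_apply]
  induction d using Finsupp.induction with
  | zero => simp
  | single_add a b f ha hb ih =>
    rw [Finsupp.prod_add_index' (by simp) (by intros; rw [pow_add]),
      Finsupp.prod_add_index' (by simp) (by intros; rw [pow_add]),
      Finsupp.sum_add_index' (by simp) (by intros; rw [add_smul]), mul_left_comm, ih,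
      Finsupp.prod_single_index (by exact pow_zero _),
      Finsupp.prod_single_index (by exact pow_zero _),
      Finsupp.sum_single_index (by exact zero_smul _ _), Polynomial.monomial_pow,
      Polynomial.monomial_mul_monomial]
    rw [mul_left_comm, smul_eq_mul, mul_comm (w a) b]

/-- The coefficient of `T ^ n` in the image is the part of weight `n`. Thus the map is injective,
and a weighted homogeneous polynomial is one whose image is a single power of `T`. -/
theorem coeff_coeff_gradHom {k σ : Type*} [Field k] (w : σ → ℕ) (p : MvPolynomial σ k)
    (n : ℕ) (d : σ →₀ ℕ) :
    ((gradHom w p).coeff n).coeff d = if Finsupp.weight w d = n then p.coeff d else 0 := by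
  classical
  induction p using MvPolynomial.induction_on' with
  | monomial e c =>
    rw [gradHom_monomial, Polynomial.coeff_monomial, MvPolynomial.coeff_monomial]
    by_cases h : e = d
    · subst h
      split_ifs <;> simp_all
    · split_ifs <;> simp [h]
  | add p q hp hq =>
    rw [map_add, Polynomial.coeff_add, MvPolynomial.coeff_add, hp, hq, MvPolynomial.coeff_add]
    split_ifs <;> simp

/-- The image of the product has equal degree and trailing degree in `T`. Both are additive over a
domain, and trailing degree ≤ degree for each factor, so equality holds for each factor. -/
theorem isWeightedHomogeneous_of_mul {k σ : Type*} [Field k] {w : σ → ℕ}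
    {p q : MvPolynomial σ k} {n : ℕ} (h : MvPolynomial.IsWeightedHomogeneous w (p * q) n)
    (hpq : p * q ≠ 0) : ∃ m, MvPolynomial.IsWeightedHomogeneous w q m := by
  have hc : ∀ m d, ((gradHom w (p * q)).coeff m).coeff d ≠ 0 → m = n := by
    intro m d hmd
    rw [coeff_coeff_gradHom] at hmd
    split_ifs at hmd with h1
    · rw [← h1, h hmd]
    · exact absurd rfl hmd
  have hne : ∀ r : MvPolynomial σ k, r ≠ 0 → gradHom w r ≠ 0 := by
    intro r hr h0
    apply hr
    ext d
    have := coeff_coeff_gradHom w r (Finsupp.weight w d) d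
    rw [h0, if_pos rfl] at this
    simpa using this.symm
  have hmem : ∀ m, (gradHom w (p * q)).coeff m ≠ 0 → m = n := by
    intro m hm
    obtain ⟨d, hd⟩ := MvPolynomial.ne_zero_iff.mp hm
    exact hc m d hd
  have h1 : (gradHom w (p * q)).natDegree = n :=
    hmem _ (by
      have := Polynomial.leadingCoeff_ne_zero.mpr (hne _ hpq)
      rwa [Polynomial.leadingCoeff] at this)
  have h2 : (gradHom w (p * q)).natTrailingDegree = n :=
    hmem _ (by
      have := mt Polynomial.trailingCoeff_eq_zero.mp (hne _ hpq)
      rwa [Polynomial.trailingCoeff] at this)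
  have hp := hne p (left_ne_zero_of_mul hpq)
  have hq := hne q (right_ne_zero_of_mul hpq)
  rw [map_mul] at h1 h2
  rw [Polynomial.natDegree_mul hp hq] at h1
  rw [Polynomial.natTrailingDegree_mul hp hq] at h2
  have h3 := Polynomial.natTrailingDegree_le_natDegree (gradHom w p)
  have h4 := Polynomial.natTrailingDegree_le_natDegree (gradHom w q)
  refine ⟨(gradHom w q).natDegree, fun {d} hd => ?_⟩
  have h5 : (gradHom w q).coeff (Finsupp.weight w d) ≠ 0 := by
    intro h0
    have := coeff_coeff_gradHom w q (Finsupp.weight w d) d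
    rw [h0, if_pos rfl] at this
    exact hd this.symm
  have h6 := Polynomial.le_natDegree_of_ne_zero h5
  have h7 := Polynomial.natTrailingDegree_le_of_ne_zero h5
  omega

/-- Splits the ℕ × ℕ grading into two ℕ-gradings, to which the degree argument in `T` applies. -/
theorem isBihom_iff {k : Type*} [Field k] {F : MvPolynomial (Fin 2 ⊕ Fin 2) k} {d : ℕ × ℕ} :
    IsBihom F d ↔ MvPolynomial.IsWeightedHomogeneous (fun i => (bideg i).1) F d.1 ∧
      MvPolynomial.IsWeightedHomogeneous (fun i => (bideg i).2) F d.2 := by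
  have hw : ∀ e : Fin 2 ⊕ Fin 2 →₀ ℕ, Finsupp.weight bideg e =
      (Finsupp.weight (fun i => (bideg i).1) e, Finsupp.weight (fun i => (bideg i).2) e) := by
    intro e
    simp only [Finsupp.weight_apply]
    rw [Finsupp.sum_fintype _ _ (by simp), Finsupp.sum_fintype _ _ (by simp),
      Finsupp.sum_fintype _ _ (by simp)]
    ext <;> simp
  constructor
  · intro h
    exact ⟨fun {e} he => by have := h he; rw [hw] at this; exact congrArg Prod.fst this,
      fun {e} he => by have := h he; rw [hw] at this; exact congrArg Prod.snd this⟩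
  · intro h e he
    rw [hw, h.1 he, h.2 he]

theorem IsBihom.of_mul {k : Type*} [Field k] {p q : MvPolynomial (Fin 2 ⊕ Fin 2) k}
    {d : ℕ × ℕ} (h : IsBihom (p * q) d) (hpq : p * q ≠ 0) : ∃ e, IsBihom q e := by
  obtain ⟨h1, h2⟩ := isBihom_iff.mp h
  obtain ⟨a, ha⟩ := isWeightedHomogeneous_of_mul h1 hpq
  obtain ⟨b, hb⟩ := isWeightedHomogeneous_of_mul h2 hpq
  exact ⟨(a, b), isBihom_iff.mpr ⟨ha, hb⟩⟩

theorem biEval_smul {k : Type*} [Field k] {F : MvPolynomial (Fin 2 ⊕ Fin 2) k} {d : ℕ × ℕ}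
    (h : IsBihom F d) (s t : k) (u v : Fin 2 → k) :
    biEval (s • u) (t • v) F = s ^ d.1 * t ^ d.2 * biEval u v F := by
  unfold biEval
  rw [MvPolynomial.eval_eq', MvPolynomial.eval_eq', Finset.mul_sum]
  refine Finset.sum_congr rfl fun e he => ?_
  have hw : Finsupp.weight bideg e = d := h (MvPolynomial.mem_support_iff.mp he)
  rw [← hw, Finsupp.weight_apply, Finsupp.sum_fintype _ _ (by simp)]
  simp [Fintype.sum_sum_type, Fintype.prod_sum_type, bideg, mul_pow, pow_add]
  ring

theorem eval_eq_biEval {k : Type*} [Field k] (x : Fin 2 ⊕ Fin 2 → k)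
    (F : MvPolynomial (Fin 2 ⊕ Fin 2) k) :
    MvPolynomial.eval x F = biEval (fun i => x (Sum.inl i)) (fun i => x (Sum.inr i)) F := by
  unfold biEval
  congr 2
  ext i
  cases i <;> rfl

/-- A polynomial which vanishes wherever `u ≠ 0`, `v ≠ 0` and `h ≠ 0` is zero. -/
theorem eq_zero_of_biEval {k : Type*} [Field k] [Infinite k]
    {h P : MvPolynomial (Fin 2 ⊕ Fin 2) k} (hh : h ≠ 0)
    (H : ∀ u v : Fin 2 → k, u ≠ 0 → v ≠ 0 → biEval u v h ≠ 0 → biEval u v P = 0) : P = 0 := by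
  -- The factors `x₀` and `y₀` kill the points where `u` or `v` could vanish, and `h` kills the
  -- complement of the open set. The product vanishes on all of k⁴, hence is zero since `k` is
  -- infinite.
  have h1 : h * P * MvPolynomial.X (Sum.inl 0) * MvPolynomial.X (Sum.inr 0) = 0 := by
    apply MvPolynomial.funext
    intro x
    rw [map_zero, map_mul, map_mul, map_mul, MvPolynomial.eval_X, MvPolynomial.eval_X]
    by_contra hne
    obtain ⟨⟨⟨a1, a2⟩, a3⟩, a4⟩ : ((MvPolynomial.eval x h ≠ 0 ∧ MvPolynomial.eval x P ≠ 0) ∧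
        x (Sum.inl 0) ≠ 0) ∧ x (Sum.inr 0) ≠ 0 := by
      simpa only [ne_eq, mul_eq_zero, not_or] using hne
    rw [eval_eq_biEval] at a1 a2
    exact a2 (H _ _ (fun h0 => a3 (congrFun h0 0)) (fun h0 => a4 (congrFun h0 0)) a1)
  have hX : ∀ i, (MvPolynomial.X i : MvPolynomial (Fin 2 ⊕ Fin 2) k) ≠ 0 :=
    fun i => MvPolynomial.X_ne_zero i
  simpa [hh, hX] using h1

/-- If `F₀, F₁` are relatively prime, then every pair proportional to it is a multiple of it. -/
theorem exists_mul_of_isRelPrime {R : Type*} [CommRing R] [IsDomain R] [UniqueFactorizationMonoid R]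
    {a b a' b' : R} (hab : IsRelPrime a b) (h : a * b' = b * a') :
    ∃ c, a' = c * a ∧ b' = c * b := by
  have h1 : a ∣ a' := hab.dvd_of_dvd_mul_left ⟨b', h.symm⟩
  have h2 : b ∣ b' := hab.symm.dvd_of_dvd_mul_left ⟨a', h⟩
  obtain ⟨c, rfl⟩ := h1
  obtain ⟨e, rfl⟩ := h2
  have h3 : a * b * (e - c) = 0 := by linear_combination h
  rcases mul_eq_zero.mp h3 with h4 | h4
  · rcases mul_eq_zero.mp h4 with rfl | rfl
    · exact ⟨e, by simp, by ring⟩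
    · exact ⟨c, by ring, by simp⟩
  · rw [sub_eq_zero] at h4
    exact ⟨c, by ring, by rw [h4]; ring⟩

theorem mk_eq_mk_iff_cross {k : Type*} [Field k] {u v : Fin 2 → k} (hu : u ≠ 0) (hv : v ≠ 0) :
    Projectivization.mk k u hu = Projectivization.mk k v hv ↔ u 0 * v 1 = u 1 * v 0 := by
  rw [Projectivization.mk_eq_mk_iff']
  constructor
  · rintro ⟨a, rfl⟩
    simp; ring
  · intro h
    by_cases h0 : v 0 = 0
    · have h1 : v 1 ≠ 0 := fun h1 => hv (by ext i; fin_cases i <;> simp [h0, h1])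
      refine ⟨u 1 / v 1, ?_⟩
      have h2 : u 0 = 0 := by simpa [h0, h1] using h
      ext i; fin_cases i
      · simp [h0, h2]
      · simp [h1]
    · refine ⟨u 0 / v 0, ?_⟩
      ext i; fin_cases i
      · simp [h0]
      · simp; field_simp; rw [h, mul_comm]

/-- `F` represents `φ` globally, with bidegree `d`. -/
def IsGlobalRep {k : Type*} [Field k] (φ : Quadric k → Line k)
    (F : Fin 2 → MvPolynomial (Fin 2 ⊕ Fin 2) k) (d : ℕ × ℕ) : Prop :=
  (∀ j, IsBihom (F j) d) ∧ ∀ (u v : Fin 2 → k) (hu : u ≠ 0) (hv : v ≠ 0),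
    ∃ hF : (fun j => biEval u v (F j)) ≠ 0,
      φ (Projectivization.mk k u hu, Projectivization.mk k v hv) =
        Projectivization.mk k (fun j => biEval u v (F j)) hF

/-- Divide a local representative by its gcd to get a coprime pair `(a, b)`. A local representative
at any other point is proportional to it, hence by coprimality a multiple `r (a, b)`. A common zero
of `a, b` would be a common zero of that representative, so `(a, b)` is valid there too. -/
theorem IsRegular.exists_isGlobalRep {k : Type*} [Field k] [Infinite k]
    {φ : Quadric k → Line k} (hφ : IsRegular φ) : ∃ F d, IsGlobalRep φ F d := by
  have h10 : (![1, 0] : Fin 2 → k) ≠ 0 := fun h => one_ne_zero (congrFun h 0)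
  obtain ⟨h, F, e, d, hh, hF, hn, H⟩ := hφ _ _ h10 h10
  have hh0 : h ≠ 0 := by rintro rfl; simp [biEval] at hn
  have hFne : ∃ j, F j ≠ 0 := by
    obtain ⟨hf, -⟩ := H _ _ h10 h10 hn
    by_contra hcon
    push Not at hcon
    exact hf (by ext j; simp [hcon j, biEval])
  obtain ⟨a, b, c, hab, h0, h1⟩ : ∃ a b c, IsRelPrime a b ∧ c * a = F 0 ∧ c * b = F 1 := by
    obtain ⟨j, hj⟩ := hFne
    fin_cases j
    · exact UniqueFactorizationMonoid.exists_reduced_factors _ hj _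
    · exact UniqueFactorizationMonoid.exists_reduced_factors' _ _ hj
  have hc : c ≠ 0 := by
    rintro rfl
    obtain ⟨j, hj⟩ := hFne
    fin_cases j
    · exact hj (by simp [← h0])
    · exact hj (by simp [← h1])
  have hglob : ∀ (u v : Fin 2 → k) (hu : u ≠ 0) (hv : v ≠ 0),
      ∃ hF : (fun j => biEval u v (![a, b] j)) ≠ 0,
        φ (Projectivization.mk k u hu, Projectivization.mk k v hv) =
          Projectivization.mk k (fun j => biEval u v (![a, b] j)) hF := by
    intro u v hu hv
    obtain ⟨h', F', e', d', hh', hF', hn', H'⟩ := hφ u v hu hv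
    have hh0' : h' ≠ 0 := by rintro rfl; simp [biEval] at hn'
    -- Two representatives agree on the nonempty open set `h h' ≠ 0`, so their cross product
    -- vanishes identically.
    have hcr : F 0 * F' 1 - F 1 * F' 0 = 0 := by
      refine eq_zero_of_biEval (mul_ne_zero hh0 hh0') fun u v hu hv hne => ?_
      have hne' : biEval u v h * biEval u v h' ≠ 0 := by simpa [biEval] using hne
      obtain ⟨n1, n2⟩ := mul_ne_zero_iff.mp hne'
      obtain ⟨g1, e1⟩ := H u v hu hv n1
      obtain ⟨g2, e2⟩ := H' u v hu hv n2
      have := (mk_eq_mk_iff_cross g1 g2).mp (e1.symm.trans e2)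
      simpa [biEval, sub_eq_zero] using this
    have hcr2 : a * F' 1 = b * F' 0 := by
      refine mul_left_cancel₀ hc ?_
      rw [← h0, ← h1] at hcr
      linear_combination hcr
    obtain ⟨r, hr0, hr1⟩ := exists_mul_of_isRelPrime hab hcr2
    obtain ⟨g, eg⟩ := H' u v hu hv hn'
    have hne : (fun j => biEval u v (![a, b] j)) ≠ 0 := by
      intro h0
      apply g
      have e0 : biEval u v a = 0 := congrFun h0 0
      have e1 : biEval u v b = 0 := congrFun h0 1
      unfold biEval at *
      ext j
      fin_cases j
      · simp [hr0, e0]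
      · simp [hr1, e1]
    refine ⟨hne, ?_⟩
    rw [eg, mk_eq_mk_iff_cross]
    simp only [hr0, hr1, biEval, map_mul, Matrix.cons_val_zero, Matrix.cons_val_one]
    ring
  have hor : ∀ j, c * ![a, b] j = F j := by
    intro j; fin_cases j
    · exact h0
    · exact h1
  have hbi : ∃ d', ∀ j, IsBihom (![a, b] j) d' := by
    obtain ⟨j, hj⟩ := hFne
    have hcj : ∃ ec, IsBihom c ec := by
      refine IsBihom.of_mul (p := ![a, b] j) (d := d) ?_ ?_
      · rw [mul_comm, hor]; exact hF j
      · rw [mul_comm, hor]; exact hj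
    obtain ⟨ec, hec⟩ := hcj
    -- The truncated subtraction is harmless: for a nonzero entry the degrees satisfy `ec + ei = d`,
    -- and a zero entry is bihomogeneous of every bidegree.
    refine ⟨(d.1 - ec.1, d.2 - ec.2), fun i => ?_⟩
    by_cases hi : F i = 0
    · have : ![a, b] i = 0 := by
        have := hor i
        rw [hi] at this
        exact (mul_eq_zero.mp this).resolve_left hc
      rw [this]
      exact MvPolynomial.isWeightedHomogeneous_zero _ _ _
    · obtain ⟨ei, hei⟩ := IsBihom.of_mul (p := c) (q := ![a, b] i) (d := d)
        (by rw [hor]; exact hF i) (by rw [hor]; exact hi)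
      have h2 : IsBihom (F i) (ec + ei) := by rw [← hor]; exact hec.mul hei
      have h3 : ec + ei = d := MvPolynomial.IsWeightedHomogeneous.inj_right hi h2 (hF i)
      have h4 : (d.1 - ec.1, d.2 - ec.2) = ei := by
        rw [← h3]; ext <;> simp
      rw [h4]
      exact hei
  obtain ⟨d', hd'⟩ := hbi
  exact ⟨![a, b], d', hd', hglob⟩

end QuadricAut
namespace QuadricAut

/-! ### Bidegrees and the structure of `Aut(ℙ¹ × ℙ¹)` -/

/-- A form without zeros restricts to a nowhere vanishing polynomial, hence a constant, on each of
the two affine charts. Comparing the values at (2, 1) and (1, 1/2), which differ by the factor `2 ^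
m`, gives `2 ^ m = 1`; characteristic zero then forces `m = 0`. -/
theorem degree_eq_zero_of_nonvanishing {k : Type*} [Field k] [IsAlgClosed k] [CharZero k]
    {h : (Fin 2 → k) → k} {m : ℕ} (P Q : Polynomial k) (hP : ∀ s, h ![s, 1] = P.eval s)
    (hQ : ∀ t, h ![1, t] = Q.eval t) (hs : ∀ (s : k) u, h (s • u) = s ^ m * h u)
    (hne : ∀ u, u ≠ 0 → h u ≠ 0) : m = 0 := by
  have h1 : ∀ s : k, (![s, 1] : Fin 2 → k) ≠ 0 := fun s h => one_ne_zero (congrFun h 1)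
  have h2 : ∀ s : k, (![1, s] : Fin 2 → k) ≠ 0 := fun s h => one_ne_zero (congrFun h 0)
  have hconst : ∀ R : Polynomial k, (∀ s, R.eval s ≠ 0) → ∀ s t, R.eval s = R.eval t := by
    intro R hR
    have : R.degree = 0 := by
      by_contra hd
      obtain ⟨x, hx⟩ := IsAlgClosed.exists_root R hd
      exact hR x hx
    rw [Polynomial.eq_C_of_degree_eq_zero this]
    simp
  have hPc := hconst P fun s => by rw [← hP]; exact hne _ (h1 s)
  have hQc := hconst Q fun s => by rw [← hQ]; exact hne _ (h2 s)
  have e1 : h ![2, 1] = 2 ^ m * h ![1, 2⁻¹] := by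
    rw [← hs]; congr 1; ext i; fin_cases i <;> simp
  rw [hP, hQ, hQc _ 1, ← hQ, hPc _ 1, ← hP] at e1
  have e2 : (2 : k) ^ m = 1 := by
    have := hne _ (h1 1)
    field_simp at e1
    exact e1.symm
  have e3 : (2 : ℕ) ^ m = 1 := by exact_mod_cast e2
  simpa using e3

theorem eval_aeval_elim {k : Type*} [Field k] (a b : Fin 2 → Polynomial k)
    (F : MvPolynomial (Fin 2 ⊕ Fin 2) k) (s : k) :
    (MvPolynomial.aeval (Sum.elim a b) F).eval s =
      biEval (fun i => (a i).eval s) (fun i => (b i).eval s) F := by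
  unfold biEval
  rw [← Polynomial.coe_evalRingHom, MvPolynomial.aeval_def, MvPolynomial.hom_eval₂,
    MvPolynomial.eval, MvPolynomial.coe_eval₂Hom]
  congr 1
  · ext; simp
  · funext i; cases i <;> simp

/-- Each of the two degrees is read off after fixing the other pair of variables at (1, 0). -/
theorem IsBihom.eq_zero_of_nonvanishing {k : Type*} [Field k] [IsAlgClosed k] [CharZero k]
    {c : MvPolynomial (Fin 2 ⊕ Fin 2) k} {d : ℕ × ℕ} (hc : IsBihom c d)
    (hne : ∀ u v : Fin 2 → k, u ≠ 0 → v ≠ 0 → biEval u v c ≠ 0) : d = 0 := by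
  have h10 : (![1, 0] : Fin 2 → k) ≠ 0 := fun h => one_ne_zero (congrFun h 0)
  have e0 : (fun i => Polynomial.eval (0 : k) ((![1, 0] : Fin 2 → Polynomial k) i)) =
      (![1, 0] : Fin 2 → k) := by ext i; fin_cases i <;> simp
  have eC : ∀ s, (fun i => Polynomial.eval s ((![1, 0] : Fin 2 → Polynomial k) i)) =
      (![1, 0] : Fin 2 → k) := fun s => by ext i; fin_cases i <;> simp
  have eX : ∀ s, (fun i => Polynomial.eval s ((![Polynomial.X, 1] : Fin 2 → Polynomial k) i)) =
      (![s, 1] : Fin 2 → k) := fun s => by ext i; fin_cases i <;> simp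
  have eY : ∀ s, (fun i => Polynomial.eval s ((![1, Polynomial.X] : Fin 2 → Polynomial k) i)) =
      (![1, s] : Fin 2 → k) := fun s => by ext i; fin_cases i <;> simp
  ext
  · refine degree_eq_zero_of_nonvanishing (h := fun u => biEval u ![1, 0] c)
      (MvPolynomial.aeval (Sum.elim ![Polynomial.X, 1] ![1, 0]) c)
      (MvPolynomial.aeval (Sum.elim ![1, Polynomial.X] ![1, 0]) c) ?_ ?_ ?_ ?_
    · intro s; rw [eval_aeval_elim, eC, eX]
    · intro s; rw [eval_aeval_elim, eC, eY]
    · intro s u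
      have := biEval_smul hc s 1 u ![1, 0]
      simpa using this
    · exact fun u hu => hne u _ hu h10
  · refine degree_eq_zero_of_nonvanishing (h := fun u => biEval ![1, 0] u c)
      (MvPolynomial.aeval (Sum.elim ![1, 0] ![Polynomial.X, 1]) c)
      (MvPolynomial.aeval (Sum.elim ![1, 0] ![1, Polynomial.X]) c) ?_ ?_ ?_ ?_
    · intro s; rw [eval_aeval_elim, eC, eX]
    · intro s; rw [eval_aeval_elim, eC, eY]
    · intro s u
      have := biEval_smul hc 1 s ![1, 0] u
      simpa using this
    · exact fun u hu => hne _ u h10 hu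

/-- A nowhere vanishing pair of bihomogeneous polynomials proportional to the pair of variables
`X (g 0), X (g 1)` has the bidegree of these variables. -/
theorem bidegree_eq_of_proportional {k : Type*} [Field k] [IsAlgClosed k] [CharZero k]
    {F : Fin 2 → MvPolynomial (Fin 2 ⊕ Fin 2) k} {d w : ℕ × ℕ} (g : Fin 2 → Fin 2 ⊕ Fin 2)
    (hg : g 0 ≠ g 1)
    (hF : ∀ j, IsBihom (F j) d)
    (hw : ∀ j, IsBihom (MvPolynomial.X (g j) : MvPolynomial (Fin 2 ⊕ Fin 2) k) w)
    (hne : ∀ u v : Fin 2 → k, u ≠ 0 → v ≠ 0 → (fun j => biEval u v (F j)) ≠ 0)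
    (h : MvPolynomial.X (g 0) * F 1 = MvPolynomial.X (g 1) * F 0) : d = w := by
  have hrel : IsRelPrime (MvPolynomial.X (g 0) : MvPolynomial (Fin 2 ⊕ Fin 2) k)
      (MvPolynomial.X (g 1)) := by
    rw [Irreducible.isRelPrime_iff_not_dvd (MvPolynomial.X_prime).irreducible]
    intro hd
    exact hg (MvPolynomial.X_dvd_X.mp hd)
  -- The common factor `c` has no zeros because the pair has none, so it has bidegree zero and does
  -- not change the bidegree of the variables.
  obtain ⟨c, h0, h1⟩ := exists_mul_of_isRelPrime hrel h
  have hj : ∀ j, F j = MvPolynomial.X (g j) * c := by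
    intro j; fin_cases j
    · exact h0.trans (mul_comm _ _)
    · exact h1.trans (mul_comm _ _)
  have hcne : ∀ u v : Fin 2 → k, u ≠ 0 → v ≠ 0 → biEval u v c ≠ 0 := by
    intro u v hu hv hc0
    apply hne u v hu hv
    unfold biEval at *
    ext j
    simp [hj, hc0]
  have h10 : (![1, 0] : Fin 2 → k) ≠ 0 := fun h => one_ne_zero (congrFun h 0)
  have hc : c ≠ 0 := by
    rintro rfl
    exact hcne _ _ h10 h10 (by simp [biEval])
  have hF0 : F 0 ≠ 0 := by
    rw [h0]; exact mul_ne_zero hc (MvPolynomial.X_ne_zero _)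
  obtain ⟨e, he⟩ := IsBihom.of_mul (p := MvPolynomial.X (g 0)) (q := c) (d := d)
    (by rw [← hj]; exact hF 0) (by rw [← hj]; exact hF0)
  have he0 := he.eq_zero_of_nonvanishing hcne
  have := (hw 0).mul he
  rw [← hj] at this
  rw [← MvPolynomial.IsWeightedHomogeneous.inj_right hF0 this (hF 0), he0, add_zero]

theorem IsGlobalRep.bidegree_fst {k : Type*} [Field k] [IsAlgClosed k] [CharZero k]
    {F : Fin 2 → MvPolynomial (Fin 2 ⊕ Fin 2) k} {d : ℕ × ℕ}
    (h : IsGlobalRep (fun p : Quadric k => p.1) F d) : d = (1, 0) := by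
  refine bidegree_eq_of_proportional Sum.inl (by simp) h.1 isBihom_X_inl
    (fun u v hu hv => (h.2 u v hu hv).1) (sub_eq_zero.mp ?_)
  refine eq_zero_of_biEval one_ne_zero fun u v hu hv _ => ?_
  obtain ⟨hF, e⟩ := h.2 u v hu hv
  have := (mk_eq_mk_iff_cross _ _).mp e
  simpa [biEval, sub_eq_zero] using this

theorem IsGlobalRep.bidegree_snd {k : Type*} [Field k] [IsAlgClosed k] [CharZero k]
    {F : Fin 2 → MvPolynomial (Fin 2 ⊕ Fin 2) k} {d : ℕ × ℕ}
    (h : IsGlobalRep (fun p : Quadric k => p.2) F d) : d = (0, 1) := by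
  refine bidegree_eq_of_proportional Sum.inr (by simp) h.1 isBihom_X_inr
    (fun u v hu hv => (h.2 u v hu hv).1) (sub_eq_zero.mp ?_)
  refine eq_zero_of_biEval one_ne_zero fun u v hu hv _ => ?_
  obtain ⟨hF, e⟩ := h.2 u v hu hv
  have := (mk_eq_mk_iff_cross _ _).mp e
  simpa [biEval, sub_eq_zero] using this

/-- Bidegrees compose like a row vector times the matrix with rows `a` and `b`. This is what makes
the bidegrees of an automorphism an invertible matrix. -/
theorem IsGlobalRep.comp {k : Type*} [Field k] {φ : Quadric k → Line k}
    {f : Quadric k → Quadric k} {F P Q : Fin 2 → MvPolynomial (Fin 2 ⊕ Fin 2) k}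
    {d a b : ℕ × ℕ} (hφ : IsGlobalRep φ F d) (h1 : IsGlobalRep (fun p => (f p).1) P a)
    (h2 : IsGlobalRep (fun p => (f p).2) Q b) :
    IsGlobalRep (fun p => φ (f p)) (fun j => MvPolynomial.bind₁ (Sum.elim P Q) (F j))
      (d.1 • a + d.2 • b) := by
  refine ⟨fun j => (hφ.1 j).bind h1.1 h2.1, fun u v hu hv => ?_⟩
  obtain ⟨hP, eP⟩ := h1.2 u v hu hv
  obtain ⟨hQ, eQ⟩ := h2.2 u v hu hv
  obtain ⟨hF, eF⟩ := hφ.2 _ _ hP hQ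
  simp only [biEval_bind]
  refine ⟨hF, ?_⟩
  rw [← eF, ← eP, ← eQ]

theorem IsBihom.eq_linear {k : Type*} [Field k] {F : MvPolynomial (Fin 2 ⊕ Fin 2) k}
    {w : ℕ × ℕ} (g : Fin 2 → Fin 2 ⊕ Fin 2) (hg : g 0 ≠ g 1)
    (hw : ∀ j, IsBihom (MvPolynomial.X (g j) : MvPolynomial (Fin 2 ⊕ Fin 2) k) w)
    (hd : ∀ d : Fin 2 ⊕ Fin 2 →₀ ℕ, Finsupp.weight bideg d = w → ∃ j, d = Finsupp.single (g j) 1)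
    (hF : IsBihom F w) :
    F = ∑ j, MvPolynomial.C (F.coeff (Finsupp.single (g j) 1)) * MvPolynomial.X (g j) := by
  classical
  have hR : IsBihom (∑ j, MvPolynomial.C (F.coeff (Finsupp.single (g j) 1)) *
      MvPolynomial.X (g j)) w :=
    (MvPolynomial.weightedHomogeneousSubmodule k bideg w).sum_mem fun l _ => (hw l).C_mul _
  ext d
  by_cases h : Finsupp.weight bideg d = w
  · obtain ⟨j, rfl⟩ := hd d h
    fin_cases j <;>
    simp [MvPolynomial.coeff_C_mul, MvPolynomial.coeff_X, Finsupp.single_left_inj, hg, hg.symm]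
  · rw [MvPolynomial.IsWeightedHomogeneous.coeff_eq_zero hF d h,
      MvPolynomial.IsWeightedHomogeneous.coeff_eq_zero hR d h]

theorem weight_bideg {d : Fin 2 ⊕ Fin 2 →₀ ℕ} : Finsupp.weight bideg d =
    (d (Sum.inl 0) + d (Sum.inl 1), d (Sum.inr 0) + d (Sum.inr 1)) := by
  rw [Finsupp.weight_apply, Finsupp.sum_fintype _ _ (by simp)]
  ext <;> simp [Fintype.sum_sum_type, bideg]

theorem exists_pgl_of_linear {k : Type*} [Field k] (c : Fin 2 → Fin 2 → k)
    (h : ∀ u : Fin 2 → k, u ≠ 0 → (fun i => ∑ j, c i j * u j) ≠ 0) :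
    ∃ M : PGL(2, k), ∀ (u : Fin 2 → k) (hu : u ≠ 0),
      M • Projectivization.mk k u hu = Projectivization.mk k (fun i => ∑ j, c i j * u j) (h u hu) := by
  have hdet : (Matrix.of c).det ≠ 0 := by
    intro h0
    obtain ⟨v, hv, hv0⟩ := Matrix.exists_mulVec_eq_zero_iff.mpr h0
    exact h v hv hv0
  exact ⟨pgl (Matrix.of c) hdet, fun u hu => rfl⟩

theorem IsGlobalRep.exists_smul_fst {k : Type*} [Field k] {φ : Quadric k → Line k}
    {F : Fin 2 → MvPolynomial (Fin 2 ⊕ Fin 2) k} (h : IsGlobalRep φ F (1, 0)) :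
    ∃ M : PGL(2, k), ∀ p, φ p = M • p.1 := by
  have hw : ∀ d : Fin 2 ⊕ Fin 2 →₀ ℕ, Finsupp.weight bideg d = (1, 0) →
      ∃ j : Fin 2, d = Finsupp.single (Sum.inl j) 1 := by
    intro d hd
    rw [weight_bideg, Prod.mk.injEq] at hd
    by_cases h0 : d (Sum.inl 0) = 0
    · refine ⟨1, ?_⟩
      ext i; rcases i with i | i <;> fin_cases i <;> simp <;> omega
    · refine ⟨0, ?_⟩
      ext i; rcases i with i | i <;> fin_cases i <;> simp <;> omega
  have hl : ∀ u v i, biEval u v (F i) =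
      ∑ j, (F i).coeff (Finsupp.single (Sum.inl j) 1) * u j := by
    intro u v i
    conv_lhs => rw [(h.1 i).eq_linear Sum.inl (by simp) isBihom_X_inl hw]
    simp [biEval]
  have h10 : (![1, 0] : Fin 2 → k) ≠ 0 := fun h => one_ne_zero (congrFun h 0)
  obtain ⟨M, hM⟩ := exists_pgl_of_linear
    (fun i j => (F i).coeff (Finsupp.single (Sum.inl j) 1)) (fun u hu => by
      have := (h.2 u _ hu h10).1
      simpa only [hl] using this)
  refine ⟨M, fun ⟨p, q⟩ => ?_⟩
  induction p using Projectivization.ind with | h u hu =>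
  induction q using Projectivization.ind with | h v hv =>
  rw [hM, (h.2 u v hu hv).2]
  simp only [hl]

theorem IsGlobalRep.exists_smul_snd {k : Type*} [Field k] {φ : Quadric k → Line k}
    {F : Fin 2 → MvPolynomial (Fin 2 ⊕ Fin 2) k} (h : IsGlobalRep φ F (0, 1)) :
    ∃ M : PGL(2, k), ∀ p, φ p = M • p.2 := by
  have hw : ∀ d : Fin 2 ⊕ Fin 2 →₀ ℕ, Finsupp.weight bideg d = (0, 1) →
      ∃ j : Fin 2, d = Finsupp.single (Sum.inr j) 1 := by
    intro d hd
    rw [weight_bideg, Prod.mk.injEq] at hd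
    by_cases h0 : d (Sum.inr 0) = 0
    · refine ⟨1, ?_⟩
      ext i; rcases i with i | i <;> fin_cases i <;> simp <;> omega
    · refine ⟨0, ?_⟩
      ext i; rcases i with i | i <;> fin_cases i <;> simp <;> omega
  have hl : ∀ u v i, biEval u v (F i) =
      ∑ j, (F i).coeff (Finsupp.single (Sum.inr j) 1) * v j := by
    intro u v i
    conv_lhs => rw [(h.1 i).eq_linear Sum.inr (by simp) isBihom_X_inr hw]
    simp [biEval]
  have h10 : (![1, 0] : Fin 2 → k) ≠ 0 := fun h => one_ne_zero (congrFun h 0)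
  obtain ⟨M, hM⟩ := exists_pgl_of_linear
    (fun i j => (F i).coeff (Finsupp.single (Sum.inr j) 1)) (fun v hv => by
      have := (h.2 _ v h10 hv).1
      simpa only [hl] using this)
  refine ⟨M, fun ⟨p, q⟩ => ?_⟩
  induction p using Projectivization.ind with | h u hu =>
  induction q using Projectivization.ind with | h v hv =>
  rw [hM, (h.2 u v hu hv).2]
  simp only [hl]

/-- Every automorphism of `ℙ¹ × ℙ¹` is of the form `(M, N, id)` or `(M, N, σ)`. -/
theorem eq_str_or_eq_tw {k : Type*} [Field k] [IsAlgClosed k] [CharZero k] (f : autQuadric k) :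
    ∃ M N : PGL(2, k), f = str M N ∨ f = tw M N := by
  obtain ⟨F, d, hF⟩ := f.2.1.1.exists_isGlobalRep
  obtain ⟨G, e, hG⟩ := f.2.1.2.exists_isGlobalRep
  obtain ⟨P, a, hP⟩ := f.2.2.1.exists_isGlobalRep
  obtain ⟨Q, b, hQ⟩ := f.2.2.2.exists_isGlobalRep
  have h1 := hF.comp hP hQ
  have h2 := hG.comp hP hQ
  simp only [Equiv.apply_symm_apply] at h1 h2
  have e1 := h1.bidegree_fst
  have e2 := h2.bidegree_snd
  obtain ⟨d1, d2⟩ := d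
  obtain ⟨c1, c2⟩ := e
  obtain ⟨a1, a2⟩ := a
  obtain ⟨b1, b2⟩ := b
  have hm : ∀ x y : ℕ, x * y = 1 ↔ x = 1 ∧ y = 1 := fun x y =>
    ⟨fun h => ⟨Nat.dvd_one.mp ⟨y, h.symm⟩, Nat.dvd_one.mp ⟨x, by rw [mul_comm]; exact h.symm⟩⟩,
      fun h => by rw [h.1, h.2]⟩
  simp only [Prod.smul_mk, Prod.mk_add_mk, Prod.mk.injEq, smul_eq_mul, Nat.add_eq_zero_iff,
    mul_eq_zero, Nat.add_eq_one_iff, hm] at e1 e2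
  -- The rows `d`, `e` and `a`, `b` form two matrices over ℕ with product the identity, so they are
  -- permutation matrices.
  have key : ((d1, d2) = (1, 0) ∧ (c1, c2) = (0, 1)) ∨ ((d1, d2) = (0, 1) ∧ (c1, c2) = (1, 0)) := by
    simp only [Prod.mk.injEq]
    omega
  rcases key with ⟨hd, hc⟩ | ⟨hd, hc⟩
  · rw [hd] at hF
    rw [hc] at hG
    obtain ⟨M, hM⟩ := hF.exists_smul_fst
    obtain ⟨N, hN⟩ := hG.exists_smul_snd
    exact ⟨M, N, Or.inl (Subtype.ext (Equiv.ext fun p => Prod.ext (hM p) (hN p)))⟩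
  · rw [hd] at hF
    rw [hc] at hG
    obtain ⟨M, hM⟩ := hF.exists_smul_snd
    obtain ⟨N, hN⟩ := hG.exists_smul_fst
    exact ⟨M, N, Or.inr (Subtype.ext (Equiv.ext fun p => Prod.ext (hM p) (hN p)))⟩

/-! ### Calculating with `str` and `tw` -/

section
variable {k : Type*} [Field k] (a b c d : PGL(2, k))

theorem str_mul_str : str a b * str c d = str (a * c) (b * d) := (map_mul act (a, b) (c, d)).symm

theorem swap_mul_str : swap k * str c d = str d c * swap k := rfl

theorem swap_mul_swap : swap k * swap k = 1 := rfl

theorem str_one : str (1 : PGL(2, k)) 1 = 1 := map_one act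

theorem tw_eq : tw a b = str a b * swap k := rfl

theorem str_mul_tw : str a b * tw c d = tw (a * c) (b * d) := by
  rw [tw_eq, ← mul_assoc, str_mul_str, ← tw_eq]

theorem tw_mul_str : tw a b * str c d = tw (a * d) (b * c) := by
  rw [tw_eq, mul_assoc, swap_mul_str, ← mul_assoc, str_mul_str, ← tw_eq]

theorem tw_mul_tw : tw a b * tw c d = str (a * d) (b * c) := by
  rw [tw_eq c d, ← mul_assoc, tw_mul_str, tw_eq, mul_assoc, swap_mul_swap, mul_one]

theorem str_inv : (str a b)⁻¹ = str a⁻¹ b⁻¹ := (map_inv act (a, b)).symm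

theorem tw_inv : (tw a b)⁻¹ = tw b⁻¹ a⁻¹ := by
  rw [inv_eq_iff_mul_eq_one, tw_mul_tw, mul_inv_cancel, mul_inv_cancel, str_one]

end

/-- Fixing [1 : 0] and [0 : 1] makes the matrix diagonal, and fixing [1 : 1] makes it scalar. -/
theorem pgl_eq_one_of_smul {k : Type*} [Field k] {M : PGL(2, k)}
    (h : ∀ p : Line k, M • p = p) : M = 1 := by
  induction M using Matrix.ProjGenLinGroup.induction_on with | mk g =>
  have key : ∀ u : Fin 2 → k, u ≠ 0 → (g.1.mulVec u) 0 * u 1 = (g.1.mulVec u) 1 * u 0 := by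
    intro u hu
    have h1 := h (Projectivization.mk k u hu)
    exact (mk_eq_mk_iff_cross ((smul_ne_zero_iff_ne g).mpr hu) hu).mp h1
  have k1 := key ![1, 0] fun h => one_ne_zero (congrFun h 0)
  have k2 := key ![0, 1] fun h => one_ne_zero (congrFun h 1)
  have k3 := key ![1, 1] fun h => one_ne_zero (congrFun h 1)
  simp [Matrix.mulVec, dotProduct, Fin.sum_univ_two] at k1 k2 k3
  rw [← k1, k2, zero_add, add_zero] at k3
  rw [Matrix.ProjGenLinGroup.mk_eq_one, Matrix.GeneralLinearGroup.center_eq_range_scalar]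
  have hd : g.1 0 0 ≠ 0 := by
    intro h0
    have := g.isUnit.map Matrix.detMonoidHom
    simp [Matrix.det_fin_two, h0, ← k1] at this
  refine ⟨Units.mk0 _ hd, ?_⟩
  ext i j
  fin_cases i <;> fin_cases j <;> simp [← k1, k2, k3]

section
variable {k : Type*} [Field k]

theorem act_injective : Function.Injective (act (k := k)) := by
  rw [injective_iff_map_eq_one]
  rintro ⟨a, b⟩ h
  have h' : ∀ x y : Line k, (a • x, b • y) = (x, y) := fun x y =>
    congrArg (fun f : autQuadric k => f.1 (x, y)) h
  have x0 : Line k := Projectivization.mk k ![1, 0] fun h => one_ne_zero (congrFun h 0)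
  have ha : a = 1 := pgl_eq_one_of_smul fun p => congrArg Prod.fst (h' p x0)
  have hb : b = 1 := pgl_eq_one_of_smul fun p => congrArg Prod.snd (h' x0 p)
  rw [ha, hb]; rfl

theorem str_inj {a b c d : PGL(2, k)} : str a b = str c d ↔ a = c ∧ b = d := by
  unfold str
  rw [act_injective.eq_iff, Prod.mk.injEq]

theorem preservesRulings_str (a b : PGL(2, k)) : PreservesRulings (str a b) :=
  ⟨fun _ _ h => congrArg (a • ·) h, fun _ _ h => congrArg (b • ·) h⟩

theorem not_preservesRulings_tw (a b : PGL(2, k)) : ¬ PreservesRulings (tw a b) := by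
  intro h
  have x0 : Line k := Projectivization.mk k ![1, 0] fun h => one_ne_zero (congrFun h 0)
  let x1 : Line k := Projectivization.mk k ![1, 0] fun h => one_ne_zero (congrFun h 0)
  let x2 : Line k := Projectivization.mk k ![0, 1] fun h => one_ne_zero (congrFun h 1)
  have h1 := h.1 (x0, x1) (x0, x2) rfl
  have h2 : a • x1 = a • x2 := h1
  have h3 : x1 = x2 := MulAction.injective a h2
  have := (mk_eq_mk_iff_cross _ _).mp h3
  simp at this

theorem str_ne_tw (a b c d : PGL(2, k)) : str a b ≠ tw c d := fun h =>
  not_preservesRulings_tw c d (h ▸ preservesRulings_str a b)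

end

end QuadricAut
namespace QuadricAut

/-! ### Calculating in `PGL₂(k)` -/

section
variable {k : Type*} [Field k]

open Classical in
/-- The class of the matrix with rows `(a, b)` and `(c, d)`, if it is invertible. -/
noncomputable def mat (a b c d : k) : PGL(2, k) :=
  if h : (!![a, b; c, d]).det ≠ 0 then pgl !![a, b; c, d] h else 1

theorem pgl_eq_mat {a b c d : k} (h : (!![a, b; c, d]).det ≠ 0) :
    pgl !![a, b; c, d] h = mat a b c d := by
  rw [mat, dif_pos h]

theorem det_ne {a b c d : k} (h : a * d - b * c ≠ 0) : (!![a, b; c, d]).det ≠ 0 := by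
  rwa [Matrix.det_fin_two_of]

theorem exists_mat (g : PGL(2, k)) : ∃ a b c d : k, a * d - b * c ≠ 0 ∧ g = mat a b c d := by
  induction g using Matrix.ProjGenLinGroup.induction_on with | mk g =>
  have h : (g.1).det ≠ 0 := (g.isUnit.map Matrix.detMonoidHom).ne_zero
  have e := Matrix.eta_fin_two g.1
  refine ⟨g.1 0 0, g.1 0 1, g.1 1 0, g.1 1 1, by rwa [← Matrix.det_fin_two], ?_⟩
  rw [← pgl_eq_mat (by rwa [← e])]
  unfold pgl
  congr 1
  exact Units.ext e

theorem mat_mul {a b c d a' b' c' d' : k} (h : a * d - b * c ≠ 0) (h' : a' * d' - b' * c' ≠ 0) :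
    mat a b c d * mat a' b' c' d' =
      mat (a * a' + b * c') (a * b' + b * d') (c * a' + d * c') (c * b' + d * d') := by
  have h2 : (a * a' + b * c') * (c * b' + d * d') - (a * b' + b * d') * (c * a' + d * c') ≠ 0 := by
    convert mul_ne_zero h h' using 1; ring
  rw [← pgl_eq_mat (det_ne h), ← pgl_eq_mat (det_ne h'), ← pgl_eq_mat (det_ne h2)]
  unfold pgl
  rw [← map_mul]
  congr 1
  refine Units.ext ?_
  exact Matrix.mul_fin_two ..

theorem mat_eq_iff {a b c d a' b' c' d' : k} (h : a * d - b * c ≠ 0)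
    (h' : a' * d' - b' * c' ≠ 0) :
    mat a b c d = mat a' b' c' d' ↔
      ∃ s, s ≠ 0 ∧ a' = s * a ∧ b' = s * b ∧ c' = s * c ∧ d' = s * d := by
  rw [← pgl_eq_mat (det_ne h), ← pgl_eq_mat (det_ne h')]
  unfold pgl
  rw [Matrix.ProjGenLinGroup.mk_eq_mk_iff]
  constructor
  · rintro ⟨u, hu⟩
    have key := congrArg Units.val hu
    refine ⟨u, u.ne_zero, ?_⟩
    have k1 := congrFun (congrFun key 0) 0
    have k2 := congrFun (congrFun key 0) 1
    have k3 := congrFun (congrFun key 1) 0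
    have k4 := congrFun (congrFun key 1) 1
    simp [Matrix.GeneralLinearGroup.mkOfDetNeZero, Matrix.mul_apply] at k1 k2 k3 k4
    refine ⟨?_, ?_, ?_, ?_⟩
    · rw [← k1]; ring
    · rw [← k2]; ring
    · rw [← k3]; ring
    · rw [← k4]; ring
  · rintro ⟨s, hs, rfl, rfl, rfl, rfl⟩
    refine ⟨Units.mk0 s hs, Units.ext ?_⟩
    ext i j
    fin_cases i <;> fin_cases j <;>
      simp [Matrix.GeneralLinearGroup.mkOfDetNeZero, Matrix.mul_apply, mul_comm]

theorem mat_smul_eq {a b c d s : k} (hs : s ≠ 0) :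
    mat (s * a) (s * b) (s * c) (s * d) = mat a b c d := by
  by_cases h : a * d - b * c = 0
  · have h1 : (!![a, b; c, d]).det = 0 := by rwa [Matrix.det_fin_two_of]
    have h2 : (!![s * a, s * b; s * c, s * d]).det = 0 := by
      rw [Matrix.det_fin_two_of]; linear_combination s ^ 2 * h
    rw [mat, mat, dif_neg (by simpa using h2), dif_neg (by simpa using h1)]
  · refine ((mat_eq_iff h ?_).mpr ⟨s, hs, rfl, rfl, rfl, rfl⟩).symm
    have : s * a * (s * d) - s * b * (s * c) = s ^ 2 * (a * d - b * c) := by ring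
    rw [this]
    exact mul_ne_zero (pow_ne_zero _ hs) h

theorem mat_one : mat (1 : k) 0 0 1 = 1 := by
  rw [← pgl_eq_mat (det_ne (by simp))]
  unfold pgl
  convert map_one Matrix.ProjGenLinGroup.mk
  refine Units.ext ?_
  ext i j
  fin_cases i <;> fin_cases j <;> simp [Matrix.GeneralLinearGroup.mkOfDetNeZero]

theorem mat_eq_one_iff {a b c d : k} (h : a * d - b * c ≠ 0) :
    mat a b c d = 1 ↔ b = 0 ∧ c = 0 ∧ a = d := by
  rw [← mat_one, eq_comm, mat_eq_iff (by simp) h]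
  constructor
  · rintro ⟨s, -, rfl, rfl, rfl, rfl⟩
    simp
  · rintro ⟨rfl, rfl, rfl⟩
    refine ⟨a, ?_, by simp, by simp, by simp, by simp⟩
    rintro rfl
    simp at h

/-- The point `[x : y]` of the projective line. -/
noncomputable def pt (x y : k) (h : (![x, y] : Fin 2 → k) ≠ 0) : Line k := Projectivization.mk k ![x, y] h

theorem vec_ne {x y : k} (h : x ≠ 0 ∨ y ≠ 0) : (![x, y] : Fin 2 → k) ≠ 0 := fun h0 =>
  h.elim (fun h => h (congrFun h0 0)) fun h => h (congrFun h0 1)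

theorem exists_pt (p : Line k) : ∃ x y h, p = pt x y h := by
  induction p using Projectivization.ind with | h u hu =>
  have e : u = ![u 0, u 1] := by ext i; fin_cases i <;> rfl
  exact ⟨u 0, u 1, e ▸ hu, by unfold pt; congr⟩

theorem pt_eq_pt {x y x' y' : k} {h h'} : pt x y h = pt x' y' h' ↔ x * y' = y * x' :=
  mk_eq_mk_iff_cross h h'

theorem mat_smul_pt {a b c d x y : k} (h : a * d - b * c ≠ 0) (hv : (![x, y] : Fin 2 → k) ≠ 0) :
    ∃ hv', mat a b c d • pt x y hv = pt (a * x + b * y) (c * x + d * y) hv' := by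
  rw [← pgl_eq_mat (det_ne h)]
  have e : (!![a, b; c, d]).mulVec ![x, y] = ![a * x + b * y, c * x + d * y] := by
    ext i; fin_cases i <;> simp <;> ring
  have hne := (smul_ne_zero_iff_ne (Matrix.GeneralLinearGroup.mkOfDetNeZero _ (det_ne h))).mpr hv
  have e' : (Matrix.GeneralLinearGroup.mkOfDetNeZero _ (det_ne h)) • ![x, y] =
    ![a * x + b * y, c * x + d * y] := e
  refine ⟨e' ▸ hne, ?_⟩
  unfold pt pgl
  simp only [← e']
  rfl

theorem mat_smul_pt_eq_iff {a b c d x y x' y' : k} (h : a * d - b * c ≠ 0) {hv hv'} :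
    mat a b c d • pt x y hv = pt x' y' hv' ↔ (a * x + b * y) * y' = (c * x + d * y) * x' := by
  obtain ⟨h1, e⟩ := mat_smul_pt h hv
  rw [e, pt_eq_pt]

/-- The point at infinity. -/
noncomputable def ptInf (k : Type*) [Field k] : Line k := pt 1 0 (vec_ne (Or.inl one_ne_zero))

/-- The point zero. -/
noncomputable def ptZero (k : Type*) [Field k] : Line k := pt 0 1 (vec_ne (Or.inr one_ne_zero))

theorem exists_smul_ptInf_ptZero {p q : Line k} (h : p ≠ q) :
    ∃ P : PGL(2, k), P • ptInf k = p ∧ P • ptZero k = q := by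
  obtain ⟨x, y, hv, rfl⟩ := exists_pt p
  obtain ⟨x', y', hv', rfl⟩ := exists_pt q
  have hd : x * y' - x' * y ≠ 0 := fun h0 => h (pt_eq_pt.mpr (by linear_combination h0))
  refine ⟨mat x x' y y', ?_, ?_⟩
  · unfold ptInf; rw [mat_smul_pt_eq_iff hd]; ring
  · unfold ptZero; rw [mat_smul_pt_eq_iff hd]; ring

/-- The affine map `x ↦ a x + b`. -/
noncomputable def aff (a : kˣ) (b : k) : PGL(2, k) := mat a b 0 1

theorem aff_det (a : kˣ) (b : k) : (a : k) * 1 - b * 0 ≠ 0 := by simp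

theorem aff_mul (a a' : kˣ) (b b' : k) : aff a b * aff a' b' = aff (a * a') (a * b' + b) := by
  unfold aff
  rw [mat_mul (aff_det a b) (aff_det a' b')]
  simp

theorem aff_inj {a a' : kˣ} {b b' : k} : aff a b = aff a' b' ↔ a = a' ∧ b = b' := by
  unfold aff
  rw [mat_eq_iff (aff_det a b) (aff_det a' b')]
  constructor
  · rintro ⟨s, -, h1, h2, -, h4⟩
    rw [mul_one] at h4
    rw [← h4, one_mul] at h1 h2
    exact ⟨Units.ext h1.symm, h2.symm⟩
  · rintro ⟨rfl, rfl⟩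
    exact ⟨1, by simp⟩

theorem aff_one : aff (1 : kˣ) (0 : k) = 1 := by unfold aff; simp [mat_one]

theorem aff_one_pow (b : k) (n : ℕ) : aff (1 : kˣ) b ^ n = aff 1 (n * b) := by
  induction n with
  | zero => simp [aff_one]
  | succ n ih => rw [pow_succ, ih, aff_mul]; simp; ring_nf

theorem aff_one_eq_one_of_pow [CharZero k] {b : k} {n : ℕ} (hn : n ≠ 0)
    (h : aff (1 : kˣ) b ^ n = 1) : b = 0 := by
  rw [aff_one_pow, ← aff_one, aff_inj] at h
  simpa [hn] using h.2

/-- The torus of diagonal matrices. -/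
noncomputable def torus : kˣ →* PGL(2, k) where
  toFun a := aff a 0
  map_one' := aff_one
  map_mul' a b := by rw [aff_mul]; simp

theorem torus_eq (a : kˣ) : torus a = mat (a : k) 0 0 1 := rfl

theorem torus_injective : Function.Injective (torus (k := k)) := fun _ _ h => (aff_inj.mp h).1

theorem exists_aff_of_smul {g : PGL(2, k)} (h : g • ptInf k = ptInf k) : ∃ a b, g = aff a b := by
  obtain ⟨a, b, c, d, hd, rfl⟩ := exists_mat g
  unfold ptInf at h
  rw [mat_smul_pt_eq_iff hd] at h
  obtain rfl : c = 0 := by simpa using h.symm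
  have ha : a ≠ 0 := by rintro rfl; simp at hd
  have hd' : d ≠ 0 := by rintro rfl; simp at hd
  refine ⟨Units.mk0 (a / d) (div_ne_zero ha hd'), b / d, ?_⟩
  unfold aff
  have := mat_smul_eq (a := a / d) (b := b / d) (c := 0) (d := 1) hd'
  rw [mul_div_cancel₀ _ hd', mul_div_cancel₀ _ hd', mul_zero, mul_one] at this
  exact this

theorem exists_torus_of_smul {g : PGL(2, k)} (h : g • ptInf k = ptInf k)
    (h' : g • ptZero k = ptZero k) : ∃ a, g = torus a := by
  obtain ⟨a, b, rfl⟩ := exists_aff_of_smul h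
  unfold aff ptZero at h'
  rw [mat_smul_pt_eq_iff (aff_det a b)] at h'
  obtain rfl : b = 0 := by simpa using h'
  exact ⟨a, rfl⟩

theorem exists_anti_of_smul {g : PGL(2, k)} (h : g • ptInf k = ptZero k)
    (h' : g • ptZero k = ptInf k) : ∃ b : kˣ, g = mat 0 (b : k) 1 0 := by
  obtain ⟨a, b, c, d, hd, rfl⟩ := exists_mat g
  unfold ptZero ptInf at h h'
  rw [mat_smul_pt_eq_iff hd] at h h'
  obtain rfl : a = 0 := by simpa using h
  obtain rfl : d = 0 := by simpa using h'.symm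
  have hb : b ≠ 0 := by rintro rfl; simp at hd
  have hc : c ≠ 0 := by rintro rfl; simp at hd
  refine ⟨Units.mk0 (b / c) (div_ne_zero hb hc), ?_⟩
  have := mat_smul_eq (a := 0) (b := b / c) (c := 1) (d := 0) hc
  rw [mul_div_cancel₀ _ hc, mul_zero, mul_one] at this
  exact this

theorem torus_smul_ptInf (a : kˣ) : torus a • ptInf k = ptInf k := by
  rw [torus_eq]; unfold ptInf; rw [mat_smul_pt_eq_iff (by simp)]; simp

theorem torus_smul_ptZero (a : kˣ) : torus a • ptZero k = ptZero k := by
  rw [torus_eq]; unfold ptZero; rw [mat_smul_pt_eq_iff (by simp)]; simp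

theorem ptInf_ne_ptZero : ptInf k ≠ ptZero k := by
  intro h
  have := pt_eq_pt.mp h
  simp at this

theorem torus_smul_eq_iff {a : kˣ} (ha : a ≠ 1) {p : Line k} :
    torus a • p = p ↔ p = ptInf k ∨ p = ptZero k := by
  constructor
  · obtain ⟨x, y, h, rfl⟩ := exists_pt p
    rw [torus_eq, mat_smul_pt_eq_iff (by simp)]
    unfold ptInf ptZero
    rw [pt_eq_pt, pt_eq_pt]
    intro h
    have h1 : ((a : k) - 1) * (x * y) = 0 := by linear_combination h
    have ha' : (a : k) - 1 ≠ 0 := fun h0 => ha (Units.ext (by simpa using sub_eq_zero.mp h0))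
    have := (mul_eq_zero.mp h1).resolve_left ha'
    rcases mul_eq_zero.mp this with h | h <;> simp [h]
  · rintro (rfl | rfl)
    · exact torus_smul_ptInf a
    · exact torus_smul_ptZero a

end

/-! ### Fixed points of elements of finite order. -/

section
variable {k : Type*} [Field k] [IsAlgClosed k]

theorem exists_fixed_point (g : PGL(2, k)) : ∃ p : Line k, g • p = p := by
  obtain ⟨a, b, c, d, hd, rfl⟩ := exists_mat g
  by_cases hc : c = 0
  · refine ⟨ptInf k, ?_⟩
    unfold ptInf
    rw [mat_smul_pt_eq_iff hd]
    simp [hc]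
  · obtain ⟨z, hz⟩ := IsAlgClosed.exists_root
      (Polynomial.C c * Polynomial.X ^ 2 + Polynomial.C (d - a) * Polynomial.X +
        Polynomial.C (-b)) (by rw [Polynomial.degree_quadratic hc]; norm_num)
    refine ⟨pt z 1 (vec_ne (Or.inr one_ne_zero)), ?_⟩
    rw [mat_smul_pt_eq_iff hd]
    simp [Polynomial.IsRoot] at hz
    linear_combination -hz

end

section
variable {k : Type*} [Field k]

/-- A nontrivial element of finite order is diagonalisable. -/
theorem exists_conj_torus [CharZero k] {g : PGL(2, k)} (hg : IsOfFinOrder g) (h1 : g ≠ 1)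
    {p : Line k} (hp : g • p = p) :
    ∃ (P : PGL(2, k)) (a : kˣ), a ≠ 1 ∧ P • p = ptInf k ∧ P * g * P⁻¹ = torus a := by
  have hex : ∃ q : Line k, q ≠ p := by
    by_cases h : ptInf k = p
    · exact ⟨ptZero k, by rw [← h]; exact ptInf_ne_ptZero.symm⟩
    · exact ⟨_, h⟩
  obtain ⟨q, hq⟩ := hex
  obtain ⟨Q, hQ, -⟩ := exists_smul_ptInf_ptZero hq.symm
  obtain ⟨a, b, hab⟩ := exists_aff_of_smul (g := Q⁻¹ * g * Q) (by
    rw [mul_smul, mul_smul, hQ, hp, ← hQ, inv_smul_smul])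
  have hf : IsOfFinOrder (Q⁻¹ * g * Q) := by
    have := (MulAut.conj Q⁻¹).toMonoidHom.isOfFinOrder hg
    simpa using this
  -- If `a = 1`, the element is a translation, and in characteristic zero a translation of finite
  -- order is trivial.
  have ha : a ≠ 1 := by
    rintro rfl
    rw [hab] at hf
    obtain ⟨n, hn, hn1⟩ := hf.exists_pow_eq_one
    have := aff_one_eq_one_of_pow hn.ne' hn1
    rw [this, aff_one] at hab
    apply h1
    have : g = Q * (Q⁻¹ * g * Q) * Q⁻¹ := by group
    rw [this, hab]; group
  have ha' : 1 - (a : k) ≠ 0 := fun h0 => ha (Units.ext (by simpa using (sub_eq_zero.mp h0).symm))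
  -- `b / (1 - a)` is the finite fixed point of `x ↦ a x + b`; the translation moves it to zero.
  refine ⟨aff 1 (-(b / (1 - a))) * Q⁻¹, a, ha, ?_, ?_⟩
  · rw [mul_smul, ← hQ, inv_smul_smul]
    unfold aff ptInf
    rw [mat_smul_pt_eq_iff (by simp)]
    simp
  · have : aff 1 (-(b / (1 - a))) * Q⁻¹ * g * (aff 1 (-(b / (1 - a))) * Q⁻¹)⁻¹ =
        aff 1 (-(b / (1 - a))) * (Q⁻¹ * g * Q) * (aff 1 (-(b / (1 - a))))⁻¹ := by group
    rw [this, hab, mul_inv_eq_iff_eq_mul]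
    change _ = aff a 0 * _
    rw [aff_mul, aff_mul, aff_inj]
    refine ⟨by simp, ?_⟩
    push_cast
    field_simp
    ring

theorem exists_two_fixed_points [CharZero k] {g : PGL(2, k)} (hg : IsOfFinOrder g) (h1 : g ≠ 1)
    {p : Line k} (hp : g • p = p) :
    ∃ q, q ≠ p ∧ ∀ x, g • x = x ↔ x = p ∨ x = q := by
  obtain ⟨P, a, ha, hP, hg'⟩ := exists_conj_torus hg h1 hp
  refine ⟨P⁻¹ • ptZero k, ?_, fun x => ?_⟩
  · intro h
    rw [inv_smul_eq_iff, hP] at h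
    exact ptInf_ne_ptZero h.symm
  · have h2 : g • x = x ↔ torus a • (P • x) = P • x := by
      rw [← hg', mul_smul, inv_smul_smul, mul_smul, smul_left_cancel_iff]
    rw [h2, torus_smul_eq_iff ha, ← hP, smul_left_cancel_iff, eq_inv_smul_iff]

/-- In a finite group, two nontrivial elements which share a fixed point share both of them. -/
theorem smul_eq_of_share [CharZero k] {H : Subgroup PGL(2, k)} [Finite H] {g h : PGL(2, k)}
    (hg : g ∈ H) (hh : h ∈ H) (h1 : g ≠ 1) {p q : Line k} (hgp : g • p = p) (hgq : g • q = q)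
    (hhp : h • p = p) : h • q = q := by
  by_cases hpq : p = q
  · rw [← hpq, hhp]
  have hfin : ∀ x ∈ H, IsOfFinOrder x := fun x hx => by
    have := isOfFinOrder_of_finite (⟨x, hx⟩ : H)
    exact H.subtype.isOfFinOrder this
  obtain ⟨Q, hp, hq⟩ := exists_smul_ptInf_ptZero hpq
  obtain ⟨a, ha⟩ := exists_torus_of_smul (g := Q⁻¹ * g * Q)
    (by rw [mul_smul, mul_smul, hp, hgp, ← hp, inv_smul_smul])
    (by rw [mul_smul, mul_smul, hq, hgq, ← hq, inv_smul_smul])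
  obtain ⟨c, b, hb⟩ := exists_aff_of_smul (g := Q⁻¹ * h * Q)
    (by rw [mul_smul, mul_smul, hp, hhp, ← hp, inv_smul_smul])
  have ha1 : a ≠ 1 := by
    rintro rfl
    rw [map_one] at ha
    apply h1
    have : g = Q * (Q⁻¹ * g * Q) * Q⁻¹ := by group
    rw [this, ha]; group
  have hcomm : IsOfFinOrder (Q⁻¹ * (g * h * g⁻¹ * h⁻¹) * Q) := by
    have := (MulAut.conj Q⁻¹).toMonoidHom.isOfFinOrder
      (hfin _ (H.mul_mem (H.mul_mem (H.mul_mem hg hh) (H.inv_mem hg)) (H.inv_mem hh)))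
    simpa using this
  -- With `g` diagonal and `h` affine, the commutator is the translation by `(a - 1) b`. It has
  -- finite order, so it is trivial and `b = 0`; thus `h` is diagonal too.
  have e : Q⁻¹ * (g * h * g⁻¹ * h⁻¹) * Q = aff 1 (a * b - b) := by
    have : Q⁻¹ * (g * h * g⁻¹ * h⁻¹) * Q =
      (Q⁻¹ * g * Q) * (Q⁻¹ * h * Q) * ((Q⁻¹ * h * Q) * (Q⁻¹ * g * Q))⁻¹ := by group
    rw [this, ha, hb, mul_inv_eq_iff_eq_mul]
    change aff a 0 * _ = _ * (_ * aff a 0)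
    simp only [aff_mul, aff_inj]
    refine ⟨by rw [one_mul, mul_comm], by simp⟩
  rw [e] at hcomm
  obtain ⟨n, hn, hn1⟩ := hcomm.exists_pow_eq_one
  have h0 := aff_one_eq_one_of_pow hn.ne' hn1
  have ha' : (a : k) - 1 ≠ 0 := fun h0 => ha1 (Units.ext (by simpa using sub_eq_zero.mp h0))
  have hb0 : b = 0 := by
    have : ((a : k) - 1) * b = 0 := by linear_combination h0
    exact (mul_eq_zero.mp this).resolve_left ha'
  have h3 : (Q⁻¹ * h * Q) • ptZero k = ptZero k := by
    rw [hb, hb0]; exact torus_smul_ptZero c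
  rw [mul_smul, mul_smul, hq, inv_smul_eq_iff, hq] at h3
  exact h3

end

end QuadricAut
namespace QuadricAut

/-! ### Traces of elements of finite order -/

/-- The sequence with `Mⁿ⁺¹ = uₙ₊₁ M - δ uₙ` for a `2 × 2` matrix of trace `t` and
determinant `δ`. -/
def powCoeff {k : Type*} [Field k] (t δ : k) : ℕ → k
  | 0 => 0
  | 1 => 1
  | n + 2 => t * powCoeff t δ (n + 1) - δ * powCoeff t δ n

section
variable {k : Type*} [Field k]

/-- Cayley–Hamilton. The first identity, multiplied by the determinant δ, computes the determinant
of `u (n + 1) M - δ u n`, and so shows that this matrix is invertible. -/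
theorem mat_pow {a b c d : k} (h : a * d - b * c ≠ 0) (n : ℕ) :
    let u := powCoeff (a + d) (a * d - b * c)
    u (n + 1) ^ 2 - (a + d) * u (n + 1) * u n + (a * d - b * c) * u n ^ 2 = (a * d - b * c) ^ n ∧
      mat a b c d ^ (n + 1) = mat (u (n + 1) * a - (a * d - b * c) * u n) (u (n + 1) * b)
        (u (n + 1) * c) (u (n + 1) * d - (a * d - b * c) * u n) := by
  intro u
  have hu : ∀ n, u (n + 2) = (a + d) * u (n + 1) - (a * d - b * c) * u n := fun _ => rfl
  have hu0 : u 0 = 0 := rfl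
  have hu1 : u 1 = 1 := rfl
  induction n with
  | zero => simp [hu0, hu1]
  | succ n ih =>
    obtain ⟨h1, h2⟩ := ih
    refine ⟨?_, ?_⟩
    · rw [pow_succ (a * d - b * c) n, ← h1, hu]; ring
    · rw [pow_succ, h2, mat_mul _ h, hu]
      · congr 1 <;> ring
      · have : (u (n + 1) * a - (a * d - b * c) * u n) * (u (n + 1) * d - (a * d - b * c) * u n) -
            u (n + 1) * b * (u (n + 1) * c) = (a * d - b * c) ^ (n + 1) := by
          rw [pow_succ, ← h1]; ring
        rw [this]
        exact pow_ne_zero _ h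

/-- Since `M ^ (n + 1) = u (n + 1) M - δ u n`, the power is scalar exactly when its coefficient at
`M` vanishes or `M` is scalar. Orders of elements thereby become polynomial conditions on trace and
determinant. -/
theorem mat_pow_eq_one_iff {a b c d : k} (h : a * d - b * c ≠ 0) (n : ℕ) :
    mat a b c d ^ (n + 1) = 1 ↔
      powCoeff (a + d) (a * d - b * c) (n + 1) = 0 ∨ mat a b c d = 1 := by
  obtain ⟨h1, h2⟩ := mat_pow h n
  set u := powCoeff (a + d) (a * d - b * c)
  constructor
  · intro h3
    rw [h2, mat_eq_one_iff] at h3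
    · by_cases h0 : u (n + 1) = 0
      · exact Or.inl h0
      · right
        rw [mat_eq_one_iff h]
        refine ⟨by simpa [h0] using h3.1, by simpa [h0] using h3.2.1, mul_left_cancel₀ h0 ?_⟩
        linear_combination h3.2.2
    · have : (u (n + 1) * a - (a * d - b * c) * u n) * (u (n + 1) * d - (a * d - b * c) * u n) -
          u (n + 1) * b * (u (n + 1) * c) = (a * d - b * c) ^ (n + 1) := by
        rw [pow_succ, ← h1]; ring
      rw [this]
      exact pow_ne_zero _ h
  · rintro (h0 | h0)
    · rw [h2, mat_eq_one_iff]
      · simp [h0]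
      · have : u n ≠ 0 := by
          intro h3
          rw [h0, h3] at h1
          exact pow_ne_zero n h (by rw [← h1]; ring)
        simp only [h0, zero_mul, zero_sub, mul_zero, sub_zero, neg_mul_neg]
        exact mul_ne_zero (mul_ne_zero h this) (mul_ne_zero h this)
    · rw [h0, one_pow]

theorem powCoeff_two (t δ : k) : powCoeff t δ 2 = t := by simp [powCoeff]
theorem powCoeff_three (t δ : k) : powCoeff t δ 3 = t ^ 2 - δ := by simp [powCoeff]; ring
theorem powCoeff_four (t δ : k) : powCoeff t δ 4 = t * (t ^ 2 - 2 * δ) := by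
  simp [powCoeff]; ring
theorem powCoeff_five (t δ : k) : powCoeff t δ 5 = t ^ 4 - 3 * t ^ 2 * δ + δ ^ 2 := by
  simp [powCoeff]; ring

/-- Every involution is represented by a matrix of trace zero. -/
theorem exists_mat_of_orderOf_two {x : PGL(2, k)} (hx : orderOf x = 2) :
    ∃ a b c : k, a ^ 2 + b * c ≠ 0 ∧ x = mat a b c (-a) := by
  obtain ⟨a, b, c, d, h, rfl⟩ := exists_mat x
  have h2 : mat a b c d ^ (1 + 1) = 1 := orderOf_dvd_iff_pow_eq_one.mp hx.dvd
  have h1 : mat a b c d ≠ 1 := fun h => by rw [h, orderOf_one] at hx; omega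
  have h3 := ((mat_pow_eq_one_iff h 1).mp h2).resolve_right h1
  rw [powCoeff_two] at h3
  obtain rfl : d = -a := by linear_combination h3
  exact ⟨a, b, c, fun h0 => h (by linear_combination -h0), rfl⟩

theorem orderOf_mat_eq_three {a b c d : k} (h : a * d - b * c ≠ 0) (h1 : mat a b c d ≠ 1) :
    orderOf (mat a b c d) = 3 ↔ (a + d) ^ 2 = a * d - b * c := by
  rw [orderOf_eq_prime_iff, mat_pow_eq_one_iff h 2, powCoeff_three, sub_eq_zero]
  tauto

theorem orderOf_mat_eq_two {a b c d : k} (h : a * d - b * c ≠ 0) (h1 : mat a b c d ≠ 1) :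
    orderOf (mat a b c d) = 2 ↔ a + d = 0 := by
  rw [orderOf_eq_prime_iff, mat_pow_eq_one_iff h 1, powCoeff_two]
  tauto

/-- The elements `y, x` of a group have orders `m` and `2`, and their product has order `3`. -/
structure IsTriangle {G : Type*} [Group G] (m : ℕ) (y x : G) : Prop where
  left : orderOf y = m
  right : orderOf x = 2
  mul : orderOf (y * x) = 3

theorem IsTriangle.map {G G' : Type*} [Group G] [Group G'] {m : ℕ} {y x : G}
    (h : IsTriangle m y x) (f : G →* G') (hf : Function.Injective f) :
    IsTriangle m (f y) (f x) :=
  ⟨by rw [orderOf_injective f hf, h.left], by rw [orderOf_injective f hf, h.right],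
    by rw [← map_mul, orderOf_injective f hf, h.mul]⟩

theorem conj_injective {G : Type*} [Group G] (P : G) :
    Function.Injective (MulAut.conj P).toMonoidHom := (MulAut.conj P).injective

theorem IsTriangle.conj {G : Type*} [Group G] {m : ℕ} {y x : G}
    (h : IsTriangle m y x) (P : G) : IsTriangle m (P * y * P⁻¹) (P * x * P⁻¹) :=
  h.map (MulAut.conj P).toMonoidHom (conj_injective P)

/-- Vanishing means `l² - l + 1 = 0`, hence `l³ = -1`, which is impossible for an element of order
3, 4 or 5 in characteristic zero. -/
theorem kappa_ne_zero {m : ℕ} (hm : m = 3 ∨ m = 4 ∨ m = 5) [CharZero k] {l : kˣ}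
    (hl : orderOf l = m) : 1 - (l : k) - (l : k)⁻¹ ≠ 0 := by
  intro h0
  have hl0 : (l : k) ≠ 0 := l.ne_zero
  have h1 : (l : k) ^ 2 = l - 1 := by field_simp at h0; linear_combination -h0
  have h3 : (l : k) ^ 3 = -1 := by linear_combination (l + 1 : k) * h1
  have hpow : (l : k) ^ m = 1 := by
    have := congrArg Units.val (pow_orderOf_eq_one l)
    rw [hl] at this
    simpa using this
  have h2 : (2 : k) ≠ 0 := two_ne_zero
  have hl1 : l ≠ 1 := fun h => by rw [h, orderOf_one] at hl; omega
  rcases hm with rfl | rfl | rfl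
  · apply h2; linear_combination h3 - hpow
  · have h4 : (l : k) = -1 := by linear_combination (l : k) * h3 - hpow
    rw [h4] at h1; apply h2
    have : (3 : k) = 0 := by linear_combination h1
    exact absurd this three_ne_zero
  · have h4 : (l : k) = 1 := by linear_combination (l : k) ^ 3 * h3 - h3 - (l : k) * hpow
    exact hl1 (Units.ext h4)

/-- The normal form of a triangle whose first element is diagonal. -/
theorem IsTriangle.normal_form [CharZero k] {m : ℕ} (hm : m = 3 ∨ m = 4 ∨ m = 5) {l : kˣ}
    {x : PGL(2, k)} (h : IsTriangle m (torus l) x) :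
    ∃ μ : kˣ, torus μ * x * (torus μ)⁻¹ = mat 1 (1 - (l : k) - (l : k)⁻¹) 1 (-1) := by
  obtain ⟨a, b, c, hd, rfl⟩ := exists_mat_of_orderOf_two h.right
  have hl : orderOf l = m := by rw [← orderOf_injective _ torus_injective, h.left]
  have hl0 : (l : k) ≠ 0 := l.ne_zero
  have h3 := h.mul
  have hd' : a * -a - b * c ≠ 0 := fun h0 => hd (by linear_combination -h0)
  have hd2 : (l * a + 0 * c) * (0 * b + 1 * -a) - (l * b + 0 * -a) * (0 * a + 1 * c) ≠ 0 := by
    have : (l * a + 0 * c) * (0 * b + 1 * -a) - (l * b + 0 * -a) * (0 * a + 1 * c) =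
      -((l : k) * (a ^ 2 + b * c)) := by ring
    rw [this]
    exact neg_ne_zero.mpr (mul_ne_zero hl0 hd)
  rw [torus_eq, mat_mul (by simp) hd', orderOf_mat_eq_three hd2] at h3
  swap
  · intro h1
    rw [h1, orderOf_one] at h3
    omega
  -- This is the condition trace² = det for the product to have order three, rewritten.
  have e1 : a ^ 2 * (1 - l - (l : k)⁻¹) = b * c := by
    field_simp
    linear_combination -h3
  have ha : a ≠ 0 := by
    rintro rfl
    exact hd (by linear_combination -e1)
  have hbc : b * c ≠ 0 := by
    rw [← e1]
    exact mul_ne_zero (pow_ne_zero _ ha) (kappa_ne_zero hm hl)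
  have hc : c ≠ 0 := right_ne_zero_of_mul hbc
  -- Conjugation by diag(μ, 1) multiplies the upper right entry by μ and divides the lower left one
  -- by μ. With μ = c / a the lower left entry becomes `a`, and dividing the matrix by `a` gives the
  -- normal form.
  refine ⟨Units.mk0 (c / a) (div_ne_zero hc ha), ?_⟩
  have hk : a * a⁻¹ = 1 := mul_inv_cancel₀ ha
  have hdet : (1 : k) * -1 - (1 - (l : k) - (l : k)⁻¹) * 1 ≠ 0 := by
    intro h0
    apply hd
    linear_combination -e1 - a ^ 2 * h0
  rw [mul_inv_eq_iff_eq_mul, torus_eq, mat_mul (by simp [hc, ha]) hd',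
    mat_mul hdet (by simp [hc, ha]), mat_eq_iff]
  · refine ⟨a⁻¹, inv_ne_zero ha, ?_, ?_, ?_, ?_⟩
    · simp; field_simp
    · simp; field_simp
      field_simp at e1
      linear_combination e1
    · simp; field_simp
    · simp; field_simp
  · have : ((Units.mk0 (c / a) (div_ne_zero hc ha) : k) * a + 0 * c) * (0 * b + 1 * -a) -
        ((Units.mk0 (c / a) (div_ne_zero hc ha) : k) * b + 0 * -a) * (0 * a + 1 * c) =
        -(c / a * (a ^ 2 + b * c)) := by simp; ring
    rw [this]
    exact neg_ne_zero.mpr (mul_ne_zero (div_ne_zero hc ha) hd)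
  · have : ((1 : k) * (Units.mk0 (c / a) (div_ne_zero hc ha) : k) +
        (1 - (l : k) - (l : k)⁻¹) * 0) * (1 * 0 + -1 * 1) -
        (1 * 0 + (1 - (l : k) - (l : k)⁻¹) * 1) * (1 * (Units.mk0 (c / a) (div_ne_zero hc ha) : k) + -1 * 0) =
        c / a * ((1 : k) * -1 - (1 - (l : k) - (l : k)⁻¹) * 1) := by simp; ring
    rw [this]
    exact mul_ne_zero (div_ne_zero hc ha) hdet

theorem conj_torus_inv (l : kˣ) : ∃ P : PGL(2, k), P * torus l * P⁻¹ = torus l⁻¹ := by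
  refine ⟨mat 0 1 1 0, ?_⟩
  have hl : (l : k) ≠ 0 := l.ne_zero
  rw [mul_inv_eq_iff_eq_mul, torus_eq, torus_eq, mat_mul (by simp) (by simp),
    mat_mul (by simp) (by simp), mat_eq_iff (by simp) (by simp)]
  exact ⟨(l : k)⁻¹, inv_ne_zero hl, by simp⟩

theorem IsTriangle.exists_conj [CharZero k] {m : ℕ} (hm : m = 3 ∨ m = 4 ∨ m = 5) {l : kˣ}
    {y x P : PGL(2, k)} (h : IsTriangle m y x) (hP : P * y * P⁻¹ = torus l) :
    ∃ Q : PGL(2, k), Q * y * Q⁻¹ = torus l ∧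
      Q * x * Q⁻¹ = mat 1 (1 - (l : k) - (l : k)⁻¹) 1 (-1) := by
  have h' := h.conj P
  rw [hP] at h'
  obtain ⟨μ, hμ⟩ := h'.normal_form hm
  refine ⟨torus μ * P, ?_, ?_⟩
  · have : torus μ * P * y * (torus μ * P)⁻¹ = torus μ * (P * y * P⁻¹) * (torus μ)⁻¹ := by group
    rw [this, hP, ← map_inv, ← map_mul, ← map_mul, mul_comm μ, mul_inv_cancel_right]
  · rw [← hμ]; group

variable [IsAlgClosed k] [CharZero k]

theorem exists_conj_torus_of_orderOf {y : PGL(2, k)} {m : ℕ} (hm : 2 ≤ m) (hy : orderOf y = m) :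
    ∃ (P : PGL(2, k)) (l : kˣ), orderOf l = m ∧ P * y * P⁻¹ = torus l := by
  obtain ⟨p, hp⟩ := exists_fixed_point y
  obtain ⟨P, l, -, -, e⟩ := exists_conj_torus (orderOf_pos_iff.mp (by omega))
    (fun h => by rw [h, orderOf_one] at hy; omega) hp
  refine ⟨P, l, ?_, e⟩
  rw [← orderOf_injective _ torus_injective, ← e, ← hy]
  exact orderOf_injective (MulAut.conj P).toMonoidHom (conj_injective P) y

theorem exists_conj_torus_pow {ω : kˣ} {m : ℕ} (hm : 2 ≤ m) (hω : IsPrimitiveRoot ω m)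
    {y : PGL(2, k)} (hy : orderOf y = m) :
    ∃ (P : PGL(2, k)) (j : ℕ), j < m ∧ j.Coprime m ∧ P * y * P⁻¹ = torus (ω ^ j) := by
  obtain ⟨P, l, hl, e⟩ := exists_conj_torus_of_orderOf hm hy
  have : NeZero m := ⟨by omega⟩
  have hω' : IsPrimitiveRoot (ω : k) m := IsPrimitiveRoot.coe_units_iff.mpr hω
  obtain ⟨j, hj, hc, h⟩ := hω'.isPrimitiveRoot_iff.mp
    (IsPrimitiveRoot.coe_units_iff.mpr (hl ▸ IsPrimitiveRoot.orderOf l))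
  refine ⟨P, j, hj, hc, ?_⟩
  rw [e]
  congr 1
  exact Units.ext (by rw [← h, Units.val_pow_eq_pow_val])

/-- Two triangles of type `(3, 2, 3)` or `(4, 2, 3)` are conjugate. -/
theorem IsTriangle.conj_of_le_four {m : ℕ} (hm : m = 3 ∨ m = 4) {y x y' x' : PGL(2, k)}
    (h : IsTriangle m y x) (h' : IsTriangle m y' x') :
    ∃ P : PGL(2, k), P * y * P⁻¹ = y' ∧ P * x * P⁻¹ = x' := by
  obtain ⟨Q, l, hl, hQ⟩ := exists_conj_torus_of_orderOf (by omega) h.left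
  obtain ⟨R, hR⟩ : ∃ R, R * y' * R⁻¹ = torus l := by
    have hprim : IsPrimitiveRoot l m := hl ▸ IsPrimitiveRoot.orderOf l
    obtain ⟨R, j, hj, hc, e⟩ := exists_conj_torus_pow (by omega) hprim h'.left
    -- The units modulo 3 and 4 are ±1, and `x ↦ 1 / x` conjugates diag(l, 1) to its inverse. Hence
    -- the eigenvalue can be made the same for both triangles. Modulo 5 there are further units.
    have hcase : j = 1 ∨ j = m - 1 := by
      rcases hm with rfl | rfl <;> interval_cases j <;> first | omega | (revert hc; decide)
    rcases hcase with rfl | rfl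
    · exact ⟨R, by rw [e, pow_one]⟩
    · obtain ⟨S, hS⟩ := conj_torus_inv (l ^ (m - 1))
      refine ⟨S * R, ?_⟩
      have e2 : S * R * y' * (S * R)⁻¹ = S * (R * y' * R⁻¹) * S⁻¹ := by group
      rw [e2, e, hS]
      congr 1
      rw [inv_eq_iff_mul_eq_one, ← pow_succ, Nat.sub_add_cancel (by omega), hprim.pow_eq_one]
  obtain ⟨Q', a1, a2⟩ := h.exists_conj (by omega) hQ
  obtain ⟨R', b1, b2⟩ := h'.exists_conj (by omega) hR
  refine ⟨R'⁻¹ * Q', ?_, ?_⟩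
  · have : R'⁻¹ * Q' * y * (R'⁻¹ * Q')⁻¹ = R'⁻¹ * (Q' * y * Q'⁻¹) * R' := by group
    rw [this, a1, ← b1]; group
  · have : R'⁻¹ * Q' * x * (R'⁻¹ * Q')⁻¹ = R'⁻¹ * (Q' * x * Q'⁻¹) * R' := by group
    rw [this, a2, ← b2]; group

end
end QuadricAut
namespace QuadricAut

/-! ### Subgroups of a wreath product `Γ ≀ C₂` -/

/-- The nontrivial element of `C₂`. -/
def flip : Cyc 2 := Multiplicative.ofAdd 1

theorem flip_mul_flip : flip * flip = 1 := by decide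

theorem eq_one_or_flip (q : Cyc 2) : q = 1 ∨ q = flip := by revert q; decide

theorem flip_ne_one : flip ≠ 1 := by decide

section
variable {Γ : Type*} [Group Γ]

/-- The element `(a, b)` of the base group of `Γ ≀ C₂`. -/
def wst (a b : Γ) : WrC2 Γ := ⟨fun q => if q = 1 then a else b, 1⟩

/-- The element `(a, b)σ` of `Γ ≀ C₂`. -/
def wts (a b : Γ) : WrC2 Γ := ⟨fun q => if q = 1 then a else b, flip⟩

theorem wr_cases (w : WrC2 Γ) : (∃ a b, w = wst a b) ∨ ∃ a b, w = wts a b := by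
  have h : w.left = fun q => if q = 1 then w.left 1 else w.left flip := by
    funext q
    rcases eq_one_or_flip q with rfl | rfl <;> simp [flip_ne_one]
  rcases eq_one_or_flip w.right with h1 | h1
  · exact Or.inl ⟨w.left 1, w.left flip, RegularWreathProduct.ext h h1⟩
  · exact Or.inr ⟨w.left 1, w.left flip, RegularWreathProduct.ext h h1⟩

section
variable (a b c d : Γ)

theorem wst_mul_wst : wst a b * wst c d = wst (a * c) (b * d) := by
  refine RegularWreathProduct.ext (funext fun q => ?_) rfl
  rcases eq_one_or_flip q with rfl | rfl <;> simp [wst, flip_ne_one]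

theorem wst_mul_wts : wst a b * wts c d = wts (a * c) (b * d) := by
  refine RegularWreathProduct.ext (funext fun q => ?_) rfl
  rcases eq_one_or_flip q with rfl | rfl <;> simp [wst, wts, flip_ne_one]

theorem wts_mul_wst : wts a b * wst c d = wts (a * d) (b * c) := by
  have h : flip⁻¹ = flip := by decide
  refine RegularWreathProduct.ext (funext fun q => ?_) rfl
  rcases eq_one_or_flip q with rfl | rfl <;> simp [wst, wts, flip_ne_one, h, flip_mul_flip]

theorem wts_mul_wts : wts a b * wts c d = wst (a * d) (b * c) := by
  have h : flip⁻¹ = flip := by decide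
  refine RegularWreathProduct.ext (funext fun q => ?_) flip_mul_flip
  rcases eq_one_or_flip q with rfl | rfl <;> simp [wst, wts, flip_ne_one, h, flip_mul_flip]

theorem wst_one : wst (1 : Γ) 1 = 1 := by
  refine RegularWreathProduct.ext (funext fun q => ?_) rfl
  simp [wst]

theorem wst_inv : (wst a b)⁻¹ = wst a⁻¹ b⁻¹ := by
  rw [inv_eq_iff_mul_eq_one, wst_mul_wst, mul_inv_cancel, mul_inv_cancel, wst_one]

theorem wts_inv : (wts a b)⁻¹ = wts b⁻¹ a⁻¹ := by
  rw [inv_eq_iff_mul_eq_one, wts_mul_wts, mul_inv_cancel, mul_inv_cancel, wst_one]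

end

theorem wst_inj {a b c d : Γ} : wst a b = wst c d ↔ a = c ∧ b = d := by
  refine ⟨fun h => ?_, fun h => by rw [h.1, h.2]⟩
  have h' := congrArg RegularWreathProduct.left h
  have h1 := congrFun h' 1
  have h2 := congrFun h' flip
  simpa [wst, flip_ne_one] using And.intro h1 h2

theorem wts_inj {a b c d : Γ} : wts a b = wts c d ↔ a = c ∧ b = d := by
  refine ⟨fun h => ?_, fun h => by rw [h.1, h.2]⟩
  have h' := congrArg RegularWreathProduct.left h
  have h1 := congrFun h' 1
  have h2 := congrFun h' flip
  simpa [wts, flip_ne_one] using And.intro h1 h2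

theorem wst_ne_wts (a b c d : Γ) : wst a b ≠ wts c d := fun h =>
  flip_ne_one (congrArg RegularWreathProduct.right h).symm

/-- The base group of `Γ ≀ C₂`. -/
def wstHom : Γ × Γ →* WrC2 Γ where
  toFun g := wst g.1 g.2
  map_one' := wst_one
  map_mul' _ _ := (wst_mul_wst ..).symm

theorem wstHom_injective : Function.Injective (wstHom (Γ := Γ)) := fun _ _ h =>
  Prod.ext (wst_inj.mp h).1 (wst_inj.mp h).2

/-- The homomorphism `Γ ≀ C₂ → Aut(ℙ¹ × ℙ¹)` given by a homomorphism `Γ → PGL₂(k)`. -/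
noncomputable def wrHom {k : Type*} [Field k] (ρ : Γ →* PGL(2, k)) : WrC2 Γ →* autQuadric k where
  toFun w := if w.right = 1 then str (ρ (w.left 1)) (ρ (w.left flip))
    else tw (ρ (w.left 1)) (ρ (w.left flip))
  map_one' := by simp [str_one]
  map_mul' v w := by
    rcases wr_cases v with ⟨a, b, rfl⟩ | ⟨a, b, rfl⟩ <;>
    rcases wr_cases w with ⟨c, d, rfl⟩ | ⟨c, d, rfl⟩ <;>
    simp only [wst_mul_wst, wst_mul_wts, wts_mul_wst, wts_mul_wts] <;>
    simp [wst, wts, flip_ne_one, str_mul_str, str_mul_tw, tw_mul_str, tw_mul_tw]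

section
variable {k : Type*} [Field k] (ρ : Γ →* PGL(2, k))

theorem wrHom_wst (a b : Γ) : wrHom ρ (wst a b) = str (ρ a) (ρ b) := by
  simp [wrHom, wst, flip_ne_one]

theorem wrHom_wts (a b : Γ) : wrHom ρ (wts a b) = tw (ρ a) (ρ b) := by
  simp [wrHom, wts, flip_ne_one]

theorem wrHom_injective (hρ : Function.Injective ρ) : Function.Injective (wrHom ρ) := by
  rw [injective_iff_map_eq_one]
  intro w h
  rcases wr_cases w with ⟨a, b, rfl⟩ | ⟨a, b, rfl⟩
  · rw [wrHom_wst, ← str_one, str_inj] at h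
    rw [hρ (h.1.trans (map_one ρ).symm), hρ (h.2.trans (map_one ρ).symm), wst_one]
  · rw [wrHom_wts, ← str_one] at h
    exact absurd h.symm (str_ne_tw _ _ _ _)

end

/-! ### Groups generated by a subgroup of the base group and one more element -/

/-- The subgroup of `Γ ≀ C₂` generated by `K ≤ Γ × Γ` and `(m, n)σ`. -/
def twistGroup (K : Subgroup (Γ × Γ)) (m n : Γ) : Subgroup (WrC2 Γ) :=
  K.map wstHom ⊔ Subgroup.zpowers (wts m n)

/-- The conditions under which `K` has index two in `twistGroup K m n`. -/
structure IsTwist (K : Subgroup (Γ × Γ)) (m n : Γ) : Prop where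
  sq : (m * n, n * m) ∈ K
  conj : ∀ a b, (a, b) ∈ K → (m * b * m⁻¹, n * a * n⁻¹) ∈ K

theorem wst_mem_twistGroup {K : Subgroup (Γ × Γ)} {m n a b : Γ} (h : (a, b) ∈ K) :
    wst a b ∈ twistGroup K m n :=
  Subgroup.mem_sup_left ⟨(a, b), h, rfl⟩

theorem wts_mem_twistGroup (K : Subgroup (Γ × Γ)) (m n : Γ) : wts m n ∈ twistGroup K m n :=
  Subgroup.mem_sup_right (Subgroup.mem_zpowers _)

theorem twistGroup_le {K : Subgroup (Γ × Γ)} {m n : Γ} {L : Subgroup (WrC2 Γ)}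
    (h : ∀ a b, (a, b) ∈ K → wst a b ∈ L) (ht : wts m n ∈ L) : twistGroup K m n ≤ L := by
  refine sup_le ?_ ?_
  · rintro _ ⟨⟨a, b⟩, hab, rfl⟩
    exact h a b hab
  · rwa [Subgroup.zpowers_le]

theorem IsTwist.conj_inv {K : Subgroup (Γ × Γ)} {m n : Γ} (h : IsTwist K m n) {a b : Γ}
    (hab : (a, b) ∈ K) : (n⁻¹ * b * n, m⁻¹ * a * m) ∈ K := by
  have h1 := h.conj _ _ hab
  have h2 := h.sq
  have h3 := K.mul_mem (K.mul_mem (K.inv_mem h2) h1) h2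
  simp only [Prod.inv_mk, Prod.mk_mul_mk] at h3
  convert h3 using 2 <;> group

/-- The two conditions of `IsTwist` say that (m, n)σ normalises `K` and that its square lies in `K`,
so `K` together with the coset K(m, n)σ is already a group. -/
theorem IsTwist.mem_iff {K : Subgroup (Γ × Γ)} {m n : Γ} (h : IsTwist K m n) (w : WrC2 Γ) :
    w ∈ twistGroup K m n ↔ ∃ a b, (a, b) ∈ K ∧ (w = wst a b ∨ w = wts (a * m) (b * n)) := by
  constructor
  · intro hw
    let M : Subgroup (WrC2 Γ) :=
      { carrier := {w | ∃ a b, (a, b) ∈ K ∧ (w = wst a b ∨ w = wts (a * m) (b * n))}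
        one_mem' := ⟨1, 1, K.one_mem, Or.inl wst_one.symm⟩
        mul_mem' := by
          rintro _ _ ⟨a, b, hab, rfl | rfl⟩ ⟨c, d, hcd, rfl | rfl⟩
          · exact ⟨_, _, K.mul_mem hab hcd, Or.inl (wst_mul_wst ..)⟩
          · refine ⟨_, _, K.mul_mem hab hcd, Or.inr ?_⟩
            rw [wst_mul_wts, mul_assoc, mul_assoc]
          · refine ⟨_, _, K.mul_mem hab (h.conj _ _ hcd), Or.inr ?_⟩
            rw [wts_mul_wst]
            congr 1 <;> group
          · refine ⟨_, _, K.mul_mem (K.mul_mem hab (h.conj _ _ hcd)) h.sq, Or.inl ?_⟩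
            rw [wts_mul_wts]
            simp only [Prod.mk_mul_mk]
            congr 1 <;> group
        inv_mem' := by
          rintro _ ⟨a, b, hab, rfl | rfl⟩
          · exact ⟨_, _, K.inv_mem hab, Or.inl (wst_inv ..)⟩
          · refine ⟨_, _, K.mul_mem (h.conj_inv (K.inv_mem hab)) (K.inv_mem h.sq), Or.inr ?_⟩
            rw [wts_inv]
            simp only [Prod.inv_mk]
            congr 1 <;> group }
    have hle : twistGroup K m n ≤ M :=
      twistGroup_le (fun a b hab => ⟨a, b, hab, Or.inl rfl⟩)
        ⟨1, 1, K.one_mem, Or.inr (by rw [one_mul, one_mul])⟩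
    exact hle hw
  · rintro ⟨a, b, hab, rfl | rfl⟩
    · exact wst_mem_twistGroup hab
    · rw [← wst_mul_wts]
      exact Subgroup.mul_mem _ (wst_mem_twistGroup hab) (wts_mem_twistGroup K m n)

theorem IsTwist.wst_mem_iff {K : Subgroup (Γ × Γ)} {m n : Γ} (h : IsTwist K m n) {a b : Γ} :
    wst a b ∈ twistGroup K m n ↔ (a, b) ∈ K := by
  rw [h.mem_iff]
  constructor
  · rintro ⟨c, d, hcd, h | h⟩
    · rw [wst_inj] at h
      rwa [h.1, h.2]
    · exact absurd h (wst_ne_wts _ _ _ _)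
  · exact fun h => ⟨a, b, h, Or.inl rfl⟩

theorem IsTwist.wts_mem_iff {K : Subgroup (Γ × Γ)} {m n : Γ} (h : IsTwist K m n) {a b : Γ} :
    wts a b ∈ twistGroup K m n ↔ (a * m⁻¹, b * n⁻¹) ∈ K := by
  rw [h.mem_iff]
  constructor
  · rintro ⟨c, d, hcd, h | h⟩
    · exact absurd h.symm (wst_ne_wts _ _ _ _)
    · rw [wts_inj] at h
      rw [h.1, h.2]
      simpa using hcd
  · exact fun h => ⟨_, _, h, Or.inr (by simp)⟩

theorem IsTwist.card {K : Subgroup (Γ × Γ)} {m n : Γ} (h : IsTwist K m n) [Finite K] :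
    Nat.card (twistGroup K m n) = 2 * Nat.card K := by
  let f : K ⊕ K → twistGroup K m n := Sum.elim
    (fun x => ⟨wst x.1.1 x.1.2, wst_mem_twistGroup x.2⟩)
    (fun x => ⟨wts (x.1.1 * m) (x.1.2 * n), h.wts_mem_iff.mpr (by simp)⟩)
  have hf : Function.Bijective f := by
    constructor
    · rintro (x | x) (y | y) hxy
      · have := wst_inj.mp (congrArg Subtype.val hxy)
        rw [Subtype.ext (Prod.ext this.1 this.2)]
      · exact absurd (congrArg Subtype.val hxy) (wst_ne_wts _ _ _ _)
      · exact absurd (congrArg Subtype.val hxy).symm (wst_ne_wts _ _ _ _)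
      · have := wts_inj.mp (congrArg Subtype.val hxy)
        rw [mul_left_inj, mul_left_inj] at this
        rw [Subtype.ext (Prod.ext this.1 this.2)]
    · rintro ⟨w, hw⟩
      obtain ⟨a, b, hab, rfl | rfl⟩ := (h.mem_iff w).mp hw
      · exact ⟨Sum.inl ⟨(a, b), hab⟩, rfl⟩
      · exact ⟨Sum.inr ⟨(a, b), hab⟩, rfl⟩
  rw [← Nat.card_congr (Equiv.ofBijective f hf), Nat.card_sum, two_mul]

/-- Conversely, every subgroup of `Γ ≀ C₂` which contains `(m, n)σ` is of this form. -/
theorem isTwist_comap {L : Subgroup (WrC2 Γ)} {m n : Γ} (h : wts m n ∈ L) :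
    IsTwist (L.comap wstHom) m n where
  sq := by
    have := L.mul_mem h h
    rw [wts_mul_wts] at this
    exact this
  conj a b hab := by
    have h1 : wst a b ∈ L := hab
    have := L.mul_mem (L.mul_mem h h1) (L.inv_mem h)
    rw [wts_mul_wst, wts_inv, wts_mul_wts] at this
    exact this

theorem eq_twistGroup {L : Subgroup (WrC2 Γ)} {m n : Γ} (h : wts m n ∈ L) :
    L = twistGroup (L.comap wstHom) m n := by
  refine le_antisymm (fun w hw => ?_) (twistGroup_le (fun a b hab => hab) h)
  rcases wr_cases w with ⟨a, b, rfl⟩ | ⟨a, b, rfl⟩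
  · exact wst_mem_twistGroup hw
  · rw [(isTwist_comap h).wts_mem_iff]
    have := L.mul_mem hw (L.inv_mem h)
    rw [wts_inv, wts_mul_wts] at this
    exact this

/-- The element `(m, n)σ` matters only modulo `K`. -/
theorem twistGroup_congr {L : Subgroup (WrC2 Γ)} {K : Subgroup (Γ × Γ)} {m n : Γ}
    (hK : ∀ a b, wst a b ∈ L ↔ (a, b) ∈ K) (h : wts m n ∈ L) : L = twistGroup K m n := by
  rw [eq_twistGroup h]
  congr 1
  ext ⟨a, b⟩
  exact hK a b

theorem IsConjTo.trans {A : Type*} [Group A] {G L M : Subgroup A} (h : IsConjTo G L)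
    (h' : IsConjTo L M) : IsConjTo G M := by
  obtain ⟨α, rfl⟩ := h
  obtain ⟨β, rfl⟩ := h'
  refine ⟨α * β, ?_⟩
  rw [Subgroup.map_map]
  congr 1
  ext x
  simp [mul_assoc]

theorem map_conj_eq_iff {A : Type*} [Group A] {G L : Subgroup A} {α : A} :
    L.map (MulAut.conj α).toMonoidHom = G ↔ ∀ x, α * x * α⁻¹ ∈ G ↔ x ∈ L := by
  constructor
  · rintro rfl x
    constructor
    · rintro ⟨y, hy, h⟩
      have : y = x := (MulAut.conj α).injective h
      rwa [← this]
    · exact fun hx => ⟨x, hx, rfl⟩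
  · intro h
    ext x
    constructor
    · rintro ⟨y, hy, rfl⟩
      exact (h y).mpr hy
    · intro hx
      refine ⟨α⁻¹ * x * α, (h _).mp ?_, ?_⟩
      · convert hx using 1; group
      · change α * (α⁻¹ * x * α) * α⁻¹ = x
        group

theorem IsConjTo.symm {A : Type*} [Group A] {G L : Subgroup A} (h : IsConjTo G L) :
    IsConjTo L G := by
  obtain ⟨α, h⟩ := h
  rw [map_conj_eq_iff] at h
  refine ⟨α⁻¹, map_conj_eq_iff.mpr fun x => ?_⟩
  rw [← h]
  have : α * (α⁻¹ * x * α⁻¹⁻¹) * α⁻¹ = x := by group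
  rw [this]

theorem IsConjTo.map {A B : Type*} [Group A] [Group B] {G L : Subgroup A} (h : IsConjTo G L)
    (f : A →* B) : IsConjTo (G.map f) (L.map f) := by
  obtain ⟨α, rfl⟩ := h
  refine ⟨f α, ?_⟩
  rw [Subgroup.map_map, Subgroup.map_map]
  congr 1
  ext x
  simp

theorem IsConjTo.nonempty_mulEquiv {A : Type*} [Group A] {G L : Subgroup A} (h : IsConjTo G L) :
    Nonempty (L ≃* G) := by
  obtain ⟨α, rfl⟩ := h
  exact ⟨L.equivMapOfInjective _ (conj_injective α)⟩

/-- The pairs `(a, b)` of elements of `T` which are congruent modulo `N`. -/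
def congrPairs (T N : Subgroup Γ) (hN : ∀ a ∈ T, ∀ n ∈ N, a * n * a⁻¹ ∈ N) :
    Subgroup (Γ × Γ) where
  carrier := {p | p.1 ∈ T ∧ p.2 ∈ T ∧ p.1 * p.2⁻¹ ∈ N}
  one_mem' := ⟨T.one_mem, T.one_mem, by simp⟩
  mul_mem' := by
    rintro ⟨a, b⟩ ⟨c, d⟩ ⟨h1, h2, h3⟩ ⟨h4, h5, h6⟩
    refine ⟨T.mul_mem h1 h4, T.mul_mem h2 h5, ?_⟩
    have := N.mul_mem (hN a h1 _ h6) h3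
    convert this using 1
    simp only [Prod.fst_mul, Prod.snd_mul]
    group
  inv_mem' := by
    rintro ⟨a, b⟩ ⟨h1, h2, h3⟩
    refine ⟨T.inv_mem h1, T.inv_mem h2, ?_⟩
    have := hN _ (T.inv_mem h1) _ (N.inv_mem h3)
    convert this using 1
    simp only [Prod.fst_inv, Prod.snd_inv]
    group

theorem mem_congrPairs {T N : Subgroup Γ} {hN} {a b : Γ} :
    (a, b) ∈ congrPairs T N hN ↔ a ∈ T ∧ b ∈ T ∧ a * b⁻¹ ∈ N := Iff.rfl

theorem card_congrPairs {T N : Subgroup Γ} {hN} (hNT : N ≤ T) :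
    Nat.card (congrPairs T N hN) = Nat.card T * Nat.card N := by
  let f : congrPairs T N hN ≃ T × N :=
    { toFun := fun x => (⟨x.1.2, x.2.2.1⟩, ⟨x.1.1 * x.1.2⁻¹, x.2.2.2⟩)
      invFun := fun y => ⟨(y.2.1 * y.1.1, y.1.1),
        T.mul_mem (hNT y.2.2) y.1.2, y.1.2, by simp⟩
      left_inv := fun x => by simp
      right_inv := fun y => by simp }
  rw [Nat.card_congr f, Nat.card_prod]

/-- Goursat's lemma for a subgroup of `Γ ≀ C₂` which contains `(1, p)σ`: if the isomorphism
`T / N ≃ T / N` which it defines is induced by the conjugation with `q`, then the subgroup is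
conjugate to one whose intersection with the base group is `congrPairs T N`. -/
theorem exists_conj_congrPairs {L : Subgroup (WrC2 Γ)} {T N : Subgroup Γ} {p q : Γ}
    (hp : wts 1 p ∈ L) (hT : ∀ a, a ∈ T ↔ ∃ b, wst a b ∈ L) (hN : ∀ n, n ∈ N ↔ wst n 1 ∈ L)
    (hqT : ∀ a, q * a * q⁻¹ ∈ T ↔ a ∈ T) (hq : ∀ a b, wst a b ∈ L → q * a * q⁻¹ * b⁻¹ ∈ N) :
    ∃ (hTN : ∀ a ∈ T, ∀ n ∈ N, a * n * a⁻¹ ∈ N) (L' : Subgroup (WrC2 Γ)),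
      IsConjTo L L' ∧ (∀ a b, wst a b ∈ L' ↔ (a, b) ∈ congrPairs T N hTN) ∧
        wts q (p * q⁻¹) ∈ L' := by
  have hTN : ∀ a ∈ T, ∀ n ∈ N, a * n * a⁻¹ ∈ N := by
    intro a ha n hn
    obtain ⟨b, hb⟩ := (hT a).mp ha
    rw [hN] at hn ⊢
    have := L.mul_mem (L.mul_mem hb hn) (L.inv_mem hb)
    rw [wst_mul_wst, wst_inv, wst_mul_wst] at this
    simpa using this
  have hsnd : ∀ a b, wst a b ∈ L → b ∈ T := by
    intro a b hab
    refine (hT b).mpr ⟨p * a * p⁻¹, ?_⟩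
    have := L.mul_mem (L.mul_mem hp hab) (L.inv_mem hp)
    rw [wts_mul_wst, wts_inv, wts_mul_wts] at this
    simpa using this
  have hN' : ∀ n, n ∈ N → wst 1 n ∈ L := by
    intro n hn
    have := L.mul_mem (L.mul_mem (L.inv_mem hp) ((hN n).mp hn)) hp
    rw [wts_inv, wts_mul_wst, wts_mul_wts] at this
    simpa using this
  -- Conjugation by (q, 1) replaces (a, b) by (q a q⁻¹, b), whose entries are congruent modulo `N`
  -- by hypothesis, and (1, p)σ by (q, p q⁻¹)σ.
  refine ⟨hTN, L.map (MulAut.conj (wst q 1)).toMonoidHom, IsConjTo.symm ⟨_, rfl⟩, ?_, ?_⟩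
  · intro a b
    have e := (map_conj_eq_iff.mp (rfl : L.map (MulAut.conj (wst q 1)).toMonoidHom = _))
      (wst (q⁻¹ * a * q) b)
    rw [wst_inv, wst_mul_wst, wst_mul_wst] at e
    have e1 : q * (q⁻¹ * a * q) * q⁻¹ = a := by group
    rw [e1, one_mul, inv_one, mul_one] at e
    rw [e, mem_congrPairs]
    constructor
    · intro h
      refine ⟨?_, hsnd _ _ h, ?_⟩
      · rw [← e1, hqT, hT]
        exact ⟨b, h⟩
      · have := hq _ _ h
        rwa [e1] at this
    · rintro ⟨ha, hb, hab⟩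
      rw [← e1, hqT, hT] at ha
      obtain ⟨c, hc⟩ := ha
      have h1 := hq _ _ hc
      rw [e1] at h1
      -- Any `b` congruent to `a` differs from the known partner `c` by an element of `N`, which can
      -- be absorbed into the second factor.
      have h2 : c⁻¹ * b ∈ N := by
        have h3 := N.mul_mem (N.inv_mem hab) h1
        have h4 := hTN _ (T.inv_mem (hsnd _ _ hc)) _ h3
        convert h4 using 1; group
      have h3 := L.mul_mem hc (hN' _ h2)
      rw [wst_mul_wst] at h3
      simpa using h3
  · refine ⟨wts 1 p, hp, ?_⟩
    change wst q 1 * wts 1 p * (wst q 1)⁻¹ = _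
    rw [wst_inv, wst_mul_wts, wts_mul_wst]
    simp

/-- A criterion for the hypothesis on `q` in `exists_conj_congrPairs`. -/
theorem conj_mul_inv_mem {L : Subgroup (WrC2 Γ)} {T N : Subgroup Γ} {p q : Γ}
    (hp : wts 1 p ∈ L) (hT : ∀ a, a ∈ T ↔ ∃ b, wst a b ∈ L) (hN : ∀ n, n ∈ N ↔ wst n 1 ∈ L)
    (S : Set Γ) (hS : Subgroup.closure S = T)
    (hq : ∀ s ∈ S, ∃ b, wst s b ∈ L ∧ q * s * q⁻¹ * b⁻¹ ∈ N) :
    ∀ a b, wst a b ∈ L → q * a * q⁻¹ * b⁻¹ ∈ N := by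
  have hTN : ∀ a ∈ T, ∀ n ∈ N, a * n * a⁻¹ ∈ N := by
    intro a ha n hn
    obtain ⟨b, hb⟩ := (hT a).mp ha
    rw [hN] at hn ⊢
    have := L.mul_mem (L.mul_mem hb hn) (L.inv_mem hb)
    rw [wst_mul_wst, wst_inv, wst_mul_wst] at this
    simpa using this
  have hsnd : ∀ a b, wst a b ∈ L → b ∈ T := by
    intro a b hab
    refine (hT b).mpr ⟨p * a * p⁻¹, ?_⟩
    have := L.mul_mem (L.mul_mem hp hab) (L.inv_mem hp)
    rw [wts_mul_wst, wts_inv, wts_mul_wts] at this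
    simpa using this
  have hN' : ∀ n, wst 1 n ∈ L → n ∈ N := by
    intro n hn
    rw [hN]
    have := L.mul_mem (L.mul_mem hp hn) (L.inv_mem hp)
    rw [wts_mul_wst, wts_inv, wts_mul_wts] at this
    simpa using this
  have key : ∀ a ∈ T, ∃ b, wst a b ∈ L ∧ q * a * q⁻¹ * b⁻¹ ∈ N := by
    intro a ha
    rw [← hS] at ha
    induction ha using Subgroup.closure_induction with
    | mem x hx => exact hq x hx
    | one => exact ⟨1, by rw [wst_one]; exact L.one_mem, by simp⟩
    | mul x y _ _ hx hy =>
      obtain ⟨b, hb, hb'⟩ := hx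
      obtain ⟨c, hc, hc'⟩ := hy
      refine ⟨b * c, by rw [← wst_mul_wst]; exact L.mul_mem hb hc, ?_⟩
      have := N.mul_mem hb' (hTN _ (hsnd _ _ hb) _ hc')
      convert this using 1; group
    | inv x _ hx =>
      obtain ⟨b, hb, hb'⟩ := hx
      refine ⟨b⁻¹, by rw [← wst_inv]; exact L.inv_mem hb, ?_⟩
      have := hTN _ (T.inv_mem (hsnd _ _ hb)) _ (N.inv_mem hb')
      convert this using 1; group
  intro a b hab
  obtain ⟨c, hc, hc'⟩ := key a ((hT a).mpr ⟨b, hab⟩)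
  have h1 := L.mul_mem hc (L.inv_mem hab)
  rw [wst_inv, wst_mul_wst, mul_inv_cancel] at h1
  have := N.mul_mem hc' (hN' _ h1)
  convert this using 1; group

end
end QuadricAut
namespace QuadricAut

open Equiv

/-! ### Generators of `S₄` and `A₅` -/

/-- `pA`, `pB`, `pC`, `pD` are chosen so that the octahedral representation `octHom` sends them to
the matrices A, B, C, D. -/
def pA : Perm (Fin 4) := Equiv.swap 0 2 * Equiv.swap 1 3
def pB : Perm (Fin 4) := Equiv.swap 0 3 * Equiv.swap 1 2
def pC : Perm (Fin 4) := Equiv.swap 0 3 * Equiv.swap 1 3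
def pD : Perm (Fin 4) := Equiv.swap 0 3

/-- A four-cycle and a transposition which generate `S₄`. -/
def pa : Perm (Fin 4) := finRotate 4
def pb : Perm (Fin 4) := Equiv.swap 0 1

/-- A five-cycle and a double transposition which generate `A₅`. -/
def pE : Perm (Fin 5) := finRotate 5
def pF : Perm (Fin 5) := Equiv.swap 0 1 * Equiv.swap 2 3

/-- Words in the generators `pa`, `pb`, on which `octHom` is defined; they allow the images of `pA`,
..., `pD` to be computed. -/
theorem pA_eq : pA = pa ^ 2 := by decide +kernel
theorem pB_eq : pB = pb * pa ^ 2 * pb := by decide +kernel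
theorem pC_eq : pC = pA * pB * (pa * pb) := by decide +kernel
theorem pD_eq : pD = pa ^ 3 * pb * pa := by decide +kernel

theorem eq_word_perm_four (g : Perm (Fin 4)) :
    ∃ i < 2, ∃ j < 2, ∃ l < 3, ∃ m < 2, g = pA ^ i * pB ^ j * pC ^ l * pD ^ m := by
  revert g; decide +kernel

theorem eq_word_alternating_four (g : Perm (Fin 4)) (hg : Perm.sign g = 1) :
    ∃ i < 2, ∃ j < 2, ∃ l < 3, g = pA ^ i * pB ^ j * pC ^ l := by
  revert g; decide +kernel

theorem closure_pABC : Subgroup.closure {pA, pB, pC} = alternatingGroup (Fin 4) := by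
  refine le_antisymm ?_ fun g hg => ?_
  · rw [Subgroup.closure_le]
    rintro _ (rfl | rfl | rfl) <;> exact Perm.mem_alternatingGroup.mpr (by decide +kernel)
  · obtain ⟨i, -, j, -, l, -, rfl⟩ := eq_word_alternating_four g (Perm.mem_alternatingGroup.mp hg)
    refine mul_mem (mul_mem (pow_mem ?_ _) (pow_mem ?_ _)) (pow_mem ?_ _) <;>
    exact Subgroup.subset_closure (by simp)

theorem closure_pABCD : Subgroup.closure {pA, pB, pC, pD} = ⊤ := by
  rw [eq_top_iff]
  intro g _
  obtain ⟨i, -, j, -, l, -, m, -, rfl⟩ := eq_word_perm_four g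
  refine mul_mem (mul_mem (mul_mem (pow_mem ?_ _) (pow_mem ?_ _)) (pow_mem ?_ _)) (pow_mem ?_ _) <;>
  exact Subgroup.subset_closure (by simp)

theorem closure_pab : Subgroup.closure {pa, pb} = ⊤ := by
  have ha : pa ∈ Subgroup.closure {pa, pb} := Subgroup.subset_closure (by simp)
  have hb : pb ∈ Subgroup.closure {pa, pb} := Subgroup.subset_closure (by simp)
  have hA : pA ∈ Subgroup.closure {pa, pb} := pA_eq ▸ pow_mem ha 2
  have hB : pB ∈ Subgroup.closure {pa, pb} := pB_eq ▸ mul_mem (mul_mem hb (pow_mem ha 2)) hb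
  rw [eq_top_iff, ← closure_pABCD, Subgroup.closure_le]
  rintro _ (rfl | rfl | rfl | rfl)
  · exact hA
  · exact hB
  · exact pC_eq ▸ mul_mem (mul_mem hA hB) (mul_mem ha hb)
  · exact pD_eq ▸ mul_mem (mul_mem (pow_mem ha 3) hb) ha

theorem orderOf_eq_four {G : Type*} [Group G] {x : G} (h : x ^ 4 = 1) (h' : x ^ 2 ≠ 1) :
    orderOf x = 4 := orderOf_eq_prime_pow (p := 2) (n := 1) (by simpa using h') (by simpa using h)

theorem isTriangle_pab : IsTriangle 4 pa pb :=
  ⟨orderOf_eq_four (by decide +kernel) (by decide +kernel),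
    orderOf_eq_prime (by decide +kernel) (by decide +kernel),
    orderOf_eq_prime (by decide +kernel) (by decide +kernel)⟩

theorem isTriangle_pCA : IsTriangle 3 pC pA :=
  ⟨orderOf_eq_prime (by decide +kernel) (by decide +kernel),
    orderOf_eq_prime (by decide +kernel) (by decide +kernel),
    orderOf_eq_prime (by decide +kernel) (by decide +kernel)⟩

instance : Fact (Nat.Prime 5) := ⟨by norm_num⟩

theorem isTriangle_pEF : IsTriangle 5 pE pF :=
  ⟨orderOf_eq_prime (by decide +kernel) (by decide +kernel),
    orderOf_eq_prime (by decide +kernel) (by decide +kernel),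
    orderOf_eq_prime (by decide +kernel) (by decide +kernel)⟩

/-- The five-cycle and the double transposition as elements of `A₅`. -/
def aE : alternatingGroup (Fin 5) := ⟨pE, Perm.mem_alternatingGroup.mpr (by decide +kernel)⟩
def aF : alternatingGroup (Fin 5) := ⟨pF, Perm.mem_alternatingGroup.mpr (by decide +kernel)⟩

theorem IsTriangle.of_map {G G' : Type*} [Group G] [Group G'] {m : ℕ} {y x : G}
    (f : G →* G') (hf : Function.Injective f) (h : IsTriangle m (f y) (f x)) :
    IsTriangle m y x :=
  ⟨by rw [← orderOf_injective f hf, h.left], by rw [← orderOf_injective f hf, h.right],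
    by rw [← orderOf_injective f hf, map_mul, h.mul]⟩

theorem isTriangle_aEF : IsTriangle 5 aE aF :=
  IsTriangle.of_map (alternatingGroup (Fin 5)).subtype (Subgroup.subtype_injective _) isTriangle_pEF

theorem card_alternatingGroup_five : Nat.card (alternatingGroup (Fin 5)) = 60 := by
  rw [nat_card_alternatingGroup]; simp [Nat.factorial]

theorem card_alternatingGroup_four : Nat.card (alternatingGroup (Fin 4)) = 12 := by
  rw [nat_card_alternatingGroup]; simp [Nat.factorial]

theorem card_perm_four : Nat.card (Perm (Fin 4)) = 24 := by
  rw [Nat.card_perm]; simp [Nat.factorial]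

/-- A subgroup of `A₅` which contains elements of orders two, three and five is `A₅`. -/
theorem eq_top_of_orders {K : Subgroup (alternatingGroup (Fin 5))}
    {x y z : alternatingGroup (Fin 5)} (hx : x ∈ K) (hy : y ∈ K) (hz : z ∈ K)
    (h2 : orderOf x = 2) (h3 : orderOf y = 3) (h5 : orderOf z = 5) : K = ⊤ := by
  have d2 : 2 ∣ Nat.card K := by
    have := Subgroup.orderOf_dvd_natCard K hx; rwa [h2] at this
  have d3 : 3 ∣ Nat.card K := by
    have := Subgroup.orderOf_dvd_natCard K hy; rwa [h3] at this
  have d5 : 5 ∣ Nat.card K := by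
    have := Subgroup.orderOf_dvd_natCard K hz; rwa [h5] at this
  have hc := K.card_mul_index
  rw [card_alternatingGroup_five] at hc
  have h0 : 0 < Nat.card K := Nat.card_pos
  -- The order is divisible by 30 and divides 60. Index two would give a normal subgroup, which the
  -- simplicity of A₅ excludes.
  have hi : K.index = 1 ∨ K.index = 2 := by
    obtain ⟨m, hm⟩ : 30 ∣ Nat.card K := by omega
    rw [hm] at hc
    have h1 : m * K.index = 2 := by
      have : 30 * (m * K.index) = 30 * 2 := by rw [← mul_assoc, hc]
      omega
    have := Nat.le_of_dvd (by norm_num) (Dvd.intro_left m h1)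
    interval_cases K.index <;> simp_all
  rcases hi with hi | hi
  · exact Subgroup.index_eq_one.mp hi
  · have := Subgroup.normal_of_index_eq_two hi
    rcases this.eq_bot_or_eq_top with h | h
    · rw [h] at hx
      rw [Subgroup.mem_bot.mp hx, orderOf_one] at h2
      omega
    · exact h

theorem closure_aEF : Subgroup.closure {aE, aF} = ⊤ := by
  have hE : aE ∈ Subgroup.closure {aE, aF} := Subgroup.subset_closure (by simp)
  have hF : aF ∈ Subgroup.closure {aE, aF} := Subgroup.subset_closure (by simp)
  exact eq_top_of_orders hF (mul_mem hE hF) hE isTriangle_aEF.right isTriangle_aEF.mul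
    isTriangle_aEF.left

/-! ### Automorphisms of `A₄`, `S₄` and `A₅` -/

-- The images of the generators `pC`, `pA` under an automorphism of A₄ satisfy these conditions, so
-- every automorphism of A₄ is conjugation by an element of S₄.
set_option synthInstance.maxSize 4000 in
theorem exists_conj_pC_pA : ∀ c x : Perm (Fin 4), c ^ 3 = 1 ∧ c ≠ 1 ∧ x ^ 2 = 1 ∧ x ≠ 1 ∧
    Perm.sign x = 1 → ∃ s : Perm (Fin 4), s * pC * s⁻¹ = c ∧ s * pA * s⁻¹ = x := by
  decide +kernel

/-- S₄ acts transitively on its (4, 2, 3) triangles, so all automorphisms of S₄ are inner. -/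
theorem exists_conj_pa_pb : ∀ c x : Perm (Fin 4), c ^ 4 = 1 ∧ c ^ 2 ≠ 1 ∧ x ^ 2 = 1 ∧ x ≠ 1 ∧
    (c * x) ^ 3 = 1 → ∃ s : Perm (Fin 4), s * pa * s⁻¹ = c ∧ s * pb * s⁻¹ = x := by
  decide +kernel

theorem exists_conj_pE : ∀ c : Perm (Fin 5), c ^ 5 = 1 ∧ c ≠ 1 →
    ∃ s : Perm (Fin 5), s * pE * s⁻¹ = c := by
  decide +kernel

/-- The five-cycle being fixed, only conjugation by its powers is left, and this is enough to reach
every admissible involution. -/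
theorem exists_pow_conj_pF : ∀ x : Perm (Fin 5), x ^ 2 = 1 ∧ x ≠ 1 ∧ (pE * x) ^ 3 = 1 →
    ∃ i < 5, pE ^ i * pF * (pE ^ i)⁻¹ = x := by
  decide +kernel

/-- Combines conjugacy of the five-cycles in S₅ with the adjustment of the involution by powers of
`pE`. As `aE`, `aF` generate A₅, it makes every automorphism of A₅ a conjugation in S₅. -/
theorem exists_conj_pE_pF {c x : Perm (Fin 5)} (h : IsTriangle 5 c x) :
    ∃ s : Perm (Fin 5), s * pE * s⁻¹ = c ∧ s * pF * s⁻¹ = x := by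
  have hc : c ^ 5 = 1 := orderOf_dvd_iff_pow_eq_one.mp h.left.dvd
  obtain ⟨s, hs⟩ := exists_conj_pE c ⟨hc, fun h1 => by
    have := h.left; rw [h1, orderOf_one] at this; omega⟩
  have h' := h.conj s⁻¹
  have e : s⁻¹ * c * s⁻¹⁻¹ = pE := by rw [← hs]; group
  rw [e] at h'
  obtain ⟨i, -, hi⟩ := exists_pow_conj_pF _ ⟨orderOf_dvd_iff_pow_eq_one.mp h'.right.dvd,
    fun h1 => by have := h'.right; rw [h1, orderOf_one] at this; omega,
    orderOf_dvd_iff_pow_eq_one.mp h'.mul.dvd⟩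
  refine ⟨s * pE ^ i, ?_, ?_⟩
  · rw [← hs]
    have : s * pE ^ i * pE * (s * pE ^ i)⁻¹ = s * (pE ^ i * pE * (pE ^ i)⁻¹) * s⁻¹ := by group
    rw [this, ← pow_succ, pow_succ', mul_inv_cancel_right]
  · have : s * pE ^ i * pF * (s * pE ^ i)⁻¹ = s * (pE ^ i * pF * (pE ^ i)⁻¹) * s⁻¹ := by group
    rw [this, hi]; group

/-- Every automorphism of `A₅` is induced by a permutation. -/
theorem exists_perm_of_mulAut (θ : MulAut (alternatingGroup (Fin 5))) :
    ∃ s : Perm (Fin 5), ∀ a, ((θ a : alternatingGroup (Fin 5)) : Perm (Fin 5)) = s * a * s⁻¹ := by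
  have h : IsTriangle 5 ((θ aE : alternatingGroup (Fin 5)) : Perm (Fin 5)) (θ aF) :=
    isTriangle_aEF.map ((alternatingGroup (Fin 5)).subtype.comp θ.toMonoidHom)
      ((Subgroup.subtype_injective _).comp θ.injective)
  obtain ⟨s, h1, h2⟩ := exists_conj_pE_pF h
  refine ⟨s, fun a => ?_⟩
  have key : ((alternatingGroup (Fin 5)).subtype.comp θ.toMonoidHom) =
      (MulAut.conj s).toMonoidHom.comp (alternatingGroup (Fin 5)).subtype := by
    refine MonoidHom.eq_of_eqOn_dense closure_aEF ?_
    rintro _ (rfl | rfl)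
    · exact h1.symm
    · exact h2.symm
  exact DFunLike.congr_fun key a

/-! ### Normal subgroups -/

/-- The Klein four-group in `S₄`. -/
def kleinV : Subgroup (Perm (Fin 4)) where
  carrier := {g | g = 1 ∨ g = pA ∨ g = pB ∨ g = pA * pB}
  one_mem' := Or.inl rfl
  mul_mem' := by
    rintro _ _ (rfl | rfl | rfl | rfl) (rfl | rfl | rfl | rfl) <;> simp only [Set.mem_ofPred_eq] <;>
    decide +kernel
  inv_mem' := by
    rintro _ (rfl | rfl | rfl | rfl) <;> simp only [Set.mem_ofPred_eq] <;> decide +kernel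

theorem mem_kleinV {g : Perm (Fin 4)} : g ∈ kleinV ↔ g = 1 ∨ g = pA ∨ g = pB ∨ g = pA * pB :=
  Iff.rfl

instance : DecidablePred (· ∈ kleinV) := fun _ => decidable_of_iff' _ mem_kleinV

instance : kleinV.Normal := ⟨by decide +kernel⟩

theorem closure_pAB : Subgroup.closure {pA, pB} = kleinV := by
  refine le_antisymm ?_ ?_
  · rw [Subgroup.closure_le]
    rintro _ (rfl | rfl) <;> simp [mem_kleinV]
  · have hA : pA ∈ Subgroup.closure {pA, pB} := Subgroup.subset_closure (by simp)
    have hB : pB ∈ Subgroup.closure {pA, pB} := Subgroup.subset_closure (by simp)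
    rintro _ (rfl | rfl | rfl | rfl)
    · exact one_mem _
    · exact hA
    · exact hB
    · exact mul_mem hA hB

theorem card_kleinV : Nat.card kleinV = 4 := by
  rw [Nat.card_eq_fintype_card]; decide +kernel

theorem kleinV_le : kleinV ≤ alternatingGroup (Fin 4) := by
  rw [← closure_pABC, ← closure_pAB]
  exact Subgroup.closure_mono (by intro x; simp; tauto)

/-- Forces a nontrivial subgroup normalised by A₄ to contain `pA`, and then all of V₄. -/
theorem exists_conj_mul_conj_eq_pA : ∀ g : Perm (Fin 4), g ≠ 1 ∧ Perm.sign g = 1 →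
    ∃ x y : Perm (Fin 4), Perm.sign x = 1 ∧ Perm.sign y = 1 ∧
      x * g * x⁻¹ * (y * g * y⁻¹)⁻¹ = pA := by decide +kernel

theorem exists_conj_mul_conj_eq_pA' : ∀ g : Perm (Fin 4), g ≠ 1 →
    ∃ x y : Perm (Fin 4), x * g * x⁻¹ * (y * g * y⁻¹) = pA := by decide +kernel

theorem exists_pow_mul_eq_pC : ∀ g : Perm (Fin 4), Perm.sign g = 1 ∧ g ∉ kleinV →
    ∃ i < 3, ∃ v, v ∈ kleinV ∧ g ^ i * v = pC := by decide +kernel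

/-- A normal subgroup of S₄ which is not inside V₄ thus meets A₄ outside V₄ as well. -/
theorem exists_commutator : ∀ g : Perm (Fin 4), g ∉ kleinV →
    ∃ x : Perm (Fin 4), Perm.sign (x * g * x⁻¹ * g⁻¹) = 1 ∧ x * g * x⁻¹ * g⁻¹ ∉ kleinV := by
  decide +kernel

/-- A nontrivial `N` contains V₄. If it contains more, then a power of an element outside V₄,
corrected by V₄, is `pC`, and `N` is everything. Normality is needed only relative to A₄, because
`N` is given inside S₄. -/
theorem alternating_normal_cases {N : Subgroup (Perm (Fin 4))} (hN : N ≤ alternatingGroup (Fin 4))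
    (h : ∀ a ∈ alternatingGroup (Fin 4), ∀ n ∈ N, a * n * a⁻¹ ∈ N) :
    N = ⊥ ∨ N = kleinV ∨ N = alternatingGroup (Fin 4) := by
  by_cases h0 : N = ⊥
  · exact Or.inl h0
  right
  obtain ⟨g, hg, hg1⟩ := N.bot_or_exists_ne_one.resolve_left h0
  obtain ⟨x, y, hx, hy, hxy⟩ := exists_conj_mul_conj_eq_pA g
    ⟨hg1, Perm.mem_alternatingGroup.mp (hN hg)⟩
  have hA : pA ∈ N := by
    rw [← hxy]
    exact mul_mem (h x (Perm.mem_alternatingGroup.mpr hx) _ hg)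
      (inv_mem (h y (Perm.mem_alternatingGroup.mpr hy) _ hg))
  have hB : pB ∈ N := by
    have : pB = pC * pA * pC⁻¹ ∨ pB = pC⁻¹ * pA * pC⁻¹⁻¹ := by decide +kernel
    have hC : pC ∈ alternatingGroup (Fin 4) := Perm.mem_alternatingGroup.mpr (by decide +kernel)
    rcases this with h1 | h1
    · exact h1 ▸ h _ hC _ hA
    · exact h1 ▸ h _ (inv_mem hC) _ hA
  have hV : kleinV ≤ N := by
    rw [← closure_pAB, Subgroup.closure_le]
    rintro _ (rfl | rfl)
    · exact hA
    · exact hB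
  by_cases h1 : N ≤ kleinV
  · exact Or.inl (le_antisymm h1 hV)
  · right
    obtain ⟨g, hg, hgV⟩ := Set.not_subset.mp h1
    obtain ⟨i, -, v, hv, hi⟩ := exists_pow_mul_eq_pC g ⟨Perm.mem_alternatingGroup.mp (hN hg), hgV⟩
    refine le_antisymm hN ?_
    rw [← closure_pABC, Subgroup.closure_le]
    rintro _ (rfl | rfl | rfl)
    · exact hA
    · exact hB
    · exact hi ▸ mul_mem (pow_mem hg i) (hV hv)

/-- The intersection with A₄ is trivial, V₄ or A₄. In the first case a product of two conjugates of
a nontrivial element would be `pA`; in the second a commutator would lie in A₄ outside V₄; in the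
third `N` has index at most two. -/
theorem perm_normal_cases {N : Subgroup (Perm (Fin 4))} (h : ∀ a, ∀ n ∈ N, a * n * a⁻¹ ∈ N) :
    N = ⊥ ∨ N = kleinV ∨ N = alternatingGroup (Fin 4) ∨ N = ⊤ := by
  rcases alternating_normal_cases (N := N ⊓ alternatingGroup (Fin 4)) inf_le_right
    (fun a ha n hn => Subgroup.mem_inf.mpr ⟨h a n hn.1, mul_mem (mul_mem ha hn.2) (inv_mem ha)⟩) with h1 | h1 | h1
  · left
    by_contra h0
    obtain ⟨g, hg, hg1⟩ := N.bot_or_exists_ne_one.resolve_left h0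
    obtain ⟨x, y, hxy⟩ := exists_conj_mul_conj_eq_pA' g hg1
    have hA : pA ∈ N ⊓ alternatingGroup (Fin 4) := by
      refine ⟨?_, Perm.mem_alternatingGroup.mpr (by decide +kernel)⟩
      rw [← hxy]
      exact mul_mem (h x _ hg) (h y _ hg)
    rw [h1] at hA
    exact absurd (Subgroup.mem_bot.mp hA) (by decide +kernel)
  · right; left
    refine le_antisymm (fun g hg => ?_) (h1 ▸ inf_le_left)
    by_contra hgV
    obtain ⟨x, hx, hxV⟩ := exists_commutator g hgV
    apply hxV
    rw [← h1]
    exact Subgroup.mem_inf.mpr ⟨mul_mem (h x _ hg) (inv_mem hg), Perm.mem_alternatingGroup.mpr hx⟩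
  · right; right
    have hle : alternatingGroup (Fin 4) ≤ N := h1 ▸ inf_le_left
    by_cases h2 : N ≤ alternatingGroup (Fin 4)
    · exact Or.inl (le_antisymm h2 hle)
    · right
      obtain ⟨g, hg, hgA⟩ := Set.not_subset.mp h2
      rw [eq_top_iff]
      intro x _
      by_cases hx : x ∈ alternatingGroup (Fin 4)
      · exact hle hx
      · have e : x = x * g⁻¹ * g := by group
        rw [e]
        refine mul_mem (hle ?_) hg
        rw [Perm.mem_alternatingGroup] at hx ⊢
        have hg' : ¬ Perm.sign g = 1 := fun h => hgA (Perm.mem_alternatingGroup.mpr h)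
        rw [Perm.sign_mul, Perm.sign_inv, (Int.units_eq_one_or _).resolve_left hx,
          (Int.units_eq_one_or _).resolve_left hg']
        rfl

end QuadricAut
namespace QuadricAut

/-! ### Fibre products over `T / N` and Goursat data. -/

section
variable {Γ : Type*} [Group Γ]

theorem conj_mem_of_normal {T N : Subgroup Γ} [hN : N.Normal] :
    ∀ a ∈ T, ∀ n ∈ N, a * n * a⁻¹ ∈ N := fun a _ n hn => hN.conj_mem n hn a

/-- The subgroup of `Γ ≀ C₂` generated by the pairs of elements of `T` congruent modulo `N`
and `(m, n)σ`. -/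
def congrGroup (T N : Subgroup Γ) [N.Normal] (m n : Γ) : Subgroup (WrC2 Γ) :=
  twistGroup (congrPairs T N conj_mem_of_normal) m n

/-- It suffices that `m` and `n` induce the same automorphism of `T / N` and that `m n` lies in `T`
and agrees with `n m` modulo `N`. -/
theorem isTwist_congrPairs {T N : Subgroup Γ} [hT : T.Normal] [hN : N.Normal] {m n : Γ}
    (h1 : m * n ∈ T) (h2 : m * n * (n * m)⁻¹ ∈ N)
    (h3 : ∀ b ∈ T, m * b * m⁻¹ * (n * b * n⁻¹)⁻¹ ∈ N) :
    IsTwist (congrPairs T N conj_mem_of_normal) m n where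
  sq := ⟨h1, by simpa [mul_assoc] using hT.conj_mem _ h1 n, h2⟩
  conj a b := by
    rintro ⟨ha, hb, hab⟩
    refine ⟨hT.conj_mem _ hb _, hT.conj_mem _ ha _, ?_⟩
    have := N.mul_mem (h3 b hb) (hN.conj_mem _ (N.inv_mem hab) n)
    convert this using 1
    simp only
    group

theorem isTwist_congrPairs_self {T N : Subgroup Γ} [T.Normal] [hN : N.Normal] {m : Γ}
    (h1 : m * m ∈ T) : IsTwist (congrPairs T N conj_mem_of_normal) m m :=
  isTwist_congrPairs h1 (by simp) (by simp)

theorem isTwist_congrPairs_one {T N : Subgroup Γ} [T.Normal] [hN : N.Normal] :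
    IsTwist (congrPairs T N conj_mem_of_normal) 1 1 := isTwist_congrPairs_self (by simp)

/-- The generating sets of the theorem have this shape: (s, 1) for generators of `N`, (s, s) for the
remaining generators of `T`, and one (m, n)σ. Conjugation by (m, n)σ supplies the elements (1, s) of
the second factor, and (a, b) = (a b⁻¹, 1)(b, b) gives the fibre product. -/
theorem closure_eq_congrGroup {T N : Subgroup Γ} [N.Normal] {m n : Γ} (SN ST : Set Γ)
    (hSN : Subgroup.closure SN = N) (hST : Subgroup.closure (SN ∪ ST) = T) :
    Subgroup.closure ((fun s => wst s 1) '' SN ∪ (fun s => wst s s) '' ST ∪ {wts m n}) =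
      congrGroup T N m n := by
  have hNT : N ≤ T := by
    rw [← hSN, ← hST]
    exact Subgroup.closure_mono Set.subset_union_left
  set L := Subgroup.closure
    ((fun s => wst s 1) '' SN ∪ (fun s => wst s s) '' ST ∪ {wts m n}) with hL
  have ht : wts m n ∈ L := Subgroup.subset_closure (Or.inr rfl)
  refine le_antisymm ?_ (twistGroup_le ?_ ht)
  · rw [hL, Subgroup.closure_le]
    rintro _ ((⟨s, hs, rfl⟩ | ⟨s, hs, rfl⟩) | rfl)
    · have h : s ∈ N := hSN ▸ Subgroup.subset_closure hs
      exact wst_mem_twistGroup ⟨hNT h, T.one_mem, by simpa using h⟩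
    · have h : s ∈ T := hST ▸ Subgroup.subset_closure (Or.inr hs)
      exact wst_mem_twistGroup ⟨h, h, by simp⟩
    · exact wts_mem_twistGroup _ _ _
  · have h1 : ∀ x ∈ N, wst x 1 ∈ L := by
      intro x hx
      have h : N ≤ (L.comap wstHom).comap (MonoidHom.inl Γ Γ) := by
        rw [← hSN, Subgroup.closure_le]
        exact fun s hs => Subgroup.subset_closure (Or.inl (Or.inl ⟨s, hs, rfl⟩))
      exact h hx
    have h2 : ∀ x ∈ N, wst 1 x ∈ L := by
      intro x hx
      have h := Subgroup.Normal.conj_mem (H := N) inferInstance x hx n⁻¹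
      have h' := L.mul_mem (L.mul_mem ht (h1 _ h)) (L.inv_mem ht)
      rw [wts_mul_wst, wts_inv, wts_mul_wts] at h'
      convert h' using 2 <;> group
    have h3 : ∀ x ∈ T, wst x x ∈ L := by
      intro x hx
      have h : T ≤ (L.comap wstHom).comap ((MonoidHom.id Γ).prod (MonoidHom.id Γ)) := by
        rw [← hST, Subgroup.closure_le]
        rintro s (hs | hs)
        · have hs' : s ∈ N := hSN ▸ Subgroup.subset_closure hs
          have := L.mul_mem (h1 s hs') (h2 s hs')
          rw [wst_mul_wst, one_mul, mul_one] at this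
          exact this
        · exact Subgroup.subset_closure (Or.inl (Or.inr ⟨s, hs, rfl⟩))
      exact h hx
    rintro a b ⟨-, hb, hab⟩
    have := L.mul_mem (h1 _ hab) (h3 b hb)
    rw [wst_mul_wst] at this
    simpa using this

/-- The data attached to a subgroup of `Γ ≀ C₂` which contains some `(1, p)σ`. -/
structure GoursatData (L : Subgroup (WrC2 Γ)) (T N : Subgroup Γ) (p : Γ) : Prop where
  twist : wts 1 p ∈ L
  fst : ∀ a, a ∈ T ↔ ∃ b, wst a b ∈ L
  ker : ∀ n, n ∈ N ↔ wst n 1 ∈ L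

namespace GoursatData
variable {L : Subgroup (WrC2 Γ)} {T N : Subgroup Γ} {p : Γ} (h : GoursatData L T N p)
include h

theorem swap_mem {a b : Γ} (hab : wst a b ∈ L) : wst b (p * a * p⁻¹) ∈ L := by
  have := L.mul_mem (L.mul_mem h.twist hab) (L.inv_mem h.twist)
  rw [wts_mul_wst, wts_inv, wts_mul_wts] at this
  simpa using this

theorem snd_mem {a b : Γ} (hab : wst a b ∈ L) : b ∈ T := (h.fst b).mpr ⟨_, h.swap_mem hab⟩

theorem mem_of_one {n : Γ} (hn : wst 1 n ∈ L) : n ∈ N := by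
  rw [h.ker]
  simpa using h.swap_mem hn

theorem sq_mem : wst p p ∈ L := by
  have := L.mul_mem h.twist h.twist
  rw [wts_mul_wts] at this
  simpa using this

theorem p_mem : p ∈ T := (h.fst p).mpr ⟨p, h.sq_mem⟩

theorem le : N ≤ T := fun n hn => (h.fst n).mpr ⟨1, (h.ker n).mp hn⟩

theorem conj_mem : ∀ a ∈ T, ∀ n ∈ N, a * n * a⁻¹ ∈ N := by
  intro a ha n hn
  obtain ⟨b, hb⟩ := (h.fst a).mp ha
  rw [h.ker] at hn ⊢
  have := L.mul_mem (L.mul_mem hb hn) (L.inv_mem hb)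
  rw [wst_mul_wst, wst_inv, wst_mul_wst] at this
  simpa using this

theorem right_notMem {a b : Γ} (hab : wst a b ∈ L) (ha : a ∉ N) : b ∉ N := by
  intro hb
  apply ha
  have h1 := L.mul_mem (L.mul_mem (L.inv_mem h.twist) ((h.ker b).mp hb)) h.twist
  rw [wts_inv, wts_mul_wst, wts_mul_wts] at h1
  have h2 := L.mul_mem hab (L.inv_mem h1)
  rw [wst_inv, wst_mul_wst] at h2
  rw [h.ker]
  simpa using h2

theorem right_pow_mem {a b : Γ} (hab : wst a b ∈ L) {r : ℕ} (ha : a ^ r = 1) : b ^ r ∈ N := by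
  have h1 := L.pow_mem hab r
  have h2 : wst a b ^ r = wst (a ^ r) (b ^ r) := (map_pow wstHom (a, b) r).symm
  rw [h2, ha] at h1
  exact h.mem_of_one h1

/-- After conjugation by (q, 1) the group is the standard fibre product extended by (q, p q⁻¹)σ. The
hypotheses on `m`, `n` say that (m, n)σ lies in the same coset. -/
theorem isConjTo [N.Normal] [hT : T.Normal] {q : Γ}
    (hq : ∀ a b, wst a b ∈ L → q * a * q⁻¹ * b⁻¹ ∈ N) {m n : Γ} (hm : m * q⁻¹ ∈ T)
    (hn : n * q * p⁻¹ ∈ T) (hmn : m * q⁻¹ * (p * q⁻¹ * n⁻¹) ∈ N) :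
    IsConjTo L (congrGroup T N m n) := by
  have hqT : ∀ a, q * a * q⁻¹ ∈ T ↔ a ∈ T := fun a =>
    ⟨fun h => by simpa [mul_assoc] using hT.conj_mem _ h q⁻¹, fun h => hT.conj_mem _ h q⟩
  obtain ⟨hTN, L', h1, h2, h3⟩ := exists_conj_congrPairs h.twist h.fst h.ker hqT hq
  have h4 : wts m n ∈ L' := by
    have := L'.mul_mem ((h2 (m * q⁻¹) (n * q * p⁻¹)).mpr ⟨hm, hn, by
      convert hmn using 1; simp only; group⟩) h3
    rw [wst_mul_wts] at this
    convert this using 2 <;> group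
  rwa [twistGroup_congr h2 h4] at h1

/-- The isomorphism φ of `T / N` defined by `L` is conjugation by `q`. Applying (1, p)σ to (a, b)
gives (b, p a p⁻¹), so φ² is conjugation by `p`; hence `p⁻¹ q²` acts trivially on `T / N`. -/
theorem commutator_mem [hN : N.Normal] {q : Γ}
    (hq : ∀ a b, wst a b ∈ L → q * a * q⁻¹ * b⁻¹ ∈ N) {a : Γ} (ha : a ∈ T) :
    p⁻¹ * (q * q) * a * (p⁻¹ * (q * q))⁻¹ * a⁻¹ ∈ N := by
  obtain ⟨b, hb⟩ := (h.fst a).mp ha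
  have h1 := hN.conj_mem _ (hq _ _ hb) q
  have h2 := hq _ _ (h.swap_mem hb)
  convert hN.conj_mem _ (N.mul_mem h1 h2) p⁻¹ using 1
  group

end GoursatData

/-- Every subgroup of `Γ ≀ C₂` which contains some `(1, p)σ` has `GoursatData`. -/
theorem exists_goursatData {L : Subgroup (WrC2 Γ)} {T : Subgroup Γ} {p : Γ}
    (hp : wts 1 p ∈ L) (hT : ∀ a, a ∈ T ↔ ∃ b, wst a b ∈ L) : ∃ N, GoursatData L T N p :=
  ⟨(L.comap wstHom).comap (MonoidHom.inl Γ Γ), hp, hT, fun _ => Iff.rfl⟩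

theorem GoursatData.isConjTo_top {L : Subgroup (WrC2 Γ)} {T : Subgroup Γ} [T.Normal] {p : Γ}
    (h : GoursatData L T T p) : IsConjTo L (congrGroup T T 1 1) :=
  h.isConjTo (q := 1) (fun a b hab => by
    simpa using T.mul_mem ((h.fst a).mpr ⟨b, hab⟩) (T.inv_mem (h.snd_mem hab)))
    (by simp) (by simpa using h.p_mem) (by simpa using h.p_mem)

end
open Equiv

/-! ### The subgroups of `S₄ ≀ C₂` -/

/-- The seven subgroups of `S₄ ≀ C₂` with `T = A₄`. -/
def a4W : Fin 7 → Subgroup (WrC2 (Perm (Fin 4))) := ![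
  Subgroup.closure {wst pA pA, wst pB pB, wst pC pC, wts 1 1},
  Subgroup.closure {wst pA pA, wst pB pB, wst pC pC, wts pD pD},
  Subgroup.closure {wst pA 1, wst pB 1, wst pC pC, wts 1 1},
  Subgroup.closure {wst pA 1, wst pB 1, wst pC pC, wts 1 pC},
  Subgroup.closure {wst pA 1, wst pB 1, wst pC pC, wts pD pD},
  Subgroup.closure {wst pA 1, wst pB 1, wst pC 1, wts 1 1},
  Subgroup.closure {wst pA 1, wst pB 1, wst pC 1, wts pD pD}]

/-- The five subgroups of `S₄ ≀ C₂` with `T = S₄`. -/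
def s4W : Fin 5 → Subgroup (WrC2 (Perm (Fin 4))) := ![
  Subgroup.closure {wst pA pA, wst pB pB, wst pC pC, wst pD pD, wts 1 1},
  Subgroup.closure {wst pA 1, wst pB 1, wst pC pC, wst pD pD, wts 1 1},
  Subgroup.closure {wst pA 1, wst pB 1, wst pC 1, wst pD pD, wts 1 1},
  Subgroup.closure {wst pA 1, wst pB 1, wst pC 1, wst pD pD, wts 1 pD},
  Subgroup.closure {wst pA 1, wst pB 1, wst pC 1, wst pD 1, wts 1 1}]

local notation "𝔸" => alternatingGroup (Fin 4)

theorem closure_pAB_union_pC : Subgroup.closure ({pA, pB} ∪ {pC}) = 𝔸 := by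
  rw [← closure_pABC]
  congr 1
  ext x
  simp only [Set.mem_union, Set.mem_insert_iff, Set.mem_singleton_iff, or_assoc]

theorem closure_pAB_union_pCD : Subgroup.closure ({pA, pB} ∪ {pC, pD}) = ⊤ := by
  rw [← closure_pABCD]
  congr 1
  ext x
  simp only [Set.mem_union, Set.mem_insert_iff, Set.mem_singleton_iff, or_assoc]

theorem closure_pABC_union_pD : Subgroup.closure ({pA, pB, pC} ∪ {pD}) = ⊤ := by
  rw [← closure_pABCD]
  congr 1
  ext x
  simp only [Set.mem_union, Set.mem_insert_iff, Set.mem_singleton_iff, or_assoc]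

theorem a4W_zero : a4W 0 = congrGroup 𝔸 ⊥ 1 1 := by
  refine Eq.trans (congrArg Subgroup.closure (Set.ext fun x => ?_))
    (closure_eq_congrGroup ∅ {pA, pB, pC} Subgroup.closure_empty (by rw [Set.empty_union, closure_pABC]))
  simp only [Set.mem_union, Set.mem_insert_iff, Set.mem_singleton_iff, Set.image_insert_eq,
    Set.image_singleton, Set.image_empty, Set.mem_empty_iff_false, or_assoc, false_or]

theorem a4W_one : a4W 1 = congrGroup 𝔸 ⊥ pD pD := by
  refine Eq.trans (congrArg Subgroup.closure (Set.ext fun x => ?_))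
    (closure_eq_congrGroup ∅ {pA, pB, pC} Subgroup.closure_empty (by rw [Set.empty_union, closure_pABC]))
  simp only [Set.mem_union, Set.mem_insert_iff, Set.mem_singleton_iff, Set.image_insert_eq,
    Set.image_singleton, Set.image_empty, Set.mem_empty_iff_false, or_assoc, false_or]

theorem a4W_two : a4W 2 = congrGroup 𝔸 kleinV 1 1 := by
  refine Eq.trans (congrArg Subgroup.closure (Set.ext fun x => ?_))
    (closure_eq_congrGroup {pA, pB} {pC} closure_pAB closure_pAB_union_pC)
  simp only [Set.mem_union, Set.mem_insert_iff, Set.mem_singleton_iff, Set.image_insert_eq,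
    Set.image_singleton, Set.image_empty, Set.mem_empty_iff_false, or_assoc, false_or]

theorem a4W_three : a4W 3 = congrGroup 𝔸 kleinV 1 pC := by
  refine Eq.trans (congrArg Subgroup.closure (Set.ext fun x => ?_))
    (closure_eq_congrGroup {pA, pB} {pC} closure_pAB closure_pAB_union_pC)
  simp only [Set.mem_union, Set.mem_insert_iff, Set.mem_singleton_iff, Set.image_insert_eq,
    Set.image_singleton, Set.image_empty, Set.mem_empty_iff_false, or_assoc, false_or]

theorem a4W_four : a4W 4 = congrGroup 𝔸 kleinV pD pD := by
  refine Eq.trans (congrArg Subgroup.closure (Set.ext fun x => ?_))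
    (closure_eq_congrGroup {pA, pB} {pC} closure_pAB closure_pAB_union_pC)
  simp only [Set.mem_union, Set.mem_insert_iff, Set.mem_singleton_iff, Set.image_insert_eq,
    Set.image_singleton, Set.image_empty, Set.mem_empty_iff_false, or_assoc, false_or]

theorem a4W_five : a4W 5 = congrGroup 𝔸 𝔸 1 1 := by
  refine Eq.trans (congrArg Subgroup.closure (Set.ext fun x => ?_))
    (closure_eq_congrGroup {pA, pB, pC} ∅ closure_pABC (by rw [Set.union_empty, closure_pABC]))
  simp only [Set.mem_union, Set.mem_insert_iff, Set.mem_singleton_iff, Set.image_insert_eq,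
    Set.image_singleton, Set.image_empty, Set.mem_empty_iff_false, or_assoc, false_or]

theorem a4W_six : a4W 6 = congrGroup 𝔸 𝔸 pD pD := by
  refine Eq.trans (congrArg Subgroup.closure (Set.ext fun x => ?_))
    (closure_eq_congrGroup {pA, pB, pC} ∅ closure_pABC (by rw [Set.union_empty, closure_pABC]))
  simp only [Set.mem_union, Set.mem_insert_iff, Set.mem_singleton_iff, Set.image_insert_eq,
    Set.image_singleton, Set.image_empty, Set.mem_empty_iff_false, or_assoc, false_or]

theorem s4W_zero : s4W 0 = congrGroup ⊤ ⊥ 1 1 := by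
  refine Eq.trans (congrArg Subgroup.closure (Set.ext fun x => ?_))
    (closure_eq_congrGroup ∅ {pA, pB, pC, pD} Subgroup.closure_empty (by rw [Set.empty_union, closure_pABCD]))
  simp only [Set.mem_union, Set.mem_insert_iff, Set.mem_singleton_iff, Set.image_insert_eq,
    Set.image_singleton, Set.image_empty, Set.mem_empty_iff_false, or_assoc, false_or]

theorem s4W_one : s4W 1 = congrGroup ⊤ kleinV 1 1 := by
  refine Eq.trans (congrArg Subgroup.closure (Set.ext fun x => ?_))
    (closure_eq_congrGroup {pA, pB} {pC, pD} closure_pAB closure_pAB_union_pCD)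
  simp only [Set.mem_union, Set.mem_insert_iff, Set.mem_singleton_iff, Set.image_insert_eq,
    Set.image_singleton, Set.image_empty, Set.mem_empty_iff_false, or_assoc, false_or]

theorem s4W_two : s4W 2 = congrGroup ⊤ 𝔸 1 1 := by
  refine Eq.trans (congrArg Subgroup.closure (Set.ext fun x => ?_))
    (closure_eq_congrGroup {pA, pB, pC} {pD} closure_pABC closure_pABC_union_pD)
  simp only [Set.mem_union, Set.mem_insert_iff, Set.mem_singleton_iff, Set.image_insert_eq,
    Set.image_singleton, Set.image_empty, Set.mem_empty_iff_false, or_assoc, false_or]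

theorem s4W_three : s4W 3 = congrGroup ⊤ 𝔸 1 pD := by
  refine Eq.trans (congrArg Subgroup.closure (Set.ext fun x => ?_))
    (closure_eq_congrGroup {pA, pB, pC} {pD} closure_pABC closure_pABC_union_pD)
  simp only [Set.mem_union, Set.mem_insert_iff, Set.mem_singleton_iff, Set.image_insert_eq,
    Set.image_singleton, Set.image_empty, Set.mem_empty_iff_false, or_assoc, false_or]

theorem s4W_four : s4W 4 = congrGroup ⊤ ⊤ 1 1 := by
  refine Eq.trans (congrArg Subgroup.closure (Set.ext fun x => ?_))
    (closure_eq_congrGroup {pA, pB, pC, pD} ∅ closure_pABCD (by rw [Set.union_empty, closure_pABCD]))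
  simp only [Set.mem_union, Set.mem_insert_iff, Set.mem_singleton_iff, Set.image_insert_eq,
    Set.image_singleton, Set.image_empty, Set.mem_empty_iff_false, or_assoc, false_or]

end QuadricAut
namespace QuadricAut
section
open Equiv
local notation "𝔸" => alternatingGroup (Fin 4)

/-! ### Classification of the subgroups of `S₄ ≀ C₂` by the kernel `N`. -/

theorem closure_pCA : Subgroup.closure {pC, pA} = 𝔸 := by
  have hC : pC ∈ Subgroup.closure {pC, pA} := Subgroup.subset_closure (by simp)
  have hA : pA ∈ Subgroup.closure {pC, pA} := Subgroup.subset_closure (by simp)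
  have e : pB = pC * pA * pC⁻¹ ∨ pB = pC⁻¹ * pA * pC := by decide +kernel
  have hB : pB ∈ Subgroup.closure {pC, pA} := by
    rcases e with e | e <;> rw [e]
    · exact mul_mem (mul_mem hC hA) (inv_mem hC)
    · exact mul_mem (mul_mem (inv_mem hC) hA) hC
  refine le_antisymm ?_ ?_
  · rw [← closure_pABC]
    exact Subgroup.closure_mono (by rintro _ (rfl | rfl) <;> simp)
  · rw [← closure_pABC, Subgroup.closure_le]
    rintro _ (rfl | rfl | rfl) <;> assumption

theorem sign_pC : Perm.sign pC = 1 := by decide +kernel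
theorem sign_pA : Perm.sign pA = 1 := by decide +kernel
theorem sign_pD : Perm.sign pD = -1 := by decide +kernel

theorem eq_one_of_commute_pC_pA : ∀ g : Perm (Fin 4), g * pC * g⁻¹ * pC⁻¹ = 1 ∧
    g * pA * g⁻¹ * pA⁻¹ = 1 → g = 1 := by decide +kernel

theorem mem_kleinV_of_commute : ∀ g : Perm (Fin 4), g * pC * g⁻¹ * pC⁻¹ ∈ kleinV ∧
    g * pD * g⁻¹ * pD⁻¹ ∈ kleinV → g ∈ kleinV := by decide +kernel

/-- The quotient A₄/V₄ has order three; its identity and its inversion are induced by `1` and `pD`.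
-/
theorem exists_conj_pC_mod : ∀ c : Perm (Fin 4), c ∉ kleinV ∧ Perm.sign c = 1 →
    ∃ q : Perm (Fin 4), (q = 1 ∨ q = pD) ∧ q * pC * q⁻¹ * c⁻¹ ∈ kleinV := by decide +kernel

/-- The quotient S₄/V₄ is S₃, and all its automorphisms are inner. -/
theorem exists_conj_pC_pD_mod : ∀ c d : Perm (Fin 4),
    c ∉ kleinV ∧ c ^ 3 ∈ kleinV ∧ d ∉ kleinV ∧ d ^ 2 ∈ kleinV →
    ∃ q : Perm (Fin 4), q * pC * q⁻¹ * c⁻¹ ∈ kleinV ∧ q * pD * q⁻¹ * d⁻¹ ∈ kleinV := by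
  decide +kernel

/-- Replacing `q` by `pC ^ i q` does not change its action on A₄/V₄ but moves the coset of (q, p
q⁻¹)σ. With a suitable `i` the coset contains σ or (1, C)σ if `q` is even, and (D, D)σ if `q` is
odd. -/
theorem kleinV_residue {q : Perm (Fin 4)} (hq : q = 1 ∨ q = pD) : ∀ p : Perm (Fin 4),
    Perm.sign p = 1 ∧ q * p * q⁻¹ * p⁻¹ ∈ kleinV →
    ∃ i < 3, pC ^ i * q * pC * (pC ^ i * q)⁻¹ * (q * pC * q⁻¹)⁻¹ ∈ kleinV ∧
      ((Perm.sign q = 1 ∧ (pC ^ i * q)⁻¹ * (p * (pC ^ i * q)⁻¹) ∈ kleinV) ∨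
      (Perm.sign q = 1 ∧ (pC ^ i * q)⁻¹ * (p * (pC ^ i * q)⁻¹ * pC⁻¹) ∈ kleinV) ∨
      (Perm.sign q = -1 ∧ pD * (pC ^ i * q)⁻¹ * (p * (pC ^ i * q)⁻¹ * pD⁻¹) ∈ kleinV)) := by
  rcases hq with rfl | rfl <;> decide +kernel

section
variable {L : Subgroup (WrC2 (Perm (Fin 4)))} {p : Perm (Fin 4)}

/-- Classification of the subgroups of `S₄ ≀ C₂` with `T = A₄`. -/
theorem exists_isConjTo_a4W (hp : wts 1 p ∈ L) (hT : ∀ a, a ∈ 𝔸 ↔ ∃ b, wst a b ∈ L) :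
    ∃ j, IsConjTo L (a4W j) := by
  obtain ⟨N, h⟩ := exists_goursatData hp hT
  have hpA := Perm.mem_alternatingGroup.mp h.p_mem
  have hCA : pC ∈ 𝔸 := Perm.mem_alternatingGroup.mpr sign_pC
  have hAA : pA ∈ 𝔸 := Perm.mem_alternatingGroup.mpr sign_pA
  obtain ⟨c, hc⟩ := (hT pC).mp hCA
  obtain ⟨x, hx⟩ := (hT pA).mp hAA
  have hcA := Perm.mem_alternatingGroup.mp (h.snd_mem hc)
  have hxA := Perm.mem_alternatingGroup.mp (h.snd_mem hx)
  rcases alternating_normal_cases h.le h.conj_mem with rfl | rfl | rfl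
  · have hc1 := h.right_notMem hc (by rw [Subgroup.mem_bot]; decide +kernel)
    have hx1 := h.right_notMem hx (by rw [Subgroup.mem_bot]; decide +kernel)
    have hc3 := h.right_pow_mem hc (r := 3) (by decide +kernel)
    have hx2 := h.right_pow_mem hx (r := 2) (by decide +kernel)
    rw [Subgroup.mem_bot] at hc1 hx1 hc3 hx2
    -- With `N` trivial, `L` meets the base in the graph of an automorphism of A₄, which is
    -- conjugation by some `q` in S₄.
    obtain ⟨q, hq1, hq2⟩ := exists_conj_pC_pA c x ⟨hc3, hc1, hx2, hx1, hxA⟩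
    have hq := conj_mul_inv_mem (q := q) hp hT h.ker {pC, pA} closure_pCA (by
      rintro _ (rfl | rfl)
      · exact ⟨c, hc, by simp [hq1]⟩
      · exact ⟨x, hx, by simp [hq2]⟩)
    have hpq := eq_one_of_commute_pC_pA _ ⟨Subgroup.mem_bot.mp (h.commutator_mem hq hCA),
      Subgroup.mem_bot.mp (h.commutator_mem hq hAA)⟩
    rw [inv_mul_eq_one] at hpq
    -- Here `p = q²`, so the remaining element is (q, q)σ. Modulo the diagonal of A₄ it is σ or (D,
    -- D)σ according to the sign of `q`.
    rcases Int.units_eq_one_or (Perm.sign q) with hs | hs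
    · refine ⟨0, a4W_zero ▸ h.isConjTo hq ?_ ?_ ?_⟩
      · simp [hs]
      · simp [hs, hpq]
      · simp [hpq]
    · refine ⟨1, a4W_one ▸ h.isConjTo hq ?_ ?_ ?_⟩
      · simp [hs, sign_pD]
      · simp [hs, hpq, sign_pD]
      · simp [hpq]
  · have hc1 := h.right_notMem hc (by decide +kernel)
    obtain ⟨q, hq0, hq⟩ := exists_conj_pC_mod c ⟨hc1, hcA⟩
    have key : ∀ q : Perm (Fin 4), q * pC * q⁻¹ * c⁻¹ ∈ kleinV →
        ∀ a b, wst a b ∈ L → q * a * q⁻¹ * b⁻¹ ∈ kleinV := by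
      intro q hq
      refine conj_mul_inv_mem hp hT h.ker {pC, pA} closure_pCA ?_
      rintro _ (rfl | rfl)
      · exact ⟨c, hc, hq⟩
      · refine ⟨1, (h.ker _).mp (by decide +kernel), ?_⟩
        rw [inv_one, mul_one]
        exact Subgroup.Normal.conj_mem inferInstance _ (by decide +kernel) _
    obtain ⟨i, -, hi, hr⟩ := kleinV_residue hq0 p ⟨hpA, key q hq p p h.sq_mem⟩
    have hi' : pC ^ i * q * pC * (pC ^ i * q)⁻¹ * c⁻¹ ∈ kleinV := by
      have := mul_mem hi hq
      rwa [mul_assoc _ (q * pC * q⁻¹)⁻¹, inv_mul_cancel_left] at this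
    have hq' := key _ hi'
    have hsq : Perm.sign (pC ^ i * q) = Perm.sign q := by simp [sign_pC]
    set q' := pC ^ i * q
    rcases hr with ⟨hs, hr⟩ | ⟨hs, hr⟩ | ⟨hs, hr⟩ <;> rw [← hsq] at hs
    · refine ⟨2, a4W_two ▸ h.isConjTo hq' ?_ ?_ ?_⟩
      · simp [hs]
      · simp [hs, hpA]
      · simpa using hr
    · refine ⟨3, a4W_three ▸ h.isConjTo hq' ?_ ?_ ?_⟩
      · simp [hs]
      · simp [hs, hpA, sign_pC]
      · simpa using hr
    · refine ⟨4, a4W_four ▸ h.isConjTo hq' ?_ ?_ ?_⟩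
      · simp [hs, sign_pD]
      · simp [hs, hpA, sign_pD]
      · exact hr
  · exact ⟨5, a4W_five ▸ h.isConjTo_top⟩

/-- Classification of the subgroups of `S₄ ≀ C₂` with `T = S₄`. -/
theorem exists_isConjTo_s4W (hp : wts 1 p ∈ L) (hT : ∀ a, ∃ b, wst a b ∈ L) :
    ∃ j, IsConjTo L (s4W j) := by
  have hT' : ∀ a, a ∈ (⊤ : Subgroup (Perm (Fin 4))) ↔ ∃ b, wst a b ∈ L :=
    fun a => ⟨fun _ => hT a, fun _ => Subgroup.mem_top a⟩
  obtain ⟨N, h⟩ := exists_goursatData hp hT'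
  obtain ⟨c, hc⟩ := hT pC
  obtain ⟨d, hd⟩ := hT pD
  rcases perm_normal_cases (fun a => h.conj_mem a (Subgroup.mem_top a)) with
    rfl | rfl | rfl | rfl
  · obtain ⟨a, ha⟩ := hT pa
    obtain ⟨b, hb⟩ := hT pb
    have ha4 := h.right_pow_mem ha (r := 4) (by decide +kernel)
    have hb2 := h.right_pow_mem hb (r := 2) (by decide +kernel)
    have ha2' : wst (pa ^ 2) (a ^ 2) ∈ L := by
      simpa [pow_two, wst_mul_wst] using L.mul_mem ha ha
    have ha2 := h.right_notMem ha2' (by rw [Subgroup.mem_bot]; decide +kernel)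
    have hb1 := h.right_notMem hb (by rw [Subgroup.mem_bot]; decide +kernel)
    have hab' : wst (pa * pb) (a * b) ∈ L := by
      simpa [wst_mul_wst] using L.mul_mem ha hb
    have hab := h.right_pow_mem hab' (r := 3) (by decide +kernel)
    rw [Subgroup.mem_bot] at ha4 hb2 ha2 hb1 hab
    obtain ⟨q, hq1, hq2⟩ := exists_conj_pa_pb a b ⟨ha4, ha2, hb2, hb1, hab⟩
    have hq := conj_mul_inv_mem (q := q) hp hT' h.ker {pa, pb} closure_pab (by
      rintro _ (rfl | rfl)
      · exact ⟨a, ha, by simp [hq1]⟩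
      · exact ⟨b, hb, by simp [hq2]⟩)
    have hpq := eq_one_of_commute_pC_pA _
      ⟨Subgroup.mem_bot.mp (h.commutator_mem hq (Subgroup.mem_top _)),
      Subgroup.mem_bot.mp (h.commutator_mem hq (Subgroup.mem_top _))⟩
    rw [inv_mul_eq_one] at hpq
    exact ⟨0, s4W_zero ▸ h.isConjTo hq (Subgroup.mem_top _) (Subgroup.mem_top _) (by simp [hpq])⟩
  · have hc1 := h.right_notMem hc (by decide +kernel)
    have hd1 := h.right_notMem hd (by decide +kernel)
    have hc3 := h.right_pow_mem hc (r := 3) (by decide +kernel)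
    have hd2 := h.right_pow_mem hd (r := 2) (by decide +kernel)
    obtain ⟨q, hq1, hq2⟩ := exists_conj_pC_pD_mod c d ⟨hc1, hc3, hd1, hd2⟩
    have hV : ∀ v ∈ kleinV, ∃ b, wst v b ∈ L ∧ q * v * q⁻¹ * b⁻¹ ∈ kleinV := by
      refine fun v hv => ⟨1, (h.ker _).mp hv, ?_⟩
      rw [inv_one, mul_one]
      exact Subgroup.Normal.conj_mem inferInstance _ hv _
    have hq := conj_mul_inv_mem (q := q) hp hT' h.ker {pA, pB, pC, pD} closure_pABCD (by
      rintro _ (rfl | rfl | rfl | rfl)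
      · exact hV _ (by decide +kernel)
      · exact hV _ (by decide +kernel)
      · exact ⟨c, hc, hq1⟩
      · exact ⟨d, hd, hq2⟩)
    -- `p⁻¹ q²` is central modulo V₄, and S₄/V₄ has trivial centre, so `p` is `q²` modulo V₄.
    have hr := mem_kleinV_of_commute _
      ⟨h.commutator_mem hq (Subgroup.mem_top _), h.commutator_mem hq (Subgroup.mem_top _)⟩
    have hr' := Subgroup.Normal.conj_mem (H := kleinV) inferInstance _ (inv_mem hr) q
    refine ⟨1, s4W_one ▸ h.isConjTo hq (Subgroup.mem_top _) (Subgroup.mem_top _) ?_⟩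
    convert hr' using 1
    group
  · have hd1 := h.right_notMem hd (Perm.mem_alternatingGroup.not.mpr (by decide +kernel))
    have hdA : Perm.sign d = -1 := (Int.units_eq_one_or _).resolve_left
      fun h' => hd1 (Perm.mem_alternatingGroup.mpr h')
    have hV : ∀ v ∈ 𝔸, ∃ b, wst v b ∈ L ∧ 1 * v * 1⁻¹ * b⁻¹ ∈ 𝔸 :=
      fun v hv => ⟨1, (h.ker _).mp hv, by simpa using hv⟩
    -- A group of order two has no nontrivial automorphism, so no conjugation is needed. Only the
    -- sign of `p` remains as an invariant.
    have hq := conj_mul_inv_mem (q := 1) hp hT' h.ker {pA, pB, pC, pD} closure_pABCD (by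
      rintro _ (rfl | rfl | rfl | rfl)
      · exact hV _ (Perm.mem_alternatingGroup.mpr (by decide +kernel))
      · exact hV _ (Perm.mem_alternatingGroup.mpr (by decide +kernel))
      · exact hV _ (Perm.mem_alternatingGroup.mpr (by decide +kernel))
      · exact ⟨d, hd, by simp [sign_pD, hdA]⟩)
    rcases Int.units_eq_one_or (Perm.sign p) with hs | hs
    · exact ⟨2, s4W_two ▸ h.isConjTo hq (Subgroup.mem_top _) (Subgroup.mem_top _) (by simp [hs])⟩
    · exact ⟨3, s4W_three ▸ h.isConjTo hq (Subgroup.mem_top _) (Subgroup.mem_top _)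
        (by simp [hs, sign_pD])⟩
  · exact ⟨4, s4W_four ▸ h.isConjTo_top⟩

end

/-! ### The subgroups of `A₅ ≀ C₂` -/

local notation "𝔸₅" => alternatingGroup (Fin 5)

/-- The three subgroups of `A₅ ≀ C₂` with `T = A₅`. -/
def a5W (θ : MulAut 𝔸₅) : Fin 3 → Subgroup (WrC2 𝔸₅) := ![
  Subgroup.closure {wst aE aE, wst aF aF, wts 1 1},
  Subgroup.closure {wst aE (θ aE), wts 1 1},
  Subgroup.closure {wst 1 aE, wst 1 aF, wst aE 1, wst aF 1, wts 1 1}]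

variable (θ : MulAut 𝔸₅)

theorem a5W_zero : a5W θ 0 = congrGroup ⊤ ⊥ 1 1 := by
  refine Eq.trans (congrArg Subgroup.closure (Set.ext fun x => ?_))
    (closure_eq_congrGroup ∅ {aE, aF} Subgroup.closure_empty (by rw [Set.empty_union, closure_aEF]))
  simp only [Set.mem_union, Set.mem_insert_iff, Set.mem_singleton_iff, Set.image_insert_eq,
    Set.image_singleton, Set.image_empty, Set.mem_empty_iff_false, or_assoc, false_or]

theorem a5W_two : a5W θ 2 = congrGroup ⊤ ⊤ 1 1 := by
  rw [← closure_eq_congrGroup {aE, aF} ∅ closure_aEF (by rw [Set.union_empty, closure_aEF])]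
  refine le_antisymm ?_ (Subgroup.closure_mono ?_)
  · change Subgroup.closure _ ≤ _
    rw [Subgroup.closure_le]
    set M := Subgroup.closure ((fun s : 𝔸₅ => wst s 1) '' {aE, aF} ∪
      (fun s => wst s s) '' ∅ ∪ {wts 1 1}) with hM
    have ht : wts 1 1 ∈ M := Subgroup.subset_closure (Or.inr rfl)
    have hE : wst aE 1 ∈ M := Subgroup.subset_closure (Or.inl (Or.inl ⟨aE, by simp, rfl⟩))
    have hF : wst aF 1 ∈ M := Subgroup.subset_closure (Or.inl (Or.inl ⟨aF, by simp, rfl⟩))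
    have hsw : ∀ a b, wst a b ∈ M → wst b a ∈ M := fun a b h => by
      simpa [wts_mul_wst, wts_mul_wts] using M.mul_mem (M.mul_mem ht h) ht
    rintro _ (rfl | rfl | rfl | rfl | rfl)
    · exact hsw _ _ hE
    · exact hsw _ _ hF
    · exact hE
    · exact hF
    · exact ht
  · simp only [Set.image_insert_eq, Set.image_singleton, Set.image_empty, Set.union_empty]
    intro x
    simp only [Set.mem_union, Set.mem_insert_iff, Set.mem_singleton_iff]
    tauto

/-- The graph of an automorphism. -/
def graphPairs {Γ : Type*} [Group Γ] (θ : MulAut Γ) : Subgroup (Γ × Γ) where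
  carrier := {x | θ x.1 = x.2}
  one_mem' := map_one θ
  mul_mem' {x y} hx hy := by
    simp only [Set.mem_ofPred_eq] at *
    rw [Prod.fst_mul, Prod.snd_mul, map_mul, hx, hy]
  inv_mem' {x} hx := by
    simp only [Set.mem_ofPred_eq] at *
    rw [Prod.fst_inv, Prod.snd_inv, map_inv, hx]

theorem mem_graphPairs {Γ : Type*} [Group Γ] {θ : MulAut Γ} {a b : Γ} :
    (a, b) ∈ graphPairs θ ↔ θ a = b := Iff.rfl

theorem isTwist_graphPairs {Γ : Type*} [Group Γ] {θ : MulAut Γ} (h : ∀ a, θ (θ a) = a) :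
    IsTwist (graphPairs θ) 1 1 where
  sq := by simp [mem_graphPairs]
  conj a b := by
    simp only [mem_graphPairs, one_mul, inv_one, mul_one]
    rintro rfl
    exact h a

theorem card_graphPairs {Γ : Type*} [Group Γ] {θ : MulAut Γ} :
    Nat.card (graphPairs θ) = Nat.card Γ :=
  Nat.card_congr
    { toFun := fun x => x.1.1
      invFun := fun a => ⟨(a, θ a), rfl⟩
      left_inv := fun ⟨⟨a, b⟩, h⟩ => Subtype.ext (Prod.ext rfl h)
      right_inv := fun a => rfl }

/-- Two words in E and its conjugate by τ of orders three and two, valid for every odd involution τ.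
With the order five of E they show that E and its image generate A₅. -/
theorem word_orders : ∀ τ : Perm (Fin 5), Perm.sign τ = -1 ∧ τ ^ 2 = 1 →
    (pE * (τ * pE * τ⁻¹) * pE ^ 2 * (τ * pE * τ⁻¹)⁻¹) ^ 3 = 1 ∧
    pE * (τ * pE * τ⁻¹) * pE ^ 2 * (τ * pE * τ⁻¹)⁻¹ ≠ 1 ∧
    (pE * (τ * pE * τ⁻¹) * pE ^ 3 * (τ * pE * τ⁻¹)⁻¹) ^ 2 = 1 ∧
    pE * (τ * pE * τ⁻¹) * pE ^ 3 * (τ * pE * τ⁻¹)⁻¹ ≠ 1 := by decide +kernel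

variable {θ}

theorem closure_aE_theta {τ : Perm (Fin 5)} (hτ : ∀ a, (θ a : Perm (Fin 5)) = τ * a * τ⁻¹)
    (h1 : Perm.sign τ = -1) (h2 : τ ^ 2 = 1) : Subgroup.closure {aE, θ aE} = ⊤ := by
  have hE : aE ∈ Subgroup.closure {aE, θ aE} := Subgroup.subset_closure (by simp)
  have hT : θ aE ∈ Subgroup.closure {aE, θ aE} := Subgroup.subset_closure (by simp)
  obtain ⟨h3, h4, h5, h6⟩ := word_orders τ ⟨h1, h2⟩
  have e : (θ aE : Perm (Fin 5)) = τ * pE * τ⁻¹ := hτ aE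
  rw [← e] at h3 h4 h5 h6
  refine eq_top_of_orders (x := aE * θ aE * aE ^ 3 * (θ aE)⁻¹) (y := aE * θ aE * aE ^ 2 * (θ aE)⁻¹)
    (mul_mem (mul_mem (mul_mem hE hT) (pow_mem hE 3)) (inv_mem hT))
    (mul_mem (mul_mem (mul_mem hE hT) (pow_mem hE 2)) (inv_mem hT)) hE ?_ ?_ isTriangle_aEF.left
  · exact orderOf_eq_prime (Subtype.ext h5) fun h => h6 (congrArg Subtype.val h)
  · exact orderOf_eq_prime (Subtype.ext h3) fun h => h4 (congrArg Subtype.val h)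

/-- Conjugating (E, θ E) by σ gives (θ E, E), which also lies on the graph because θ is an
involution. Since E and θ E generate A₅, one pair and σ generate the whole graph. -/
theorem a5W_one (hc : Subgroup.closure {aE, θ aE} = ⊤) (hθ : ∀ a, θ (θ a) = a) :
    a5W θ 1 = twistGroup (graphPairs θ) 1 1 := by
  change Subgroup.closure {wst aE (θ aE), wts 1 1} = _
  set M := Subgroup.closure {wst aE (θ aE), wts 1 1} with hM
  have ht : wts 1 1 ∈ M := Subgroup.subset_closure (by simp)
  have hE : wst aE (θ aE) ∈ M := Subgroup.subset_closure (by simp)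
  refine le_antisymm ?_ (twistGroup_le ?_ ht)
  · rw [hM, Subgroup.closure_le]
    rintro _ (rfl | rfl)
    · exact wst_mem_twistGroup rfl
    · exact wts_mem_twistGroup _ _ _
  · have h : (⊤ : Subgroup 𝔸₅) ≤
        (M.comap wstHom).comap ((MonoidHom.id 𝔸₅).prod θ.toMonoidHom) := by
      rw [← hc, Subgroup.closure_le]
      rintro _ (rfl | rfl)
      · exact hE
      · change wst (θ aE) (θ (θ aE)) ∈ M
        rw [hθ]
        simpa [wts_mul_wst, wts_mul_wts] using M.mul_mem (M.mul_mem ht hE) ht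
    intro a b hab
    rw [← mem_graphPairs.mp hab]
    exact h (Subgroup.mem_top a)

theorem alternating_five_normal_cases {N : Subgroup 𝔸₅} (h : ∀ a, ∀ n ∈ N, a * n * a⁻¹ ∈ N) :
    N = ⊥ ∨ N = ⊤ :=
  Subgroup.Normal.eq_bot_or_eq_top ⟨fun n hn a => h a n hn⟩

theorem eq_one_of_commute_pE_pF : ∀ p : Perm (Fin 5), p * pE * p⁻¹ = pE ∧ p * pF * p⁻¹ = pF →
    p = 1 := by decide +kernel

theorem eq_one_of_central {p : 𝔸₅} (h : ∀ a, p * a * p⁻¹ = a) : p = 1 :=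
  Subtype.ext (eq_one_of_commute_pE_pF p
    ⟨congrArg Subtype.val (h aE), congrArg Subtype.val (h aF)⟩)

/-- Classification of the subgroups of `A₅ ≀ C₂` with `T = A₅`. -/
theorem exists_isConjTo_a5W {τ : Perm (Fin 5)} (hτ : ∀ a, (θ a : Perm (Fin 5)) = τ * a * τ⁻¹)
    (h1 : Perm.sign τ = -1) (h2 : τ ^ 2 = 1) {L : Subgroup (WrC2 𝔸₅)} {p : 𝔸₅}
    (hp : wts 1 p ∈ L) (hT : ∀ a, ∃ b, wst a b ∈ L) : ∃ j, IsConjTo L (a5W θ j) := by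
  have hθ : ∀ a, θ (θ a) = a := fun a => Subtype.ext (by
    rw [hτ, hτ]
    have : τ * (τ * a * τ⁻¹) * τ⁻¹ = τ ^ 2 * a * (τ ^ 2)⁻¹ := by
      simp only [pow_two, mul_inv_rev, mul_assoc]
    rw [this, h2]; simp)
  have hT' : ∀ a, a ∈ (⊤ : Subgroup 𝔸₅) ↔ ∃ b, wst a b ∈ L :=
    fun a => ⟨fun _ => hT a, fun _ => Subgroup.mem_top a⟩
  obtain ⟨N, h⟩ := exists_goursatData hp hT'
  rcases alternating_five_normal_cases (fun a => h.conj_mem a (Subgroup.mem_top a)) with rfl | rfl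
  swap
  · exact ⟨2, a5W_two θ ▸ h.isConjTo_top⟩
  obtain ⟨e, he⟩ := hT aE
  obtain ⟨f, hf⟩ := hT aF
  have hord : ∀ {a b : 𝔸₅} {r : ℕ}, wst a b ∈ L → r.Prime → orderOf a = r → orderOf b = r := by
    intro a b r hab hr ha
    have : Fact r.Prime := ⟨hr⟩
    refine orderOf_eq_prime (Subgroup.mem_bot.mp (h.right_pow_mem hab (ha ▸ pow_orderOf_eq_one a)))
      fun hb => ?_
    have := h.right_notMem hab (by
      rw [Subgroup.mem_bot]; rintro rfl; rw [orderOf_one] at ha; exact hr.one_lt.ne ha)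
    exact this (Subgroup.mem_bot.mpr hb)
  have hef : wst (aE * aF) (e * f) ∈ L := by simpa [wst_mul_wst] using L.mul_mem he hf
  have htri : IsTriangle 5 e f :=
    ⟨hord he (by norm_num) isTriangle_aEF.left, hord hf (by norm_num) isTriangle_aEF.right,
      hord hef (by norm_num) isTriangle_aEF.mul⟩
  obtain ⟨s, hs1, hs2⟩ := exists_conj_pE_pF
    (htri.map (alternatingGroup (Fin 5)).subtype (Subgroup.subtype_injective _))
  rcases Int.units_eq_one_or (Perm.sign s) with hs | hs
  · let q : 𝔸₅ := ⟨s, Perm.mem_alternatingGroup.mpr hs⟩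
    have hq1 : q * aE * q⁻¹ = e := Subtype.ext hs1
    have hq2 : q * aF * q⁻¹ = f := Subtype.ext hs2
    have hq := conj_mul_inv_mem (q := q) hp hT' h.ker {aE, aF} closure_aEF (by
      rintro _ (rfl | rfl)
      · exact ⟨e, he, by simp [hq1]⟩
      · exact ⟨f, hf, by simp [hq2]⟩)
    have hpq : p⁻¹ * (q * q) = 1 := eq_one_of_central fun a =>
      mul_inv_eq_one.mp (Subgroup.mem_bot.mp (h.commutator_mem hq (Subgroup.mem_top a)))
    rw [inv_mul_eq_one] at hpq
    exact ⟨0, a5W_zero θ ▸ h.isConjTo hq (Subgroup.mem_top _) (Subgroup.mem_top _)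
      (by simp [hpq])⟩
  -- The automorphism is conjugation by an odd `s`. As τ is odd of order two, `q = τ s` is even and
  -- the automorphism is θ after conjugation by `q`, so conjugating by (q, 1) leaves the graph of θ.
  · let q : 𝔸₅ := ⟨τ * s, Perm.mem_alternatingGroup.mpr (by simp [hs, h1])⟩
    have hgraph : ∀ a b, wst a b ∈ L → θ (q * a * q⁻¹) = b := by
      have hle : (⊤ : Subgroup 𝔸₅) ≤ (L.comap wstHom).comap ((MonoidHom.id 𝔸₅).prod
          (θ.toMonoidHom.comp (MulAut.conj q).toMonoidHom)) := by
        have key : ∀ a b : 𝔸₅, s * a * s⁻¹ = (b : Perm (Fin 5)) → θ (q * a * q⁻¹) = b := by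
          intro a b hab
          refine Subtype.ext ?_
          rw [hτ]
          change τ * (τ * s * a * (τ * s)⁻¹) * τ⁻¹ = _
          rw [← hab]
          have : τ * (τ * s * a * (τ * s)⁻¹) * τ⁻¹ = τ ^ 2 * (s * a * s⁻¹) * (τ ^ 2)⁻¹ := by
            simp only [pow_two, mul_inv_rev, mul_assoc]
          rw [this, h2]; simp
        rw [← closure_aEF, Subgroup.closure_le]
        rintro _ (rfl | rfl)
        · change wst aE (θ (q * aE * q⁻¹)) ∈ L
          rwa [key _ _ hs1]
        · change wst aF (θ (q * aF * q⁻¹)) ∈ L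
          rwa [key _ _ hs2]
      intro a b hab
      have h1 : wst a (θ (q * a * q⁻¹)) ∈ L := hle (Subgroup.mem_top a)
      have h2 := L.mul_mem hab (L.inv_mem h1)
      rw [wst_inv, wst_mul_wst, mul_inv_cancel] at h2
      have h3 := Subgroup.mem_bot.mp (h.mem_of_one h2)
      exact (mul_inv_eq_one.mp h3).symm
    have hgraph' : ∀ a, wst a (θ (q * a * q⁻¹)) ∈ L := fun a => by
      obtain ⟨b, hb⟩ := hT a
      rwa [hgraph a b hb]
    set L' := L.map (MulAut.conj (wst q 1)).toMonoidHom with hL'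
    have hmem := map_conj_eq_iff.mp hL'.symm
    have hL'g : ∀ a b, wst a b ∈ L' ↔ (a, b) ∈ graphPairs θ := by
      intro a b
      have e1 := hmem (wst (q⁻¹ * a * q) b)
      rw [wst_inv, wst_mul_wst, wst_mul_wst] at e1
      have e2 : q * (q⁻¹ * a * q) * q⁻¹ = a := by group
      rw [e2, one_mul, inv_one, mul_one] at e1
      rw [e1, mem_graphPairs]
      constructor
      · intro h
        have := hgraph _ _ h
        rwa [e2] at this
      · rintro rfl
        have := hgraph' (q⁻¹ * a * q)
        rwa [e2] at this
    have ht' : wts q (p * q⁻¹) ∈ L' := by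
      have := (hmem (wts 1 p)).mpr hp
      rw [wst_inv, wst_mul_wts, wts_mul_wst] at this
      simpa using this
    have ht : wts 1 (θ q⁻¹ * (p * q⁻¹)) ∈ L' := by
      have := L'.mul_mem ((hL'g q⁻¹ (θ q⁻¹)).mpr rfl) ht'
      rw [wst_mul_wts] at this
      simpa using this
    set r := θ q⁻¹ * (p * q⁻¹) with hr
    -- Conjugation by (1, r)σ sends (a, θ a) to (θ a, r a r⁻¹). Both lie on the graph of the
    -- involution θ, so `r` is central.
    have hr1 : r = 1 := by
      refine eq_one_of_central fun a => ?_
      have h1 : wst a (θ a) ∈ L' := (hL'g _ _).mpr rfl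
      have h2 := L'.mul_mem (L'.mul_mem ht h1) (L'.inv_mem ht)
      rw [wts_mul_wst, wts_inv, wts_mul_wts, hL'g, mem_graphPairs] at h2
      simpa [hθ] using h2.symm
    rw [hr1] at ht
    refine ⟨1, ?_⟩
    rw [a5W_one (closure_aE_theta hτ h1 h2) hθ, ← twistGroup_congr hL'g ht]
    exact IsConjTo.symm ⟨_, rfl⟩

end
end QuadricAut
namespace QuadricAut

/-! ### Recognizing isomorphism classes of finite groups -/

section
variable {A H N Q : Type*} [Group A] [Group H] [Group N] [Group Q]

/-- Identifies a subgroup of known finite order from a faithful copy of the expected group inside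
it. -/
theorem nonempty_mulEquiv_of_card {L : Subgroup A} [Finite L] (f : H →* A)
    (hf : Function.Injective f) (hL : ∀ x, f x ∈ L) (hc : Nat.card L ≤ Nat.card H) :
    Nonempty (L ≃* H) := by
  have e : f.range = L := by
    refine Subgroup.eq_of_le_of_card_ge (by rintro _ ⟨x, rfl⟩; exact hL x) ?_
    rwa [← Nat.card_congr (MonoidHom.ofInjective hf).toEquiv]
  exact ⟨((MonoidHom.ofInjective hf).trans (MulEquiv.subgroupCongr e)).symm⟩

/-- The images of `N` and `Q` meet trivially and the second normalises the first, so the semidirect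
product embeds in `L`; the order leaves room for nothing else. -/
theorem isSemidirect_of_card {L : Subgroup A} [Finite L] (i : N →* A) (j : Q →* A)
    (hi : Function.Injective i) (hj : Function.Injective j) (hiL : ∀ n, i n ∈ L)
    (hjL : ∀ q, j q ∈ L) (hconj : ∀ q n, ∃ n', j q * i n * (j q)⁻¹ = i n')
    (hd : ∀ n q, i n = j q → n = 1) (hc : Nat.card L ≤ Nat.card N * Nat.card Q) :
    IsSemidirect L N Q := by
  have hle : j.range ≤ Subgroup.normalizer (i.range : Set A) := by
    have key : ∀ q n, j q * i n * (j q)⁻¹ ∈ i.range := fun q n => by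
      obtain ⟨n', h⟩ := hconj q n
      exact ⟨n', h.symm⟩
    rintro _ ⟨q, rfl⟩
    rw [Subgroup.mem_normalizer_iff]
    refine fun x => ⟨?_, ?_⟩
    · rintro ⟨n, rfl⟩
      exact key q n
    · rintro ⟨n, hn⟩
      have := key q⁻¹ n
      rw [hn, map_inv] at this
      convert this using 1
      group
  have hdis : Disjoint i.range j.range := by
    rw [Subgroup.disjoint_def]
    rintro _ ⟨n, rfl⟩ ⟨q, hq⟩
    rw [hd n q hq.symm, map_one]
  let f := SemidirectProduct.monoidHomSubgroup hle
  have hf : Function.Injective f := by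
    intro x y hxy
    exact SemidirectProduct.equivProd.injective (Subgroup.mul_injective_of_disjoint hdis hxy)
  have hfL : ∀ x, f x ∈ L := by
    rintro ⟨⟨_, n, rfl⟩, ⟨_, q, rfl⟩⟩
    exact L.mul_mem (hiL n) (hjL q)
  obtain ⟨e⟩ := nonempty_mulEquiv_of_card f hf hfL (by
    rw [SemidirectProduct.card]
    rwa [← Nat.card_congr (MonoidHom.ofInjective hi).toEquiv,
      ← Nat.card_congr (MonoidHom.ofInjective hj).toEquiv])
  exact ⟨_, ⟨e.trans (SemidirectProduct.congr' (MonoidHom.ofInjective hi).symm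
    (MonoidHom.ofInjective hj).symm)⟩⟩

theorem isSemidirect_of_mulEquiv {G G' : Type*} [Group G] [Group G'] (e : G ≃* G')
    (h : IsSemidirect G' N Q) : IsSemidirect G N Q := by
  obtain ⟨φ, ⟨f⟩⟩ := h
  exact ⟨φ, ⟨e.trans f⟩⟩

/-- The homomorphism from a cyclic group which maps the generator to `g`. -/
def cycHom (n : ℕ) [NeZero n] (g : A) (h : g ^ n = 1) : Cyc n →* A where
  toFun x := g ^ (Multiplicative.toAdd x).val
  map_one' := by simp
  map_mul' x y := by
    rw [toAdd_mul, ZMod.val_add, ← pow_add]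
    conv_rhs => rw [← Nat.mod_add_div (ZMod.val _ + ZMod.val _) n, pow_add, pow_mul, h, one_pow,
      mul_one]

theorem cycHom_apply (n : ℕ) [NeZero n] (g : A) (h : g ^ n = 1) (x : Cyc n) :
    cycHom n g h x = g ^ (Multiplicative.toAdd x).val := rfl

theorem cycHom_injective {n : ℕ} [NeZero n] {g : A} (h : g ^ n = 1) (h' : orderOf g = n) :
    Function.Injective (cycHom n g h) := by
  intro x y hxy
  have := pow_injOn_Iio_orderOf (x := g) (by rw [h']; exact ZMod.val_lt _)
    (by rw [h']; exact ZMod.val_lt _) hxy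
  exact Multiplicative.toAdd.injective (ZMod.val_injective n this)

/-- The homomorphism from a dihedral group which maps `r i` to `x ^ i` and `sr i` to `y * x ^ i`. -/
def dihedralHom (n : ℕ) [NeZero n] (x y : A) (hx : x ^ n = 1) (hy : y * y = 1)
    (hxy : y * x * y = x⁻¹) : DihedralGroup n →* A :=
  have h1 : ∀ a b, cycHom n x hx (.ofAdd (a + b)) =
    cycHom n x hx (.ofAdd a) * cycHom n x hx (.ofAdd b) := fun a b => map_mul _ _ _
  have h2 : ∀ a, cycHom n x hx (.ofAdd (-a)) = (cycHom n x hx (.ofAdd a))⁻¹ :=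
    fun a => map_inv (cycHom n x hx) (.ofAdd a)
  have hyi : y⁻¹ = y := inv_eq_of_mul_eq_one_left hy
  have h3 : ∀ a, cycHom n x hx (.ofAdd a) * y = y * (cycHom n x hx (.ofAdd a))⁻¹ := fun a => by
    have h4 : y * x * y⁻¹ = x⁻¹ := by rw [hyi, hxy]
    have : y * x ^ a.val * y⁻¹ = (x ^ a.val)⁻¹ := by rw [← conj_pow, h4, inv_pow]
    change x ^ a.val * y = y * (x ^ a.val)⁻¹
    rw [← this, hyi, ← mul_assoc, ← mul_assoc, hy, one_mul]
  { toFun := fun g => match g with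
      | .r i => cycHom n x hx (.ofAdd i)
      | .sr i => y * cycHom n x hx (.ofAdd i)
    map_one' := by
      rw [DihedralGroup.one_def]
      exact map_one (cycHom n x hx)
    map_mul' := by
      rintro (i | i) (j | j)
      · exact h1 i j
      · rw [DihedralGroup.r_mul_sr]
        simp only [sub_eq_add_neg, h1, h2, ← mul_assoc, h3]
        rw [mul_assoc, mul_assoc, ← h2, ← h1, ← h1, add_comm]
      · rw [DihedralGroup.sr_mul_r]
        simp only [h1, ← mul_assoc]
      · rw [DihedralGroup.sr_mul_sr]
        simp only [sub_eq_add_neg, h1, h2, ← mul_assoc]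
        rw [mul_assoc y, h3, ← mul_assoc, hy, one_mul, ← h2, ← h1, ← h1, add_comm] }

theorem dihedralHom_r {n : ℕ} [NeZero n] {x y : A} (hx : x ^ n = 1) (hy : y * y = 1)
    (hxy : y * x * y = x⁻¹) (i : ZMod n) : dihedralHom n x y hx hy hxy (.r i) = x ^ i.val := rfl

theorem dihedralHom_sr {n : ℕ} [NeZero n] {x y : A} (hx : x ^ n = 1) (hy : y * y = 1)
    (hxy : y * x * y = x⁻¹) (i : ZMod n) : dihedralHom n x y hx hy hxy (.sr i) = y * x ^ i.val := rfl

theorem dihedralHom_injective {n : ℕ} [NeZero n] {x y : A} (hx : x ^ n = 1) (hy : y * y = 1)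
    (hxy : y * x * y = x⁻¹) (h' : orderOf x = n) (hyx : ∀ m, x ^ m ≠ y) :
    Function.Injective (dihedralHom n x y hx hy hxy) := by
  rw [injective_iff_map_eq_one]
  rintro (i | i) h
  · have : (Multiplicative.ofAdd i : Cyc n) = 1 := cycHom_injective hx h' (by rw [map_one]; exact h)
    have : i = 0 := this
    rw [this, DihedralGroup.one_def]
  · rw [dihedralHom_sr, mul_eq_one_iff_inv_eq, inv_eq_of_mul_eq_one_left hy] at h
    exact absurd h.symm (hyx _)

end

section
variable {Γ Γ' : Type*} [Group Γ] [Group Γ']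

theorem card_cyc (n : ℕ) : Nat.card (Cyc n) = n := Nat.card_zmod n

theorem card_wrC2 [Finite Γ] : Nat.card (WrC2 Γ) = 2 * (Nat.card Γ * Nat.card Γ) := by
  rw [RegularWreathProduct.card, card_cyc]; ring

instance [Finite Γ] : Finite (WrC2 Γ) :=
  Finite.of_equiv _ (RegularWreathProduct.equivProd Γ (Cyc 2)).symm

theorem card_congrGroup [Finite Γ] {T N : Subgroup Γ} [N.Normal] {m n : Γ} (hN : N ≤ T)
    (h : IsTwist (congrPairs T N conj_mem_of_normal) m n) :
    Nat.card (congrGroup T N m n) = 2 * (Nat.card T * Nat.card N) := by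
  rw [congrGroup, h.card, card_congrPairs hN]

/-- Functoriality of the wreath product. -/
def wrMap (f : Γ →* Γ') : WrC2 Γ →* WrC2 Γ' where
  toFun w := ⟨fun q => f (w.left q), w.right⟩
  map_one' := RegularWreathProduct.ext (funext fun _ => by simp) rfl
  map_mul' v w := RegularWreathProduct.ext (funext fun _ => by simp) rfl

theorem wrMap_wst (f : Γ →* Γ') (a b : Γ) : wrMap f (wst a b) = wst (f a) (f b) :=
  RegularWreathProduct.ext (funext fun _ => apply_ite f _ _ _) rfl

theorem wrMap_wts (f : Γ →* Γ') (a b : Γ) : wrMap f (wts a b) = wts (f a) (f b) :=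
  RegularWreathProduct.ext (funext fun _ => apply_ite f _ _ _) rfl

theorem wrMap_injective {f : Γ →* Γ'} (hf : Function.Injective f) :
    Function.Injective (wrMap f) := by
  intro v w h
  have h1 := congrArg RegularWreathProduct.left h
  have h2 : (wrMap f v).right = (wrMap f w).right := congrArg RegularWreathProduct.right h
  exact RegularWreathProduct.ext (funext fun q => hf (congrFun h1 q)) h2

/-- The homomorphism `Γ × C₂ → Γ ≀ C₂` given by the diagonal. -/
def diagHom (Γ : Type*) [Group Γ] : Γ × Cyc 2 →* WrC2 Γ where
  toFun x := ⟨fun _ => x.1, x.2⟩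
  map_one' := rfl
  map_mul' _ _ := RegularWreathProduct.ext (funext fun _ => by simp) rfl

theorem diagHom_one (a : Γ) : diagHom Γ (a, 1) = wst a a :=
  RegularWreathProduct.ext (funext fun _ => by simp [diagHom, wst]) rfl

theorem diagHom_flip (a : Γ) : diagHom Γ (a, flip) = wts a a :=
  RegularWreathProduct.ext (funext fun _ => by simp [diagHom, wts]) rfl

theorem diagHom_injective : Function.Injective (diagHom Γ) := by
  intro x y h
  exact Prod.ext (congrFun (congrArg RegularWreathProduct.left h) 1)
    (congrArg RegularWreathProduct.right h)

theorem nonempty_congrGroup_bot [Finite Γ] (T : Subgroup Γ) [T.Normal] :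
    Nonempty (congrGroup T ⊥ 1 1 ≃* T × Cyc 2) := by
  refine nonempty_mulEquiv_of_card ((diagHom Γ).comp (T.subtype.prodMap (MonoidHom.id _)))
    (diagHom_injective.comp ((Subgroup.subtype_injective T).prodMap Function.injective_id)) ?_ ?_
  · rintro ⟨a, q⟩
    rcases eq_one_or_flip q with rfl | rfl
    · change diagHom Γ (a, 1) ∈ _
      rw [diagHom_one]
      exact wst_mem_twistGroup ⟨a.2, a.2, by simp⟩
    · change diagHom Γ (a, flip) ∈ _
      rw [diagHom_flip]
      exact isTwist_congrPairs_one.wts_mem_iff.mpr ⟨by simp, by simp, by simp⟩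
  · rw [card_congrGroup bot_le isTwist_congrPairs_one, Nat.card_prod, card_cyc, Subgroup.card_bot]
    omega

/-- Conjugation by (m, 1) turns (m, m)σ into (m², 1)σ, which lies in the standard wreath product
because `m²` is in `T`. -/
theorem nonempty_congrGroup_self [Finite Γ] (T : Subgroup Γ) [T.Normal] {m : Γ} (h : m * m ∈ T) :
    Nonempty (congrGroup T T m m ≃* WrC2 T) := by
  have hT : ∀ {x g : Γ}, x ∈ T → g * x * g⁻¹ ∈ T :=
    fun {x g} hx => Subgroup.Normal.conj_mem inferInstance x hx g
  have ht : IsTwist (congrPairs T T conj_mem_of_normal) m m := isTwist_congrPairs_self h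
  refine nonempty_mulEquiv_of_card
    ((MulAut.conj (wst m 1)⁻¹).toMonoidHom.comp (wrMap T.subtype))
    ((MulAut.conj _).injective.comp (wrMap_injective (Subgroup.subtype_injective T))) ?_ ?_
  · intro w
    change (wst m 1)⁻¹ * wrMap T.subtype w * (wst m 1)⁻¹⁻¹ ∈ _
    rcases wr_cases w with ⟨a, b, rfl⟩ | ⟨a, b, rfl⟩
    · rw [wrMap_wst, wst_inv, wst_mul_wst, wst_inv, wst_mul_wst, congrGroup, ht.wst_mem_iff,
        mem_congrPairs]
      have h1 : m⁻¹ * a * m ∈ T := by simpa using hT (g := m⁻¹) a.2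
      have h2 : (b : Γ) ∈ T := b.2
      simpa using ⟨h1, T.mul_mem h1 (T.inv_mem h2)⟩
    · rw [wrMap_wts, wst_inv, wst_mul_wts, wst_inv, wts_mul_wst, congrGroup, ht.wts_mem_iff,
        mem_congrPairs]
      have h1 : m⁻¹ * a * m⁻¹ ∈ T := by
        have := T.mul_mem (hT (g := m⁻¹) a.2) (T.inv_mem h)
        convert this using 1
        group
      have h2 : (b : Γ) ∈ T := b.2
      simpa using ⟨h1, T.mul_mem h1 (T.inv_mem h2)⟩
  · rw [card_congrGroup le_rfl ht, card_wrC2]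

end
end QuadricAut
namespace QuadricAut
section
open Equiv
local notation "𝔸" => alternatingGroup (Fin 4)
local notation "𝔸₅" => alternatingGroup (Fin 5)

/-! ### Orders and structure of the listed subgroups of `S₄ ≀ C₂`. -/

theorem pC_mem : pC ∈ 𝔸 := Perm.mem_alternatingGroup.mpr sign_pC

theorem pD_mul_pD_mem {T : Subgroup (Perm (Fin 4))} : pD * pD ∈ T := by
  have : pD * pD = 1 := by decide +kernel
  rw [this]; exact one_mem _

theorem isTwist_pD (T N : Subgroup (Perm (Fin 4))) [T.Normal] [N.Normal] :
    IsTwist (congrPairs T N conj_mem_of_normal) pD pD := isTwist_congrPairs_self pD_mul_pD_mem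

/-- Expresses that A₄/V₄ is abelian. -/
theorem conj_pC_mem_kleinV : ∀ b : Perm (Fin 4), Perm.sign b = 1 →
    b * (pC * b * pC⁻¹)⁻¹ ∈ kleinV ∧ pC * b * pC⁻¹ * b⁻¹ ∈ kleinV := by decide +kernel

theorem isTwist_pC : IsTwist (congrPairs 𝔸 kleinV conj_mem_of_normal) 1 pC :=
  isTwist_congrPairs (by simpa using pC_mem) (by simp)
    fun b hb => by simpa using (conj_pC_mem_kleinV b (Perm.mem_alternatingGroup.mp hb)).1

theorem isTwist_one_pD : IsTwist (congrPairs ⊤ 𝔸 conj_mem_of_normal) 1 pD :=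
  isTwist_congrPairs (Subgroup.mem_top _) (by simp) (fun b _ => by simp [sign_pD])

theorem card_a4W (j : Fin 7) : Nat.card (a4W j) = ![24, 24, 96, 96, 96, 288, 288] j := by
  have hV := kleinV_le
  have hA := card_alternatingGroup_four
  fin_cases j
  · change Nat.card (a4W 0) = 24
    rw [a4W_zero, card_congrGroup bot_le isTwist_congrPairs_one, hA, Subgroup.card_bot]
  · change Nat.card (a4W 1) = 24
    rw [a4W_one, card_congrGroup bot_le (isTwist_pD _ _), hA, Subgroup.card_bot]
  · change Nat.card (a4W 2) = 96
    rw [a4W_two, card_congrGroup hV isTwist_congrPairs_one, hA, card_kleinV]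
  · change Nat.card (a4W 3) = 96
    rw [a4W_three, card_congrGroup hV isTwist_pC, hA, card_kleinV]
  · change Nat.card (a4W 4) = 96
    rw [a4W_four, card_congrGroup hV (isTwist_pD _ _), hA, card_kleinV]
  · change Nat.card (a4W 5) = 288
    rw [a4W_five, card_congrGroup le_rfl isTwist_congrPairs_one, hA]
  · change Nat.card (a4W 6) = 288
    rw [a4W_six, card_congrGroup le_rfl (isTwist_pD _ _), hA]

theorem card_s4W (j : Fin 5) : Nat.card (s4W j) = ![48, 192, 576, 576, 1152] j := by
  have hA := card_alternatingGroup_four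
  have hS : Nat.card (⊤ : Subgroup (Perm (Fin 4))) = 24 := Subgroup.card_top.trans card_perm_four
  fin_cases j
  · change Nat.card (s4W 0) = 48
    rw [s4W_zero, card_congrGroup bot_le isTwist_congrPairs_one, hS, Subgroup.card_bot]
  · change Nat.card (s4W 1) = 192
    rw [s4W_one, card_congrGroup le_top isTwist_congrPairs_one, hS, card_kleinV]
  · change Nat.card (s4W 2) = 576
    rw [s4W_two, card_congrGroup le_top isTwist_congrPairs_one, hS, hA]
  · change Nat.card (s4W 3) = 576
    rw [s4W_three, card_congrGroup le_top isTwist_one_pD, hS, hA]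
  · change Nat.card (s4W 4) = 1152
    rw [s4W_four, card_congrGroup le_top isTwist_congrPairs_one, hS]

theorem nonempty_a4W_zero : Nonempty (a4W 0 ≃* 𝔸 × Cyc 2) := by
  rw [a4W_zero]; exact nonempty_congrGroup_bot _

theorem nonempty_a4W_five : Nonempty (a4W 5 ≃* WrC2 𝔸) := by
  rw [a4W_five]; exact nonempty_congrGroup_self _ (by simp)

theorem nonempty_a4W_six : Nonempty (a4W 6 ≃* WrC2 𝔸) := by
  rw [a4W_six]; exact nonempty_congrGroup_self _ pD_mul_pD_mem

theorem nonempty_congrGroup_top {Γ : Type*} [Group Γ] [Finite Γ] :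
    Nonempty (congrGroup (⊤ : Subgroup Γ) ⊤ 1 1 ≃* WrC2 Γ) :=
  nonempty_mulEquiv_of_card (MonoidHom.id _) Function.injective_id
    (fun w => by
      rcases wr_cases w with ⟨a, b, rfl⟩ | ⟨a, b, rfl⟩
      · exact wst_mem_twistGroup ⟨Subgroup.mem_top _, Subgroup.mem_top _, Subgroup.mem_top _⟩
      · exact isTwist_congrPairs_one.wts_mem_iff.mpr
          ⟨Subgroup.mem_top _, Subgroup.mem_top _, Subgroup.mem_top _⟩)
    (by rw [card_congrGroup le_rfl isTwist_congrPairs_one, card_wrC2, Subgroup.card_top])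

theorem nonempty_congrGroup_top_bot {Γ : Type*} [Group Γ] [Finite Γ] :
    Nonempty (congrGroup (⊤ : Subgroup Γ) ⊥ 1 1 ≃* Γ × Cyc 2) := by
  obtain ⟨e⟩ := nonempty_congrGroup_bot (⊤ : Subgroup Γ)
  exact ⟨e.trans (Subgroup.topEquiv.prodCongr (MulEquiv.refl _))⟩

theorem nonempty_s4W_zero : Nonempty (s4W 0 ≃* Perm (Fin 4) × Cyc 2) := by
  rw [s4W_zero]; exact nonempty_congrGroup_top_bot

theorem nonempty_s4W_four : Nonempty (s4W 4 ≃* WrC2 (Perm (Fin 4))) := by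
  rw [s4W_four]; exact nonempty_congrGroup_top

theorem nonempty_a5W_zero (θ : MulAut 𝔸₅) : Nonempty (a5W θ 0 ≃* 𝔸₅ × Cyc 2) := by
  rw [a5W_zero]; exact nonempty_congrGroup_top_bot

theorem nonempty_a5W_two (θ : MulAut 𝔸₅) : Nonempty (a5W θ 2 ≃* WrC2 𝔸₅) := by
  rw [a5W_two]; exact nonempty_congrGroup_top

/-- The embedding `S₄ → S₄ × C₂ → S₄ ≀ C₂` given by the sign. -/
def signDiag : Perm (Fin 4) →* WrC2 (Perm (Fin 4)) where
  toFun s := if Perm.sign s = 1 then wst s s else wts s s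
  map_one' := by simp [wst_one]
  map_mul' s t := by
    rcases Int.units_eq_one_or (Perm.sign s) with hs | hs <;>
    rcases Int.units_eq_one_or (Perm.sign t) with ht | ht <;>
    simp [hs, ht, wst_mul_wst, wst_mul_wts, wts_mul_wst, wts_mul_wts]

theorem signDiag_even {s : Perm (Fin 4)} (h : Perm.sign s = 1) : signDiag s = wst s s := if_pos h

theorem signDiag_odd {s : Perm (Fin 4)} (h : Perm.sign s = -1) : signDiag s = wts s s :=
  if_neg (by rw [h]; decide)

theorem signDiag_injective : Function.Injective signDiag := by
  rw [injective_iff_map_eq_one]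
  intro s hs
  rcases Int.units_eq_one_or (Perm.sign s) with h | h
  · rw [signDiag_even h, ← wst_one] at hs
    exact (wst_inj.mp hs).1
  · rw [signDiag_odd h, ← wst_one] at hs
    exact absurd hs.symm (wst_ne_wts _ _ _ _)

theorem signDiag_mem (N : Subgroup (Perm (Fin 4))) [N.Normal] (s : Perm (Fin 4)) :
    signDiag s ∈ congrGroup 𝔸 N pD pD := by
  rcases Int.units_eq_one_or (Perm.sign s) with h | h
  · rw [signDiag_even h]
    exact wst_mem_twistGroup ⟨h, h, by simp⟩
  · rw [signDiag_odd h]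
    exact (isTwist_pD _ _).wts_mem_iff.mpr ⟨by simp [h, sign_pD], by simp [h, sign_pD], by simp⟩

theorem nonempty_a4W_one : Nonempty (a4W 1 ≃* Perm (Fin 4)) := by
  have : Finite (a4W 1) := inferInstance
  refine nonempty_mulEquiv_of_card signDiag signDiag_injective
    (fun s => a4W_one ▸ signDiag_mem _ s) ?_
  rw [card_a4W, card_perm_four]; rfl

/-- The isomorphism `C₂² ≃ V₄`. -/
def klein : (Fin 2 → Cyc 2) →* Perm (Fin 4) where
  toFun x := (if x 0 = 1 then 1 else pA) * (if x 1 = 1 then 1 else pB)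
  map_one' := by decide +kernel
  map_mul' := by decide +kernel

theorem klein_injective : Function.Injective klein := by
  rw [injective_iff_map_eq_one]; decide +kernel

theorem klein_mem : ∀ x, klein x ∈ kleinV := by decide +kernel

theorem exists_klein : ∀ v ∈ kleinV, ∃ x, klein x = v := by decide +kernel

/-- The embedding of `C₂⁴` with image `V₄ × V₄`. -/
def kleinSq : (Fin 4 → Cyc 2) →* WrC2 (Perm (Fin 4)) where
  toFun x := wst (klein ![x 0, x 1]) (klein ![x 2, x 3])
  map_one' := by
    rw [← wst_one]; congr 1
  map_mul' x y := by
    rw [wst_mul_wst, ← map_mul, ← map_mul]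
    congr 2 <;> (funext i; fin_cases i <;> rfl)

theorem kleinSq_injective : Function.Injective kleinSq := by
  intro x y h
  obtain ⟨h1, h2⟩ := wst_inj.mp h
  have h1 := klein_injective h1
  have h2 := klein_injective h2
  funext i
  fin_cases i
  · exact congrFun h1 0
  · exact congrFun h1 1
  · exact congrFun h2 0
  · exact congrFun h2 1

theorem exists_kleinSq {a b : Perm (Fin 4)} (ha : a ∈ kleinV) (hb : b ∈ kleinV) :
    ∃ x, kleinSq x = wst a b := by
  obtain ⟨x, rfl⟩ := exists_klein a ha
  obtain ⟨y, rfl⟩ := exists_klein b hb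
  refine ⟨![x 0, x 1, y 0, y 1], ?_⟩
  change wst _ _ = _
  congr 2 <;> (funext i; fin_cases i <;> rfl)

theorem exists_conj_kleinSq (w : WrC2 (Perm (Fin 4))) (x : Fin 4 → Cyc 2) :
    ∃ y, w * kleinSq x * w⁻¹ = kleinSq y := by
  have hV : ∀ {v s : Perm (Fin 4)}, v ∈ kleinV → s * v * s⁻¹ ∈ kleinV :=
    fun hv => Subgroup.Normal.conj_mem inferInstance _ hv _
  rcases wr_cases w with ⟨a, b, rfl⟩ | ⟨a, b, rfl⟩
  · obtain ⟨y, hy⟩ := exists_kleinSq (hV (s := a) (klein_mem ![x 0, x 1]))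
      (hV (s := b) (klein_mem ![x 2, x 3]))
    refine ⟨y, ?_⟩
    change wst a b * wst _ _ * _ = _
    rw [hy, wst_inv, wst_mul_wst, wst_mul_wst]
  · obtain ⟨y, hy⟩ := exists_kleinSq (hV (s := a) (klein_mem ![x 2, x 3]))
      (hV (s := b) (klein_mem ![x 0, x 1]))
    refine ⟨y, ?_⟩
    change wts a b * wst _ _ * _ = _
    rw [hy, wts_inv, wts_mul_wst, wts_mul_wts]

theorem kleinSq_mem {T : Subgroup (Perm (Fin 4))} (hT : kleinV ≤ T) (m n : Perm (Fin 4))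
    (x : Fin 4 → Cyc 2) : kleinSq x ∈ congrGroup T kleinV m n :=
  wst_mem_twistGroup ⟨hT (klein_mem _), hT (klein_mem _),
    kleinV.mul_mem (klein_mem _) (kleinV.inv_mem (klein_mem _))⟩

theorem wts_pow_two {Γ : Type*} [Group Γ] (a b : Γ) : wts a b ^ 2 = wst (a * b) (b * a) := by
  rw [pow_two, wts_mul_wts]

theorem wst_pow {Γ : Type*} [Group Γ] (a b : Γ) (r : ℕ) : wst a b ^ r = wst (a ^ r) (b ^ r) :=
  (map_pow wstHom (a, b) r).symm

theorem pC_pow_three : pC ^ 3 = 1 := by decide +kernel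

/-- (C, C)σ is the product of the commuting elements (C, C) of order three and σ of order two; it
generates a cyclic complement of order six to V₄ × V₄. -/
theorem wts_pC_pow : wts pC pC ^ 6 = 1 := by
  rw [show 6 = 2 * 3 from rfl, pow_mul, wts_pow_two, wst_pow, ← pow_two, ← pow_mul, mul_comm,
    pow_mul, pC_pow_three, one_pow, wst_one]

theorem orderOf_wts_pC : orderOf (wts pC pC) = 6 := by
  refine (orderOf_eq_iff (by norm_num)).mpr ⟨wts_pC_pow, fun m h1 h2 => ?_⟩
  have e2 : wts pC pC ^ 2 = wst (pC * pC) (pC * pC) := wts_pow_two _ _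
  have e3 : wts pC pC ^ 3 = wts (pC * pC * pC) (pC * pC * pC) := by
    rw [pow_succ, e2, wst_mul_wts]
  have e4 : wts pC pC ^ 4 = wst (pC * pC * (pC * pC)) (pC * pC * (pC * pC)) := by
    rw [pow_succ, e3, wts_mul_wts, mul_assoc (pC * pC)]
  have e5 : wts pC pC ^ 5 = wts (pC * pC * (pC * pC) * pC) (pC * pC * (pC * pC) * pC) := by
    rw [pow_succ, e4, wst_mul_wts]
  rw [← wst_one]
  interval_cases m
  · rw [pow_one]; exact (wst_ne_wts _ _ _ _).symm
  · rw [e2]; exact fun h => absurd (wst_inj.mp h).1 (by decide +kernel)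
  · rw [e3]; exact (wst_ne_wts _ _ _ _).symm
  · rw [e4]; exact fun h => absurd (wst_inj.mp h).1 (by decide +kernel)
  · rw [e5]; exact (wst_ne_wts _ _ _ _).symm

theorem wts_pC_mem {T : Subgroup (Perm (Fin 4))} [T.Normal] (hT : pC ∈ T) :
    wts pC pC ∈ congrGroup T kleinV 1 1 :=
  isTwist_congrPairs_one.wts_mem_iff.mpr ⟨by simpa, by simpa, by simp⟩

theorem pow_wts_pC_eq (i : ℕ) : wts pC pC ^ i = diagHom _ (pC ^ i, flip ^ i) := by
  rw [← diagHom_flip, ← map_pow]; rfl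

theorem pC_pow_eq_one_of_mem (i : ℕ) (h : pC ^ i ∈ kleinV) : pC ^ i = 1 := by
  have e : pC ^ i = pC ^ (i % 3) := by
    conv_lhs => rw [← Nat.mod_add_div i 3, pow_add, pow_mul, pC_pow_three, one_pow, mul_one]
  have key : ∀ j < 3, pC ^ j ∈ kleinV → pC ^ j = 1 := by decide +kernel
  rw [e] at h ⊢
  exact key _ (Nat.mod_lt _ (by norm_num)) h

theorem card_fun_cyc (n : ℕ) : Nat.card (Fin n → Cyc 2) = 2 ^ n := by
  rw [Nat.card_fun, card_cyc, Nat.card_fin]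

/-- An element of `V₄ × V₄` which lies on the diagonal together with a complement of `V₄`
is trivial. -/
theorem kleinSq_eq_one_of_diag {x : Fin 4 → Cyc 2} {a : Perm (Fin 4)} {q : Cyc 2}
    (h : kleinSq x = diagHom _ (a, q)) (ha : a ∈ kleinV → a = 1) : x = 1 := by
  rcases eq_one_or_flip q with rfl | rfl
  · rw [diagHom_one] at h
    obtain ⟨h1, h2⟩ := wst_inj.mp h
    have : a = 1 := ha (h1 ▸ klein_mem _)
    apply kleinSq_injective
    rw [h, this, map_one, wst_one]
  · rw [diagHom_flip] at h
    exact absurd h (wst_ne_wts _ _ _ _)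

theorem isSemidirect_a4W_two : IsSemidirect (a4W 2) (Fin 4 → Cyc 2) (Cyc 6) := by
  refine isSemidirect_of_card kleinSq (cycHom 6 (wts pC pC) wts_pC_pow) kleinSq_injective
    (cycHom_injective _ orderOf_wts_pC) (fun x => a4W_two ▸ kleinSq_mem kleinV_le _ _ x)
    (fun q => Subgroup.pow_mem _ (a4W_two ▸ wts_pC_mem pC_mem) _)
    (fun q x => exists_conj_kleinSq _ x) (fun x q h => ?_) ?_
  · rw [cycHom_apply, pow_wts_pC_eq] at h
    exact kleinSq_eq_one_of_diag h (pC_pow_eq_one_of_mem _)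
  · rw [card_a4W, card_fun_cyc, card_cyc]; decide

/-- Conjugation by (C, 1) preserves the fibre product, since A₄/V₄ is abelian, and moves σ to (C,
C⁻¹)σ. This is congruent to (1, C⁻²)σ = (1, C)σ, so the two groups are conjugate and the structure
of one carries over to the other. -/
theorem isConjTo_a4W_two_three : IsConjTo (a4W 2) (a4W 3) := by
  have ht : IsTwist (congrPairs 𝔸 kleinV conj_mem_of_normal) 1 1 := isTwist_congrPairs_one
  have h : GoursatData (a4W 2) 𝔸 kleinV 1 := by
    rw [a4W_two]
    refine ⟨wts_mem_twistGroup _ _ _, fun a => ?_, fun n => ?_⟩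
    · simp only [congrGroup, ht.wst_mem_iff, mem_congrPairs]
      exact ⟨fun h => ⟨a, h, h, by simp⟩, fun ⟨b, h, _⟩ => h⟩
    · rw [congrGroup, ht.wst_mem_iff, mem_congrPairs]
      exact ⟨fun h => ⟨kleinV_le h, one_mem _, by simpa using h⟩, fun h => by simpa using h.2.2⟩
  rw [a4W_three]
  refine h.isConjTo (q := pC) (fun a b hab => ?_) ?_ ?_ (by decide +kernel)
  · rw [a4W_two, congrGroup, ht.wst_mem_iff, mem_congrPairs] at hab
    have := kleinV.mul_mem (conj_pC_mem_kleinV a (Perm.mem_alternatingGroup.mp hab.1)).2 hab.2.2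
    rwa [mul_assoc _ a⁻¹, inv_mul_cancel_left] at this
  · simp [sign_pC]
  · simp [sign_pC]

theorem isSemidirect_a4W_three : IsSemidirect (a4W 3) (Fin 4 → Cyc 2) (Cyc 6) := by
  obtain ⟨e⟩ := isConjTo_a4W_two_three.nonempty_mulEquiv
  exact isSemidirect_of_mulEquiv e isSemidirect_a4W_two

/-- The embedding of `C₂²` into `V₄ × V₄` as the graph of the conjugation with `C`. -/
def kleinGraph : (Fin 2 → Cyc 2) →* WrC2 (Perm (Fin 4)) :=
  wstHom.comp (klein.prod ((MulAut.conj pC).toMonoidHom.comp klein))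

theorem kleinGraph_apply (x : Fin 2 → Cyc 2) :
    kleinGraph x = wst (klein x) (pC * klein x * pC⁻¹) := rfl

/-- Even permutations act on V₄ by maps commuting with conjugation by C, odd ones invert the latter,
and the swap in (s, s)σ compensates this. So the graph of conjugation by C on V₄ is normalised by
the copy `signDiag` of S₄, and it meets the diagonal trivially because the conjugation has no
nontrivial fixed point. -/
theorem conj_pC_kleinV : ∀ v ∈ kleinV, ∀ s : Perm (Fin 4),
    pC * v * pC⁻¹ ∈ kleinV ∧ (v = pC * v * pC⁻¹ → v = 1) ∧
    (Perm.sign s = 1 ∧ pC * (s * v * s⁻¹) * pC⁻¹ = s * (pC * v * pC⁻¹) * s⁻¹ ∨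
    Perm.sign s = -1 ∧ pC * (s * (pC * v * pC⁻¹) * s⁻¹) * pC⁻¹ = s * v * s⁻¹) := by
  decide +kernel

theorem isSemidirect_a4W_four : IsSemidirect (a4W 4) (Fin 2 → Cyc 2) (Perm (Fin 4)) := by
  have hV : ∀ {v s : Perm (Fin 4)}, v ∈ kleinV → s * v * s⁻¹ ∈ kleinV :=
    fun hv => Subgroup.Normal.conj_mem inferInstance _ hv _
  refine isSemidirect_of_card kleinGraph signDiag
    (wstHom_injective.comp fun x y h => klein_injective (congrArg Prod.fst h)) signDiag_injective
    (fun x => ?_) (fun s => a4W_four ▸ signDiag_mem _ s) (fun s x => ?_) (fun x s h => ?_) ?_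
  · rw [a4W_four, kleinGraph_apply]
    have h1 := klein_mem x
    have h2 := hV (s := pC) h1
    exact wst_mem_twistGroup ⟨kleinV_le h1, kleinV_le h2, kleinV.mul_mem h1 (kleinV.inv_mem h2)⟩
  · obtain ⟨h1, -, ⟨hs, h⟩ | ⟨hs, h⟩⟩ := conj_pC_kleinV _ (klein_mem x) s
    · obtain ⟨y, hy⟩ := exists_klein _ (hV (s := s) (klein_mem x))
      refine ⟨y, ?_⟩
      rw [signDiag_even hs, kleinGraph_apply, kleinGraph_apply, wst_inv, wst_mul_wst, wst_mul_wst,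
        hy, h]
    · obtain ⟨y, hy⟩ := exists_klein _ (hV (s := s) h1)
      refine ⟨y, ?_⟩
      rw [signDiag_odd hs, kleinGraph_apply, kleinGraph_apply, wts_inv, wts_mul_wst, wts_mul_wts,
        hy, h]
  · rw [kleinGraph_apply] at h
    rcases Int.units_eq_one_or (Perm.sign s) with hs | hs
    · rw [signDiag_even hs, wst_inj] at h
      have := (conj_pC_kleinV _ (klein_mem x) 1).2.1 (h.1.trans h.2.symm)
      exact klein_injective (this.trans (map_one _).symm)
    · rw [signDiag_odd hs] at h
      exact absurd h (wst_ne_wts _ _ _ _)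
  · rw [card_a4W, card_fun_cyc, card_perm_four]; decide

end
end QuadricAut
namespace QuadricAut
section
open Equiv
local notation "𝔸" => alternatingGroup (Fin 4)
local notation "𝔸₅" => alternatingGroup (Fin 5)

theorem pD_mul_pD : pD * pD = 1 := by decide +kernel

theorem wts_pC_conj : wst pD pD * wts pC pC * wst pD pD = (wts pC pC)⁻¹ := by
  have : pD * pC * pD = pC⁻¹ := by decide +kernel
  rw [wst_mul_wts, wts_mul_wst, wts_inv, this]

theorem wts_pC_pow_ne (m : ℕ) : wts pC pC ^ m ≠ wst pD pD := by
  rw [pow_wts_pC_eq]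
  intro h
  have h1 : pC ^ m = pD := congrFun (congrArg RegularWreathProduct.left h) 1
  have h2 := congrArg Perm.sign h1
  rw [map_pow, sign_pC, sign_pD, one_pow] at h2
  exact absurd h2 (by decide)

theorem kleinV_pD_pC (i : ℕ) : pD * pC ^ i ∉ kleinV := fun h => by
  have h1 := Perm.mem_alternatingGroup.mp (kleinV_le h)
  rw [map_mul, map_pow, sign_pC, sign_pD, one_pow] at h1
  exact absurd h1 (by decide)

/-- The complement of V₄ × V₄ is generated by (C, C)σ of order six and by (D, D), which inverts it.
-/
theorem isSemidirect_s4W_one : IsSemidirect (s4W 1) (Fin 4 → Cyc 2) (DihedralGroup 6) := by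
  have hyy : wst pD pD * wst pD pD = 1 := by rw [wst_mul_wst, pD_mul_pD, wst_one]
  have hC : wts pC pC ∈ s4W 1 := s4W_one ▸ wts_pC_mem (Subgroup.mem_top _)
  have hD : wst pD pD ∈ s4W 1 := by
    rw [s4W_one]
    exact wst_mem_twistGroup ⟨Subgroup.mem_top _, Subgroup.mem_top _, by simp⟩
  refine isSemidirect_of_card kleinSq (dihedralHom 6 (wts pC pC) (wst pD pD) wts_pC_pow hyy
    wts_pC_conj) kleinSq_injective (dihedralHom_injective _ _ _ orderOf_wts_pC wts_pC_pow_ne)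
    (fun x => s4W_one ▸ kleinSq_mem le_top _ _ x) ?_ (fun q x => exists_conj_kleinSq _ x) ?_ ?_
  · rintro (i | i)
    · exact Subgroup.pow_mem _ hC _
    · exact Subgroup.mul_mem _ hD (Subgroup.pow_mem _ hC _)
  · rintro x (i | i) h
    · rw [dihedralHom_r, pow_wts_pC_eq] at h
      exact kleinSq_eq_one_of_diag h (pC_pow_eq_one_of_mem _)
    · rw [dihedralHom_sr, pow_wts_pC_eq, ← diagHom_one, ← map_mul] at h
      exact kleinSq_eq_one_of_diag h fun h => absurd h (kleinV_pD_pC _)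
  · rw [card_s4W, card_fun_cyc, DihedralGroup.nat_card]; decide

/-- The embedding of `A₄ × A₄`. -/
def altSq : 𝔸 × 𝔸 →* WrC2 (Perm (Fin 4)) := wstHom.comp ((𝔸).subtype.prodMap (𝔸).subtype)

theorem altSq_apply (x : 𝔸 × 𝔸) : altSq x = wst (x.1 : Perm (Fin 4)) x.2 := rfl

theorem altSq_injective : Function.Injective altSq :=
  wstHom_injective.comp ((Subgroup.subtype_injective 𝔸).prodMap (Subgroup.subtype_injective 𝔸))

theorem altSq_mem (m n : Perm (Fin 4)) (x : 𝔸 × 𝔸) : altSq x ∈ congrGroup ⊤ 𝔸 m n :=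
  wst_mem_twistGroup ⟨Subgroup.mem_top _, Subgroup.mem_top _, mul_mem x.1.2 (inv_mem x.2.2)⟩

theorem exists_conj_altSq (w : WrC2 (Perm (Fin 4))) (x : 𝔸 × 𝔸) :
    ∃ y, w * altSq x * w⁻¹ = altSq y := by
  have hA : ∀ (v : 𝔸) (s : Perm (Fin 4)), s * v * s⁻¹ ∈ 𝔸 :=
    fun v s => Subgroup.Normal.conj_mem inferInstance _ v.2 _
  rcases wr_cases w with ⟨a, b, rfl⟩ | ⟨a, b, rfl⟩
  · refine ⟨(⟨_, hA x.1 a⟩, ⟨_, hA x.2 b⟩), ?_⟩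
    rw [altSq_apply, altSq_apply, wst_inv, wst_mul_wst, wst_mul_wst]
  · refine ⟨(⟨_, hA x.2 a⟩, ⟨_, hA x.1 b⟩), ?_⟩
    rw [altSq_apply, altSq_apply, wts_inv, wts_mul_wst, wts_mul_wts]

theorem card_altSq : Nat.card (𝔸 × 𝔸) = 144 := by
  rw [Nat.card_prod, card_alternatingGroup_four]

/-- The embedding of `C₂²` with image generated by `(D, D)` and `σ`. -/
def diagD : (Fin 2 → Cyc 2) →* WrC2 (Perm (Fin 4)) where
  toFun x := diagHom _ (if x 0 = 1 then 1 else pD, x 1)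
  map_one' := map_one _
  map_mul' x y := by
    rw [← map_mul]
    congr 1
    refine Prod.ext ?_ rfl
    have h : ∀ u v : Cyc 2, (if u * v = 1 then 1 else pD) =
      (if u = 1 then 1 else pD) * if v = 1 then 1 else pD := by decide +kernel
    exact h _ _

theorem diagD_apply (x : Fin 2 → Cyc 2) :
    diagD x = diagHom _ (if x 0 = 1 then 1 else pD, x 1) := rfl

theorem pD_ne_one : pD ≠ 1 := by decide +kernel

theorem diagD_injective : Function.Injective diagD := by
  rw [injective_iff_map_eq_one]
  intro x h
  have h1 := diagHom_injective (h.trans (map_one (diagHom _)).symm)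
  rw [Prod.mk_eq_one] at h1
  funext i
  fin_cases i
  · by_contra h0
    change ¬ x 0 = 1 at h0
    rw [if_neg h0] at h1
    exact pD_ne_one h1.1
  · exact h1.2

theorem isSemidirect_s4W_two : IsSemidirect (s4W 2) (𝔸 × 𝔸) (Fin 2 → Cyc 2) := by
  refine isSemidirect_of_card altSq diagD altSq_injective diagD_injective
    (fun x => s4W_two ▸ altSq_mem _ _ x) (fun q => ?_) (fun q x => exists_conj_altSq _ x)
    (fun x q h => ?_) ?_
  · rw [s4W_two, diagD_apply]
    rcases eq_one_or_flip (q 1) with hq | hq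
    · rw [hq, diagHom_one]
      exact wst_mem_twistGroup ⟨Subgroup.mem_top _, Subgroup.mem_top _, by simp⟩
    · rw [hq, diagHom_flip]
      exact isTwist_congrPairs_one.wts_mem_iff.mpr
        ⟨Subgroup.mem_top _, Subgroup.mem_top _, by simp⟩
  · rw [altSq_apply, diagD_apply] at h
    rcases eq_one_or_flip (q 1) with hq | hq
    · rw [hq, diagHom_one] at h
      obtain ⟨h1, h2⟩ := wst_inj.mp h
      by_cases h0 : q 0 = 1
      · rw [if_pos h0] at h1 h2
        exact Prod.ext (Subtype.ext h1) (Subtype.ext h2)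
      · rw [if_neg h0] at h1
        have := Perm.mem_alternatingGroup.mp x.1.2
        rw [h1, sign_pD] at this
        exact absurd this (by decide)
    · rw [hq, diagHom_flip] at h
      exact absurd h (wst_ne_wts _ _ _ _)
  · rw [card_s4W, card_fun_cyc, card_altSq]; decide

/-- The complement of A₄ × A₄ is generated by (1, D)σ, whose square is (D, D) and whose order is
therefore four. -/
theorem isSemidirect_s4W_three : IsSemidirect (s4W 3) (𝔸 × 𝔸) (Cyc 4) := by
  have e2 : wts 1 pD ^ 2 = wst pD pD := by rw [wts_pow_two, one_mul, mul_one]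
  have e3 : wts 1 pD ^ 3 = wts pD (pD * pD) := by
    rw [pow_succ, e2, wst_mul_wts, mul_one]
  have e4 : wts 1 pD ^ 4 = 1 := by
    rw [pow_succ, e3, wts_mul_wts, pD_mul_pD, one_mul, wst_one]
  have hord : orderOf (wts 1 pD) = 4 := orderOf_eq_four e4 (by
    rw [e2, ← wst_one]; exact fun h => pD_ne_one (wst_inj.mp h).1)
  refine isSemidirect_of_card altSq (cycHom 4 (wts 1 pD) e4) altSq_injective
    (cycHom_injective _ hord)
    (fun x => s4W_three ▸ altSq_mem _ _ x) (fun q => Subgroup.pow_mem _ ?_ _)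
    (fun q x => exists_conj_altSq _ x) (fun x q h => ?_) ?_
  · rw [s4W_three]; exact wts_mem_twistGroup _ _ _
  · rw [altSq_apply, cycHom_apply] at h
    have hlt : (Multiplicative.toAdd q).val < 4 := ZMod.val_lt _
    generalize (Multiplicative.toAdd q).val = m at h hlt
    interval_cases m
    · rw [pow_zero, ← wst_one, wst_inj] at h
      exact Prod.ext (Subtype.ext h.1) (Subtype.ext h.2)
    · rw [pow_one] at h; exact absurd h (wst_ne_wts _ _ _ _)
    · rw [e2, wst_inj] at h
      have := Perm.mem_alternatingGroup.mp x.1.2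
      rw [h.1, sign_pD] at this
      exact absurd this (by decide)
    · rw [e3] at h; exact absurd h (wst_ne_wts _ _ _ _)
  · rw [card_s4W, card_cyc, card_altSq]; decide

/-! ### The groups with `T = A₅` -/

section
variable {θ : MulAut 𝔸₅} {τ : Perm (Fin 5)} (hτ : ∀ a, (θ a : Perm (Fin 5)) = τ * a * τ⁻¹)
    (h1 : Perm.sign τ = -1) (h2 : τ ^ 2 = 1)
include hτ h1 h2

theorem theta_theta (a : 𝔸₅) : θ (θ a) = a := Subtype.ext (by
  rw [hτ, hτ]
  have : τ * (τ * a * τ⁻¹) * τ⁻¹ = τ ^ 2 * a * (τ ^ 2)⁻¹ := by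
    simp only [pow_two, mul_inv_rev, mul_assoc]
  rw [this, h2]; simp)

theorem card_a5W (j : Fin 3) : Nat.card (a5W θ j) = ![120, 120, 7200] j := by
  have hA : Nat.card (⊤ : Subgroup 𝔸₅) = 60 := Subgroup.card_top.trans card_alternatingGroup_five
  fin_cases j
  · change Nat.card (a5W θ 0) = 120
    rw [a5W_zero, card_congrGroup bot_le isTwist_congrPairs_one, hA, Subgroup.card_bot]
  · change Nat.card (a5W θ 1) = 120
    rw [a5W_one (closure_aE_theta hτ h1 h2) (theta_theta hτ h1 h2),
      (isTwist_graphPairs (theta_theta hτ h1 h2)).card, card_graphPairs, card_alternatingGroup_five]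
  · change Nat.card (a5W θ 2) = 7200
    rw [a5W_two, card_congrGroup le_top isTwist_congrPairs_one, hA]

/-- S₅ embeds by `p ↦ (p, τ p τ)` for even `p` and `p ↦ (p τ, τ p)σ` for odd `p`. In both cases the
pair is of the form (a, θ a) with `a` even, so the image lies in the group; the orders agree. The
calculation takes place in `S₅ ≀ C₂`, where τ is available. -/
theorem nonempty_a5W_one : Nonempty (a5W θ 1 ≃* Perm (Fin 5)) := by
  have hττ : τ * τ = 1 := by rw [← pow_two, h2]
  have hτi : τ⁻¹ = τ := inv_eq_of_mul_eq_one_left hττ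
  have c1 : ∀ x, τ * (τ * x) = x := fun x => by rw [← mul_assoc, hττ, one_mul]
  let f : Perm (Fin 5) →* WrC2 (Perm (Fin 5)) :=
    { toFun := fun p => if Perm.sign p = 1 then wst p (τ * p * τ) else wts (p * τ) (τ * p)
      map_one' := by simp [hττ, wst_one]
      map_mul' := fun s t => by
        rcases Int.units_eq_one_or (Perm.sign s) with hs | hs <;>
        rcases Int.units_eq_one_or (Perm.sign t) with ht | ht <;>
        simp [hs, ht, wst_mul_wst, wst_mul_wts, wts_mul_wst, wts_mul_wts, mul_assoc, c1] }
  have heven : ∀ {p}, Perm.sign p = 1 → f p = wst p (τ * p * τ) := fun h => if_pos h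
  have hodd : ∀ {p}, Perm.sign p = -1 → f p = wts (p * τ) (τ * p) :=
    fun h => if_neg (by rw [h]; decide)
  have hf : Function.Injective f := by
    rw [injective_iff_map_eq_one]
    intro s hs
    rcases Int.units_eq_one_or (Perm.sign s) with h | h
    · rw [heven h, ← wst_one] at hs
      exact (wst_inj.mp hs).1
    · rw [hodd h, ← wst_one] at hs
      exact absurd hs.symm (wst_ne_wts _ _ _ _)
  have hg : Function.Injective (wrMap (𝔸₅).subtype) := wrMap_injective (Subgroup.subtype_injective _)
  have hc : Nat.card ((a5W θ 1).map (wrMap (𝔸₅).subtype)) = 120 := by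
    rw [← Nat.card_congr ((a5W θ 1).equivMapOfInjective _ hg).toEquiv, card_a5W hτ h1 h2]; rfl
  have hθ := theta_theta hτ h1 h2
  obtain ⟨e⟩ := nonempty_mulEquiv_of_card (L := (a5W θ 1).map (wrMap (𝔸₅).subtype)) f hf
    (fun p => by
      rw [a5W_one (closure_aE_theta hτ h1 h2) hθ]
      rcases Int.units_eq_one_or (Perm.sign p) with h | h
      · have hp : p ∈ 𝔸₅ := Perm.mem_alternatingGroup.mpr h
        refine ⟨wst ⟨p, hp⟩ (θ ⟨p, hp⟩), wst_mem_twistGroup rfl, ?_⟩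
        rw [wrMap_wst, heven h]
        congr 1
        exact (hτ _).trans (by rw [hτi])
      · have hp : p * τ ∈ 𝔸₅ := Perm.mem_alternatingGroup.mpr (by simp [h, h1])
        refine ⟨wts ⟨_, hp⟩ (θ ⟨_, hp⟩), (isTwist_graphPairs hθ).wts_mem_iff.mpr ?_, ?_⟩
        · rw [inv_one, mul_one, mul_one]; rfl
        · rw [wrMap_wts, hodd h]
          congr 1
          exact (hτ _).trans (by simp only [mul_assoc]; rw [mul_inv_cancel, mul_one]))
    (by rw [hc, Nat.card_perm]; simp [Nat.factorial])
  exact ⟨((a5W θ 1).equivMapOfInjective _ hg).trans e⟩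

end
end
end QuadricAut
namespace QuadricAut

/-! ### Presentations of `S₄` and `A₅` -/

section
variable {P : Type*} [Group P]

theorem pow_eq_pow_mod' {x : P} {n : ℕ} (hx : x ^ n = 1) (j : ℕ) : x ^ j = x ^ (j % n) := by
  conv_lhs => rw [← Nat.mod_add_div j n, pow_add, pow_mul, hx, one_pow, mul_one]

/-- Coset enumeration. -/
theorem card_closure_le_of_cosets {x y : P} {n m : ℕ} (hn : 0 < n) (hx : x ^ n = 1) (hy : y ^ 2 = 1)
    (v : Fin m → P) (h1 : ∃ i, v i = 1) (hxv : ∀ i, ∃ i' c, x * v i = v i' * x ^ c)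
    (hyv : ∀ i, ∃ i' c, y * v i = v i' * x ^ c) :
    Finite (Subgroup.closure {x, y}) ∧ Nat.card (Subgroup.closure {x, y}) ≤ m * n := by
  have := NeZero.of_pos hn
  -- The products `v i * x ^ j` fill the left cosets `v i ⟨x⟩`. Their set contains 1 and is stable
  -- under left multiplication by the generators, hence contains the generated group.
  let f : Fin m × Fin n → P := fun p => v p.1 * x ^ (p.2 : ℕ)
  have hf : ∀ i (j : ℕ), v i * x ^ j ∈ Set.range f := fun i j =>
    ⟨(i, ⟨j % n, Nat.mod_lt _ hn⟩), by simp only [f]; rw [← pow_eq_pow_mod' hx]⟩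
  have step : ∀ (g : P), (∀ i, ∃ i' c, g * v i = v i' * x ^ c) →
      ∀ s ∈ Set.range f, g * s ∈ Set.range f := by
    rintro g hg _ ⟨⟨i, j⟩, rfl⟩
    obtain ⟨i', c, h⟩ := hg i
    simp only [f]
    rw [← mul_assoc, h, mul_assoc, ← pow_add]
    exact hf _ _
  have stepX := step x hxv
  have stepY := step y hyv
  have hsub : ∀ g ∈ Subgroup.closure {x, y}, g ∈ Set.range f := by
    intro g hg
    induction hg using Subgroup.closure_induction_left with
    | one =>
      obtain ⟨i, hi⟩ := h1
      have := hf i 0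
      rwa [hi, one_mul, pow_zero] at this
    | mul_left z hz s _ hs =>
      rcases hz with rfl | rfl
      · exact stepX s hs
      · exact stepY s hs
    | inv_mul_cancel z hz s _ hs =>
      rcases hz with rfl | rfl
      · have hi : ∀ j : ℕ, z ^ j * s ∈ Set.range f := by
          intro j
          induction j with
          | zero => rwa [pow_zero, one_mul]
          | succ j ih => rw [pow_succ', mul_assoc]; exact stepX _ ih
        have e : z⁻¹ = z ^ (n - 1) := by
          rw [inv_eq_iff_mul_eq_one, ← pow_succ', Nat.sub_add_cancel hn, hx]
        rw [e]
        exact hi _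
      · have e : z⁻¹ = z := by rw [inv_eq_iff_mul_eq_one, ← pow_two, hy]
        rw [e]
        exact stepY s hs
  have hfin : (Set.range f).Finite := Set.finite_range f
  have hfin' : ((Subgroup.closure {x, y} : Subgroup P) : Set P).Finite := hfin.subset hsub
  refine ⟨hfin', ?_⟩
  calc Nat.card (Subgroup.closure {x, y}) ≤ Nat.card (Set.range f) := Nat.card_mono hfin hsub
    _ ≤ Nat.card (Fin m × Fin n) := Finite.card_range_le f
    _ = m * n := by simp

/-- The relations close up on six left cosets of ⟨a⟩. The rules `r1`, `r2`, `r3` rewrite the only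
products that are not visibly in the table. -/
theorem card_closure_le_twentyFour {a b : P} (ha : a ^ 4 = 1) (hb : b ^ 2 = 1)
    (hab : (a * b) ^ 3 = 1) :
    Finite (Subgroup.closure {a, b}) ∧ Nat.card (Subgroup.closure {a, b}) ≤ 24 := by
  have hbb : b * b = 1 := by rw [← pow_two, hb]
  have hbi : b⁻¹ = b := inv_eq_of_mul_eq_one_left hbb
  have hai : a ^ 3 = a⁻¹ := by rw [eq_inv_iff_mul_eq_one, ← pow_succ, ha]
  have r1 : b * a * b = a⁻¹ * b * a⁻¹ := by
    have : b * a * b = a⁻¹ * (a * b) ^ 3 * b⁻¹ * a⁻¹ := by rw [pow_succ, pow_two]; group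
    rw [this, hab, hbi, mul_one]
  have r2 : b * a⁻¹ * b = a * b * a := by
    have := congrArg (·⁻¹) r1
    simp only [mul_inv_rev, hbi, inv_inv] at this
    rw [mul_assoc, this, mul_assoc]
  have r3 : a * (b * a ^ 2 * b) = b * a ^ 2 * b * a⁻¹ := by
    calc a * (b * a ^ 2 * b) = (a * b * a) * (a * b) := by rw [pow_two]; group
      _ = b * a⁻¹ * (b * a * b) := by rw [← r2]; group
      _ = b * a⁻¹ * a⁻¹ * b * a⁻¹ := by rw [r1]; group
      _ = b * (a ^ 3 * a⁻¹) * b * a⁻¹ := by rw [hai]; group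
      _ = b * a ^ 2 * b * a⁻¹ := by group
  refine card_closure_le_of_cosets (n := 4) (m := 6) (by norm_num) ha hb
    ![1, b, a * b, a ^ 2 * b, a ^ 3 * b, b * a ^ 2 * b] ⟨0, rfl⟩ ?_ ?_
  · intro i
    fin_cases i
    · exact ⟨0, 1, by simp⟩
    · exact ⟨2, 0, by simp⟩
    · exact ⟨3, 0, by simp [pow_two, mul_assoc]⟩
    · exact ⟨4, 0, by simp [pow_succ', mul_assoc]⟩
    · exact ⟨1, 0, by simp [hai]⟩
    · exact ⟨5, 3, by simpa [hai] using r3⟩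
  · intro i
    fin_cases i
    · exact ⟨1, 0, by simp⟩
    · exact ⟨0, 0, by simp [hbb]⟩
    · exact ⟨4, 3, by simpa [hai, mul_assoc] using r1⟩
    · exact ⟨5, 0, by simp [mul_assoc]⟩
    · exact ⟨2, 1, by simpa [hai, mul_assoc] using r2⟩
    · refine ⟨3, 0, ?_⟩
      change b * (b * a ^ 2 * b) = a ^ 2 * b * a ^ 0
      rw [mul_assoc, ← mul_assoc, hbb, one_mul, pow_zero, mul_one]

/-- The same with twelve left cosets of ⟨a⟩: the trivial one, the five of `a ^ i b`, the five of `a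
^ i b a² b`, and that of `b a³ b a² b`, which is fixed by `a` in view of `r9`. -/
theorem card_closure_le_sixty {a b : P} (ha : a ^ 5 = 1) (hb : b ^ 2 = 1)
    (hab : (a * b) ^ 3 = 1) :
    Finite (Subgroup.closure {a, b}) ∧ Nat.card (Subgroup.closure {a, b}) ≤ 60 := by
  have hbb : b * b = 1 := by rw [← pow_two, hb]
  have hbi : b⁻¹ = b := inv_eq_of_mul_eq_one_left hbb
  have hai : a ^ 4 = a⁻¹ := by rw [eq_inv_iff_mul_eq_one, ← pow_succ, ha]
  have hai2 : a ^ 3 = a⁻¹ * a⁻¹ := by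
    rw [← hai, ← pow_add, show 4 + 4 = 5 + 3 from rfl, pow_add, ha, one_mul]
  have r1 : b * a * b = a⁻¹ * b * a⁻¹ := by
    have : b * a * b = a⁻¹ * (a * b) ^ 3 * b⁻¹ * a⁻¹ := by rw [pow_succ, pow_two]; group
    rw [this, hab, hbi, mul_one]
  have r2 : b * a⁻¹ * b = a * b * a := by
    have := congrArg (·⁻¹) r1
    simp only [mul_inv_rev, hbi, inv_inv] at this
    rw [mul_assoc, this, mul_assoc]
  have r4 : b * a ^ 3 * b = a * b * a ^ 2 * b * a := by
    calc b * a ^ 3 * b = b * a⁻¹ * (b * b) * a⁻¹ * b := by rw [hai2, hbb]; group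
      _ = (b * a⁻¹ * b) * (b * a⁻¹ * b) := by group
      _ = a * b * a ^ 2 * b * a := by rw [r2, pow_two]; group
  have r5 : b * a ^ 2 * b = a⁻¹ * b * (a⁻¹ * a⁻¹) * b * a⁻¹ := by
    have := congrArg (·⁻¹) r4
    rw [hai2] at this
    simp only [mul_inv_rev, hbi, inv_inv, pow_two] at this
    rw [pow_two, mul_assoc, this]
    group
  have r7 : b * (a * (b * a ^ 2 * b)) = a ^ 3 * b * a⁻¹ := by
    calc b * (a * (b * a ^ 2 * b)) = (b * a * b) * a ^ 2 * b := by group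
      _ = (a⁻¹ * b * a⁻¹) * a ^ 2 * b := by rw [r1]
      _ = a⁻¹ * (b * a * b) := by rw [pow_two]; group
      _ = a ^ 3 * b * a⁻¹ := by rw [r1, hai2]; group
  have r8 : b * (a ^ 2 * (b * a ^ 2 * b)) = a ^ 4 * (b * a ^ 2 * b) * a⁻¹ := by
    calc b * (a ^ 2 * (b * a ^ 2 * b)) = (b * a ^ 2 * b) * a ^ 2 * b := by group
      _ = a⁻¹ * b * (a⁻¹ * a⁻¹) * (b * a * b) := by rw [r5, pow_two]; group
      _ = a⁻¹ * b * (a⁻¹ * a⁻¹ * a⁻¹) * b * a⁻¹ := by rw [r1]; group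
      _ = a ^ 4 * (b * a ^ 2 * b) * a⁻¹ := by
        rw [hai, show a⁻¹ * a⁻¹ * a⁻¹ = a ^ 2 by rw [← hai2]; group]; group
  have r10 : b * (a ^ 4 * (b * a ^ 2 * b)) = a ^ 2 * (b * a ^ 2 * b) * a := by
    calc b * (a ^ 4 * (b * a ^ 2 * b)) = (b * a⁻¹ * b) * a ^ 2 * b := by rw [hai]; group
      _ = a * b * a ^ 3 * b := by rw [r2, pow_two, pow_succ, pow_two]; group
      _ = a * (b * a ^ 3 * b) := by group
      _ = a ^ 2 * (b * a ^ 2 * b) * a := by rw [r4]; simp only [pow_two, mul_assoc]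
  have r9 : a * (b * a ^ 3 * (b * a ^ 2 * b)) = b * a ^ 3 * (b * a ^ 2 * b) * a⁻¹ := by
    have h : b * a ^ 3 * (b * a ^ 2 * b) = a * (b * a ^ 3 * (b * a ^ 2 * b)) * a := by
      calc b * a ^ 3 * (b * a ^ 2 * b) = (b * a ^ 3 * b) * a ^ 2 * b := by group
        _ = (a * b * a ^ 2 * b * a) * a ^ 2 * b := by rw [r4]
        _ = a * b * a ^ 2 * (b * a ^ 3 * b) := by group
        _ = a * b * a ^ 3 * (b * a ^ 2 * b) * a := by rw [r4]; group
        _ = a * (b * a ^ 3 * (b * a ^ 2 * b)) * a := by group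
    conv_rhs => rw [h]
    group
  refine card_closure_le_of_cosets (n := 5) (m := 12) (by norm_num) ha hb
    ![1, b, a * b, a ^ 2 * b, a ^ 3 * b, a ^ 4 * b, b * a ^ 2 * b, a * (b * a ^ 2 * b),
      a ^ 2 * (b * a ^ 2 * b), a ^ 3 * (b * a ^ 2 * b), a ^ 4 * (b * a ^ 2 * b),
      b * a ^ 3 * (b * a ^ 2 * b)] ⟨0, rfl⟩ ?_ ?_
  · intro i
    fin_cases i
    · exact ⟨0, 1, by simp⟩
    · exact ⟨2, 0, by simp⟩
    · exact ⟨3, 0, by simp [pow_two, mul_assoc]⟩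
    · exact ⟨4, 0, by simp [pow_succ', mul_assoc]⟩
    · exact ⟨5, 0, by simp [pow_succ', mul_assoc]⟩
    · exact ⟨1, 0, by simp [hai]⟩
    · exact ⟨7, 0, by simp⟩
    · exact ⟨8, 0, by simp [pow_two, mul_assoc]⟩
    · exact ⟨9, 0, by simp [pow_succ', mul_assoc]⟩
    · exact ⟨10, 0, by simp [pow_succ', mul_assoc]⟩
    · exact ⟨6, 0, by simp [hai]⟩
    · refine ⟨11, 4, ?_⟩
      rw [hai]
      exact r9
  · intro i
    fin_cases i
    · exact ⟨1, 0, by simp⟩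
    · exact ⟨0, 0, by simp [hbb]⟩
    · exact ⟨5, 4, by simpa [hai, mul_assoc] using r1⟩
    · exact ⟨6, 0, by simp [mul_assoc]⟩
    · exact ⟨7, 1, by simpa [mul_assoc] using r4⟩
    · exact ⟨2, 1, by simpa [hai, mul_assoc] using r2⟩
    · refine ⟨3, 0, ?_⟩
      change b * (b * a ^ 2 * b) = a ^ 2 * b * a ^ 0
      rw [mul_assoc, ← mul_assoc, hbb, one_mul, pow_zero, mul_one]
    · refine ⟨4, 4, ?_⟩
      rw [hai]
      exact r7
    · refine ⟨10, 4, ?_⟩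
      rw [← hai] at r8
      exact r8
    · exact ⟨11, 0, by simp [mul_assoc]⟩
    · refine ⟨8, 1, ?_⟩
      rw [pow_one]
      exact r10
    · refine ⟨9, 0, ?_⟩
      change b * (b * a ^ 3 * (b * a ^ 2 * b)) = a ^ 3 * (b * a ^ 2 * b) * a ^ 0
      rw [pow_zero, mul_one, mul_assoc b (a ^ 3), ← mul_assoc b b, hbb, one_mul]

end

/-! ### Homomorphisms from order bounds. -/

section
variable {Γ G : Type*} [Group Γ] [Group G]

/-- The subgroup of Γ × G generated by (α, a) and (β, b) projects onto Γ. If it is no larger than Γ,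
the projection is bijective and the subgroup is the graph of a homomorphism. -/
theorem exists_hom_of_card_closure_le {α β : Γ} (hgen : Subgroup.closure {α, β} = ⊤) {a b : G}
    (h : Finite (Subgroup.closure {(α, a), (β, b)}) ∧
      Nat.card (Subgroup.closure {(α, a), (β, b)}) ≤ Nat.card Γ) :
    ∃ f : Γ →* G, f α = a ∧ f β = b := by
  obtain ⟨hfin, hc⟩ := h
  set K := Subgroup.closure {(α, a), (β, b)} with hK
  have ha : (α, a) ∈ K := Subgroup.subset_closure (by simp)
  have hb : (β, b) ∈ K := Subgroup.subset_closure (by simp)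
  let π : K →* Γ := (MonoidHom.fst Γ G).comp K.subtype
  have hs : Function.Surjective π := by
    rw [← MonoidHom.range_eq_top, eq_top_iff, ← hgen, Subgroup.closure_le]
    rintro _ (rfl | rfl)
    · exact ⟨⟨_, ha⟩, rfl⟩
    · exact ⟨⟨_, hb⟩, rfl⟩
  have : Finite Γ := Finite.of_surjective _ hs
  have hπ : Function.Bijective π := (Nat.bijective_iff_surjective_and_card π).mpr
    ⟨hs, le_antisymm hc (Nat.card_le_card_of_surjective _ hs)⟩
  let e := MulEquiv.ofBijective π hπ
  refine ⟨((MonoidHom.snd Γ G).comp K.subtype).comp e.symm.toMonoidHom, ?_, ?_⟩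
  · have : e.symm α = ⟨_, ha⟩ := e.symm_apply_eq.mpr rfl
    change ((e.symm α : K) : Γ × G).2 = a
    rw [this]
  · have : e.symm β = ⟨_, hb⟩ := e.symm_apply_eq.mpr rfl
    change ((e.symm β : K) : Γ × G).2 = b
    rw [this]

theorem exists_hom_perm_four {a b : G} (ha : a ^ 4 = 1) (hb : b ^ 2 = 1) (hab : (a * b) ^ 3 = 1) :
    ∃ f : Equiv.Perm (Fin 4) →* G, f pa = a ∧ f pb = b := by
  refine exists_hom_of_card_closure_le closure_pab ?_
  rw [card_perm_four]
  refine card_closure_le_twentyFour ?_ ?_ ?_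
  · exact Prod.ext (by decide +kernel : pa ^ 4 = 1) ha
  · exact Prod.ext (by decide +kernel : pb ^ 2 = 1) hb
  · exact Prod.ext (by decide +kernel : (pa * pb) ^ 3 = 1) hab

theorem exists_hom_alternating_five {a b : G} (ha : a ^ 5 = 1) (hb : b ^ 2 = 1)
    (hab : (a * b) ^ 3 = 1) :
    ∃ f : alternatingGroup (Fin 5) →* G, f aE = a ∧ f aF = b := by
  refine exists_hom_of_card_closure_le closure_aEF ?_
  rw [card_alternatingGroup_five]
  refine card_closure_le_sixty ?_ ?_ ?_
  · exact Prod.ext (Subtype.ext (by decide +kernel : pE ^ 5 = 1) : aE ^ 5 = 1) ha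
  · exact Prod.ext (Subtype.ext (by decide +kernel : pF ^ 2 = 1) : aF ^ 2 = 1) hb
  · exact Prod.ext (Subtype.ext (by decide +kernel : (pE * pF) ^ 3 = 1) : (aE * aF) ^ 3 = 1) hab

end
end QuadricAut
namespace QuadricAut

/-! ### The octahedral and the icosahedral representation -/

theorem orderOf_torus {k : Type*} [Field k] (l : kˣ) : orderOf (torus l) = orderOf l :=
  orderOf_injective torus torus_injective l

section
variable {k : Type*} [Field k] (ω : RootChoice k)

theorem RootChoice.orderOf_root {n : ℕ} (hn : 0 < n) : orderOf (ω.root n) = n :=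
  ((ω.prim n hn).eq_orderOf).symm

theorem mE_eq : mE ω = torus (ω.root 5) := pgl_eq_mat _

theorem mB_eq : mB k = mat 0 1 1 0 := pgl_eq_mat _

theorem mR_eq (n : ℕ) : mR ω n = torus (ω.root n)⁻¹ := by
  unfold mR
  rw [pgl_eq_mat, torus_eq, ← mat_smul_eq (ω.root n).ne_zero (a := (((ω.root n)⁻¹ : kˣ) : k))]
  simp

/-- The matrix `F` with a general unit in place of `ω₅`. -/
noncomputable def kleinF (l : kˣ) : PGL(2, k) := mat 1 (1 - (l : k) - (l : k)⁻¹) 1 (-1)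

theorem mF_eq : mF ω = kleinF (ω.root 5) := pgl_eq_mat _

end

section
variable {k : Type*} [Field k]

theorem kleinF_det {l : kˣ} (h : (l : k) ≠ 1) :
    (1 : k) * (-1) - (1 - (l : k) - (l : k)⁻¹) * 1 ≠ 0 := by
  have h0 := l.ne_zero
  have h2 : (1 : k) * (-1) - (1 - (l : k) - (l : k)⁻¹) * 1 = (l - 1) ^ 2 * (l : k)⁻¹ := by
    field_simp
    ring
  rw [h2]
  exact mul_ne_zero (pow_ne_zero _ (sub_ne_zero.mpr h)) (inv_ne_zero h0)

theorem kleinF_sq {l : kˣ} (h : (l : k) ≠ 1) : kleinF l ^ 2 = 1 := by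
  unfold kleinF
  rw [mat_pow_eq_one_iff (kleinF_det h) 1, powCoeff_two]
  exact Or.inl (by ring)

/-- The product has trace `l - 1` and determinant `(l - 1)²`, so trace² = det, the condition for its
cube to be trivial. -/
theorem torus_mul_kleinF_pow {l : kˣ} (h : (l : k) ≠ 1) : (torus l * kleinF l) ^ 3 = 1 := by
  have h0 := l.ne_zero
  unfold kleinF
  have h1 : (l : k) * 1 - 0 * 0 ≠ 0 := by simp
  rw [torus_eq, mat_mul h1 (kleinF_det h), mat_pow_eq_one_iff _ 2, powCoeff_three]
  · left
    field_simp
    ring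
  · have e : (l * 1 + 0 * 1) * (0 * (1 - (l : k) - (l : k)⁻¹) + 1 * -1) -
      (l * (1 - (l : k) - (l : k)⁻¹) + 0 * -1) * (0 * 1 + 1 * 1) = (l - 1) ^ 2 := by
      field_simp
      ring
    rw [e]
    exact pow_ne_zero _ (sub_ne_zero.mpr h)

variable (ω : RootChoice k)

theorem RootChoice.root_ne_one {n : ℕ} (hn : 1 < n) : (ω.root n : k) ≠ 1 := fun h =>
  (ω.prim n (by omega)).ne_one hn (Units.ext h)

theorem torus_root_pow {n : ℕ} (hn : 0 < n) : torus (ω.root n) ^ n = 1 := by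
  rw [← map_pow, (ω.prim n hn).pow_eq_one, map_one]

theorem exists_octHom : ∃ f : Equiv.Perm (Fin 4) →* PGL(2, k),
    f pa = torus (ω.root 4) ∧ f pb = kleinF (ω.root 4) :=
  exists_hom_perm_four (torus_root_pow ω (by norm_num))
    (kleinF_sq (ω.root_ne_one (by norm_num))) (torus_mul_kleinF_pow (ω.root_ne_one (by norm_num)))

theorem exists_icoHom : ∃ f : alternatingGroup (Fin 5) →* PGL(2, k),
    f aE = torus (ω.root 5) ∧ f aF = kleinF (ω.root 5) :=
  exists_hom_alternating_five (torus_root_pow ω (by norm_num))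
    (kleinF_sq (ω.root_ne_one (by norm_num))) (torus_mul_kleinF_pow (ω.root_ne_one (by norm_num)))

/-- The octahedral representation `S₄ → PGL₂(k)`. -/
noncomputable def octHom : Equiv.Perm (Fin 4) →* PGL(2, k) := (exists_octHom ω).choose

/-- The icosahedral representation `A₅ → PGL₂(k)`. -/
noncomputable def icoHom : alternatingGroup (Fin 5) →* PGL(2, k) := (exists_icoHom ω).choose

theorem octHom_pa : octHom ω pa = torus (ω.root 4) := (exists_octHom ω).choose_spec.1
theorem octHom_pb : octHom ω pb = kleinF (ω.root 4) := (exists_octHom ω).choose_spec.2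
theorem icoHom_aE : icoHom ω aE = mE ω := (exists_icoHom ω).choose_spec.1.trans (mE_eq ω).symm
theorem icoHom_aF : icoHom ω aF = mF ω := (exists_icoHom ω).choose_spec.2.trans (mF_eq ω).symm

variable [CharZero k]

theorem mA_eq : mA k = mat 1 0 0 (-1) := pgl_eq_mat _
theorem mC_eq : mC ω = mat ω.i (-ω.i) 1 1 := pgl_eq_mat _
theorem mD_eq : mD ω = mat 1 (-ω.i) ω.i (-1) := pgl_eq_mat _

theorem kleinF_root_four : kleinF (ω.root 4) = mat 1 1 1 (-1) := by
  have h := ω.i_sq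
  have h0 : ω.i ≠ 0 := Units.ne_zero _
  unfold kleinF
  congr 1
  change 1 - ω.i - ω.i⁻¹ = 1
  field_simp
  linear_combination -h

theorem torus_root_four_sq : torus (ω.root 4) ^ 2 = mat (-1) 0 0 1 := by
  rw [← map_pow, torus_eq]
  congr 1
  rw [Units.val_pow_eq_pow_val]
  exact ω.i_sq

theorem octHom_pA : octHom ω pA = mA k := by
  rw [pA_eq, map_pow, octHom_pa, torus_root_four_sq, mA_eq,
    ← mat_smul_eq (neg_ne_zero.mpr (one_ne_zero (α := k)))]
  simp

theorem two_det : (1 : k) * (-1) - 1 * 1 ≠ 0 := by norm_num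

theorem octHom_pB : octHom ω pB = mB k := by
  rw [pB_eq, map_mul, map_mul, map_pow, octHom_pa, octHom_pb, torus_root_four_sq, mB_eq,
    kleinF_root_four, mat_mul two_det (by norm_num), mat_mul (by norm_num) two_det,
    ← mat_smul_eq (s := -2) (by norm_num) (a := (0 : k))]
  norm_num

theorem octHom_pC : octHom ω pC = mC ω := by
  have h := ω.i_sq
  have h0 : ω.i ≠ 0 := Units.ne_zero _
  have hi : ((ω.root 4 : kˣ) : k) = ω.i := rfl
  rw [pC_eq, map_mul, map_mul, map_mul, octHom_pA, octHom_pB, octHom_pa, octHom_pb,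
    mA_eq, mB_eq, mC_eq, torus_eq, kleinF_root_four, hi,
    mat_mul (by norm_num) (by norm_num), mat_mul (by simpa using h0) two_det, mat_mul (by norm_num),
    ← mat_smul_eq (s := ω.i) h0]
  · congr 1 <;> first | ring1 | linear_combination (-1 : k) * h | linear_combination h
  · intro h1
    apply h0
    linear_combination (-1 / 2 : k) * h1

theorem octHom_pD : octHom ω pD = mD ω := by
  have h := ω.i_sq
  have h0 : ω.i ≠ 0 := Units.ne_zero _
  have hi : ((ω.root 4 : kˣ) : k) = ω.i := rfl
  rw [pD_eq, map_mul, map_mul, pow_succ, map_mul, map_pow, octHom_pa, octHom_pb,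
    torus_root_four_sq, mD_eq, torus_eq, kleinF_root_four, hi,
    mat_mul (by norm_num) (by simpa using h0), mat_mul (by simpa using h0) two_det,
    mat_mul (by simpa using h0) (by simpa using h0)]
  congr 1 <;> first | ring1 | linear_combination (-1 : k) * h | linear_combination h

theorem mA_ne_one : mA k ≠ 1 := by
  rw [mA_eq, Ne, mat_eq_one_iff (by norm_num)]
  rintro ⟨-, -, h⟩
  norm_num at h

/-- From a nontrivial element of the kernel a product of two conjugates equal to `pA` also lies in
the kernel, whereas A ≠ 1. -/
theorem octHom_injective : Function.Injective (octHom ω) := by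
  rw [injective_iff_map_eq_one]
  intro g hg
  by_contra h
  obtain ⟨x, y, hxy⟩ := exists_conj_mul_conj_eq_pA' g h
  apply mA_ne_one (k := k)
  rw [← octHom_pA ω, ← hxy]
  simp [hg]

theorem icoHom_injective : Function.Injective (icoHom ω) := by
  rw [← MonoidHom.ker_eq_bot_iff]
  refine (Subgroup.Normal.eq_bot_or_eq_top inferInstance).resolve_right fun h => ?_
  have h1 : aE ∈ (icoHom ω).ker := h ▸ Subgroup.mem_top _
  rw [MonoidHom.mem_ker, icoHom_aE, mE_eq, ← map_one torus] at h1
  exact ω.root_ne_one (n := 5) (by norm_num) (congrArg Units.val (torus_injective h1))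

end
end QuadricAut
namespace QuadricAut

/-! ### Conjugacy of the representations of `A₄`, `S₄` and `A₅` -/

section
open Equiv
local notation "𝔸" => alternatingGroup (Fin 4)
local notation "𝔸₅" => alternatingGroup (Fin 5)

theorem conj_eq_of_generators {Γ G : Type*} [Group Γ] [Group G] {f g : Γ →* G} {α β : Γ}
    (hgen : Subgroup.closure {α, β} = ⊤) {P : G} (h1 : P * f α * P⁻¹ = g α)
    (h2 : P * f β * P⁻¹ = g β) (x : Γ) : P * f x * P⁻¹ = g x := by
  have : (MulAut.conj P).toMonoidHom.comp f = g := by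
    refine MonoidHom.eq_of_eqOn_dense hgen ?_
    rintro _ (rfl | rfl)
    · exact h1
    · exact h2
  exact DFunLike.congr_fun this x

/-- The three-cycle and the double transposition as elements of `A₄`. -/
def aC : 𝔸 := ⟨pC, pC_mem⟩
def aA : 𝔸 := ⟨pA, Perm.mem_alternatingGroup.mpr sign_pA⟩

theorem closure_aCA : Subgroup.closure {aC, aA} = ⊤ := by
  apply Subgroup.map_injective (Subgroup.subtype_injective 𝔸)
  rw [MonoidHom.map_closure, ← MonoidHom.range_eq_map, Subgroup.range_subtype,
    Set.image_insert_eq, Set.image_singleton]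
  exact closure_pCA

theorem isTriangle_aCA : IsTriangle 3 aC aA :=
  IsTriangle.of_map (𝔸).subtype (Subgroup.subtype_injective _) isTriangle_pCA

variable {k : Type*} [Field k] [IsAlgClosed k] [CharZero k]

theorem exists_conj_alternating_four {f g : 𝔸 →* PGL(2, k)} (hf : Function.Injective f)
    (hg : Function.Injective g) : ∃ P, ∀ x, P * f x * P⁻¹ = g x := by
  obtain ⟨P, h1, h2⟩ := IsTriangle.conj_of_le_four (Or.inl rfl) (isTriangle_aCA.map f hf)
    (isTriangle_aCA.map g hg)
  exact ⟨P, conj_eq_of_generators closure_aCA h1 h2⟩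

theorem exists_conj_perm_four {f g : Perm (Fin 4) →* PGL(2, k)} (hf : Function.Injective f)
    (hg : Function.Injective g) : ∃ P, ∀ x, P * f x * P⁻¹ = g x := by
  obtain ⟨P, h1, h2⟩ := IsTriangle.conj_of_le_four (Or.inr rfl) (isTriangle_pab.map f hf)
    (isTriangle_pab.map g hg)
  exact ⟨P, conj_eq_of_generators closure_pab h1 h2⟩

variable (ω : RootChoice k)

/-- When E maps to a conjugate of diag(ω^±1, 1), inversion brings the exponent to 1, and the normal
form of the triangle then gives the standard matrices E and F. -/
theorem exists_conj_icoHom_of_torus {f : 𝔸₅ →* PGL(2, k)} (hf : Function.Injective f)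
    {P : PGL(2, k)} {j : ℕ} (hj : j % 5 = 1 ∨ j % 5 = 4)
    (hP : P * f aE * P⁻¹ = torus (ω.root 5 ^ j)) : ∃ P, ∀ x, P * f x * P⁻¹ = icoHom ω x := by
  have h5 : ω.root 5 ^ 5 = 1 := (ω.prim 5 (by norm_num)).pow_eq_one
  have key : ∃ P, P * f aE * P⁻¹ = torus (ω.root 5) := by
    rw [pow_eq_pow_mod' h5] at hP
    rcases hj with hj | hj <;> rw [hj] at hP
    · exact ⟨P, by rw [hP, pow_one]⟩
    · have e : ω.root 5 ^ 4 = (ω.root 5)⁻¹ := by rw [eq_inv_iff_mul_eq_one, ← pow_succ, h5]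
      obtain ⟨Q, hQ⟩ := conj_torus_inv ((ω.root 5)⁻¹)
      refine ⟨Q * P, ?_⟩
      rw [e] at hP
      have : Q * P * f aE * (Q * P)⁻¹ = Q * (P * f aE * P⁻¹) * Q⁻¹ := by group
      rw [this, hP, hQ, inv_inv]
  obtain ⟨P, hP⟩ := key
  obtain ⟨Q, h1, h2⟩ := IsTriangle.exists_conj (by norm_num) (isTriangle_aEF.map f hf) hP
  refine ⟨Q, conj_eq_of_generators closure_aEF ?_ ?_⟩
  · rw [h1, icoHom_aE, mE_eq]
  · rw [h2, icoHom_aF, mF_eq]; rfl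

theorem exists_conj_pE_sq : ∃ s : Perm (Fin 5), s * pE * s⁻¹ = pE ^ 2 :=
  exists_conj_pE (pE ^ 2) (by decide +kernel)

theorem exists_conj_icoHom {f : 𝔸₅ →* PGL(2, k)} (hf : Function.Injective f) :
    ∃ (P : PGL(2, k)) (θ : MulAut 𝔸₅), ∀ x, P * f x * P⁻¹ = icoHom ω (θ x) := by
  have hy : orderOf (f aE) = 5 := (isTriangle_aEF.map f hf).left
  obtain ⟨P, j, hj, hc, hP⟩ := exists_conj_torus_pow (by norm_num) (ω.prim 5 (by norm_num)) hy
  have hj' : j = 1 ∨ j = 4 ∨ j = 2 ∨ j = 3 := by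
    interval_cases j <;> first | exact absurd hc (by decide) | simp
  by_cases h14 : j % 5 = 1 ∨ j % 5 = 4
  · obtain ⟨Q, hQ⟩ := exists_conj_icoHom_of_torus ω hf h14 hP
    exact ⟨Q, 1, hQ⟩
  -- For the exponents 2 and 3, composing with the conjugation that takes E to E² doubles the
  -- exponent, which becomes ±1 modulo 5.
  · obtain ⟨s, hs⟩ := exists_conj_pE_sq
    let θ : MulAut 𝔸₅ := MulAut.conjNormal s
    have hθ : θ aE = aE ^ 2 := Subtype.ext hs
    obtain ⟨Q, hQ⟩ := exists_conj_icoHom_of_torus ω (f := f.comp θ.toMonoidHom) (P := P)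
      (j := j * 2) (hf.comp θ.injective) (by omega) (by
        change P * f (θ aE) * P⁻¹ = _
        rw [hθ, map_pow, ← conj_pow, hP, ← map_pow, pow_mul])
    refine ⟨Q, θ⁻¹, fun x => ?_⟩
    rw [← hQ]
    change _ = Q * f (θ (θ⁻¹ x)) * Q⁻¹
    rw [MulAut.apply_inv_self]

end
end QuadricAut

namespace QuadricAut

/-! ### Counting orbits -/

section Counting

/-- The equation 1/2 + 1/3 + 1/e = 1 + 2/N leaves only e < 6, and each e determines N. -/
theorem signature_aux {a b c N e : ℕ} (hN : 2 ≤ N) (ha : a * 2 = N) (hb : b * 3 = N)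
    (hc : c * e = N) (he : 3 ≤ e) (h : a + b + c = N + 2) :
    (e = 3 ∧ N = 12) ∨ (e = 4 ∧ N = 24) ∨ (e = 5 ∧ N = 60) := by
  have h6 : e < 6 := by
    by_contra! h6
    have := Nat.mul_le_mul_left c h6
    omega
  obtain rfl | rfl | rfl : e = 3 ∨ e = 4 ∨ e = 5 := by
    omega
  all_goals omega

/-- The orbit sizes `a, b, c` and the stabilizer orders `d, e, f` of a group of order `N` which
acts with three orbits as in Klein's theorem. -/
theorem signature_of_two {a b c N e f : ℕ} (hN : 2 ≤ N) (ha : a * 2 = N) (hb : b * e = N)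
    (hc : c * f = N) (he : 2 ≤ e) (hf : 2 ≤ f) (h : a + b + c = N + 2) :
    (b = 2 ∨ c = 2) ∨ ∃ m, ((m = 3 ∧ N = 12) ∨ (m = 4 ∧ N = 24) ∨ (m = 5 ∧ N = 60)) ∧
      (e = m ∨ f = m) ∧ (e = 2 ∨ e = 3 ∨ e = m) ∧ (f = 2 ∨ f = 3 ∨ f = m) := by
  rcases he.eq_or_lt with rfl | he
  · left; right; omega
  rcases hf.eq_or_lt with rfl | hf
  · left; left; omega
  by_cases he3 : e = 3
  · subst he3
    rcases signature_aux hN ha hb hc hf h with h | h | h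
    all_goals exact Or.inr ⟨f, by omega, by omega, by omega, by omega⟩
  by_cases hf3 : f = 3
  · subst hf3
    rcases signature_aux hN ha hc hb he (by omega) with h | h | h
    all_goals exact Or.inr ⟨e, by omega, by omega, by omega, by omega⟩
  have := Nat.mul_le_mul_left b (show 4 ≤ e by omega)
  have := Nat.mul_le_mul_left c (show 4 ≤ f by omega)
  omega

/-- 1/d + 1/e + 1/f = 1 + 2/N exceeds one, so some stabilizer order is two. An orbit of size two is
kept apart as the dihedral case. -/
theorem signature {a b c N d e f : ℕ} (hN : 2 ≤ N) (ha : a * d = N) (hb : b * e = N)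
    (hc : c * f = N) (hd : 2 ≤ d) (he : 2 ≤ e) (hf : 2 ≤ f) (h : a + b + c = N + 2) :
    (a = 2 ∨ b = 2 ∨ c = 2) ∨ ∃ m, ((m = 3 ∧ N = 12) ∨ (m = 4 ∧ N = 24) ∨ (m = 5 ∧ N = 60)) ∧
      (d = m ∨ e = m ∨ f = m) ∧ (d = 2 ∨ d = 3 ∨ d = m) ∧ (e = 2 ∨ e = 3 ∨ e = m) ∧
        (f = 2 ∨ f = 3 ∨ f = m) := by
  have h2 : d = 2 ∨ e = 2 ∨ f = 2 := by
    by_contra! h2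
    have := Nat.mul_le_mul_left a (show 3 ≤ d by omega)
    have := Nat.mul_le_mul_left b (show 3 ≤ e by omega)
    have := Nat.mul_le_mul_left c (show 3 ≤ f by omega)
    omega
  rcases h2 with rfl | rfl | rfl
  · rcases signature_of_two hN ha hb hc he hf h with h | ⟨m, hm, h1, h2, h3⟩
    · exact Or.inl (Or.inr h)
    · exact Or.inr ⟨m, hm, Or.inr h1, Or.inl rfl, h2, h3⟩
  · rcases signature_of_two hN hb ha hc hd hf (by omega) with h | ⟨m, hm, h1, h2, h3⟩
    · exact Or.inl (h.imp_right Or.inr)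
    · exact Or.inr ⟨m, hm, h1.imp_right Or.inr, h2, Or.inl rfl, h3⟩
  · rcases signature_of_two hN hc ha hb hd he (by omega) with h | ⟨m, hm, h1, h2, h3⟩
    · exact Or.inl (h.imp_right Or.inl)
    · exact Or.inr ⟨m, hm, h1.imp_right Or.inl, h2, h3, Or.inl rfl⟩

/-- `H` preserves a pair of distinct points. -/
def PreservesPair (H : Type*) [Group H] {X : Type*} [MulAction H X] (p q : X) : Prop :=
  p ≠ q ∧ ∀ h : H, (h • p = p ∧ h • q = q) ∨ (h • p = q ∧ h • q = p)

theorem exists_preservesPair_of_ncard {H X : Type*} [Group H] [MulAction H X] {s : Set X}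
    (hs : s.ncard = 2) (hinv : ∀ (h : H), ∀ x ∈ s, h • x ∈ s) :
    ∃ p q : X, PreservesPair H p q := by
  obtain ⟨p, q, hpq, rfl⟩ := Set.ncard_eq_two.mp hs
  refine ⟨p, q, hpq, fun h => ?_⟩
  have h1 := hinv h p (by simp)
  have h2 := hinv h q (by simp)
  have h3 : h • p ≠ h • q := fun e => hpq (MulAction.injective h e)
  simp only [Set.mem_insert_iff, Set.mem_singleton_iff] at h1 h2
  rcases h1 with h1 | h1 <;> rcases h2 with h2 | h2
  · exact absurd (h1.trans h2.symm) h3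
  · exact Or.inl ⟨h1, h2⟩
  · exact Or.inr ⟨h1, h2⟩
  · exact absurd (h1.trans h2.symm) h3

/-- With N the order of `H` and r the number of orbits, Burnside's count reads |X| + 2(N - 1) = rN.
For r = 2 it gives |X| = 2, an invariant pair; for r = 3 it gives |X| = N + 2, the input of
`signature`. -/
theorem burnside_finite {H X : Type*} [Group H] [Finite H] [MulAction H X] [Finite X]
    (hN : 2 ≤ Nat.card H) (h2 : ∀ h : H, h ≠ 1 → Nat.card (MulAction.fixedBy X h) = 2)
    (hX : ∀ x : X, ∃ h : H, h ≠ 1 ∧ h • x = x) :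
    (∃ p q : X, PreservesPair H p q) ∨
      ∃ m, ((m = 3 ∧ Nat.card H = 12) ∨ (m = 4 ∧ Nat.card H = 24) ∨ (m = 5 ∧ Nat.card H = 60)) ∧
        (∃ x : X, Nat.card (MulAction.stabilizer H x) = m) ∧
        ∀ x : X, Nat.card (MulAction.stabilizer H x) = 2 ∨
          Nat.card (MulAction.stabilizer H x) = 3 ∨ Nat.card (MulAction.stabilizer H x) = m := by
  classical
  have := Fintype.ofFinite H
  have := Fintype.ofFinite X
  have : Fintype (Quotient (MulAction.orbitRel H X)) := Fintype.ofFinite _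
  have hb := MulAction.sum_card_fixedBy_eq_card_orbits_mul_card_group H X
  rw [← Finset.add_sum_erase _ _ (Finset.mem_univ 1),
    Finset.sum_congr rfl (g := fun _ => 2) (fun g hg => by
      rw [← Nat.card_eq_fintype_card]; exact h2 g (Finset.ne_of_mem_erase hg))] at hb
  rw [Finset.sum_const, Finset.card_erase_of_mem (Finset.mem_univ _), Finset.card_univ,
    smul_eq_mul] at hb
  have h1 : Fintype.card (MulAction.fixedBy X (1 : H)) = Fintype.card X := by
    rw [Fintype.card_eq_nat_card, Fintype.card_eq_nat_card]
    refine Nat.card_congr (Equiv.subtypeUnivEquiv fun x => by simp)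
  rw [h1] at hb
  let n : Quotient (MulAction.orbitRel H X) → ℕ := fun o => Nat.card (MulAction.orbit H o.out)
  have hsum : Fintype.card X = ∑ o : Quotient (MulAction.orbitRel H X), n o := by
    rw [Fintype.card_congr (MulAction.selfEquivSigmaOrbits H X), Fintype.card_sigma]
    exact Finset.sum_congr rfl fun o _ => by rw [← Nat.card_eq_fintype_card]
  have hne : ∀ x : X, Nat.card (MulAction.orbit H x) * Nat.card (MulAction.stabilizer H x) =
      Fintype.card H := fun x => by
    rw [Nat.card_eq_fintype_card, Nat.card_eq_fintype_card]
    exact MulAction.card_orbit_mul_card_stabilizer_eq_card_group H x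
  have he : ∀ x : X, 2 ≤ Nat.card (MulAction.stabilizer H x) := fun x => by
    obtain ⟨h, h1, hx⟩ := hX x
    have : Nontrivial (MulAction.stabilizer H x) :=
      ⟨⟨⟨h, hx⟩, 1, fun e => h1 (congrArg Subtype.val e)⟩⟩
    exact Finite.one_lt_card
  have hn1 : ∀ o, 1 ≤ n o := fun o => Nat.one_le_iff_ne_zero.mpr (by
    have : Nonempty (MulAction.orbit H o.out) := ⟨⟨_, MulAction.mem_orbit_self _⟩⟩
    exact Nat.card_pos.ne')
  have hn2 : ∀ o, n o * 2 ≤ Fintype.card H := fun o => by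
    rw [← hne o.out]; exact Nat.mul_le_mul_left _ (he _)
  have hs1 : Fintype.card (Quotient (MulAction.orbitRel H X)) ≤ Fintype.card X := by
    rw [hsum]; simpa using Finset.sum_le_sum fun o (_ : o ∈ Finset.univ) => hn1 o
  have hs2 : Fintype.card X * 2 ≤ Fintype.card (Quotient (MulAction.orbitRel H X)) * Fintype.card H := by
    rw [hsum, Finset.sum_mul]; simpa using Finset.sum_le_sum fun o (_ : o ∈ Finset.univ) => hn2 o
  rw [Nat.card_eq_fintype_card] at hN ⊢
  -- All stabilizers are nontrivial, so orbits have at most N/2 points and 2|X| ≤ rN. Inserted into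
  -- Burnside's count this gives r < 4.
  have hr : Fintype.card (Quotient (MulAction.orbitRel H X)) < 4 := by
    by_contra! h
    have := Nat.mul_le_mul_right (Fintype.card H) h
    omega
  have hpair : Fintype.card X = 2 → ∃ p q : X, PreservesPair H p q := fun h =>
    exists_preservesPair_of_ncard (s := Set.univ)
      (by rw [Set.ncard_univ, Nat.card_eq_fintype_card, h]) fun _ _ _ => Set.mem_univ _
  have horb : ∀ o, n o = 2 → ∃ p q : X, PreservesPair H p q := fun o h =>
    exists_preservesPair_of_ncard (s := MulAction.orbit H o.out) h
      fun g x hx => MulAction.mem_orbit_of_mem_orbit g hx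
  generalize hrr : Fintype.card (Quotient (MulAction.orbitRel H X)) = r at hr hb hs1 hs2
  interval_cases r
  · omega
  · omega
  · left; apply hpair; omega
  · let ε : Fin 3 ≃ (Quotient (MulAction.orbitRel H X)) := (Fintype.equivFinOfCardEq hrr).symm
    rw [← ε.sum_comp, Fin.sum_univ_three] at hsum
    have hex : ∀ x : X, ∃ i, Nat.card (MulAction.stabilizer H x) =
        Nat.card (MulAction.stabilizer H (ε i).out) := fun x => by
      refine ⟨ε.symm (Quotient.mk _ x), ?_⟩
      rw [Equiv.apply_symm_apply]
      have hrel : (MulAction.orbitRel H X).r x (Quotient.mk (MulAction.orbitRel H X) x).out :=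
        (MulAction.orbitRel H X).symm (Quotient.mk_out x)
      exact Nat.card_congr (MulAction.stabilizerEquivStabilizerOfOrbitRel hrel).toEquiv
    rcases signature hN (hne (ε 0).out) (hne (ε 1).out) (hne (ε 2).out) (he _) (he _) (he _)
      (by change n (ε 0) + n (ε 1) + n (ε 2) = _; omega) with h | ⟨m, hm, hd, h0, h1, h2⟩
    · left
      rcases h with h | h | h
      exacts [horb _ h, horb _ h, horb _ h]
    · right
      refine ⟨m, hm, ?_, fun x => ?_⟩
      · rcases hd with h | h | h
        exacts [⟨_, h⟩, ⟨_, h⟩, ⟨_, h⟩]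
      · obtain ⟨i, hi⟩ := hex x
        rw [hi]
        fin_cases i
        exacts [h0, h1, h2]

end Counting

end QuadricAut

namespace QuadricAut

/-! ### The poles of a finite subgroup of `PGL₂(k)` -/

variable {k : Type*} [Field k] [CharZero k]

theorem isOfFinOrder_of_mem {G : Type*} [Group G] {H : Subgroup G} [Finite H] {g : G}
    (hg : g ∈ H) : IsOfFinOrder g :=
  H.subtype.isOfFinOrder (isOfFinOrder_of_finite (⟨g, hg⟩ : H))

/-- A finite subgroup of `PGL₂(k)` with a fixed point is conjugate to a subgroup of the torus. -/
theorem exists_conj_le_torus_range {K : Subgroup PGL(2, k)} [Finite K] {p : Line k}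
    (h : ∀ g ∈ K, g • p = p) :
    ∃ P : PGL(2, k), K.map (MulAut.conj P).toMonoidHom ≤ (torus (k := k)).range := by
  by_cases hK : ∃ g ∈ K, g ≠ 1
  · obtain ⟨g, hg, h1⟩ := hK
    obtain ⟨P, a, ha, hP, e⟩ := exists_conj_torus (isOfFinOrder_of_mem hg) h1 (h g hg)
    refine ⟨P, ?_⟩
    rintro _ ⟨g', hg', rfl⟩
    have hgq : g • (P⁻¹ • ptZero k) = P⁻¹ • ptZero k := by
      rw [smul_smul, eq_inv_smul_iff, smul_smul, ← mul_assoc, e, torus_smul_ptZero]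
    have hgq' := smul_eq_of_share hg hg' h1 (h g hg) hgq (h g' hg')
    obtain ⟨b, hb⟩ := exists_torus_of_smul (g := P * g' * P⁻¹)
      (by rw [← hP, smul_smul, mul_assoc, inv_mul_cancel, mul_one, mul_smul, h g' hg'])
      (by rw [mul_assoc, mul_smul, mul_smul, hgq', smul_inv_smul])
    exact ⟨b, hb.symm⟩
  · push Not at hK
    refine ⟨1, ?_⟩
    rintro _ ⟨g', hg', rfl⟩
    rw [hK g' hg', map_one]
    exact one_mem _

/-- The subgroup is conjugate into the torus, and finite subgroups of the multiplicative group of a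
field are cyclic. -/
theorem isCyclic_of_fixed_point {K : Subgroup PGL(2, k)} [Finite K] {p : Line k}
    (h : ∀ g ∈ K, g • p = p) : IsCyclic K := by
  obtain ⟨P, hP⟩ := exists_conj_le_torus_range h
  set L := K.map (MulAut.conj P).toMonoidHom
  have e : (L.comap torus).map torus = L := Subgroup.map_comap_eq_self hP
  have : Finite L := Finite.of_equiv _ (K.equivMapOfInjective _ (conj_injective P)).toEquiv
  have : Finite (L.comap torus) :=
    Finite.of_injective (fun x : L.comap torus => (⟨torus x.1, x.2⟩ : L))
      fun x y hxy => Subtype.ext (torus_injective (congrArg Subtype.val hxy))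
  have h2 : IsCyclic ((L.comap torus).map torus : Subgroup PGL(2, k)) :=
    isCyclic_of_surjective _ ((L.comap torus).equivMapOfInjective _ torus_injective).surjective
  rw [e] at h2
  exact isCyclic_of_surjective _ (K.equivMapOfInjective _ (conj_injective P)).symm.surjective

theorem card_fixedPoints {g : PGL(2, k)} [IsAlgClosed k] (hg : IsOfFinOrder g) (h1 : g ≠ 1) :
    {x : Line k | g • x = x}.ncard = 2 := by
  obtain ⟨p, hp⟩ := exists_fixed_point g
  obtain ⟨q, hq, h⟩ := exists_two_fixed_points hg h1 hp
  rw [Set.ncard_eq_two]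
  exact ⟨p, q, hq.symm, by ext x; simp [h]⟩

variable [IsAlgClosed k]

/-- The points with nontrivial stabilizer. -/
def poles (H : Subgroup PGL(2, k)) : SubMulAction H (Line k) where
  carrier := {p | ∃ h : H, h ≠ 1 ∧ h • p = p}
  smul_mem' := by
    rintro g p ⟨h, h1, hp⟩
    refine ⟨g * h * g⁻¹, fun e => h1 ?_, ?_⟩
    · rwa [mul_inv_eq_one, mul_eq_left] at e
    · rw [mul_smul, inv_smul_smul, mul_smul, hp]

instance (H : Subgroup PGL(2, k)) [Finite H] : Finite (poles H) := by
  have e : ((poles H : SubMulAction H (Line k)) : Set (Line k)) =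
      ⋃ h : {h : H // h ≠ 1}, {x : Line k | h.1.1 • x = x} := by
    ext p
    simp only [Set.mem_iUnion, Set.mem_setOf_eq]
    exact ⟨fun ⟨h, h1, hp⟩ => ⟨⟨h, h1⟩, hp⟩, fun ⟨h, hp⟩ => ⟨h.1, h.2, hp⟩⟩
  change Finite ((poles H : SubMulAction H (Line k)) : Set (Line k))
  rw [e]
  have : ∀ h : {h : H // h ≠ 1}, Finite {x : Line k | h.1.1 • x = x} := fun h =>
    Set.finite_of_ncard_ne_zero (by
      rw [card_fixedPoints (isOfFinOrder_of_mem h.1.2) fun e => h.2 (Subtype.ext e)]; norm_num)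
  exact Set.finite_iUnion this

theorem card_fixedBy_poles {H : Subgroup PGL(2, k)} [Finite H] {h : H} (h1 : h ≠ 1) :
    Nat.card (MulAction.fixedBy (poles H) h) = 2 := by
  refine Eq.trans ?_ (card_fixedPoints (isOfFinOrder_of_mem h.2) fun e => h1 (Subtype.ext e))
  rw [← Nat.card_coe_set_eq]
  refine Nat.card_congr ⟨fun x => ⟨x.1.1, congrArg Subtype.val x.2⟩,
    fun x => ⟨⟨x.1, h, h1, x.2⟩, Subtype.ext x.2⟩, fun _ => rfl, fun _ => rfl⟩

/-- The numerical part of Klein's classification. -/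
theorem exists_preservesPair_or_signature (H : Subgroup PGL(2, k)) [Finite H] :
    (∃ p q : Line k, PreservesPair H p q) ∨
      ∃ m, ((m = 3 ∧ Nat.card H = 12) ∨ (m = 4 ∧ Nat.card H = 24) ∨ (m = 5 ∧ Nat.card H = 60)) ∧
        (∃ y ∈ H, orderOf y = m) ∧
        ∀ y ∈ H, orderOf y = 1 ∨ orderOf y = 2 ∨ orderOf y = 3 ∨ orderOf y = m := by
  by_cases hN : 2 ≤ Nat.card H
  swap
  · left
    have : Subsingleton H := (Finite.card_le_one_iff_subsingleton).mp (by omega)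
    exact ⟨ptInf k, ptZero k, ptInf_ne_ptZero, fun h => Or.inl
      ⟨by rw [Subsingleton.elim h 1, one_smul], by rw [Subsingleton.elim h 1, one_smul]⟩⟩
  rcases burnside_finite (H := H) (X := poles H) hN (fun h h1 => card_fixedBy_poles h1)
    (fun x => by obtain ⟨h, h1, hx⟩ := x.2; exact ⟨h, h1, Subtype.ext hx⟩) with
    ⟨p, q, hpq, hH⟩ | ⟨m, hm, ⟨p, hp⟩, hst⟩
  · left
    refine ⟨p, q, fun e => hpq (Subtype.ext e), fun h => ?_⟩
    exact (hH h).imp (fun a => ⟨congrArg Subtype.val a.1, congrArg Subtype.val a.2⟩)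
      (fun a => ⟨congrArg Subtype.val a.1, congrArg Subtype.val a.2⟩)
  · right
    refine ⟨m, hm, ?_, fun y hy => ?_⟩
    -- The stabilizer of order `m` is cyclic, so its generator has order `m`.
    · set K := (MulAction.stabilizer H p).map H.subtype
      let eK := (MulAction.stabilizer H p).equivMapOfInjective _ H.subtype_injective
      have : Finite K := Finite.of_equiv _ eK.toEquiv
      have hc : IsCyclic K := isCyclic_of_fixed_point (p := p.1) (by
        rintro _ ⟨g, hg, rfl⟩
        exact congrArg Subtype.val hg)
      obtain ⟨y, hy⟩ := IsCyclic.exists_ofOrder_eq_natCard (α := K)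
      obtain ⟨y', -, e⟩ := y.2
      refine ⟨y.1, e ▸ y'.2, ?_⟩
      rw [Subgroup.orderOf_coe, hy, ← hp]
      exact (Nat.card_congr eK.toEquiv).symm
    · by_cases h1 : y = 1
      · left; rw [h1, orderOf_one]
      obtain ⟨p, hp⟩ := exists_fixed_point y
      have hs := hst ⟨p, ⟨y, hy⟩, fun e => h1 (congrArg Subtype.val e), hp⟩
      have hd : orderOf y ∣ Nat.card (MulAction.stabilizer H
          (⟨p, ⟨y, hy⟩, fun e => h1 (congrArg Subtype.val e), hp⟩ : poles H)) := by
        have := orderOf_dvd_natCard (⟨⟨y, hy⟩, Subtype.ext hp⟩ : MulAction.stabilizer H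
          (⟨p, ⟨y, hy⟩, fun e => h1 (congrArg Subtype.val e), hp⟩ : poles H))
        rwa [← Subgroup.orderOf_coe, ← Subgroup.orderOf_coe] at this
      -- Every element lies in the stabilizer of a pole. Among the proper divisors of 2, 3, 4, 5
      -- only 2 | 4 gives an order other than one, and two is already allowed.
      have key : ∀ N : ℕ, orderOf y ∣ N → (N = 2 ∨ N = 3 ∨ N = 4 ∨ N = 5) →
          orderOf y = 1 ∨ orderOf y = N ∨ (N = 4 ∧ orderOf y = 2) := by
        intro N hd hN
        have hle := Nat.le_of_dvd (by omega) hd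
        obtain rfl | rfl | rfl | rfl := hN <;> generalize orderOf y = d at * <;>
          interval_cases d <;> omega
      have := key _ hd (by omega)
      omega

end QuadricAut

namespace QuadricAut

/-! ### Finding a triangle -/

variable {k : Type*} [Field k] [CharZero k]

/-- For diag(w, 1) times the involution, trace²/det = s V with s = a²/(a² + bc) and V = 2 - w - w⁻¹.
Orders 3, 4, 5 mean that this number is 1, is 2, or is a root of t² - 3t + 1. Order two would need
trace zero, excluded by `w ≠ 1` and `a ≠ 0`. -/
theorem orderOf_torus_mul_cases {m : ℕ} (hm : m = 3 ∨ m = 4 ∨ m = 5) {w : kˣ} (hw : w ≠ 1)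
    {a b c : k} (hd : a ^ 2 + b * c ≠ 0) (ha : a ≠ 0) (hbc : ¬(b = 0 ∧ c = 0))
    (ho : orderOf (torus w * mat a b c (-a)) = 1 ∨ orderOf (torus w * mat a b c (-a)) = 2 ∨
      orderOf (torus w * mat a b c (-a)) = 3 ∨ orderOf (torus w * mat a b c (-a)) = m) :
    (orderOf (torus w * mat a b c (-a)) = 3 ∧
        a ^ 2 / (a ^ 2 + b * c) * (2 - (w : k) - (w : k)⁻¹) = 1) ∨
      (m = 4 ∧ a ^ 2 / (a ^ 2 + b * c) * (2 - (w : k) - (w : k)⁻¹) = 2) ∨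
      (m = 5 ∧ (a ^ 2 / (a ^ 2 + b * c) * (2 - (w : k) - (w : k)⁻¹)) ^ 2 -
        3 * (a ^ 2 / (a ^ 2 + b * c) * (2 - (w : k) - (w : k)⁻¹)) + 1 = 0) := by
  have hw0 : (w : k) ≠ 0 := w.ne_zero
  have hw1 : (w : k) - 1 ≠ 0 := fun h => hw (Units.ext (sub_eq_zero.mp h))
  have e : torus w * mat a b c (-a) = mat (w * a) (w * b) c (-a) := by
    rw [torus_eq, mat_mul (by simp) (by intro h; apply hd; linear_combination -h)]
    simp
  rw [e] at ho ⊢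
  have hdet : (w : k) * a * -a - w * b * c ≠ 0 := by
    intro h
    exact mul_ne_zero hw0 hd (by linear_combination -h)
  have h1 : mat ((w : k) * a) (w * b) c (-a) ≠ 1 := fun h => by
    obtain ⟨h1, h2, -⟩ := (mat_eq_one_iff hdet).mp h
    exact hbc ⟨by simpa using h1, h2⟩
  have htr : (w : k) * a + -a ≠ 0 := by
    have : (w : k) * a + -a = (w - 1) * a := by ring
    rw [this]; exact mul_ne_zero hw1 ha
  set s := a ^ 2 / (a ^ 2 + b * c) with hs
  set V := 2 - (w : k) - (w : k)⁻¹ with hV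
  have hs' : a ^ 2 = s * (a ^ 2 + b * c) := by rw [hs, div_mul_cancel₀ _ hd]
  have hV' : ((w : k) - 1) ^ 2 = - w * V := by rw [hV]; field_simp; ring
  have hτ : ((w : k) * a + -a) ^ 2 = (s * V) * ((w : k) * a * -a - w * b * c) := by
    linear_combination (w - 1) ^ 2 * hs' + s * (a ^ 2 + b * c) * hV'
  rcases ho with ho | ho | ho | ho
  · exact absurd (orderOf_eq_one_iff.mp ho) h1
  · exact absurd ((orderOf_mat_eq_two hdet h1).mp ho) htr
  · left
    refine ⟨ho, ?_⟩
    rw [orderOf_mat_eq_three hdet h1, hτ] at ho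
    exact mul_right_cancel₀ hdet (ho.trans (one_mul _).symm)
  rcases hm with rfl | rfl | rfl
  · left
    refine ⟨ho, ?_⟩
    rw [orderOf_mat_eq_three hdet h1, hτ] at ho
    exact mul_right_cancel₀ hdet (ho.trans (one_mul _).symm)
  · right; left
    refine ⟨rfl, ?_⟩
    have h := ((mat_pow_eq_one_iff hdet 3).mp (orderOf_dvd_iff_pow_eq_one.mp ho.dvd)).resolve_right h1
    rw [powCoeff_four] at h
    have h := (mul_eq_zero.mp h).resolve_left htr
    rw [hτ] at h
    exact mul_right_cancel₀ hdet (by linear_combination h)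
  · right; right
    refine ⟨rfl, ?_⟩
    have h := ((mat_pow_eq_one_iff hdet 4).mp (orderOf_dvd_iff_pow_eq_one.mp ho.dvd)).resolve_right h1
    rw [powCoeff_five] at h
    refine (mul_eq_zero.mp ?_).resolve_right (pow_ne_zero 2 hdet)
    linear_combination h - (((w : k) * a + -a) ^ 2 + (s * V) * ((w : k) * a * -a - w * b * c) -
      3 * ((w : k) * a * -a - w * b * c)) * hτ

/-- If l gives order four, then s = 1, and l² = -1 would give the value 4, which no allowed order
has. For m = 5, if l and l² both gave order five, the two quadratic equations for s would contradict
each other. So l, or l² when m = 5, gives order three. -/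
theorem exists_orderOf_torus_pow_mul {m : ℕ} (hm : m = 3 ∨ m = 4 ∨ m = 5) {l : kˣ}
    (hl : orderOf l = m) {a b c : k} (hd : a ^ 2 + b * c ≠ 0) (ha : a ≠ 0)
    (hbc : ¬(b = 0 ∧ c = 0))
    (ho : ∀ w ∈ Subgroup.zpowers l,
      orderOf (torus w * mat a b c (-a)) = 1 ∨ orderOf (torus w * mat a b c (-a)) = 2 ∨
      orderOf (torus w * mat a b c (-a)) = 3 ∨ orderOf (torus w * mat a b c (-a)) = m) :
    ∃ j : ℕ, j.Coprime m ∧ orderOf (torus (l ^ j) * mat a b c (-a)) = 3 := by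
  have hl1 : l ≠ 1 := fun h => by rw [h, orderOf_one] at hl; omega
  have hl2 : l ^ 2 ≠ 1 := fun h => by
    have := Nat.le_of_dvd (by norm_num) (orderOf_dvd_of_pow_eq_one h); omega
  have hl0 : (l : k) ≠ 0 := l.ne_zero
  have hs0 : a ^ 2 / (a ^ 2 + b * c) ≠ 0 := div_ne_zero (pow_ne_zero 2 ha) hd
  have h1 := orderOf_torus_mul_cases hm hl1 hd ha hbc (ho l (Subgroup.mem_zpowers l))
  have h2 := orderOf_torus_mul_cases hm hl2 hd ha hbc (ho (l ^ 2) (Subgroup.npow_mem_zpowers l 2))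
  generalize a ^ 2 / (a ^ 2 + b * c) = s at h1 h2 hs0
  rcases h1 with ⟨h1, -⟩ | ⟨rfl, h1⟩ | ⟨rfl, h1⟩
  · exact ⟨1, by simp, by rwa [pow_one]⟩
  · exfalso
    have h4 : (l : k) ^ 2 = -1 := by
      have h : l ^ 4 = 1 := by rw [← hl, pow_orderOf_eq_one]
      have h' : (l : k) ^ 4 = 1 := by rw [← Units.val_pow_eq_pow_val, h, Units.val_one]
      have h2 : (l : k) ^ 2 - 1 ≠ 0 := fun h => hl2 (Units.ext (by
        push_cast; exact sub_eq_zero.mp h))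
      exact mul_left_cancel₀ h2 (by linear_combination h')
    have hi : (l : k)⁻¹ = - l := by field_simp; linear_combination h4
    have hs : s = 1 := by
      rw [hi] at h1
      exact mul_left_cancel₀ (two_ne_zero (α := k)) (by linear_combination h1)
    rw [hs] at h2
    push_cast at h2
    rw [h4] at h2
    norm_num at h2
  · rcases h2 with ⟨h2, -⟩ | ⟨h2, -⟩ | ⟨-, h2⟩
    · exact ⟨2, by norm_num, h2⟩
    · omega
    exfalso
    have h5 : (l : k) ^ 4 + l ^ 3 + l ^ 2 + l + 1 = 0 := by
      have h : l ^ 5 = 1 := by rw [← hl, pow_orderOf_eq_one]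
      have h' : (l : k) ^ 5 = 1 := by rw [← Units.val_pow_eq_pow_val, h, Units.val_one]
      have h2 : (l : k) - 1 ≠ 0 := fun h => hl1 (Units.ext (sub_eq_zero.mp h))
      exact mul_left_cancel₀ h2 (by linear_combination h')
    set u := (l : k) + (l : k)⁻¹ with hu
    have hu2 : u ^ 2 + u - 1 = 0 := by
      rw [hu]; field_simp; linear_combination h5
    have e1 : 2 - (l : k) - (l : k)⁻¹ = 2 - u := by rw [hu]; ring
    have e2 : 2 - ((l ^ 2 : kˣ) : k) - ((l ^ 2 : kˣ) : k)⁻¹ = 3 + u := by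
      push_cast
      have : (l : k) ^ 2 + ((l : k) ^ 2)⁻¹ = u ^ 2 - 2 := by rw [hu]; field_simp; ring
      linear_combination -this - hu2
    rw [e1] at h1
    rw [e2] at h2
    have hu5 : 1 + 2 * u ≠ 0 := fun h => by
      have : (5 : k) = 0 := by linear_combination -4 * hu2 + (1 + 2 * u) * h
      norm_num at this
    -- With u = l + l⁻¹ the two values of V are 2 - u and 3 + u, with sum 5 and difference 1 + 2u ≠
    -- 0. Subtracting the two quadratic equations and cancelling s(1 + 2u) gives this.
    have hs : 5 * s = 3 := by
      refine mul_left_cancel₀ (mul_ne_zero hs0 hu5) ?_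
      linear_combination h2 - h1
    -- The sum of the squares of the two values of V is 15 by u² + u = 1, so the sum of the
    -- equations reads 15s² - 15s + 2 = 0, and s = 3/5 turns it into -8/5 = 0.
    have : (8 : k) = 0 := by
      linear_combination -5 * h1 - 5 * h2 + 10 * s ^ 2 * hu2 + (15 * s - 6) * hs
    norm_num at this

section Pair

variable {H : Subgroup PGL(2, k)} [Finite H]

theorem orderOf_eq_two_of_swap {g : PGL(2, k)} {p q : Line k} (hpq : p ≠ q) (h : g • p = q)
    (h' : g • q = p) : orderOf g = 2 := by
  obtain ⟨P, hp, hq⟩ := exists_smul_ptInf_ptZero hpq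
  obtain ⟨b, hb⟩ := exists_anti_of_smul (g := P⁻¹ * g * P)
    (by rw [mul_smul, hp, mul_smul, h, ← hq, inv_smul_smul])
    (by rw [mul_smul, hq, mul_smul, h', ← hp, inv_smul_smul])
  have hd : (0 : k) * 0 - b * 1 ≠ 0 := by simp
  have h2 := (orderOf_mat_eq_two hd fun e => by
    have := (mat_eq_one_iff hd).mp e; simp at this).mpr (by simp)
  rw [← hb] at h2
  refine Eq.trans ?_ h2
  rw [← orderOf_injective _ (conj_injective P⁻¹) g]
  simp

theorem smul_eq_iff_of_fixed {g : PGL(2, k)} (hg : IsOfFinOrder g) (h1 : g ≠ 1) {p q : Line k}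
    (hpq : p ≠ q) (hp : g • p = p) (hq : g • q = q) (x : Line k) :
    g • x = x ↔ x = p ∨ x = q := by
  obtain ⟨q', hq', h⟩ := exists_two_fixed_points hg h1 hp
  rw [(((h q).mp hq).resolve_left hpq.symm)]
  exact h x

/-- If all conjugates in `H` of some nontrivial `w` fix `p` and `q` then `H` preserves the pair. -/
theorem preservesPair_of_conj_fixed {w : PGL(2, k)} (hw : w ∈ H) (h1 : w ≠ 1) {p q : Line k}
    (hpq : p ≠ q)
    (h : ∀ g ∈ H, (g * w * g⁻¹) • p = p ∧ (g * w * g⁻¹) • q = q) : PreservesPair H p q := by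
  have hfix := smul_eq_iff_of_fixed (isOfFinOrder_of_mem hw) h1 hpq
    (by simpa using (h 1 (one_mem _)).1) (by simpa using (h 1 (one_mem _)).2)
  refine ⟨hpq, fun g => ?_⟩
  have key : ∀ x : Line k, (g.1⁻¹ * w * g.1⁻¹⁻¹) • x = x → g.1 • x = p ∨ g.1 • x = q := by
    intro x hx
    rw [← hfix]
    rwa [inv_inv, mul_smul, mul_smul, inv_smul_eq_iff] at hx
  obtain ⟨hp, hq⟩ := h g.1⁻¹ (inv_mem g.2)
  have hne : g.1 • p ≠ g.1 • q := fun e => hpq (MulAction.injective g.1 e)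
  rcases key p hp with h1 | h1 <;> rcases key q hq with h2 | h2
  · exact absurd (h1.trans h2.symm) hne
  · exact Or.inl ⟨h1, h2⟩
  · exact Or.inr ⟨h1, h2⟩
  · exact absurd (h1.trans h2.symm) hne

theorem orderOf_conj_eq {G : Type*} [Group G] (g x : G) : orderOf (g * x * g⁻¹) = orderOf x :=
  orderOf_injective _ (conj_injective g) x

/-- Involutions of `H` which move the fixed points of a rotation of order at least three. -/
theorem exists_involution_not_preserving (h2 : 2 ∣ Nat.card H)
    (hH : ∀ p q : Line k, ¬ PreservesPair H p q) {y : PGL(2, k)} (hy : y ∈ H) (hy2 : y ^ 2 ≠ 1)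
    {p q : Line k} (hpq : p ≠ q) (hp : y • p = p) (hq : y • q = q) :
    ∃ x ∈ H, orderOf x = 2 ∧ ¬(x • p = p ∧ x • q = q) ∧ ¬(x • p = q ∧ x • q = p) := by
  by_contra! hcon
  have hpres : ∀ x ∈ H, orderOf x = 2 → (x • p = p ∧ x • q = q) ∨ (x • p = q ∧ x • q = p) := by
    intro x hx ho
    by_contra! hx'
    have := hcon x hx ho (fun a => hx'.1 a)
    exact absurd this.2 (hx'.2 this.1)
  -- If all involutions preserve {p, q} and z interchanges p and q, then z and zy are involutions,
  -- and every conjugate of y² = (z · zy)² is the square of an element preserving {p, q}; so it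
  -- fixes both points. If no element interchanges them, every involution fixes both. In either case
  -- all conjugates of a nontrivial element fix p and q, so H preserves the pair.
  by_cases hsw : ∃ z ∈ H, z • p = q ∧ z • q = p
  · obtain ⟨z, hz, hzp, hzq⟩ := hsw
    refine hH p q (preservesPair_of_conj_fixed (pow_mem hy 2) hy2 hpq fun g hg => ?_)
    have hz2 := orderOf_eq_two_of_swap hpq hzp hzq
    have hzy := orderOf_eq_two_of_swap (g := z * y) hpq (by rw [mul_smul, hp, hzp])
      (by rw [mul_smul, hq, hzq])
    have a1 := hpres _ (mul_mem (mul_mem hg hz) (inv_mem hg)) (by rw [orderOf_conj_eq, hz2])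
    have a2 := hpres _ (mul_mem (mul_mem hg (mul_mem hz hy)) (inv_mem hg))
      (by rw [orderOf_conj_eq, hzy])
    have hzi : z⁻¹ = z := inv_eq_of_mul_eq_one_right (by
      rw [← pow_two]; exact orderOf_dvd_iff_pow_eq_one.mp hz2.dvd)
    have e : g * y ^ 2 * g⁻¹ = (g * z * g⁻¹) * (g * (z * y) * g⁻¹) * (g * z * g⁻¹) *
        (g * (z * y) * g⁻¹) := by
      have hzz : ∀ t, z * (z * t) = t := fun t => by
        rw [← mul_assoc]; nth_rewrite 1 [← hzi]; rw [inv_mul_cancel, one_mul]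
      simp only [mul_assoc, inv_mul_cancel_left, hzz, pow_two]
    rw [e]
    simp only [mul_smul _ _ p, mul_smul _ _ q]
    simp only [mul_smul] at a1 a2 ⊢
    rcases a1 with ⟨b1, b2⟩ | ⟨b1, b2⟩ <;> rcases a2 with ⟨c1, c2⟩ | ⟨c1, c2⟩ <;>
      simp only [b1, b2, c1, c2, and_self]
  · push Not at hsw
    obtain ⟨z, hz⟩ := exists_prime_orderOf_dvd_card' (G := H) 2 h2
    have hz' : orderOf z.1 = 2 := by rw [Subgroup.orderOf_coe, hz]
    refine hH p q (preservesPair_of_conj_fixed z.2 (fun e => by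
      rw [e, orderOf_one] at hz'; omega) hpq fun g hg => ?_)
    have hm := mul_mem (mul_mem hg z.2) (inv_mem hg)
    exact (hpres _ hm (by rw [orderOf_conj_eq, hz'])).resolve_right fun h => hsw _ hm h.1 h.2

/-- Take y of order `m` and an involution x that does not preserve the fixed points of y. Some power
of y, still of order `m`, then has a product of order three with x. -/
theorem exists_isTriangle [IsAlgClosed k] (h2 : 2 ∣ Nat.card H) (hH : ∀ p q : Line k, ¬ PreservesPair H p q)
    {m : ℕ} (hm : m = 3 ∨ m = 4 ∨ m = 5) (hy : ∃ y ∈ H, orderOf y = m)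
    (ho : ∀ y ∈ H, orderOf y = 1 ∨ orderOf y = 2 ∨ orderOf y = 3 ∨ orderOf y = m) :
    ∃ y ∈ H, ∃ x ∈ H, IsTriangle m y x := by
  obtain ⟨y, hy, hym⟩ := hy
  obtain ⟨P, l, hl, hP⟩ := exists_conj_torus_of_orderOf (by omega) hym
  have hy' : y = P⁻¹ * torus l * P := by rw [← hP]; group
  have hne : P⁻¹ • ptInf k ≠ P⁻¹ • ptZero k := fun e =>
    ptInf_ne_ptZero (MulAction.injective _ e)
  obtain ⟨x, hx, hx2, hx3, hx4⟩ := exists_involution_not_preserving h2 hH hy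
    (fun h => by have := Nat.le_of_dvd (by norm_num) (orderOf_dvd_of_pow_eq_one h); omega)
    hne (by rw [hy', mul_smul, smul_inv_smul, mul_smul, torus_smul_ptInf])
    (by rw [hy', mul_smul, smul_inv_smul, mul_smul, torus_smul_ptZero])
  obtain ⟨a, b, c, hd, e⟩ := exists_mat_of_orderOf_two (x := P * x * P⁻¹)
    (by rw [orderOf_conj_eq, hx2])
  have hdet : a * -a - b * c ≠ 0 := fun h => hd (by linear_combination -h)
  have ex : ∀ r s : Line k, x • P⁻¹ • r = P⁻¹ • s ↔ mat a b c (-a) • r = s := fun r s => by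
    rw [← e, mul_smul, mul_smul, smul_eq_iff_eq_inv_smul P]
  rw [ex, ex] at hx3 hx4
  unfold ptInf ptZero at hx3 hx4
  simp only [mat_smul_pt_eq_iff hdet] at hx3 hx4
  -- `a = 0` would mean that x interchanges the fixed points of y, and `b = c = 0` that it fixes
  -- both.
  obtain ⟨j, hj, h3⟩ := exists_orderOf_torus_pow_mul hm hl hd
    (by rintro rfl; exact hx4 (by simp)) (by rintro ⟨rfl, rfl⟩; exact hx3 (by simp)) (by
      rintro _ ⟨j, rfl⟩
      simp only [map_zpow]
      rw [← hP, ← e, conj_zpow]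
      have : P * y ^ j * P⁻¹ * (P * x * P⁻¹) = P * (y ^ j * x) * P⁻¹ := by group
      rw [this, orderOf_conj_eq]
      exact ho _ (mul_mem (zpow_mem hy j) hx))
  refine ⟨y ^ j, pow_mem hy j, x, hx, ?_, hx2, ?_⟩
  · rw [Nat.Coprime.orderOf_pow (by rw [hym]; exact hj.symm), hym]
  · rw [map_pow, ← hP, ← e, conj_pow] at h3
    have : P * y ^ j * P⁻¹ * (P * x * P⁻¹) = P * (y ^ j * x) * P⁻¹ := by group
    rwa [this, orderOf_conj_eq] at h3

end Pair

end QuadricAut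

namespace QuadricAut

/-! ### Klein's classification -/

variable {k : Type*} [Field k] [CharZero k]

theorem map_conj_eq_range {Γ G : Type*} [Group Γ] [Group G] {H : Subgroup G} [Finite H]
    {f : Γ →* G} (hf : Function.Injective f) {α β : Γ} (hgen : Subgroup.closure {α, β} = ⊤)
    (hc : Nat.card H = Nat.card Γ) {P y x : G} (hy : y ∈ H) (hx : x ∈ H)
    (h1 : P * y * P⁻¹ = f α) (h2 : P * x * P⁻¹ = f β) :
    H.map (MulAut.conj P).toMonoidHom = f.range := by
  have e1 : Nat.card (H.map (MulAut.conj P).toMonoidHom) = Nat.card H :=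
    (Nat.card_congr (H.equivMapOfInjective _ (conj_injective P)).toEquiv).symm
  have e2 : Nat.card f.range = Nat.card Γ :=
    (Nat.card_congr (MonoidHom.ofInjective hf).toEquiv).symm
  have : Finite (H.map (MulAut.conj P).toMonoidHom) :=
    Finite.of_equiv _ (H.equivMapOfInjective _ (conj_injective P)).toEquiv
  symm
  refine Subgroup.eq_of_le_of_card_ge ?_ (by rw [e1, e2, hc])
  rw [MonoidHom.range_eq_map, ← hgen, MonoidHom.map_closure, Subgroup.closure_le]
  rintro _ ⟨z, rfl | rfl, rfl⟩
  · exact ⟨y, hy, h1⟩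
  · exact ⟨x, hx, h2⟩

variable [IsAlgClosed k] (ω : RootChoice k)

/-- Klein's classification of the finite subgroups of `PGL₂(k)`. -/
theorem klein_classification (H : Subgroup PGL(2, k)) [Finite H] :
    (∃ p q : Line k, PreservesPair H p q) ∨
      (∃ P, H.map (MulAut.conj P).toMonoidHom ≤ (octHom ω).range) ∨
      ∃ P, H.map (MulAut.conj P).toMonoidHom ≤ (icoHom ω).range := by
  rw [or_iff_not_imp_left]
  intro hH
  rcases exists_preservesPair_or_signature H with h | ⟨m, hm, hey, ho⟩
  · exact absurd h hH
  push Not at hH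
  obtain ⟨y, hy, x, hx, ht⟩ := exists_isTriangle (by omega) hH (m := m) (by omega) hey ho
  rcases hm with ⟨rfl, hc⟩ | ⟨rfl, hc⟩ | ⟨rfl, hc⟩
  · left
    have hinj : Function.Injective ((octHom ω).comp (alternatingGroup (Fin 4)).subtype) :=
      (octHom_injective ω).comp (Subgroup.subtype_injective _)
    obtain ⟨P, h1, h2⟩ := ht.conj_of_le_four (Or.inl rfl) (isTriangle_aCA.map _ hinj)
    refine ⟨P, ?_⟩
    rw [map_conj_eq_range hinj closure_aCA (by rw [hc, card_alternatingGroup_four]) hy hx h1 h2]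
    rintro _ ⟨z, rfl⟩
    exact ⟨z, rfl⟩
  · left
    obtain ⟨P, h1, h2⟩ := ht.conj_of_le_four (Or.inr rfl)
      (isTriangle_pab.map _ (octHom_injective ω))
    exact ⟨P, (map_conj_eq_range (octHom_injective ω) closure_pab
      (by rw [hc, card_perm_four]) hy hx h1 h2).le⟩
  · right
    -- The relations of the triangle give a homomorphism from A₅ onto `H`, injective by simplicity.
    -- It is conjugate to the standard one up to an automorphism, which does not change the image.
    obtain ⟨f, hf1, hf2⟩ := exists_hom_alternating_five
      (orderOf_dvd_iff_pow_eq_one.mp ht.left.dvd) (orderOf_dvd_iff_pow_eq_one.mp ht.right.dvd)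
      (orderOf_dvd_iff_pow_eq_one.mp ht.mul.dvd)
    have hinj : Function.Injective f := by
      rw [← MonoidHom.ker_eq_bot_iff]
      refine (Subgroup.Normal.eq_bot_or_eq_top inferInstance).resolve_right fun h => ?_
      have h1 : aE ∈ f.ker := h ▸ Subgroup.mem_top _
      rw [MonoidHom.mem_ker, hf1] at h1
      have := ht.left
      rw [h1, orderOf_one] at this
      omega
    have e := map_conj_eq_range hinj closure_aEF (by rw [hc, card_alternatingGroup_five]) hy hx
      (P := 1) (by simp [hf1]) (by simp [hf2])
    obtain ⟨P, θ, hP⟩ := exists_conj_icoHom ω hinj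
    refine ⟨P, ?_⟩
    rintro _ ⟨h, hh, rfl⟩
    have : h ∈ f.range := e ▸ ⟨h, hh, by simp⟩
    obtain ⟨z, rfl⟩ := this
    exact ⟨θ z, (hP z).symm⟩

end QuadricAut

namespace QuadricAut

/-! ### Dihedral groups -/

theorem closure_dihedral (n : ℕ) [NeZero n] :
    Subgroup.closure {DihedralGroup.r 1, DihedralGroup.sr 0} = (⊤ : Subgroup (DihedralGroup n)) := by
  rw [eq_top_iff]
  have hr : ∀ i : ZMod n, DihedralGroup.r i ∈
      Subgroup.closure {DihedralGroup.r 1, DihedralGroup.sr (0 : ZMod n)} := fun i => by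
    have e : DihedralGroup.r i = (DihedralGroup.r 1) ^ i.val := by
      rw [DihedralGroup.r_one_pow, ZMod.natCast_val, ZMod.cast_id]
    rw [e]
    exact pow_mem (Subgroup.subset_closure (by simp)) _
  rintro (i | i) -
  · exact hr i
  · have e : DihedralGroup.sr i = DihedralGroup.sr 0 * DihedralGroup.r i := by
      rw [DihedralGroup.sr_mul_r, zero_add]
    rw [e]
    exact mul_mem (Subgroup.subset_closure (by simp)) (hr i)

section
variable {k : Type*} [Field k] (ω : RootChoice k)

theorem torus_mul_mB (a : kˣ) : torus a * mB k = mat 0 (a : k) 1 0 := by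
  rw [mB_eq, torus_eq, mat_mul (by simp) (by simp)]
  simp

theorem mB_mul_mB : mB k * mB k = 1 := by
  rw [mB_eq, mat_mul (by simp) (by simp)]
  simp [mat_one]

theorem mB_mul_torus (a : kˣ) : mB k * torus a = torus a⁻¹ * mB k := by
  rw [torus_mul_mB, mB_eq, torus_eq, mat_mul (by simp) (by simp),
    ← mat_smul_eq a.ne_zero (a := (0 : k))]
  simp

theorem mB_conj_torus (a : kˣ) : mB k * torus a * mB k = (torus a)⁻¹ := by
  rw [mB_mul_torus, mul_assoc, mB_mul_mB, mul_one, map_inv]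

theorem torus_ne_mB (a : kˣ) : torus a ≠ mB k := by
  rw [torus_eq, mB_eq, Ne, mat_eq_iff (by simp) (by simp)]
  rintro ⟨s, hs, h1, -⟩
  exact mul_ne_zero hs a.ne_zero h1.symm

variable (n : ℕ) [NeZero n]

theorem mR_pow : mR ω n ^ n = 1 := by
  rw [mR_eq, ← map_pow, inv_pow, (ω.prim n (NeZero.pos n)).pow_eq_one, inv_one, map_one]

/-- The dihedral representation `Dₙ → PGL₂(k)`. -/
noncomputable def dihHom : DihedralGroup n →* PGL(2, k) :=
  dihedralHom n (mR ω n) (mB k) (mR_pow ω n) mB_mul_mB (by rw [mR_eq, mB_conj_torus])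

theorem dihHom_injective : Function.Injective (dihHom ω n) := by
  refine dihedralHom_injective _ _ _ ?_ fun m => ?_
  · rw [mR_eq, orderOf_torus, orderOf_inv, ω.orderOf_root (NeZero.pos n)]
  · rw [mR_eq, ← map_pow]
    exact torus_ne_mB _

theorem dihHom_r : dihHom ω n (.r 1) = mR ω n := by
  have h : dihHom ω n (.r 1) = mR ω n ^ (1 : ZMod n).val := rfl
  rw [h, ← pow_one (mR ω n), ← pow_mul, one_mul, pow_eq_pow_mod' (mR_pow ω n) 1, ZMod.val_one_eq_one_mod]

theorem dihHom_sr : dihHom ω n (.sr 0) = mB k := by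
  have h : dihHom ω n (.sr 0) = mB k * mR ω n ^ (0 : ZMod n).val := rfl
  rw [h, ZMod.val_zero, pow_zero, mul_one]

theorem torus_mem_range_dihHom {a : kˣ} (h : a ^ n = 1) : torus a ∈ (dihHom ω n).range := by
  have hp := (IsPrimitiveRoot.coe_units_iff.mpr (ω.prim n (NeZero.pos n)).inv)
  obtain ⟨i, -, hi⟩ := hp.eq_pow_of_pow_eq_one (ξ := (a : k))
    (by rw [← Units.val_pow_eq_pow_val, h, Units.val_one])
  obtain rfl : (ω.root n)⁻¹ ^ i = a := Units.ext (by rw [Units.val_pow_eq_pow_val, hi])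
  rw [map_pow, ← mR_eq, ← dihHom_r, ← map_pow]
  exact ⟨_, rfl⟩

theorem torus_mul_mB_mem_range_dihHom {a : kˣ} (h : a ^ n = 1) :
    torus a * mB k ∈ (dihHom ω n).range :=
  mul_mem (torus_mem_range_dihHom ω n h) ⟨_, dihHom_sr ω n⟩

theorem mem_range_dihHom {g : PGL(2, k)} :
    g ∈ (dihHom ω n).range ↔ ∃ a : kˣ, a ^ n = 1 ∧ (g = torus a ∨ g = torus a * mB k) := by
  constructor
  · have hω : ((ω.root n)⁻¹) ^ n = 1 := by
      rw [inv_pow, (ω.prim n (NeZero.pos n)).pow_eq_one, inv_one]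
    rintro ⟨i | i, rfl⟩
    · have h : dihHom ω n (.r i) = mR ω n ^ i.val := rfl
      refine ⟨(ω.root n)⁻¹ ^ i.val, ?_, Or.inl ?_⟩
      · rw [← pow_mul, mul_comm, pow_mul, hω, one_pow]
      · rw [h, mR_eq, map_pow]
    · have h : dihHom ω n (.sr i) = mB k * mR ω n ^ i.val := rfl
      refine ⟨((ω.root n)⁻¹ ^ i.val)⁻¹, ?_, Or.inr ?_⟩
      · rw [inv_pow, ← pow_mul, mul_comm, pow_mul, hω, one_pow, inv_one]
      · rw [h, mR_eq, ← mB_mul_torus, map_pow]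
  · rintro ⟨a, ha, rfl | rfl⟩
    exacts [torus_mem_range_dihHom ω n ha, torus_mul_mB_mem_range_dihHom ω n ha]

theorem range_dihHom_le {m : ℕ} [NeZero m] (h : n ∣ m) :
    (dihHom ω n).range ≤ (dihHom ω m).range := by
  intro g
  rw [mem_range_dihHom, mem_range_dihHom]
  rintro ⟨a, ha, hg⟩
  obtain ⟨l, rfl⟩ := h
  exact ⟨a, by rw [pow_mul, ha, one_pow], hg⟩

/-- By Lagrange every diagonal element has order dividing |K|. An antidiagonal one is a diagonal
element times B, and its diagonal part lies in `K` because B does; so |K| serves as the index of the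
dihedral group. -/
theorem conj_le_range_dihHom_of_mB {K : Subgroup PGL(2, k)} [Finite K]
    (h : ∀ g ∈ K, ∃ a : kˣ, g = torus a ∨ g = torus a * mB k)
    (hB : ∀ a : kˣ, torus a * mB k ∈ K → mB k ∈ K) :
    haveI : NeZero (Nat.card K) := ⟨Nat.card_pos.ne'⟩
    K ≤ (dihHom ω (Nat.card K)).range := by
  have : NeZero (Nat.card K) := ⟨Nat.card_pos.ne'⟩
  intro g hg
  have hpow : ∀ a : kˣ, torus a ∈ K → a ^ Nat.card K = 1 := fun a ha => by
    have h1 : (⟨torus a, ha⟩ : K) ^ Nat.card K = 1 := pow_card_eq_one'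
    have h2 : torus a ^ Nat.card K = 1 := congrArg Subtype.val h1
    exact torus_injective (by rw [map_pow, h2, map_one])
  rw [mem_range_dihHom]
  obtain ⟨a, rfl | rfl⟩ := h g hg
  · exact ⟨a, hpow a hg, Or.inl rfl⟩
  · refine ⟨a, hpow a ?_, Or.inr rfl⟩
    have := mul_mem hg (hB a hg)
    rwa [mul_assoc, mB_mul_mB, mul_one] at this

end

section
variable {k : Type*} [Field k] [IsAlgClosed k] (ω : RootChoice k)

/-- A finite subgroup which preserves a pair of points is conjugate to a subgroup of a dihedral
group. -/
theorem exists_conj_le_range_dihHom {H : Subgroup PGL(2, k)} [Finite H] {p q : Line k}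
    (h : PreservesPair H p q) : ∃ (P : PGL(2, k)) (n : ℕ) (_ : NeZero n),
      H.map (MulAut.conj P).toMonoidHom ≤ (dihHom ω n).range := by
  obtain ⟨hpq, h⟩ := h
  obtain ⟨P, hP, hQ⟩ := exists_smul_ptInf_ptZero hpq
  have hK : ∀ g ∈ H, ∃ a : kˣ, P⁻¹ * g * P = torus a ∨ P⁻¹ * g * P = torus a * mB k := by
    intro g hg
    rcases h ⟨g, hg⟩ with ⟨h1, h2⟩ | ⟨h1, h2⟩
    · change g • p = p at h1
      change g • q = q at h2
      obtain ⟨a, ha⟩ := exists_torus_of_smul (g := P⁻¹ * g * P)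
        (by rw [mul_smul, hP, mul_smul, h1, ← hP, inv_smul_smul])
        (by rw [mul_smul, hQ, mul_smul, h2, ← hQ, inv_smul_smul])
      exact ⟨a, Or.inl ha⟩
    · change g • p = q at h1
      change g • q = p at h2
      obtain ⟨b, hb⟩ := exists_anti_of_smul (g := P⁻¹ * g * P)
        (by rw [mul_smul, hP, mul_smul, h1, ← hQ, inv_smul_smul])
        (by rw [mul_smul, hQ, mul_smul, h2, ← hP, inv_smul_smul])
      exact ⟨b, Or.inr (by rw [hb, torus_mul_mB])⟩
  -- Conjugation by diag(c, 1)⁻¹ divides the parameter of an antidiagonal element by c². With c a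
  -- square root of the parameter of one of them, that element becomes B.
  obtain ⟨c, hc⟩ : ∃ c : kˣ, ∀ a : kˣ, (∃ g ∈ H, P⁻¹ * g * P = torus a * mB k) →
      ∃ g ∈ H, P⁻¹ * g * P = torus (c * c) * mB k := by
    by_cases hex : ∃ a : kˣ, ∃ g ∈ H, P⁻¹ * g * P = torus a * mB k
    · obtain ⟨a, ha⟩ := hex
      obtain ⟨c, hc⟩ := IsAlgClosed.exists_eq_mul_self (a : k)
      have hc0 : c ≠ 0 := by
        rintro rfl
        exact a.ne_zero (by rw [hc, zero_mul])
      refine ⟨Units.mk0 c hc0, fun _ _ => ?_⟩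
      have e : Units.mk0 c hc0 * Units.mk0 c hc0 = a := Units.ext hc.symm
      rwa [e]
    · exact ⟨1, fun a ha => absurd ⟨a, ha⟩ hex⟩
  set Q := (torus c)⁻¹ * P⁻¹ with hQdef
  have hconj : ∀ a : kˣ, (torus c)⁻¹ * (torus a * mB k) * torus c =
      torus (a * (c * c)⁻¹) * mB k := fun a => by
    rw [mul_assoc, mul_assoc, mB_mul_torus, ← map_inv, ← mul_assoc, ← mul_assoc, ← map_mul,
      ← map_mul]
    congr 2
    rw [mul_inv, mul_comm c⁻¹ a, mul_assoc]
  have hQm : ∀ g, Q * g * Q⁻¹ = (torus c)⁻¹ * (P⁻¹ * g * P) * torus c := fun g => by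
    rw [hQdef]; group
  set K := H.map (MulAut.conj Q).toMonoidHom with hKdef
  have : Finite K := Finite.of_equiv _ (H.equivMapOfInjective _ (conj_injective Q)).toEquiv
  refine ⟨Q, Nat.card K, ⟨Nat.card_pos.ne'⟩, conj_le_range_dihHom_of_mB ω ?_ ?_⟩
  · rintro _ ⟨g, hg, rfl⟩
    change ∃ a : kˣ, Q * g * Q⁻¹ = _ ∨ Q * g * Q⁻¹ = _
    obtain ⟨a, ha | ha⟩ := hK g hg
    · refine ⟨a, Or.inl ?_⟩
      rw [hQm, ha, ← map_inv, ← map_mul, ← map_mul, mul_comm c⁻¹ a, inv_mul_cancel_right]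
    · exact ⟨_, Or.inr (by rw [hQm, ha, hconj])⟩
  · rintro a ⟨g, hg, hga⟩
    change Q * g * Q⁻¹ = _ at hga
    have h1 : P⁻¹ * g * P = torus (a * (c * c)) * mB k := by
      obtain ⟨b, hb | hb⟩ := hK g hg
      · exfalso
        rw [hQm, hb, ← map_inv, ← map_mul, ← map_mul, mul_comm c⁻¹ b, inv_mul_cancel_right,
          ← inv_mul_eq_iff_eq_mul, ← map_inv, ← map_mul] at hga
        exact torus_ne_mB _ hga
      · rw [hQm, hb, hconj] at hga
        have := torus_injective (mul_right_cancel hga)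
        rw [hb, ← this, inv_mul_cancel_right]
    obtain ⟨g', hg', e⟩ := hc _ ⟨g, hg, h1⟩
    refine ⟨g', hg', ?_⟩
    change Q * g' * Q⁻¹ = _
    rw [hQm, e, hconj, mul_inv_cancel, map_one, one_mul]

end

end QuadricAut

namespace QuadricAut

/-! ### The six maximal families -/

section
variable {k : Type*} [Field k] {Γ Γ' : Type*} [Group Γ] [Group Γ']

/-- The action of `Γ × Γ'` on `ℙ¹ × ℙ¹` given by homomorphisms to `PGL₂(k)`. -/
noncomputable def prHom (ρ : Γ →* PGL(2, k)) (ρ' : Γ' →* PGL(2, k)) : Γ × Γ' →* autQuadric k :=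
  act.comp (ρ.prodMap ρ')

variable (ρ : Γ →* PGL(2, k)) (ρ' : Γ' →* PGL(2, k))

theorem prHom_apply (x : Γ × Γ') : prHom ρ ρ' x = str (ρ x.1) (ρ' x.2) := rfl

variable {ρ ρ'}

theorem prHom_injective (h : Function.Injective ρ) (h' : Function.Injective ρ') :
    Function.Injective (prHom ρ ρ') := fun x y hxy => by
  rw [prHom_apply, prHom_apply, str_inj] at hxy
  exact Prod.ext (h hxy.1) (h' hxy.2)

theorem closure_eq_range_prHom {s : Set Γ} {t : Set Γ'} (hs : Subgroup.closure s = ⊤)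
    (ht : Subgroup.closure t = ⊤) :
    Subgroup.closure ((fun x => str (ρ x) 1) '' s ∪ (fun x => str 1 (ρ' x)) '' t) =
      (prHom ρ ρ').range := by
  have h1 : ((fun x => str (ρ x) 1) '' s : Set (autQuadric k)) =
      (prHom ρ ρ').comp (MonoidHom.inl Γ Γ') '' s :=
    Set.image_congr fun x _ => by simp [prHom_apply]
  have h2 : ((fun x => str 1 (ρ' x)) '' t : Set (autQuadric k)) =
      (prHom ρ ρ').comp (MonoidHom.inr Γ Γ') '' t :=
    Set.image_congr fun x _ => by simp [prHom_apply]
  rw [h1, h2, Subgroup.closure_union, ← MonoidHom.map_closure, ← MonoidHom.map_closure, hs, ht,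
    ← Subgroup.map_map, ← Subgroup.map_map, ← Subgroup.map_sup, MonoidHom.range_eq_map]
  congr 1
  rw [eq_top_iff]
  rintro ⟨x, y⟩ -
  have e : ((x, y) : Γ × Γ') = MonoidHom.inl Γ Γ' x * MonoidHom.inr Γ Γ' y := by simp
  rw [e]
  exact mul_mem (Subgroup.mem_sup_left ⟨x, trivial, rfl⟩) (Subgroup.mem_sup_right ⟨y, trivial, rfl⟩)

theorem closure_eq_range_wrHom {s : Set Γ} (hs : Subgroup.closure s = ⊤) :
    Subgroup.closure ((fun x => str (ρ x) 1) '' s ∪ {tw 1 1}) = (wrHom ρ).range := by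
  apply le_antisymm
  · rw [Subgroup.closure_le]
    rintro _ (⟨x, -, rfl⟩ | rfl)
    · exact ⟨wst x 1, by rw [wrHom_wst, map_one]⟩
    · exact ⟨wts 1 1, by rw [wrHom_wts, map_one]⟩
  · set K := Subgroup.closure ((fun x => str (ρ x) 1) '' s ∪ {tw 1 1}) with hK
    have ht : tw 1 1 ∈ K := Subgroup.subset_closure (Or.inr rfl)
    have h1 : ∀ x : Γ, str (ρ x) 1 ∈ K := by
      intro x
      have h2 : ((prHom ρ (MonoidHom.id _)).comp (MonoidHom.inl Γ PGL(2, k))).range ≤ K := by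
        rw [MonoidHom.range_eq_map, ← hs, MonoidHom.map_closure, Subgroup.closure_le]
        rintro _ ⟨x, hx, rfl⟩
        exact Subgroup.subset_closure (Or.inl ⟨x, hx, rfl⟩)
      exact h2 ⟨x, rfl⟩
    have h2 : ∀ x y : Γ, str (ρ x) (ρ y) ∈ K := by
      intro x y
      have := mul_mem (h1 x) (mul_mem ht (mul_mem (h1 y) ht))
      simpa only [str_mul_tw, tw_mul_tw, str_mul_str, one_mul, mul_one] using this
    rintro _ ⟨w, rfl⟩
    rcases wr_cases w with ⟨a, b, rfl⟩ | ⟨a, b, rfl⟩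
    · rw [wrHom_wst]
      exact h2 a b
    · have := mul_mem (h2 a b) ht
      rwa [str_mul_tw, mul_one, mul_one, ← wrHom_wts] at this

end

section
variable {k : Type*} [Field k] (ω : RootChoice k)

theorem grpDnA5_eq (n : ℕ) [NeZero n] :
    grpDnA5 ω n = (prHom (dihHom ω n) (icoHom ω)).range := by
  rw [← closure_eq_range_prHom (closure_dihedral n) closure_aEF]
  unfold grpDnA5
  congr 1
  simp only [Set.image_insert_eq, Set.image_singleton, dihHom_r, dihHom_sr, icoHom_aE, icoHom_aF,
    Set.insert_union, Set.singleton_union]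

theorem grpDnWr_eq (n : ℕ) [NeZero n] : grpDnWr ω n = (wrHom (dihHom ω n)).range := by
  rw [← closure_eq_range_wrHom (closure_dihedral n)]
  unfold grpDnWr
  congr 1
  simp only [Set.image_insert_eq, Set.image_singleton, dihHom_r, dihHom_sr,
    Set.insert_union, Set.singleton_union]

theorem grpA5Wr_eq : grpA5Wr ω = (wrHom (icoHom ω)).range := by
  rw [← closure_eq_range_wrHom closure_aEF]
  unfold grpA5Wr
  congr 1
  simp only [Set.image_insert_eq, Set.image_singleton, icoHom_aE, icoHom_aF,
    Set.insert_union, Set.singleton_union]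

variable [CharZero k]

theorem grpDnS4_eq (n : ℕ) [NeZero n] :
    grpDnS4 ω n = (prHom (dihHom ω n) (octHom ω)).range := by
  rw [← closure_eq_range_prHom (closure_dihedral n) closure_pABCD]
  unfold grpDnS4
  congr 1
  simp only [Set.image_insert_eq, Set.image_singleton, dihHom_r, dihHom_sr, octHom_pA, octHom_pB,
    octHom_pC, octHom_pD, Set.insert_union, Set.singleton_union]

theorem grpS4A5_eq : grpS4A5 ω = (prHom (octHom ω) (icoHom ω)).range := by
  rw [← closure_eq_range_prHom closure_pABCD closure_aEF]
  unfold grpS4A5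
  congr 1
  simp only [Set.image_insert_eq, Set.image_singleton, octHom_pA, octHom_pB,
    octHom_pC, octHom_pD, icoHom_aE, icoHom_aF, Set.insert_union, Set.singleton_union]

theorem grpS4Wr_eq : grpS4Wr ω = (wrHom (octHom ω)).range := by
  rw [← closure_eq_range_wrHom closure_pABCD]
  unfold grpS4Wr
  congr 1
  simp only [Set.image_insert_eq, Set.image_singleton, octHom_pA, octHom_pB,
    octHom_pC, octHom_pD, Set.insert_union, Set.singleton_union]

/-! ### Orders and isomorphism classes -/

theorem card_range {G G' : Type*} [Group G] [Group G'] {f : G →* G'} (hf : Function.Injective f) :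
    Nat.card f.range = Nat.card G :=
  (Nat.card_congr (MonoidHom.ofInjective hf).toEquiv).symm

theorem nonempty_range {G G' : Type*} [Group G] [Group G'] {f : G →* G'}
    (hf : Function.Injective f) : Nonempty (f.range ≃* G) :=
  ⟨(MonoidHom.ofInjective hf).symm⟩

theorem card_grpDnS4 (n : ℕ) [NeZero n] : Nat.card (grpDnS4 ω n) = 48 * n ∧
    Nonempty (grpDnS4 ω n ≃* DihedralGroup n × Equiv.Perm (Fin 4)) := by
  have h := prHom_injective (dihHom_injective ω n) (octHom_injective ω)
  rw [grpDnS4_eq, card_range h, Nat.card_prod, DihedralGroup.nat_card, card_perm_four]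
  exact ⟨by ring, nonempty_range h⟩

theorem card_grpDnA5 (n : ℕ) [NeZero n] : Nat.card (grpDnA5 ω n) = 120 * n ∧
    Nonempty (grpDnA5 ω n ≃* DihedralGroup n × alternatingGroup (Fin 5)) := by
  have h := prHom_injective (dihHom_injective ω n) (icoHom_injective ω)
  rw [grpDnA5_eq, card_range h, Nat.card_prod, DihedralGroup.nat_card, card_alternatingGroup_five]
  exact ⟨by ring, nonempty_range h⟩

theorem card_grpS4A5 : Nat.card (grpS4A5 ω) = 1440 ∧
    Nonempty (grpS4A5 ω ≃* Equiv.Perm (Fin 4) × alternatingGroup (Fin 5)) := by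
  have h := prHom_injective (octHom_injective ω) (icoHom_injective ω)
  rw [grpS4A5_eq, card_range h, Nat.card_prod, card_perm_four, card_alternatingGroup_five]
  exact ⟨by norm_num, nonempty_range h⟩

theorem card_grpDnWr (n : ℕ) [NeZero n] : Nat.card (grpDnWr ω n) = 8 * n ^ 2 ∧
    Nonempty (grpDnWr ω n ≃* WrC2 (DihedralGroup n)) := by
  have h := wrHom_injective _ (dihHom_injective ω n)
  rw [grpDnWr_eq, card_range h, card_wrC2, DihedralGroup.nat_card]
  exact ⟨by ring, nonempty_range h⟩

theorem card_grpS4Wr : Nat.card (grpS4Wr ω) = 1152 ∧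
    Nonempty (grpS4Wr ω ≃* WrC2 (Equiv.Perm (Fin 4))) := by
  have h := wrHom_injective _ (octHom_injective ω)
  rw [grpS4Wr_eq, card_range h, card_wrC2, card_perm_four]
  exact ⟨by norm_num, nonempty_range h⟩

theorem card_grpA5Wr : Nat.card (grpA5Wr ω) = 7200 ∧
    Nonempty (grpA5Wr ω ≃* WrC2 (alternatingGroup (Fin 5))) := by
  have h := wrHom_injective _ (icoHom_injective ω)
  rw [grpA5Wr_eq, card_range h, card_wrC2, card_alternatingGroup_five]
  exact ⟨by norm_num, nonempty_range h⟩

end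

end QuadricAut

namespace QuadricAut

/-! ### Finite subgroups of `Aut(ℙ¹ × ℙ¹)` -/

section
variable {A : Type*} [Group A] {G L L' : Subgroup A}

theorem isConjIntoSubgroup_of_map_le {α : A} (h : G.map (MulAut.conj α).toMonoidHom ≤ L) :
    IsConjIntoSubgroup G L :=
  ⟨_, h, IsConjTo.symm ⟨α, rfl⟩⟩

theorem IsConjIntoSubgroup.mono (h : IsConjIntoSubgroup G L) (hL : L ≤ L') :
    IsConjIntoSubgroup G L' := by
  obtain ⟨K, hK, h⟩ := h
  exact ⟨K, hK.trans hL, h⟩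

theorem IsConjIntoSubgroup.of_isConjTo {G' : Subgroup A} (h : IsConjIntoSubgroup G' L)
    (hG : IsConjTo G G') : IsConjIntoSubgroup G L := by
  obtain ⟨K, hK, h⟩ := h
  exact ⟨K, hK, hG.trans h⟩

theorem IsConjIntoSubgroup.conj (h : IsConjIntoSubgroup G L) (α : A) :
    IsConjIntoSubgroup G (L.map (MulAut.conj α).toMonoidHom) := by
  obtain ⟨K, hK, h⟩ := h
  exact ⟨K.map (MulAut.conj α).toMonoidHom, Subgroup.map_mono hK,
    h.trans (IsConjTo.symm ⟨α, rfl⟩)⟩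

end

section
variable {k : Type*} [Field k] {G : Subgroup (autQuadric k)}

theorem mem_firstFactor {a : PGL(2, k)} : a ∈ firstFactor G ↔ ∃ b, str a b ∈ G := by
  constructor
  · rintro ⟨⟨x, y⟩, h, rfl⟩
    exact ⟨y, h⟩
  · rintro ⟨b, h⟩
    exact ⟨(a, b), h, rfl⟩

/-- The projection of `G ∩ (PGL₂(k) × PGL₂(k))` to the second factor. -/
def secondFactor (G : Subgroup (autQuadric k)) : Subgroup PGL(2, k) :=
  (G.comap act).map (MonoidHom.snd PGL(2, k) PGL(2, k))

instance [Finite G] : Finite (G.comap (act (k := k))) :=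
  Finite.of_injective (fun x : G.comap (act (k := k)) => (⟨act x.1, x.2⟩ : G))
    fun _ _ hxy => Subtype.ext (act_injective (congrArg Subtype.val hxy))

instance [Finite G] : Finite (firstFactor G) :=
  Finite.of_surjective _ ((MonoidHom.fst PGL(2, k) PGL(2, k)).subgroupMap_surjective (G.comap act))

instance [Finite G] : Finite (secondFactor G) :=
  Finite.of_surjective _ ((MonoidHom.snd PGL(2, k) PGL(2, k)).subgroupMap_surjective (G.comap act))

theorem mem_firstFactor_of_tw {c : PGL(2, k)} (hc : tw 1 c ∈ G) : c ∈ firstFactor G := by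
  have := mul_mem hc hc
  rw [tw_mul_tw, one_mul, mul_one] at this
  exact mem_firstFactor.mpr ⟨_, this⟩

/-- Conjugation by (1, c)σ moves the second component to the first place, so both projections land
in the same subgroup H. -/
theorem mem_firstFactor_of_str {a b c : PGL(2, k)} (hc : tw 1 c ∈ G) (h : str a b ∈ G) :
    a ∈ firstFactor G ∧ b ∈ firstFactor G := by
  refine ⟨mem_firstFactor.mpr ⟨b, h⟩, ?_⟩
  have := mul_mem (mul_mem hc h) (inv_mem hc)
  rw [tw_mul_str, tw_inv, tw_mul_tw, inv_one, mul_one, one_mul] at this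
  exact mem_firstFactor.mpr ⟨_, this⟩

theorem mem_firstFactor_of_tw_mem {a b c : PGL(2, k)} (hc : tw 1 c ∈ G) (h : tw a b ∈ G) :
    a ∈ firstFactor G ∧ b ∈ firstFactor G := by
  have h1 := mul_mem h (inv_mem hc)
  rw [tw_inv, tw_mul_tw, inv_one, mul_one] at h1
  obtain ⟨h2, h3⟩ := mem_firstFactor_of_str hc h1
  refine ⟨h2, ?_⟩
  have := mul_mem h3 (mem_firstFactor_of_tw hc)
  rwa [inv_mul_cancel_right] at this

theorem map_conj_le_iff {A : Type*} [Group A] {G L : Subgroup A} {α : A} :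
    G.map (MulAut.conj α).toMonoidHom ≤ L ↔ ∀ g ∈ G, α * g * α⁻¹ ∈ L :=
  Subgroup.map_le_iff_le_comap

variable [CharZero k] [IsAlgClosed k]

theorem map_conj_le_range_wrHom {Γ : Type*} [Group Γ] {ρ : Γ →* PGL(2, k)} {c P : PGL(2, k)}
    (hc : tw 1 c ∈ G) (hP : (firstFactor G).map (MulAut.conj P).toMonoidHom ≤ ρ.range) :
    G.map (MulAut.conj (str P P)).toMonoidHom ≤ (wrHom ρ).range := by
  rw [map_conj_le_iff] at hP ⊢
  intro g hg
  obtain ⟨a, b, rfl | rfl⟩ := eq_str_or_eq_tw g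
  · obtain ⟨ha, hb⟩ := mem_firstFactor_of_str hc hg
    obtain ⟨x, hx⟩ := hP a ha
    obtain ⟨y, hy⟩ := hP b hb
    exact ⟨wst x y, by rw [wrHom_wst, hx, hy, str_inv, str_mul_str, str_mul_str]⟩
  · obtain ⟨ha, hb⟩ := mem_firstFactor_of_tw_mem hc hg
    obtain ⟨x, hx⟩ := hP a ha
    obtain ⟨y, hy⟩ := hP b hb
    exact ⟨wts x y, by rw [wrHom_wts, hx, hy, str_inv, str_mul_tw, tw_mul_str]⟩

theorem map_conj_le_range_prHom {Γ Γ' : Type*} [Group Γ] [Group Γ'] {ρ : Γ →* PGL(2, k)}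
    {ρ' : Γ' →* PGL(2, k)} (hG : ∀ g ∈ G, PreservesRulings g) {P Q : PGL(2, k)}
    (hP : (firstFactor G).map (MulAut.conj P).toMonoidHom ≤ ρ.range)
    (hQ : (secondFactor G).map (MulAut.conj Q).toMonoidHom ≤ ρ'.range) :
    G.map (MulAut.conj (str P Q)).toMonoidHom ≤ (prHom ρ ρ').range := by
  rw [map_conj_le_iff] at hP hQ ⊢
  intro g hg
  obtain ⟨a, b, rfl | rfl⟩ := eq_str_or_eq_tw g
  · obtain ⟨x, hx⟩ := hP a ⟨(a, b), hg, rfl⟩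
    obtain ⟨y, hy⟩ := hQ b ⟨(a, b), hg, rfl⟩
    exact ⟨(x, y), by rw [prHom_apply, hx, hy, str_inv, str_mul_str, str_mul_str]⟩
  · exact absurd (hG _ hg) (not_preservesRulings_tw _ _)

/-- After conjugation, a subgroup which interchanges the rulings contains some `(1, c)σ`. -/
theorem exists_tw_one_mem (hG : ∃ g ∈ G, ¬ PreservesRulings g) :
    ∃ a c : PGL(2, k), tw 1 c ∈ G.map (MulAut.conj (str 1 a)).toMonoidHom := by
  obtain ⟨g, hg, hn⟩ := hG
  obtain ⟨a, b, rfl | rfl⟩ := eq_str_or_eq_tw g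
  · exact absurd (preservesRulings_str _ _) hn
  · refine ⟨a, a * b, tw a b, hg, ?_⟩
    change str 1 a * tw a b * (str 1 a)⁻¹ = _
    rw [str_inv, str_mul_tw, tw_mul_str, one_mul, inv_one, mul_one, mul_inv_cancel]

theorem range_prHom_swap {Γ Γ' : Type*} [Group Γ] [Group Γ'] (ρ : Γ →* PGL(2, k))
    (ρ' : Γ' →* PGL(2, k)) :
    (prHom ρ ρ').range.map (MulAut.conj (swap k)).toMonoidHom ≤ (prHom ρ' ρ).range := by
  rw [map_conj_le_iff]
  rintro _ ⟨⟨x, y⟩, rfl⟩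
  refine ⟨(y, x), ?_⟩
  rw [prHom_apply, prHom_apply, swap_mul_str, mul_assoc, mul_inv_cancel, mul_one]

theorem range_prHom_le_wrHom {Γ : Type*} [Group Γ] (ρ : Γ →* PGL(2, k)) :
    (prHom ρ ρ).range ≤ (wrHom ρ).range := by
  rintro _ ⟨⟨x, y⟩, rfl⟩
  exact ⟨wst x y, by rw [wrHom_wst, prHom_apply]⟩

theorem range_prHom_mono {Γ Γ' Γ₁ : Type*} [Group Γ] [Group Γ'] [Group Γ₁] {ρ : Γ →* PGL(2, k)}
    {ρ' : Γ' →* PGL(2, k)} {ρ₁ : Γ₁ →* PGL(2, k)} (h : ρ.range ≤ ρ₁.range)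
    (h' : ρ'.range ≤ ρ₁.range) : (prHom ρ ρ').range ≤ (prHom ρ₁ ρ₁).range := by
  rintro _ ⟨⟨x, y⟩, rfl⟩
  obtain ⟨x', hx⟩ := h ⟨x, rfl⟩
  obtain ⟨y', hy⟩ := h' ⟨y, rfl⟩
  exact ⟨(x', y'), by rw [prHom_apply, prHom_apply, hx, hy]⟩

variable (ω : RootChoice k)

theorem exists_conj_le_polyhedral (H : Subgroup PGL(2, k)) [Finite H] :
    ∃ P, (∃ (n : ℕ) (_ : NeZero n), 3 ≤ n ∧
        H.map (MulAut.conj P).toMonoidHom ≤ (dihHom ω n).range) ∨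
      H.map (MulAut.conj P).toMonoidHom ≤ (octHom ω).range ∨
      H.map (MulAut.conj P).toMonoidHom ≤ (icoHom ω).range := by
  rcases klein_classification ω H with ⟨p, q, h⟩ | ⟨P, h⟩ | ⟨P, h⟩
  · obtain ⟨P, n, hn, h⟩ := exists_conj_le_range_dihHom ω h
    have := NeZero.pos n
    -- Passing from `n` to `3 n` enlarges the dihedral group and guarantees the bound `3 ≤ n`
    -- required for the wreath product.
    have hn' : NeZero (n * 3) := ⟨by omega⟩
    exact ⟨P, Or.inl ⟨n * 3, hn', by omega, h.trans (range_dihHom_le ω n (dvd_mul_right n 3))⟩⟩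
  · exact ⟨P, Or.inr (Or.inl h)⟩
  · exact ⟨P, Or.inr (Or.inr h)⟩

/-- If the rulings are interchanged, H alone decides among the wreath products. If not, the types of
the two projections give nine cases: equal types go into a wreath product, with both dihedral groups
enlarged to a common multiple, and σ puts unequal types into the listed order. -/
theorem finite_subgroup_cases (G : Subgroup (autQuadric k)) [Finite G] :
    (∃ n : ℕ, 1 ≤ n ∧ IsConjIntoSubgroup G (grpDnS4 ω n)) ∨
      (∃ n : ℕ, 1 ≤ n ∧ IsConjIntoSubgroup G (grpDnA5 ω n)) ∨
      IsConjIntoSubgroup G (grpS4A5 ω) ∨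
      (∃ n : ℕ, 3 ≤ n ∧ IsConjIntoSubgroup G (grpDnWr ω n)) ∨
      IsConjIntoSubgroup G (grpS4Wr ω) ∨ IsConjIntoSubgroup G (grpA5Wr ω) := by
  rw [grpS4A5_eq, grpS4Wr_eq, grpA5Wr_eq]
  by_cases hG : ∃ g ∈ G, ¬ PreservesRulings g
  · obtain ⟨a, c, hc⟩ := exists_tw_one_mem hG
    set G' := G.map (MulAut.conj (str 1 a)).toMonoidHom with hG'
    have : Finite G' := Finite.of_equiv _ (G.equivMapOfInjective _ (conj_injective _)).toEquiv
    have hcj : IsConjTo G G' := IsConjTo.symm ⟨_, rfl⟩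
    obtain ⟨P, ⟨n, hn, hn3, h⟩ | h | h⟩ := exists_conj_le_polyhedral ω (firstFactor G')
    all_goals
      have h := (isConjIntoSubgroup_of_map_le (map_conj_le_range_wrHom hc h)).of_isConjTo hcj
    · exact Or.inr (Or.inr (Or.inr (Or.inl ⟨n, hn3, by rwa [grpDnWr_eq]⟩)))
    · exact Or.inr (Or.inr (Or.inr (Or.inr (Or.inl h))))
    · exact Or.inr (Or.inr (Or.inr (Or.inr (Or.inr h))))
  · push Not at hG
    obtain ⟨P, hP⟩ := exists_conj_le_polyhedral ω (firstFactor G)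
    obtain ⟨Q, hQ⟩ := exists_conj_le_polyhedral ω (secondFactor G)
    rcases hP with ⟨n, hn, hn3, h⟩ | h | h <;> rcases hQ with ⟨m, hm, hm3, h'⟩ | h' | h'
    all_goals have hc := isConjIntoSubgroup_of_map_le (map_conj_le_range_prHom hG h h')
    · refine Or.inr (Or.inr (Or.inr (Or.inl ⟨n * m, by nlinarith, ?_⟩)))
      have : NeZero (n * m) := ⟨mul_ne_zero hn.ne hm.ne⟩
      rw [grpDnWr_eq]
      exact hc.mono ((range_prHom_mono (range_dihHom_le ω n (dvd_mul_right n m))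
        (range_dihHom_le ω m (dvd_mul_left m n))).trans (range_prHom_le_wrHom _))
    · exact Or.inl ⟨n, by omega, by rwa [grpDnS4_eq]⟩
    · exact Or.inr (Or.inl ⟨n, by omega, by rwa [grpDnA5_eq]⟩)
    · exact Or.inl ⟨m, by omega, by
        rw [grpDnS4_eq]; exact (hc.conj (swap k)).mono (range_prHom_swap _ _)⟩
    · exact Or.inr (Or.inr (Or.inr (Or.inr (Or.inl (hc.mono (range_prHom_le_wrHom _))))))
    · exact Or.inr (Or.inr (Or.inl hc))
    · exact Or.inr (Or.inl ⟨m, by omega, by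
        rw [grpDnA5_eq]; exact (hc.conj (swap k)).mono (range_prHom_swap _ _)⟩)
    · exact Or.inr (Or.inr (Or.inl ((hc.conj (swap k)).mono (range_prHom_swap _ _))))
    · exact Or.inr (Or.inr (Or.inr (Or.inr (Or.inr (hc.mono (range_prHom_le_wrHom _))))))

end

end QuadricAut

namespace QuadricAut

/-! ### Subgroups which interchange the rulings -/

section
variable {k : Type*} [Field k] {G G' : Subgroup (autQuadric k)}

theorem firstFactor_map_conj (x y : PGL(2, k)) :
    firstFactor (G.map (MulAut.conj (str x y)).toMonoidHom) =
      (firstFactor G).map (MulAut.conj x).toMonoidHom := by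
  have h := map_conj_eq_iff.mp (rfl : G.map (MulAut.conj (str x y)).toMonoidHom = _)
  symm
  rw [map_conj_eq_iff]
  intro a
  rw [mem_firstFactor, mem_firstFactor]
  constructor
  · rintro ⟨b, hb⟩
    refine ⟨y⁻¹ * b * y, (h _).mp ?_⟩
    rw [str_inv, str_mul_str, str_mul_str]
    simpa [mul_assoc] using hb
  · rintro ⟨b, hb⟩
    refine ⟨y * b * y⁻¹, ?_⟩
    have := (h _).mpr hb
    rwa [str_inv, str_mul_str, str_mul_str] at this

variable [CharZero k] [IsAlgClosed k]

theorem not_preservesRulings_conj {g : autQuadric k} (α : autQuadric k)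
    (h : ¬ PreservesRulings g) : ¬ PreservesRulings (α * g * α⁻¹) := by
  obtain ⟨a, b, rfl | rfl⟩ := eq_str_or_eq_tw g
  · exact absurd (preservesRulings_str _ _) h
  obtain ⟨x, y, rfl | rfl⟩ := eq_str_or_eq_tw α
  · rw [str_inv, str_mul_tw, tw_mul_str]
    exact not_preservesRulings_tw _ _
  · rw [tw_inv, tw_mul_tw, str_mul_tw]
    exact not_preservesRulings_tw _ _

/-- Two conjugate subgroups which interchange the rulings are conjugate under an element which
preserves the rulings. -/
theorem exists_map_conj_str (hG : ∃ g ∈ G, ¬ PreservesRulings g) (α : autQuadric k) :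
    ∃ x y, G.map (MulAut.conj α).toMonoidHom = G.map (MulAut.conj (str x y)).toMonoidHom := by
  obtain ⟨x, y, rfl | rfl⟩ := eq_str_or_eq_tw α
  · exact ⟨x, y, rfl⟩
  · obtain ⟨g, hg, hn⟩ := hG
    obtain ⟨a, b, rfl | rfl⟩ := eq_str_or_eq_tw g
    · exact absurd (preservesRulings_str _ _) hn
    -- The product of (x, y)σ with the element (a, b)σ of `G` is (x b, y a), and elements of `G` do
    -- not change the conjugate.
    refine ⟨x * b, y * a, ?_⟩
    have h := map_conj_eq_iff.mp
      (rfl : G.map (MulAut.conj (str (x * b) (y * a))).toMonoidHom = _)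
    rw [map_conj_eq_iff]
    intro z
    have e : tw x y * z * (tw x y)⁻¹ = str (x * b) (y * a) *
        ((tw a b)⁻¹ * z * tw a b) * (str (x * b) (y * a))⁻¹ := by
      rw [← tw_mul_tw]
      group
    rw [e, h]
    exact ⟨fun h' => by
      have := mul_mem (mul_mem hg h') (inv_mem hg)
      simpa [mul_assoc] using this, fun h' => mul_mem (mul_mem (inv_mem hg) h') hg⟩

theorem IsRankOneOfType.of_isConjTo {T : Type*} [Group T] (h : IsRankOneOfType G' T)
    (hG : IsConjTo G G') : IsRankOneOfType G T := by
  obtain ⟨h1, h2, ⟨e⟩⟩ := h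
  obtain ⟨α, rfl⟩ := hG
  refine ⟨Finite.of_equiv _ (G'.equivMapOfInjective _ (conj_injective α)).toEquiv, ?_, ?_⟩
  · obtain ⟨g, hg, hn⟩ := h2
    exact ⟨_, ⟨g, hg, rfl⟩, not_preservesRulings_conj α hn⟩
  · obtain ⟨x, y, h⟩ := exists_map_conj_str h2 α
    rw [h, firstFactor_map_conj]
    exact ⟨((firstFactor G').equivMapOfInjective _ (conj_injective x)).symm.trans e⟩

variable {Γ T : Type*} [Group Γ] [Group T] {ρ : Γ →* PGL(2, k)} {ι : T →* Γ}

theorem isRankOneOfType_map [Finite Γ] (hρ : Function.Injective ρ) (hι : Function.Injective ι)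
    {L : Subgroup (WrC2 Γ)} {m n : Γ} (hL : wts m n ∈ L)
    (hT : ∀ a, a ∈ ι.range ↔ ∃ b, wst a b ∈ L) :
    IsRankOneOfType (L.map (wrHom ρ)) T := by
  have hw := wrHom_injective ρ hρ
  refine ⟨Finite.of_equiv _ (L.equivMapOfInjective _ hw).toEquiv,
    ⟨tw (ρ m) (ρ n), ⟨_, hL, wrHom_wts _ _ _⟩, not_preservesRulings_tw _ _⟩, ?_⟩
  have e : firstFactor (L.map (wrHom ρ)) = (ρ.comp ι).range := by
    ext a
    rw [mem_firstFactor]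
    constructor
    · rintro ⟨b, w, hw, e⟩
      rcases wr_cases w with ⟨x, y, rfl⟩ | ⟨x, y, rfl⟩
      · rw [wrHom_wst, str_inj] at e
        obtain ⟨t, ht⟩ := (hT x).mpr ⟨y, hw⟩
        exact ⟨t, by rw [MonoidHom.comp_apply, ht, e.1]⟩
      · rw [wrHom_wts] at e
        exact absurd e.symm (str_ne_tw _ _ _ _)
    · rintro ⟨t, rfl⟩
      obtain ⟨b, hb⟩ := (hT (ι t)).mp ⟨t, rfl⟩
      exact ⟨ρ b, _, hb, wrHom_wst _ _ _⟩
  rw [e]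
  exact nonempty_range (f := ρ.comp ι) (hρ.comp hι)

/-- If all faithful representations of `T` in `PGL₂(k)` are conjugate, up to automorphisms of `T`,
to the restriction of the representation `ρ` of `Γ`, then all groups of type `T` come from
subgroups of `Γ ≀ C₂`. -/
theorem exists_isConjTo_map (hρ : Function.Injective ρ)
    (hconj : ∀ f : T →* PGL(2, k), Function.Injective f →
      ∃ (P : PGL(2, k)) (θ : MulAut T), ∀ x, P * f x * P⁻¹ = ρ (ι (θ x)))
    (hG : IsRankOneOfType G T) :
    ∃ (L : Subgroup (WrC2 Γ)) (p : Γ), IsConjTo G (L.map (wrHom ρ)) ∧ wts 1 p ∈ L ∧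
      ∀ a, a ∈ ι.range ↔ ∃ b, wst a b ∈ L := by
  obtain ⟨-, h2, ⟨e⟩⟩ := hG
  obtain ⟨a, c, hc⟩ := exists_tw_one_mem h2
  set G₁ := G.map (MulAut.conj (str 1 a)).toMonoidHom with hG₁
  have e₁ : firstFactor G₁ = firstFactor G := by
    rw [hG₁, firstFactor_map_conj, map_one]
    exact Subgroup.map_id _
  let f : T →* PGL(2, k) := (firstFactor G).subtype.comp e.symm.toMonoidHom
  obtain ⟨P, θ, hP⟩ := hconj f ((Subgroup.subtype_injective _).comp e.symm.injective)
  -- Using the same `P` on both factors keeps an element of the form (1, c)σ in the group and moves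
  -- H onto the image of `T` under the standard representation.
  set G₂ := G₁.map (MulAut.conj (str P P)).toMonoidHom with hG₂
  have hff : firstFactor G₂ = (ρ.comp ι).range := by
    rw [hG₂, firstFactor_map_conj, e₁]
    ext g
    constructor
    · rintro ⟨h, hh, rfl⟩
      refine ⟨θ (e ⟨h, hh⟩), ?_⟩
      rw [MonoidHom.comp_apply, ← hP]
      simp [f]
    · rintro ⟨t, rfl⟩
      refine ⟨f (θ⁻¹ t), (e.symm (θ⁻¹ t)).2, ?_⟩
      change P * f (θ⁻¹ t) * P⁻¹ = _
      rw [hP, MulAut.apply_inv_self]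
      rfl
  have hc₂ : tw 1 (P * c * P⁻¹) ∈ G₂ := by
    refine ⟨_, hc, ?_⟩
    change str P P * tw 1 c * (str P P)⁻¹ = _
    rw [str_inv, str_mul_tw, tw_mul_str, mul_one, mul_inv_cancel]
  have hle : G₂ ≤ (wrHom ρ).range := by
    have h := map_conj_le_range_wrHom (ρ := ρ) (P := 1) hc₂ (by
      rw [map_one, hff]
      rintro _ ⟨_, ⟨t, rfl⟩, rfl⟩
      exact ⟨ι t, rfl⟩)
    rw [str_one, map_one] at h
    exact (Subgroup.map_id G₂).symm.le.trans h
  have hmem : ∀ {x : PGL(2, k)}, x ∈ firstFactor G₂ ↔ ∃ t, ρ (ι t) = x := fun {x} => by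
    rw [hff]; rfl
  obtain ⟨p, hp⟩ := hmem.mp (mem_firstFactor_of_tw hc₂)
  refine ⟨G₂.comap (wrHom ρ), ι p, ?_, ?_, fun x => ?_⟩
  · rw [Subgroup.map_comap_eq_self hle]
    exact (IsConjTo.symm ⟨_, hG₁.symm⟩).trans (IsConjTo.symm ⟨_, hG₂.symm⟩)
  · rw [Subgroup.mem_comap, wrHom_wts, hp, map_one]
    exact hc₂
  · simp only [Subgroup.mem_comap, wrHom_wst]
    constructor
    · rintro ⟨t, rfl⟩
      obtain ⟨b, hb⟩ := mem_firstFactor.mp (hmem.mpr ⟨t, rfl⟩)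
      obtain ⟨s, rfl⟩ := hmem.mp (mem_firstFactor_of_str hc₂ hb).2
      exact ⟨ι s, hb⟩
    · rintro ⟨b, hb⟩
      obtain ⟨t, ht⟩ := hmem.mp (mem_firstFactor.mpr ⟨_, hb⟩)
      exact ⟨t, hρ ht⟩

end

/-! ### First projections of the listed groups. -/

theorem exists_wst_mem_congrGroup_iff {Γ : Type*} [Group Γ] {T N : Subgroup Γ} [N.Normal] {m n : Γ}
    (h : IsTwist (congrPairs T N conj_mem_of_normal) m n) (a : Γ) :
    a ∈ T ↔ ∃ b, wst a b ∈ congrGroup T N m n := by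
  simp only [congrGroup, h.wst_mem_iff, mem_congrPairs]
  exact ⟨fun ha => ⟨a, ha, ha, by simp⟩, fun ⟨_, ha, _⟩ => ha⟩

end QuadricAut

namespace QuadricAut

/-! ### The lists of the theorem -/

section
variable {k : Type*} [Field k] [CharZero k] (ω : RootChoice k)
local notation "𝔸" => alternatingGroup (Fin 4)

theorem a4List_eq (j : Fin 7) : a4List ω j = (a4W j).map (wrHom (octHom ω)) := by
  fin_cases j
  all_goals
    refine Eq.trans ?_ (MonoidHom.map_closure _ _).symm
    refine congrArg Subgroup.closure ?_
    simp only [Set.image_insert_eq, Set.image_singleton, wrHom_wst, wrHom_wts, map_one, octHom_pA,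
      octHom_pB, octHom_pC, octHom_pD]

theorem s4List_eq (j : Fin 5) : s4List ω j = (s4W j).map (wrHom (octHom ω)) := by
  fin_cases j
  all_goals
    refine Eq.trans ?_ (MonoidHom.map_closure _ _).symm
    refine congrArg Subgroup.closure ?_
    simp only [Set.image_insert_eq, Set.image_singleton, wrHom_wst, wrHom_wts, map_one, octHom_pA,
      octHom_pB, octHom_pC, octHom_pD]

theorem wrHom_octHom_injective : Function.Injective (wrHom (octHom ω)) :=
  wrHom_injective _ (octHom_injective ω)

noncomputable def a4Equiv (j : Fin 7) : a4List ω j ≃* a4W j :=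
  (MulEquiv.subgroupCongr (a4List_eq ω j)).trans
    ((a4W j).equivMapOfInjective _ (wrHom_octHom_injective ω)).symm

noncomputable def s4Equiv (j : Fin 5) : s4List ω j ≃* s4W j :=
  (MulEquiv.subgroupCongr (s4List_eq ω j)).trans
    ((s4W j).equivMapOfInjective _ (wrHom_octHom_injective ω)).symm

theorem nonempty_trans {G H K : Type*} [Group G] [Group H] [Group K] (e : G ≃* H)
    (h : Nonempty (H ≃* K)) : Nonempty (G ≃* K) := h.map e.trans

theorem a4W_spec (j : Fin 7) : (∃ m n, wts m n ∈ a4W j) ∧ ∀ a, a ∈ 𝔸 ↔ ∃ b, wst a b ∈ a4W j := by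
  fin_cases j
  · exact a4W_zero ▸ ⟨⟨_, _, wts_mem_twistGroup _ _ _⟩,
      exists_wst_mem_congrGroup_iff isTwist_congrPairs_one⟩
  · exact a4W_one ▸ ⟨⟨_, _, wts_mem_twistGroup _ _ _⟩,
      exists_wst_mem_congrGroup_iff (isTwist_pD _ _)⟩
  · exact a4W_two ▸ ⟨⟨_, _, wts_mem_twistGroup _ _ _⟩,
      exists_wst_mem_congrGroup_iff isTwist_congrPairs_one⟩
  · exact a4W_three ▸ ⟨⟨_, _, wts_mem_twistGroup _ _ _⟩,
      exists_wst_mem_congrGroup_iff isTwist_pC⟩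
  · exact a4W_four ▸ ⟨⟨_, _, wts_mem_twistGroup _ _ _⟩,
      exists_wst_mem_congrGroup_iff (isTwist_pD _ _)⟩
  · exact a4W_five ▸ ⟨⟨_, _, wts_mem_twistGroup _ _ _⟩,
      exists_wst_mem_congrGroup_iff isTwist_congrPairs_one⟩
  · exact a4W_six ▸ ⟨⟨_, _, wts_mem_twistGroup _ _ _⟩,
      exists_wst_mem_congrGroup_iff (isTwist_pD _ _)⟩

theorem s4W_spec (j : Fin 5) : (∃ m n, wts m n ∈ s4W j) ∧
    ∀ a, a ∈ (⊤ : Subgroup (Equiv.Perm (Fin 4))) ↔ ∃ b, wst a b ∈ s4W j := by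
  fin_cases j
  · exact s4W_zero ▸ ⟨⟨_, _, wts_mem_twistGroup _ _ _⟩,
      exists_wst_mem_congrGroup_iff isTwist_congrPairs_one⟩
  · exact s4W_one ▸ ⟨⟨_, _, wts_mem_twistGroup _ _ _⟩,
      exists_wst_mem_congrGroup_iff isTwist_congrPairs_one⟩
  · exact s4W_two ▸ ⟨⟨_, _, wts_mem_twistGroup _ _ _⟩,
      exists_wst_mem_congrGroup_iff isTwist_congrPairs_one⟩
  · exact s4W_three ▸ ⟨⟨_, _, wts_mem_twistGroup _ _ _⟩,
      exists_wst_mem_congrGroup_iff isTwist_one_pD⟩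
  · exact s4W_four ▸ ⟨⟨_, _, wts_mem_twistGroup _ _ _⟩,
      exists_wst_mem_congrGroup_iff isTwist_congrPairs_one⟩

variable [IsAlgClosed k] (G : Subgroup (autQuadric k))

theorem isRankOneOfType_alternating_four :
    IsRankOneOfType G 𝔸 ↔ ∃ j, IsConjTo G (a4List ω j) := by
  constructor
  · intro h
    obtain ⟨L, p, hG, hp, hT⟩ := exists_isConjTo_map (ι := (𝔸).subtype) (octHom_injective ω)
      (fun f hf => by
        obtain ⟨P, hP⟩ := exists_conj_alternating_four hf (g := (octHom ω).comp (𝔸).subtype)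
          ((octHom_injective ω).comp (Subgroup.subtype_injective _))
        exact ⟨P, 1, hP⟩) h
    rw [Subgroup.range_subtype] at hT
    obtain ⟨j, hj⟩ := exists_isConjTo_a4W hp hT
    exact ⟨j, by rw [a4List_eq]; exact hG.trans (hj.map _)⟩
  · rintro ⟨j, hj⟩
    obtain ⟨⟨m, n, h⟩, hT⟩ := a4W_spec j
    refine IsRankOneOfType.of_isConjTo ?_ hj
    rw [a4List_eq]
    exact isRankOneOfType_map (ι := (𝔸).subtype) (octHom_injective ω)
      (Subgroup.subtype_injective _) h (by rwa [Subgroup.range_subtype])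

theorem isRankOneOfType_perm_four :
    IsRankOneOfType G (Equiv.Perm (Fin 4)) ↔ ∃ j, IsConjTo G (s4List ω j) := by
  constructor
  · intro h
    obtain ⟨L, p, hG, hp, hT⟩ := exists_isConjTo_map (ι := MonoidHom.id _) (octHom_injective ω)
      (fun f hf => by
        obtain ⟨P, hP⟩ := exists_conj_perm_four hf (octHom_injective ω)
        exact ⟨P, 1, hP⟩) h
    obtain ⟨j, hj⟩ := exists_isConjTo_s4W hp fun a => (hT a).mp ⟨a, rfl⟩
    exact ⟨j, by rw [s4List_eq]; exact hG.trans (hj.map _)⟩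
  · rintro ⟨j, hj⟩
    obtain ⟨⟨m, n, h⟩, hT⟩ := s4W_spec j
    refine IsRankOneOfType.of_isConjTo ?_ hj
    rw [s4List_eq]
    exact isRankOneOfType_map (ι := MonoidHom.id _) (octHom_injective ω)
      Function.injective_id h (by rwa [MonoidHom.range_eq_top.mpr Function.surjective_id])

end

end QuadricAut

namespace QuadricAut

/-! ### The icosahedral case -/

section
variable {k : Type*} [Field k] [CharZero k] (ω : RootChoice k)
local notation "𝔸₅" => alternatingGroup (Fin 5)

theorem icosahedral_eq : icosahedral ω = (icoHom ω).range := by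
  rw [MonoidHom.range_eq_map, ← closure_aEF, MonoidHom.map_closure, Set.image_insert_eq,
    Set.image_singleton, icoHom_aE, icoHom_aF]
  rfl

/-- The isomorphism of `A₅` with the icosahedral group. -/
noncomputable def icoEquiv : 𝔸₅ ≃* icosahedral ω :=
  (MonoidHom.ofInjective (icoHom_injective ω)).trans
    (MulEquiv.subgroupCongr (icosahedral_eq ω).symm)

theorem icoEquiv_apply (a : 𝔸₅) : (icoEquiv ω a : PGL(2, k)) = icoHom ω a := rfl

theorem icoEquiv_aE : icoEquiv ω aE = icoE ω := Subtype.ext (icoHom_aE ω)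

/-- The automorphism of `A₅` which corresponds to an automorphism of the icosahedral group. -/
noncomputable def icoAut : MulAut (icosahedral ω) ≃* MulAut 𝔸₅ := MulAut.congr (icoEquiv ω).symm

variable {ω} (ξ : MulAut (icosahedral ω))

theorem icoEquiv_icoAut (a : 𝔸₅) : icoEquiv ω (icoAut ω ξ a) = ξ (icoEquiv ω a) :=
  (icoEquiv ω).apply_symm_apply _

variable {ξ}

theorem icoAut_conj (g : icosahedral ω) :
    icoAut ω (MulAut.conj g) = MulAut.conj ((icoEquiv ω).symm g) := by
  ext a : 1
  apply (icoEquiv ω).injective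
  rw [icoEquiv_icoAut, MulAut.conj_apply, MulAut.conj_apply, map_mul, map_mul, map_inv,
    MulEquiv.apply_symm_apply]

/-- Automorphisms of A₅ come from S₅. Outer excludes an even τ, and `ξ ^ 2 = 1` makes τ² centralise
A₅, hence trivial. -/
theorem IsOuterInvolution.exists_perm (h : IsOuterInvolution ξ) : ∃ τ : Equiv.Perm (Fin 5),
    (∀ a, (icoAut ω ξ a : Equiv.Perm (Fin 5)) = τ * a * τ⁻¹) ∧ Equiv.Perm.sign τ = -1 ∧
      τ ^ 2 = 1 := by
  obtain ⟨τ, hτ⟩ := exists_perm_of_mulAut (icoAut ω ξ)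
  have h1 : Equiv.Perm.sign τ = -1 := by
    refine (Int.units_eq_one_or _).resolve_left fun hs => h.1 ?_
    refine ⟨icoEquiv ω ⟨τ, Equiv.Perm.mem_alternatingGroup.mpr hs⟩, (icoAut ω).injective ?_⟩
    rw [icoAut_conj, MulEquiv.symm_apply_apply]
    ext a : 2
    exact (hτ a).symm
  refine ⟨τ, hτ, h1, ?_⟩
  have hθ : ∀ a, icoAut ω ξ (icoAut ω ξ a) = a := fun a => by
    rw [← MulAut.mul_apply, ← map_mul, ← pow_two, h.2, map_one, MulAut.one_apply]
  have hc : ∀ a : 𝔸₅, τ ^ 2 * a * (τ ^ 2)⁻¹ = a := fun a => by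
    have := congrArg Subtype.val (hθ a)
    rw [hτ, hτ] at this
    simpa [pow_two, mul_assoc] using this
  exact eq_one_of_commute_pE_pF _ ⟨hc aE, hc aF⟩

/-- Conjugation by a transposition. If it were inner, the transposition would equal an even
permutation, because the centralizer of A₅ in S₅ is trivial. -/
theorem exists_isOuterInvolution : ∃ ξ : MulAut (icosahedral ω), IsOuterInvolution ξ := by
  let τ : Equiv.Perm (Fin 5) := Equiv.swap 0 1
  have hs : Equiv.Perm.sign τ = -1 := Equiv.Perm.sign_swap (by decide)
  let θ : MulAut 𝔸₅ := MulAut.conjNormal τ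
  have hθ : icoAut ω ((icoAut ω).symm θ) = θ := MulEquiv.apply_symm_apply _ _
  refine ⟨(icoAut ω).symm θ, ?_, ?_⟩
  · rintro ⟨g, hg⟩
    have hg' := congrArg (icoAut ω) hg
    rw [hθ, icoAut_conj] at hg'
    set a := (icoEquiv ω).symm g
    have hc : ∀ x : 𝔸₅, ((a : Equiv.Perm (Fin 5))⁻¹ * τ) * x * ((a : Equiv.Perm (Fin 5))⁻¹ * τ)⁻¹
        = x := fun x => by
      have h1 : (a : Equiv.Perm (Fin 5)) * x * (a : Equiv.Perm (Fin 5))⁻¹ = τ * x * τ⁻¹ :=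
        congrArg Subtype.val (DFunLike.congr_fun hg' x)
      have h2 : ((a : Equiv.Perm (Fin 5))⁻¹ * τ) * x * ((a : Equiv.Perm (Fin 5))⁻¹ * τ)⁻¹ =
          (a : Equiv.Perm (Fin 5))⁻¹ * (τ * x * τ⁻¹) * a := by group
      rw [h2, ← h1]
      group
    have h1 := eq_one_of_commute_pE_pF _ ⟨hc aE, hc aF⟩
    rw [inv_mul_eq_one] at h1
    have h2 := Equiv.Perm.mem_alternatingGroup.mp a.2
    rw [h1, hs] at h2
    exact absurd h2 (by decide)
  · apply (icoAut ω).injective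
    rw [map_pow, hθ, map_one, ← map_pow]
    have : τ ^ 2 = 1 := by rw [pow_two, Equiv.swap_mul_self]
    rw [this, map_one]

theorem a5List_eq (ξ : MulAut (icosahedral ω)) (j : Fin 3) :
    a5List ω ξ j = (a5W (icoAut ω ξ) j).map (wrHom (icoHom ω)) := by
  have h : icoHom ω (icoAut ω ξ aE) = ξ (icoE ω) := by
    rw [← icoEquiv_apply, icoEquiv_icoAut, icoEquiv_aE]
  fin_cases j
  all_goals
    refine Eq.trans ?_ (MonoidHom.map_closure _ _).symm
    refine congrArg Subgroup.closure ?_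
    simp only [Set.image_insert_eq, Set.image_singleton, wrHom_wst, wrHom_wts, map_one, icoHom_aE,
      icoHom_aF, h]

noncomputable def a5Equiv (ξ : MulAut (icosahedral ω)) (j : Fin 3) :
    a5List ω ξ j ≃* a5W (icoAut ω ξ) j :=
  (MulEquiv.subgroupCongr (a5List_eq ξ j)).trans
    ((a5W (icoAut ω ξ) j).equivMapOfInjective _ (wrHom_injective _ (icoHom_injective ω))).symm

theorem a5W_spec {θ : MulAut 𝔸₅} {τ : Equiv.Perm (Fin 5)}
    (hτ : ∀ a, (θ a : Equiv.Perm (Fin 5)) = τ * a * τ⁻¹) (h1 : Equiv.Perm.sign τ = -1)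
    (h2 : τ ^ 2 = 1) (j : Fin 3) :
    wts 1 1 ∈ a5W θ j ∧ ∀ a, a ∈ (⊤ : Subgroup 𝔸₅) ↔ ∃ b, wst a b ∈ a5W θ j := by
  fin_cases j
  · exact a5W_zero θ ▸ ⟨wts_mem_twistGroup _ _ _,
      exists_wst_mem_congrGroup_iff isTwist_congrPairs_one⟩
  · exact a5W_one (closure_aE_theta hτ h1 h2) (theta_theta hτ h1 h2) ▸
      ⟨wts_mem_twistGroup _ _ _, fun a => ⟨fun _ => ⟨θ a, wst_mem_twistGroup rfl⟩,
        fun _ => Subgroup.mem_top a⟩⟩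
  · exact a5W_two θ ▸ ⟨wts_mem_twistGroup _ _ _,
      exists_wst_mem_congrGroup_iff isTwist_congrPairs_one⟩

variable [IsAlgClosed k] (G : Subgroup (autQuadric k))

theorem isRankOneOfType_alternating_five (hξ : IsOuterInvolution ξ) :
    IsRankOneOfType G 𝔸₅ ↔ ∃ j, IsConjTo G (a5List ω ξ j) := by
  obtain ⟨τ, hτ, h1, h2⟩ := hξ.exists_perm
  constructor
  · intro h
    obtain ⟨L, p, hG, hp, hT⟩ := exists_isConjTo_map (ι := MonoidHom.id _) (icoHom_injective ω)
      (fun f hf => exists_conj_icoHom ω hf) h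
    obtain ⟨j, hj⟩ := exists_isConjTo_a5W hτ h1 h2 hp fun a => (hT a).mp ⟨a, rfl⟩
    exact ⟨j, by rw [a5List_eq]; exact hG.trans (hj.map _)⟩
  · rintro ⟨j, hj⟩
    obtain ⟨h, hT⟩ := a5W_spec hτ h1 h2 j
    refine IsRankOneOfType.of_isConjTo ?_ hj
    rw [a5List_eq]
    exact isRankOneOfType_map (ι := MonoidHom.id _) (icoHom_injective ω)
      Function.injective_id h (by rwa [MonoidHom.range_eq_top.mpr Function.surjective_id])

end

end QuadricAut

/-! ### The theorem. -/

theorem mainTheorem9 {k : Type*} [Field k] [IsAlgClosed k] [CharZero k]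
    (ω : QuadricAut.RootChoice k) :
    -- every finite subgroup is conjugate into one of the six groups
    (∀ G : Subgroup (QuadricAut.autQuadric k), Finite G →
      (∃ n : ℕ, 1 ≤ n ∧ QuadricAut.IsConjIntoSubgroup G (QuadricAut.grpDnS4 ω n)) ∨
      (∃ n : ℕ, 1 ≤ n ∧ QuadricAut.IsConjIntoSubgroup G (QuadricAut.grpDnA5 ω n)) ∨
      QuadricAut.IsConjIntoSubgroup G (QuadricAut.grpS4A5 ω) ∨
      (∃ n : ℕ, 3 ≤ n ∧ QuadricAut.IsConjIntoSubgroup G (QuadricAut.grpDnWr ω n)) ∨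
      QuadricAut.IsConjIntoSubgroup G (QuadricAut.grpS4Wr ω) ∨
      QuadricAut.IsConjIntoSubgroup G (QuadricAut.grpA5Wr ω)) ∧
    -- orders and isomorphism classes of the six groups
    (∀ n : ℕ, 1 ≤ n →
      Nat.card (QuadricAut.grpDnS4 ω n) = 48 * n ∧
      Nonempty (QuadricAut.grpDnS4 ω n ≃* DihedralGroup n × Equiv.Perm (Fin 4)) ∧
      Nat.card (QuadricAut.grpDnA5 ω n) = 120 * n ∧
      Nonempty (QuadricAut.grpDnA5 ω n ≃* DihedralGroup n × alternatingGroup (Fin 5))) ∧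
    (∀ n : ℕ, 3 ≤ n →
      Nat.card (QuadricAut.grpDnWr ω n) = 8 * n ^ 2 ∧
      Nonempty (QuadricAut.grpDnWr ω n ≃* QuadricAut.WrC2 (DihedralGroup n))) ∧
    (Nat.card (QuadricAut.grpS4A5 ω) = 1440 ∧
      Nonempty (QuadricAut.grpS4A5 ω ≃* Equiv.Perm (Fin 4) × alternatingGroup (Fin 5)) ∧
      Nat.card (QuadricAut.grpS4Wr ω) = 1152 ∧
      Nonempty (QuadricAut.grpS4Wr ω ≃* QuadricAut.WrC2 (Equiv.Perm (Fin 4))) ∧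
      Nat.card (QuadricAut.grpA5Wr ω) = 7200 ∧
      Nonempty (QuadricAut.grpA5Wr ω ≃* QuadricAut.WrC2 (alternatingGroup (Fin 5)))) ∧
    -- rank one, `H ≃ A₄`
    ((∀ G : Subgroup (QuadricAut.autQuadric k),
        QuadricAut.IsRankOneOfType G (alternatingGroup (Fin 4)) ↔
          ∃ j : Fin 7, QuadricAut.IsConjTo G (QuadricAut.a4List ω j)) ∧
      (∀ j : Fin 7, Nat.card (QuadricAut.a4List ω j) = ![24, 24, 96, 96, 96, 288, 288] j) ∧
      Nonempty (QuadricAut.a4List ω 0 ≃* alternatingGroup (Fin 4) × QuadricAut.Cyc 2) ∧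
      Nonempty (QuadricAut.a4List ω 1 ≃* Equiv.Perm (Fin 4)) ∧
      QuadricAut.IsSemidirect (QuadricAut.a4List ω 2) (Fin 4 → QuadricAut.Cyc 2)
        (QuadricAut.Cyc 6) ∧
      QuadricAut.IsSemidirect (QuadricAut.a4List ω 3) (Fin 4 → QuadricAut.Cyc 2)
        (QuadricAut.Cyc 6) ∧
      QuadricAut.IsSemidirect (QuadricAut.a4List ω 4) (Fin 2 → QuadricAut.Cyc 2)
        (Equiv.Perm (Fin 4)) ∧
      Nonempty (QuadricAut.a4List ω 5 ≃* QuadricAut.WrC2 (alternatingGroup (Fin 4))) ∧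
      Nonempty (QuadricAut.a4List ω 6 ≃* QuadricAut.WrC2 (alternatingGroup (Fin 4)))) ∧
    -- rank one, `H ≃ S₄`
    ((∀ G : Subgroup (QuadricAut.autQuadric k),
        QuadricAut.IsRankOneOfType G (Equiv.Perm (Fin 4)) ↔
          ∃ j : Fin 5, QuadricAut.IsConjTo G (QuadricAut.s4List ω j)) ∧
      (∀ j : Fin 5, Nat.card (QuadricAut.s4List ω j) = ![48, 192, 576, 576, 1152] j) ∧
      Nonempty (QuadricAut.s4List ω 0 ≃* Equiv.Perm (Fin 4) × QuadricAut.Cyc 2) ∧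
      QuadricAut.IsSemidirect (QuadricAut.s4List ω 1) (Fin 4 → QuadricAut.Cyc 2)
        (DihedralGroup 6) ∧
      QuadricAut.IsSemidirect (QuadricAut.s4List ω 2)
        (alternatingGroup (Fin 4) × alternatingGroup (Fin 4)) (Fin 2 → QuadricAut.Cyc 2) ∧
      QuadricAut.IsSemidirect (QuadricAut.s4List ω 3)
        (alternatingGroup (Fin 4) × alternatingGroup (Fin 4)) (QuadricAut.Cyc 4) ∧
      Nonempty (QuadricAut.s4List ω 4 ≃* QuadricAut.WrC2 (Equiv.Perm (Fin 4)))) ∧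
    -- rank one, `H ≃ A₅`
    ((∃ ξ : MulAut (QuadricAut.icosahedral ω), QuadricAut.IsOuterInvolution ξ) ∧
      ∀ ξ : MulAut (QuadricAut.icosahedral ω), QuadricAut.IsOuterInvolution ξ →
        (∀ G : Subgroup (QuadricAut.autQuadric k),
          QuadricAut.IsRankOneOfType G (alternatingGroup (Fin 5)) ↔
            ∃ j : Fin 3, QuadricAut.IsConjTo G (QuadricAut.a5List ω ξ j)) ∧
        (∀ j : Fin 3, Nat.card (QuadricAut.a5List ω ξ j) = ![120, 120, 7200] j) ∧
        Nonempty (QuadricAut.a5List ω ξ 0 ≃* alternatingGroup (Fin 5) × QuadricAut.Cyc 2) ∧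
        Nonempty (QuadricAut.a5List ω ξ 1 ≃* Equiv.Perm (Fin 5)) ∧
        Nonempty (QuadricAut.a5List ω ξ 2 ≃*
          QuadricAut.WrC2 (alternatingGroup (Fin 5)))) := by
  refine ⟨fun G _ => QuadricAut.finite_subgroup_cases ω G, fun n hn => ?_, fun n hn => ?_, ?_,
    ⟨fun G => QuadricAut.isRankOneOfType_alternating_four ω G, fun j => ?_, ?_, ?_, ?_, ?_, ?_, ?_,
      ?_⟩,
    ⟨fun G => QuadricAut.isRankOneOfType_perm_four ω G, fun j => ?_, ?_, ?_, ?_, ?_, ?_⟩,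
    QuadricAut.exists_isOuterInvolution, fun ξ hξ => ?_⟩
  · have : NeZero n := ⟨by omega⟩
    obtain ⟨h1, h2⟩ := QuadricAut.card_grpDnS4 ω n
    obtain ⟨h3, h4⟩ := QuadricAut.card_grpDnA5 ω n
    exact ⟨h1, h2, h3, h4⟩
  · have : NeZero n := ⟨by omega⟩
    exact QuadricAut.card_grpDnWr ω n
  · obtain ⟨h1, h2⟩ := QuadricAut.card_grpS4A5 ω
    obtain ⟨h3, h4⟩ := QuadricAut.card_grpS4Wr ω
    obtain ⟨h5, h6⟩ := QuadricAut.card_grpA5Wr ω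
    exact ⟨h1, h2, h3, h4, h5, h6⟩
  · rw [Nat.card_congr (QuadricAut.a4Equiv ω j).toEquiv, QuadricAut.card_a4W]
  · exact QuadricAut.nonempty_trans (QuadricAut.a4Equiv ω 0) QuadricAut.nonempty_a4W_zero
  · exact QuadricAut.nonempty_trans (QuadricAut.a4Equiv ω 1) QuadricAut.nonempty_a4W_one
  · exact QuadricAut.isSemidirect_of_mulEquiv (QuadricAut.a4Equiv ω 2)
      QuadricAut.isSemidirect_a4W_two
  · exact QuadricAut.isSemidirect_of_mulEquiv (QuadricAut.a4Equiv ω 3)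
      QuadricAut.isSemidirect_a4W_three
  · exact QuadricAut.isSemidirect_of_mulEquiv (QuadricAut.a4Equiv ω 4)
      QuadricAut.isSemidirect_a4W_four
  · exact QuadricAut.nonempty_trans (QuadricAut.a4Equiv ω 5) QuadricAut.nonempty_a4W_five
  · exact QuadricAut.nonempty_trans (QuadricAut.a4Equiv ω 6) QuadricAut.nonempty_a4W_six
  · rw [Nat.card_congr (QuadricAut.s4Equiv ω j).toEquiv, QuadricAut.card_s4W]
  · exact QuadricAut.nonempty_trans (QuadricAut.s4Equiv ω 0) QuadricAut.nonempty_s4W_zero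
  · exact QuadricAut.isSemidirect_of_mulEquiv (QuadricAut.s4Equiv ω 1)
      QuadricAut.isSemidirect_s4W_one
  · exact QuadricAut.isSemidirect_of_mulEquiv (QuadricAut.s4Equiv ω 2)
      QuadricAut.isSemidirect_s4W_two
  · exact QuadricAut.isSemidirect_of_mulEquiv (QuadricAut.s4Equiv ω 3)
      QuadricAut.isSemidirect_s4W_three
  · exact QuadricAut.nonempty_trans (QuadricAut.s4Equiv ω 4) QuadricAut.nonempty_s4W_four
  · obtain ⟨τ, hτ, h1, h2⟩ := hξ.exists_perm
    refine ⟨fun G => QuadricAut.isRankOneOfType_alternating_five G hξ, fun j => ?_, ?_, ?_, ?_⟩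
    · rw [Nat.card_congr (QuadricAut.a5Equiv ξ j).toEquiv, QuadricAut.card_a5W hτ h1 h2]
    · exact QuadricAut.nonempty_trans (QuadricAut.a5Equiv ξ 0) (QuadricAut.nonempty_a5W_zero _)
    · exact QuadricAut.nonempty_trans (QuadricAut.a5Equiv ξ 1)
        (QuadricAut.nonempty_a5W_one hτ h1 h2)
    · exact QuadricAut.nonempty_trans (QuadricAut.a5Equiv ξ 2) (QuadricAut.nonempty_a5W_two _)
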